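/- Consider finite simple undirected graphs whose vertices have names in $\{0,\dots,n-1\}$, under fully dynamic updates: insertion of an edge, deletion of an edge, insertion of a vertex together with an arbitrary set of incident edges, and deletion of a vertex together with its incident edges. A matching is a set of edges no two of which share an end vertex; a vertex is free if no matching edge is incident on it. An augmenting path is a simple path between two distinct free vertices whose edges are alternately unmatched and matched; augmenting along it means replacing the matching by its symmetric difference with the edges of the path. **Theorem (fully dynamic maximum cardinality matching).** There are a deterministic word RAM algorithm and constants $C,c$, independent of the graph and of the updates, such that for every word length $w\ge c(\lfloor\log_2 n\rfloor+1)$ the following holds. Given any initial graph, the algorithm (after a terminating preprocessing, whose running time is not bounded here) explicitly maintains a maximum cardinality matching under every sequence of edge and vertex updates, and every single update takes at most $C\,(m+1)$ steps in the worst case, where $m$ is the larger of the numbers of edges before and after the update. Moreover, in each update the algorithm calls at most two times a subroutine that searches for an augmenting path from a given free vertex, augments the matching along such a path if one exists, and otherwise leaves the matching unchanged. The start vertices are determined by the update and by the matching before it: the inserted vertex, for a vertex insertion; the partner of the deleted vertex (if it was matched), for a vertex deletion; the end vertices of the deleted edge (if it was a matching edge), for an edge deletion; and, for the insertion of an edge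 $xy$, no vertex if $x$ and $y$ are both free, the free one of them if exactly one is free, and vertices among $x$, $y$ and their partners if both are matched. Each search takes place in the updated graph, or in the updated graph without some of the vertices named by the update (the end vertices of the inserted or deleted edge, or the inserted or deleted vertex); and outside of the searches, only edges incident on these named vertices enter or leave the matching. -/

import Mathlib

namespace DynMatch

/-! ### Word RAM programs with a step count

A program uses finitely many word registers and finitely many word arrays (all addressed by
literals), and finite control.  Every evaluated operation costs one step, and a computation is
possible only as long as every value that is computed is smaller than the bound `B = 2 ^ w`
given by the word length `w`. -/

/-- The memory of the machine: registers and arrays of words. -/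
structure State where
  reg : ℕ → ℕ
  arr : ℕ → ℕ → ℕ

/-- The usual instructions of a word RAM (the comparisons return `1` for true, `0` for false). -/
inductive Op where
  | add | sub | mul | div | mod | land | lor | xor | shl | shr | eq | lt | le

def Op.eval : Op → ℕ → ℕ → ℕ
  | .add, a, b => a + b
  | .sub, a, b => a - b
  | .mul, a, b => a * b
  | .div, a, b => a / b
  | .mod, a, b => a % b
  | .land, a, b => a &&& b
  | .lor, a, b => a ||| b
  | .xor, a, b => a ^^^ b
  | .shl, a, b => a <<< b
  | .shr, a, b => a >>> b
  | .eq, a, b => if a = b then 1 else 0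
  | .lt, a, b => if a < b then 1 else 0
  | .le, a, b => if a ≤ b then 1 else 0

inductive Expr where
  /-- a literal -/
  | lit (k : ℕ)
  /-- the content of a register -/
  | reg (r : ℕ)
  /-- the content of the cell of the array `a` whose index is the value of `i` -/
  | get (a : ℕ) (i : Expr)
  | op (o : Op) (e f : Expr)

namespace Expr

def eval (s : State) : Expr → ℕ
  | lit k => k
  | reg r => s.reg r
  | get a i => s.arr a (i.eval s)
  | op o e f => o.eval (e.eval s) (f.eval s)

/-- The cost of evaluating an expression: one step per node. -/
def cost : Expr → ℕ
  | lit _ => 1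
  | reg _ => 1
  | get _ i => i.cost + 1
  | op _ e f => e.cost + f.cost + 1

/-- The values of the expression and of all its subexpressions are smaller than `B`. -/
def Fits (B : ℕ) (s : State) : Expr → Prop
  | lit k => k < B
  | reg r => s.reg r < B
  | get a i => i.Fits B s ∧ s.arr a (i.eval s) < B
  | op o e f => e.Fits B s ∧ f.Fits B s ∧ o.eval (e.eval s) (f.eval s) < B

end Expr

/-- Programs.  `call` invokes a fixed subroutine, which works on the same memory. -/
inductive Cmd where
  | skip
  | set (r : ℕ) (e : Expr)
  | put (a : ℕ) (i e : Expr)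
  | seq (c d : Cmd)
  | ite (e : Expr) (c d : Cmd)
  | loop (e : Expr) (c : Cmd)
  | call

def State.setReg (s : State) (r v : ℕ) : State :=
  { s with reg := Function.update s.reg r v }

def State.setArr (s : State) (a i v : ℕ) : State :=
  { s with arr := Function.update s.arr a (Function.update (s.arr a) i v) }

/-- `Exec B sub c s t tr s'`: with values bounded by `B` and with `sub` as the body of the
subroutine, the program `c`, started in the memory `s`, halts in the memory `s'` after exactly
`t` steps (those made inside the subroutine included); `tr` lists, in the order of time, the
memory at the entry and at the exit of each call.  The subroutine itself makes no calls. -/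
inductive Exec (B : ℕ) (sub : Cmd) :
    Cmd → State → ℕ → List (State × State) → State → Prop
  | skip (s : State) : Exec B sub .skip s 1 [] s
  | set (s : State) (r : ℕ) (e : Expr) (he : e.Fits B s) :
      Exec B sub (.set r e) s (e.cost + 1) [] (s.setReg r (e.eval s))
  | put (s : State) (a : ℕ) (i e : Expr) (hi : i.Fits B s) (he : e.Fits B s) :
      Exec B sub (.put a i e) s (i.cost + e.cost + 1) [] (s.setArr a (i.eval s) (e.eval s))
  | seq (c d : Cmd) (s₁ s₂ s₃ : State) (t₁ t₂ : ℕ) (tr₁ tr₂ : List (State × State))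
      (hc : Exec B sub c s₁ t₁ tr₁ s₂) (hd : Exec B sub d s₂ t₂ tr₂ s₃) :
      Exec B sub (.seq c d) s₁ (t₁ + t₂) (tr₁ ++ tr₂) s₃
  | iteTrue (e : Expr) (c d : Cmd) (s s' : State) (t : ℕ) (tr : List (State × State))
      (he : e.Fits B s) (h : e.eval s ≠ 0) (hc : Exec B sub c s t tr s') :
      Exec B sub (.ite e c d) s (e.cost + 1 + t) tr s'
  | iteFalse (e : Expr) (c d : Cmd) (s s' : State) (t : ℕ) (tr : List (State × State))
      (he : e.Fits B s) (h : e.eval s = 0) (hd : Exec B sub d s t tr s') :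
      Exec B sub (.ite e c d) s (e.cost + 1 + t) tr s'
  | loopDone (e : Expr) (c : Cmd) (s : State) (he : e.Fits B s) (h : e.eval s = 0) :
      Exec B sub (.loop e c) s (e.cost + 1) [] s
  | loopStep (e : Expr) (c : Cmd) (s₁ s₂ s₃ : State) (t₁ t₂ : ℕ)
      (tr₁ tr₂ : List (State × State)) (he : e.Fits B s₁) (h : e.eval s₁ ≠ 0)
      (hc : Exec B sub c s₁ t₁ tr₁ s₂) (hl : Exec B sub (.loop e c) s₂ t₂ tr₂ s₃) :
      Exec B sub (.loop e c) s₁ (e.cost + 1 + t₁ + t₂) (tr₁ ++ tr₂) s₃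
  | call (s s' : State) (t : ℕ) (h : Exec B sub sub s t [] s') :
      Exec B sub .call s (t + 1) [(s, s')] s'

/-! ### Graphs, updates, matchings -/

/-- A finite graph `(V, E)` whose vertices are natural numbers. -/
structure DynGraph where
  verts : Finset ℕ
  edges : Finset (Sym2 ℕ)

namespace DynGraph

/-- `G` is a simple graph on a set of vertices with names smaller than `n`. -/
def WF (n : ℕ) (G : DynGraph) : Prop :=
  (∀ x ∈ G.verts, x < n) ∧ ∀ e ∈ G.edges, ¬ e.IsDiag ∧ ∀ x ∈ e, x ∈ G.verts

def graph (G : DynGraph) : SimpleGraph ℕ := SimpleGraph.fromEdgeSet (G.edges : Set (Sym2 ℕ))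

/-- Delete a set of vertices together with their incident edges. -/
def removeVerts (G : DynGraph) (S : Finset ℕ) : DynGraph where
  verts := G.verts \ S
  edges := G.edges.filter fun e => ∀ x ∈ S, x ∉ e

/-- A matching: a set of edges no two of which share an end vertex. -/
def IsMatching (G : DynGraph) (M : Finset (Sym2 ℕ)) : Prop :=
  M ⊆ G.edges ∧ ∀ e ∈ M, ∀ f ∈ M, ∀ x, x ∈ e → x ∈ f → e = f

def IsMaxMatching (G : DynGraph) (M : Finset (Sym2 ℕ)) : Prop :=
  G.IsMatching M ∧ ∀ N, G.IsMatching N → N.card ≤ M.card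

end DynGraph

/-- The vertex `x` is free: no edge of `M` is incident on it. -/
def Free (M : Finset (Sym2 ℕ)) (x : ℕ) : Prop := ∀ e ∈ M, x ∉ e

/-- An augmenting path: a simple path between two distinct free vertices, on which the edges
number `0, 2, 4, …` are unmatched and the edges number `1, 3, 5, …` are matched. -/
def IsAugmentingPath {G : SimpleGraph ℕ} (M : Finset (Sym2 ℕ)) {x y : ℕ} (p : G.Walk x y) :
    Prop :=
  p.IsPath ∧ x ≠ y ∧ Free M x ∧ Free M y ∧
    ∀ (i : ℕ) (h : i < p.edges.length), p.edges[i] ∈ M ↔ Odd i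

/-- The effect of a search in `H` for an augmenting path that starts at the free vertex `v`:
if there is one, the matching `N` is augmented along such a path; otherwise nothing changes. -/
def AugmentingSearch (H : DynGraph) (v : ℕ) (N N' : Finset (Sym2 ℕ)) : Prop :=
  v ∈ H.verts ∧ H.IsMatching N ∧ Free N v ∧
    ((∃ (z : ℕ) (p : H.graph.Walk v z),
        IsAugmentingPath N p ∧ N' = symmDiff N p.edges.toFinset) ∨
      ((¬ ∃ (z : ℕ) (p : H.graph.Walk v z), IsAugmentingPath N p) ∧ N' = N))

inductive Update where
  | insertEdge (x y : ℕ)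
  | deleteEdge (x y : ℕ)
  /-- insert the vertex `v` with edges to the vertices in the list `L` -/
  | insertVertex (v : ℕ) (L : List ℕ)
  | deleteVertex (x : ℕ)

namespace Update

/-- The update can be applied to `G`, with names of vertices smaller than `n`. -/
def Valid (n : ℕ) (G : DynGraph) : Update → Prop
  | insertEdge x y => x ∈ G.verts ∧ y ∈ G.verts ∧ x ≠ y ∧ s(x, y) ∉ G.edges
  | deleteEdge x y => s(x, y) ∈ G.edges
  | insertVertex v L => v < n ∧ v ∉ G.verts ∧ L.Nodup ∧ ∀ y ∈ L, y ∈ G.verts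
  | deleteVertex x => x ∈ G.verts

def apply (G : DynGraph) : Update → DynGraph
  | insertEdge x y => ⟨G.verts, insert s(x, y) G.edges⟩
  | deleteEdge x y => ⟨G.verts, G.edges.erase s(x, y)⟩
  | insertVertex v L => ⟨insert v G.verts, G.edges ∪ L.toFinset.image fun y => s(v, y)⟩
  | deleteVertex x => G.removeVerts {x}

/-- The vertices named by the update (without the neighbours of an inserted vertex). -/
def ends : Update → Finset ℕ
  | insertEdge x y => {x, y}
  | deleteEdge x y => {x, y}
  | insertVertex v _ => {v}
  | deleteVertex x => {x}

/-- The vertices from which searches may be started for the update, if `M` is the matching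
before it: an inserted vertex; the partner of a deleted vertex; both ends of a deleted matched
edge; and, for an inserted edge, no vertex if both ends are free, the free end if exactly one
is free, and the ends and their partners if both ends are matched. -/
def roots (M : Finset (Sym2 ℕ)) : Update → Set ℕ
  | insertEdge x y =>
      {z | (z = x ∧ Free M x ∧ ¬ Free M y) ∨ (z = y ∧ Free M y ∧ ¬ Free M x) ∨
        (¬ Free M x ∧ ¬ Free M y ∧ (z = x ∨ z = y ∨ s(x, z) ∈ M ∨ s(y, z) ∈ M))}
  | deleteEdge x y => {z | s(x, y) ∈ M ∧ (z = x ∨ z = y)}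
  | insertVertex v _ => {v}
  | deleteVertex x => {z | s(x, z) ∈ M}

end Update

/-! ### Input and output conventions

Array `0` holds the maintained matching, array `1` and the registers `0, 1, 2` receive the
input, and register `3` passes the start vertex to the subroutine. -/

/-- Array `0` holds the matching `M`: its entry at `x` is `y + 1` if `x` is matched to `y`, and
`0` if `x` is in no edge of `M`. -/
def State.Holds (s : State) (M : Finset (Sym2 ℕ)) : Prop :=
  ∀ x y : ℕ, s.arr 0 x = y + 1 ↔ s(x, y) ∈ M

/-- Write a code and two words to the registers `0, 1, 2` and a list of words to array `1`. -/
def State.input (s : State) (k a b : ℕ) (L : List ℕ) : State where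
  reg := Function.update (Function.update (Function.update s.reg 0 k) 1 a) 2 b
  arr := Function.update s.arr 1 fun i => if h : i < L.length then L[i] else s.arr 1 i

/-- Hand an update to the machine. -/
def State.load (s : State) : Update → State
  | .insertEdge x y => s.input 0 x y []
  | .deleteEdge x y => s.input 1 x y []
  | .insertVertex v L => s.input 2 v L.length L
  | .deleteVertex x => s.input 3 x 0 []

/-- `vs` and `es` list the vertices and the edges of `G`, each of them once. -/
def DynGraph.ListedBy (G : DynGraph) (vs : List ℕ) (es : List (ℕ × ℕ)) : Prop :=
  vs.Nodup ∧ vs.toFinset = G.verts ∧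
    (es.map fun e => s(e.1, e.2)).Nodup ∧ (es.map fun e => s(e.1, e.2)).toFinset = G.edges

/-- The memory is zero, except for the listed initial graph. -/
def initialState (vs : List ℕ) (es : List (ℕ × ℕ)) : State :=
  State.input ⟨fun _ => 0, fun _ _ => 0⟩ 0 vs.length es.length
    (vs ++ es.flatMap fun e => [e.1, e.2])

/-- `M` and `N` contain the same edges among those with no end in `T`. -/
def AgreeOff (T : Finset ℕ) (M N : Finset (Sym2 ℕ)) : Prop :=
  ∀ e : Sym2 ℕ, (∀ x ∈ T, x ∉ e) → (e ∈ M ↔ e ∈ N)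

/-- The matching `M` is turned into `M'` by the recorded calls, each of which is a search for
an augmenting path from a start vertex in `R`, in the graph `G` or in `G` minus some of the
vertices in `T`; outside of the calls, only edges with an end in `T` enter or leave the
matching. -/
def SearchLog (G : DynGraph) (T : Finset ℕ) (R : Set ℕ) :
    Finset (Sym2 ℕ) → List (State × State) → Finset (Sym2 ℕ) → Prop
  | M, [], M' => AgreeOff T M M'
  | M, (a, b) :: tr, M' =>
      ∃ S ⊆ T, ∃ N N' : Finset (Sym2 ℕ), AgreeOff T M N ∧ a.Holds N ∧ b.Holds N' ∧
        a.reg 3 ∈ R ∧ AugmentingSearch (G.removeVerts S) (a.reg 3) N N' ∧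
        SearchLog G T R N' tr M'

end DynMatch

open DynMatch

set_option linter.unusedSimpArgs false
set_option linter.unusedVariables false

namespace DynMatch

section

/-! ### Reasoning about programs -/

-- The matching is repaired one vertex at a time. Suppose that `N` is maximum in `H - v`. Restoring
-- `v` raises the maximum size by at most one, and it does so exactly when an augmenting path starts
-- at `v`; so a single search from `v` makes the matching maximum in `H`
-- (`AugmentingSearch.isMaxMatching`). The nontrivial half is an exchange argument,
-- `exists_evenPath_or_free`: a matching that covers `v` yields either an augmenting path from `v`
-- or an equally large matching that misses `v`. After an update the matching, possibly with one
-- edge dropped, is maximum in the new graph minus one or two vertices, which are then restored by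
-- one search each. In particular, dropping a matched edge `xy` from a maximum matching leaves a
-- maximum matching of the graph without `x` and `y` (`DynGraph.IsMaxMatching.erase`). This also
-- handles the insertion of an edge between two matched vertices: one of them and its partner are
-- separated and restored, and as long as they are missing the new edge is missing, too.
--
-- A search must take time linear in the number of edges. It grows an alternating tree in which a
-- node is a matched pair of an inner and an outer vertex; the root `v` is an outer vertex alone.
-- Blossoms are not contracted literally. Instead a node is absorbed, which means that it has joined
-- the blossom of its parent, that its inner vertex has become outer as well, and that the
-- responsible edge (its bridge) has been recorded. The base of a blossom is then the nearest
-- unabsorbed ancestor of its nodes. Every outer vertex has a simple alternating path from the root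
-- that can be read off from parents and bridges. `GoodPath` adds that this path meets only blossoms
-- of unabsorbed ancestors, and this is what makes the paths created by a contraction simple
-- (`Forest.exists_goodPath`). If the tree can neither grow nor contract, no augmenting path starts
-- at `v`: by induction along a simple alternating path from `v`, every vertex at even distance is
-- outer (`Forest.outer_of_evenPath`), so the path never leaves the tree.
--
-- For linear time, nearest unabsorbed ancestors are needed at constant amortized cost in a tree
-- that grows by leaves. The tree is cut into microtrees of at most `b = log₂ (m + 2)` nodes. Within
-- a microtree the answer is the highest bit of the conjunction of two words, looked up in a table
-- of logarithms. Full microtrees without unabsorbed nodes on the way up are merged into sets, the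
-- smaller set being relabelled. The sum over the microtrees of size minus logarithm of the set size
-- is a potential: a new node raises it by at most one and a relabelling lowers it by at least one
-- (`potential_union`).
--
-- The path found is augmented with a stack of subpaths. Only its unmatched edges matter, and they
-- cover every vertex of the path, so the order and the direction of traversal are irrelevant
-- (`Flips.perm`).
--
-- The programs are verified with a total correctness triple `Run` whose postcondition sees the
-- time, the record of calls and the final memory. No search initializes more memory than the listed
-- edges require, so the bounds do not depend on `n`.

infixl:65 " +ₑ " => Expr.op Op.add
infixl:65 " -ₑ " => Expr.op Op.sub
infixl:70 " *ₑ " => Expr.op Op.mul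
infixl:70 " /ₑ " => Expr.op Op.div
infixl:60 " &ₑ " => Expr.op Op.land
infix:50 " =ₑ " => Expr.op Op.eq
infix:50 " <ₑ " => Expr.op Op.lt
infix:50 " ≤ₑ " => Expr.op Op.le
infixr:30 " ;; " => Cmd.seq

/-- All words in the memory are smaller than `B`. -/
def State.Bdd (B : ℕ) (s : State) : Prop :=
  (∀ r, s.reg r < B) ∧ ∀ a i, s.arr a i < B

@[simp] theorem State.setReg_reg (s : State) (r v r' : ℕ) :
    (s.setReg r v).reg r' = if r' = r then v else s.reg r' := by
  simp [State.setReg, Function.update_apply]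

@[simp] theorem State.setReg_arr (s : State) (r v : ℕ) : (s.setReg r v).arr = s.arr := rfl

@[simp] theorem State.setArr_reg (s : State) (a i v : ℕ) : (s.setArr a i v).reg = s.reg := rfl

theorem State.setArr_arr (s : State) (a i v a' : ℕ) :
    (s.setArr a i v).arr a' =
      if a' = a then Function.update (s.arr a) i v else s.arr a' := by
  simp [State.setArr, Function.update_apply]

theorem State.Bdd.setReg {B : ℕ} {s : State} (h : s.Bdd B) {r v : ℕ} (hv : v < B) :
    (s.setReg r v).Bdd B := by
  refine ⟨fun r' => ?_, h.2⟩
  rw [State.setReg_reg]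
  split_ifs
  · exact hv
  · exact h.1 r'

theorem State.Bdd.setArr {B : ℕ} {s : State} (h : s.Bdd B) {a i v : ℕ} (hv : v < B) :
    (s.setArr a i v).Bdd B := by
  refine ⟨h.1, fun a' i' => ?_⟩
  rw [State.setArr_arr]
  split_ifs
  · rw [Function.update_apply]
    split_ifs
    · exact hv
    · exact h.2 _ _
  · exact h.2 _ _

/-- The side conditions under which an expression can be evaluated in a bounded memory. -/
def Expr.Ok (B : ℕ) (s : State) : Expr → Prop
  | .lit k => k < B
  | .reg _ => True
  | .get _ i => i.Ok B s
  | .op .add e f => e.Ok B s ∧ f.Ok B s ∧ e.eval s + f.eval s < B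
  | .op .mul e f => e.Ok B s ∧ f.Ok B s ∧ e.eval s * f.eval s < B
  | .op .shl e f => e.Ok B s ∧ f.Ok B s ∧ e.eval s <<< f.eval s < B
  | .op .lor e f => e.Ok B s ∧ f.Ok B s ∧ e.eval s ||| f.eval s < B
  | .op .xor e f => e.Ok B s ∧ f.Ok B s ∧ e.eval s ^^^ f.eval s < B
  | .op _ e f => e.Ok B s ∧ f.Ok B s ∧ 1 < B

theorem Expr.Fits.eval_lt {B : ℕ} {s : State} {e : Expr} (h : e.Fits B s) : e.eval s < B := by
  cases e with
  | lit k => exact h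
  | reg r => exact h
  | get a i => exact h.2
  | op o e f => exact h.2.2

/-- Subtraction, division, remainder, conjunction and right shift never exceed the left operand, and
comparisons are at most one. In a bounded memory only the other operations and literals can
overflow. -/
theorem Expr.Ok.fits {B : ℕ} {s : State} (hs : s.Bdd B) {e : Expr} (h : e.Ok B s) :
    e.Fits B s := by
  induction e with
  | lit k => exact h
  | reg r => exact hs.1 r
  | get a i ih => exact ⟨ih h, hs.2 _ _⟩
  | op o e f ihe ihf =>
    cases o <;> refine ⟨ihe h.1, ihf h.2.1, ?_⟩ <;>
      first
      | exact h.2.2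
      | exact lt_of_le_of_lt (Nat.sub_le _ _) (ihe h.1).eval_lt
      | exact lt_of_le_of_lt (Nat.div_le_self _ _) (ihe h.1).eval_lt
      | exact lt_of_le_of_lt (Nat.mod_le _ _) (ihe h.1).eval_lt
      | exact lt_of_le_of_lt Nat.and_le_left (ihe h.1).eval_lt
      | exact lt_of_le_of_lt (Nat.shiftRight_le _ _) (ihe h.1).eval_lt
      | (have := h.2.2; simp only [Op.eval]; split_ifs <;> omega)

/-- Bundled so that one argument hands all the rules to `simp`. Comparisons occur only as tests,
hence only through being zero or nonzero. -/
theorem Op.eval_simps :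
    (∀ a b, Op.add.eval a b = a + b) ∧ (∀ a b, Op.sub.eval a b = a - b) ∧
    (∀ a b, Op.mul.eval a b = a * b) ∧ (∀ a b, Op.div.eval a b = a / b) ∧
    (∀ a b, Op.land.eval a b = a &&& b) ∧ (∀ a b, Op.lor.eval a b = a ||| b) ∧
    (∀ a b, Op.xor.eval a b = a ^^^ b) ∧ (∀ a b, Op.shl.eval a b = a <<< b) ∧
    (∀ a b, Op.eq.eval a b ≠ 0 ↔ a = b) ∧ (∀ a b, Op.eq.eval a b = 0 ↔ a ≠ b) ∧
    (∀ a b, Op.lt.eval a b ≠ 0 ↔ a < b) ∧ (∀ a b, Op.lt.eval a b = 0 ↔ b ≤ a) ∧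
    (∀ a b, Op.le.eval a b ≠ 0 ↔ a ≤ b) ∧ ∀ a b, Op.le.eval a b = 0 ↔ b < a := by
  refine ⟨?_, ?_, ?_, ?_, ?_, ?_, ?_, ?_, ?_, ?_, ?_, ?_, ?_, ?_⟩ <;> simp [Op.eval]

theorem State.simps :
    (∀ (s : State) (r v r' : ℕ), (s.setReg r v).reg r' = if r' = r then v else s.reg r') ∧
    (∀ (s : State) (r v : ℕ), (s.setReg r v).arr = s.arr) ∧
    (∀ (s : State) (a i v : ℕ), (s.setArr a i v).reg = s.reg) ∧
    ∀ (s : State) (a i v a' : ℕ), (s.setArr a i v).arr a' =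
      if a' = a then Function.update (s.arr a) i v else s.arr a' :=
  ⟨State.setReg_reg, State.setReg_arr, State.setArr_reg, State.setArr_arr⟩

/-- The registers a program may write without counting those written by the subroutine. -/
def Cmd.wreg : Cmd → ℕ → Bool
  | .skip, _ => false
  | .set r _, r' => r == r'
  | .put _ _ _, _ => false
  | .seq c d, r => c.wreg r || d.wreg r
  | .ite _ c d, r => c.wreg r || d.wreg r
  | .loop _ c, r => c.wreg r
  | .call, _ => false

/-- The arrays a program may write without counting those written by the subroutine. -/
def Cmd.warr : Cmd → ℕ → Bool
  | .skip, _ => false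
  | .set _ _, _ => false
  | .put a _ _, a' => a == a'
  | .seq c d, a => c.warr a || d.warr a
  | .ite _ c d, a => c.warr a || d.warr a
  | .loop _ c, a => c.warr a
  | .call, _ => false

/-- Registers and arrays outside of those written by `c` or by `sub` are the same. -/
structure Same (c sub : Cmd) (s s' : State) : Prop where
  reg : ∀ r, c.wreg r = false → sub.wreg r = false → s'.reg r = s.reg r
  arr : ∀ a, c.warr a = false → sub.warr a = false → s'.arr a = s.arr a

/-- The frame rule. Since `wreg` and `warr` are computed from the program text, instances for
concrete cells are closed by `rfl`, and specifications need to mention only what changes. -/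
theorem Exec.same_of {B : ℕ} {sub : Cmd} {c : Cmd} {s s' : State} {t : ℕ}
    {tr : List (State × State)} (h : Exec B sub c s t tr s') : Same c sub s s' := by
  induction h with
  | skip s => exact ⟨fun _ _ _ => rfl, fun _ _ _ => rfl⟩
  | set s r e he =>
    refine ⟨fun r' h _ => ?_, fun _ _ _ => rfl⟩
    have : r' ≠ r := by rintro rfl; simp [Cmd.wreg] at h
    simp [this]
  | put s a i e hi he =>
    refine ⟨fun _ _ _ => rfl, fun a' h _ => ?_⟩
    have : a' ≠ a := by rintro rfl; simp [Cmd.warr] at h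
    simp [State.setArr_arr, this]
  | seq c d s₁ s₂ s₃ t₁ t₂ tr₁ tr₂ hc hd ihc ihd =>
    refine ⟨fun r h h' => ?_, fun a h h' => ?_⟩
    · simp only [Cmd.wreg, Bool.or_eq_false_iff] at h
      rw [ihd.reg r h.2 h', ihc.reg r h.1 h']
    · simp only [Cmd.warr, Bool.or_eq_false_iff] at h
      rw [ihd.arr a h.2 h', ihc.arr a h.1 h']
  | iteTrue e c d s s' t tr he h hc ih =>
    refine ⟨fun r h h' => ?_, fun a h h' => ?_⟩
    · simp only [Cmd.wreg, Bool.or_eq_false_iff] at h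
      exact ih.reg r h.1 h'
    · simp only [Cmd.warr, Bool.or_eq_false_iff] at h
      exact ih.arr a h.1 h'
  | iteFalse e c d s s' t tr he h hc ih =>
    refine ⟨fun r h h' => ?_, fun a h h' => ?_⟩
    · simp only [Cmd.wreg, Bool.or_eq_false_iff] at h
      exact ih.reg r h.2 h'
    · simp only [Cmd.warr, Bool.or_eq_false_iff] at h
      exact ih.arr a h.2 h'
  | loopDone e c s he h => exact ⟨fun _ _ _ => rfl, fun _ _ _ => rfl⟩
  | loopStep e c s₁ s₂ s₃ t₁ t₂ tr₁ tr₂ he h hc hl ihc ihl =>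
    exact ⟨fun r h h' => (ihl.reg r h h').trans (ihc.reg r h h'),
      fun a h h' => (ihl.arr a h h').trans (ihc.arr a h h')⟩
  | call s s' t h ih => exact ⟨fun r _ h' => ih.reg r h' h', fun a _ h' => ih.arr a h' h'⟩

/-- A program without calls. -/
def Cmd.callFree : Cmd → Bool
  | .seq c d => c.callFree && d.callFree
  | .ite _ c d => c.callFree && d.callFree
  | .loop _ c => c.callFree
  | .call => false
  | _ => true

/-- Without calls the subroutine is irrelevant. Call-free programs are verified with the trivial
subroutine `.skip` and then transferred; the rule for calls also requires the empty record. -/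
theorem Exec.same_of_callFree {B : ℕ} {sub : Cmd} {c : Cmd} {s s' : State} {t : ℕ}
    {tr : List (State × State)} (h : Exec B sub c s t tr s') (hf : c.callFree = true) :
    tr = [] ∧ ∀ sub', Exec B sub' c s t [] s' := by
  induction h with
  | skip s => exact ⟨rfl, fun _ => .skip _⟩
  | set s r e he => exact ⟨rfl, fun _ => .set _ _ _ he⟩
  | put s a i e hi he => exact ⟨rfl, fun _ => .put _ _ _ _ hi he⟩
  | seq c d s₁ s₂ s₃ t₁ t₂ tr₁ tr₂ hc hd ihc ihd =>
    simp only [Cmd.callFree, Bool.and_eq_true] at hf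
    obtain ⟨rfl, h1⟩ := ihc hf.1
    obtain ⟨rfl, h2⟩ := ihd hf.2
    exact ⟨rfl, fun sub' => .seq _ _ _ _ _ _ _ _ _ (h1 sub') (h2 sub')⟩
  | iteTrue e c d s s' t tr he h hc ih =>
    simp only [Cmd.callFree, Bool.and_eq_true] at hf
    obtain ⟨rfl, h1⟩ := ih hf.1
    exact ⟨rfl, fun sub' => .iteTrue _ _ _ _ _ _ _ he h (h1 sub')⟩
  | iteFalse e c d s s' t tr he h hc ih =>
    simp only [Cmd.callFree, Bool.and_eq_true] at hf
    obtain ⟨rfl, h1⟩ := ih hf.2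
    exact ⟨rfl, fun sub' => .iteFalse _ _ _ _ _ _ _ he h (h1 sub')⟩
  | loopDone e c s he h => exact ⟨rfl, fun _ => .loopDone _ _ _ he h⟩
  | loopStep e c s₁ s₂ s₃ t₁ t₂ tr₁ tr₂ he h hc hl ihc ihl =>
    obtain ⟨rfl, h1⟩ := ihc hf
    obtain ⟨rfl, h2⟩ := ihl hf
    exact ⟨rfl, fun sub' => .loopStep _ _ _ _ _ _ _ _ _ he h (h1 sub') (h2 sub')⟩
  | call s s' t h ih => simp [Cmd.callFree] at hf

/-- Started in a bounded memory, `c` halts; time, record of calls and final memory satisfy `Q`. -/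
def Run (B : ℕ) (sub c : Cmd) (s : State) (Q : ℕ → List (State × State) → State → Prop) : Prop :=
  s.Bdd B → ∃ t tr s', Exec B sub c s t tr s' ∧ s'.Bdd B ∧ Q t tr s'

theorem Run.mono {B : ℕ} {sub c : Cmd} {s : State}
    {Q Q' : ℕ → List (State × State) → State → Prop} (h : Run B sub c s Q)
    (hQ : ∀ t tr s', s.Bdd B → s'.Bdd B → Same c sub s s' → Q t tr s' → Q' t tr s') :
    Run B sub c s Q' := by
  intro hs
  obtain ⟨t, tr, s', he, hb, hq⟩ := h hs
  exact ⟨t, tr, s', he, hb, hQ _ _ _ hs hb he.same_of hq⟩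

theorem Run.seq {B : ℕ} {sub c d : Cmd} {s : State}
    {Q : ℕ → List (State × State) → State → Prop}
    (h : Run B sub c s fun t tr s' => Run B sub d s' fun t' tr' s'' => Q (t + t') (tr ++ tr') s'') :
    Run B sub (.seq c d) s Q := by
  intro hs
  obtain ⟨t, tr, s', he, hb, hq⟩ := h hs
  obtain ⟨t', tr', s'', he', hb', hq'⟩ := hq hb
  exact ⟨_, _, _, .seq _ _ _ _ _ _ _ _ _ he he', hb', hq'⟩

theorem Run.set {B : ℕ} {sub : Cmd} {r : ℕ} {e : Expr} {s : State}
    {Q : ℕ → List (State × State) → State → Prop}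
    (hok : e.Ok B s) (h : Q (e.cost + 1) [] (s.setReg r (e.eval s))) :
    Run B sub (.set r e) s Q := fun hs =>
  ⟨_, _, _, .set _ _ _ (hok.fits hs), hs.setReg (hok.fits hs).eval_lt, h⟩

theorem Run.put {B : ℕ} {sub : Cmd} {a : ℕ} {i e : Expr} {s : State}
    {Q : ℕ → List (State × State) → State → Prop}
    (hi : i.Ok B s) (hok : e.Ok B s)
    (h : Q (i.cost + e.cost + 1) [] (s.setArr a (i.eval s) (e.eval s))) :
    Run B sub (.put a i e) s Q := fun hs =>
  ⟨_, _, _, .put _ _ _ _ (hi.fits hs) (hok.fits hs), hs.setArr (hok.fits hs).eval_lt, h⟩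

theorem Run.ite {B : ℕ} {sub : Cmd} {e : Expr} {c d : Cmd} {s : State}
    {Q : ℕ → List (State × State) → State → Prop} (hok : e.Ok B s)
    (hc : e.eval s ≠ 0 → Run B sub c s fun t => Q (e.cost + 1 + t))
    (hd : e.eval s = 0 → Run B sub d s fun t => Q (e.cost + 1 + t)) :
    Run B sub (.ite e c d) s Q := by
  intro hs
  by_cases h : e.eval s = 0
  · obtain ⟨t, tr, s', he, hb, hq⟩ := hd h hs
    exact ⟨_, _, _, .iteFalse _ _ _ _ _ _ _ (hok.fits hs) h he, hb, hq⟩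
  · obtain ⟨t, tr, s', he, hb, hq⟩ := hc h hs
    exact ⟨_, _, _, .iteTrue _ _ _ _ _ _ _ (hok.fits hs) h he, hb, hq⟩

theorem Run.skip {B : ℕ} {sub : Cmd} {s : State}
    {Q : ℕ → List (State × State) → State → Prop} (h : Q 1 [] s) : Run B sub .skip s Q :=
  fun hs => ⟨_, _, _, .skip s, hs, h⟩

theorem Run.call {B : ℕ} {sub : Cmd} {s : State}
    {Q : ℕ → List (State × State) → State → Prop} (hf : sub.callFree = true)
    (h : Run B sub sub s fun t _ s' => Q (t + 1) [(s, s')] s') : Run B sub .call s Q := by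
  intro hs
  obtain ⟨t, tr, s', he, hb, hq⟩ := h hs
  exact ⟨_, _, _, .call _ _ _ ((he.same_of_callFree hf).2 sub), hb, hq⟩

/-- Loops: `I` is an invariant, and `φ` bounds the time that remains. -/
theorem Run.loop {B : ℕ} {sub : Cmd} {e : Expr} {c : Cmd} {s : State}
    {Q : ℕ → List (State × State) → State → Prop} (hf : c.callFree = true)
    (I : State → Prop) (φ : State → ℕ) (hI : I s)
    (hok : ∀ s', Same c sub s s' → I s' → e.Ok B s')
    (step : ∀ s', Same c sub s s' → I s' → e.eval s' ≠ 0 →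
      Run B sub c s' fun t _ s'' => I s'' ∧ e.cost + 1 + t + φ s'' ≤ φ s')
    (done : ∀ t s', Same c sub s s' → I s' → e.eval s' = 0 → t + φ s' ≤ φ s + (e.cost + 1) →
      Q t [] s') :
    Run B sub (.loop e c) s Q := by
  intro hs
  -- Strong induction on the value of `φ`, which drops strictly because the test of the loop already
  -- costs a step.
  suffices h : ∀ n s', φ s' = n → s'.Bdd B → Same c sub s s' → I s' →
      ∃ t s'', Exec B sub (.loop e c) s' t [] s'' ∧ s''.Bdd B ∧ Same c sub s s'' ∧ I s'' ∧
        e.eval s'' = 0 ∧ t + φ s'' ≤ n + (e.cost + 1) by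
    obtain ⟨t, s'', h1, h2, h3, h4, h5, h6⟩ :=
      h _ s rfl hs ⟨fun _ _ _ => rfl, fun _ _ _ => rfl⟩ hI
    exact ⟨t, [], s'', h1, h2, done _ _ h3 h4 h5 h6⟩
  intro n
  induction n using Nat.strong_induction_on with
  | _ n ih =>
    intro s' hn hb hsame hi
    by_cases h : e.eval s' = 0
    · exact ⟨_, _, .loopDone _ _ _ ((hok s' hsame hi).fits hb) h, hb, hsame, hi, h, by omega⟩
    · obtain ⟨t, tr, s'', he, hb', hi', hφ⟩ := step s' hsame hi h hb
      have hs2 := he.same_of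
      have hsame' : Same c sub s s'' :=
        ⟨fun r h h' => (hs2.reg r h h').trans (hsame.reg r h h'),
          fun r h h' => (hs2.arr r h h').trans (hsame.arr r h h')⟩
      obtain ⟨t', s₃, h1, h2, h3, h4, h5, h6⟩ := ih (φ s'') (by omega) s'' rfl hb' hsame' hi'
      have he' := (he.same_of_callFree hf).1
      subst he'
      exact ⟨_, s₃, .loopStep _ _ _ _ _ _ _ _ _ ((hok s' hsame hi).fits hb) h he h1, h2, h3, h4,
        h5, by omega⟩

/-- The weakest precondition, computed for straight line programs with branches; loops, calls
and programs that follow a `skip` are left to `Run`. -/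
def Pre (B : ℕ) (sub : Cmd) : Cmd → State → (ℕ → List (State × State) → State → Prop) → Prop
  | .skip, s, Q => Q 1 [] s
  | .set r e, s, Q => e.Ok B s ∧ Q (e.cost + 1) [] (s.setReg r (e.eval s))
  | .put a i e, s, Q =>
      i.Ok B s ∧ e.Ok B s ∧ Q (i.cost + e.cost + 1) [] (s.setArr a (i.eval s) (e.eval s))
  | .seq .skip d, s, Q => Run B sub d s fun t => Q (1 + t)
  | .seq c d, s, Q =>
      Pre B sub c s fun t tr s' => Pre B sub d s' fun t' tr' => Q (t + t') (tr ++ tr')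
  | .ite e c d, s, Q => e.Ok B s ∧ (e.eval s ≠ 0 → Pre B sub c s fun t => Q (e.cost + 1 + t)) ∧
      (e.eval s = 0 → Pre B sub d s fun t => Q (e.cost + 1 + t))
  | .loop e c, s, Q => Run B sub (.loop e c) s Q
  | .call, s, Q => Run B sub .call s Q

theorem Run.of_pre {B : ℕ} {sub c : Cmd} {s : State}
    {Q : ℕ → List (State × State) → State → Prop} (h : Pre B sub c s Q) : Run B sub c s Q := by
  induction c generalizing s Q with
  | skip => exact Run.skip h
  | set r e => exact Run.set h.1 h.2
  | put a i e => exact Run.put h.1 h.2.1 h.2.2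
  | seq c d ihc ihd =>
    by_cases hc : c = .skip
    · subst hc
      rw [Pre] at h
      exact Run.seq (Run.skip h)
    · rw [Pre] at h
      · exact Run.seq ((ihc h).mono fun t tr s' _ _ _ hq => ihd hq)
      · exact hc
  | ite e c d ihc ihd => exact Run.ite h.1 (fun h' => ihc (h.2.1 h')) fun h' => ihd (h.2.2 h')
  | loop e c ih => exact h
  | call => exact h

end

end DynMatch

namespace DynMatch

section

/-! ### Alternating paths and maximum matchings -/

/-- An alternating path of even length from `s` to `x` that starts with an unmatched edge, with
the list of its vertices after `s` and the list of its edges. -/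
inductive EvenPath (H : DynGraph) (N : Finset (Sym2 ℕ)) (s : ℕ) :
    ℕ → List ℕ → List (Sym2 ℕ) → Prop
  | nil : EvenPath H N s s [] []
  | snoc {x u o : ℕ} {l : List ℕ} {E : List (Sym2 ℕ)} (h : EvenPath H N s x l E)
      (hxu : s(x, u) ∈ H.edges) (hN : s(x, u) ∉ N) (huo : s(u, o) ∈ N) :
      EvenPath H N s o (l ++ [u, o]) (E ++ [s(x, u), s(u, o)])

variable {H : DynGraph} {N : Finset (Sym2 ℕ)}

theorem EvenPath.cons {v u w x : ℕ} {l : List ℕ} {E : List (Sym2 ℕ)}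
    (h : EvenPath H N w x l E) (hvu : s(v, u) ∈ H.edges) (hN : s(v, u) ∉ N)
    (huw : s(u, w) ∈ N) : EvenPath H N v x (u :: w :: l) (s(v, u) :: s(u, w) :: E) := by
  induction h with
  | nil => exact EvenPath.snoc .nil hvu hN huw
  | snoc _ h1 h2 h3 ih => exact EvenPath.snoc ih h1 h2 h3

theorem EvenPath.mem_cons {s x : ℕ} {l : List ℕ} {E : List (Sym2 ℕ)}
    (h : EvenPath H N s x l E) : x ∈ s :: l := by
  cases h <;> simp

theorem EvenPath.mem_edge {s x : ℕ} {l : List ℕ} {E : List (Sym2 ℕ)}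
    (h : EvenPath H N s x l E) (hN : N ⊆ H.edges) {y : ℕ} (hy : y ∈ l) :
    ∃ e ∈ H.edges, y ∈ e := by
  induction h with
  | nil => simp at hy
  | @snoc x u o l E h h1 h2 h3 ih =>
    simp only [List.mem_append, List.mem_cons, List.not_mem_nil, or_false] at hy
    rcases hy with hy | rfl | rfl
    · exact ih hy
    · exact ⟨_, h1, by simp⟩
    · exact ⟨_, hN h3, by simp⟩

theorem EvenPath.mem_of_mem_edges {s x : ℕ} {l : List ℕ} {E : List (Sym2 ℕ)}
    (h : EvenPath H N s x l E) {e : Sym2 ℕ} (he : e ∈ E) {y : ℕ} (hy : y ∈ e) :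
    y ∈ s :: l := by
  induction h with
  | nil => simp at he
  | @snoc x u o l E h h1 h2 h3 ih =>
    have hx := h.mem_cons
    simp only [List.mem_append, List.mem_cons, List.not_mem_nil, or_false] at he hx ⊢
    rcases he with he | rfl | rfl
    · have := ih he
      simp only [List.mem_cons] at this
      tauto
    · simp only [Sym2.mem_iff] at hy
      rcases hy with rfl | rfl <;> tauto
    · simp only [Sym2.mem_iff] at hy
      rcases hy with rfl | rfl <;> tauto

theorem DynGraph.IsMatching.eq_right (hM : H.IsMatching N) {x y z : ℕ} (h1 : s(x, y) ∈ N)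
    (h2 : s(x, z) ∈ N) : y = z := by
  have := hM.2 _ h1 _ h2 x (by simp) (by simp)
  rcases Sym2.eq_iff.1 this with ⟨_, h⟩ | ⟨h, h'⟩
  · exact h
  · exact h'.trans h

theorem DynGraph.IsMatching.erase (hM : H.IsMatching N) (e : Sym2 ℕ) :
    H.IsMatching (N.erase e) :=
  ⟨fun _ hf => hM.1 (Finset.mem_of_mem_erase hf), fun _ he _ hf =>
    hM.2 _ (Finset.mem_of_mem_erase he) _ (Finset.mem_of_mem_erase hf)⟩

theorem DynGraph.IsMatching.insert (hM : H.IsMatching N) {x y : ℕ} (he : s(x, y) ∈ H.edges)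
    (hx : Free N x) (hy : Free N y) : H.IsMatching (insert s(x, y) N) := by
  refine ⟨fun f hf => ?_, fun e he f hf z hze hzf => ?_⟩
  · rcases Finset.mem_insert.1 hf with rfl | hf
    · exact he
    · exact hM.1 hf
  · rcases Finset.mem_insert.1 hf with rfl | hf' <;>
      rcases Finset.mem_insert.1 he with rfl | he'
    · rfl
    · rcases Sym2.mem_iff.1 hzf with rfl | rfl
      · exact absurd hze (hx _ he')
      · exact absurd hze (hy _ he')
    · rcases Sym2.mem_iff.1 hze with rfl | rfl
      · exact absurd hzf (hx _ hf')
      · exact absurd hzf (hy _ hf')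
    · exact hM.2 _ he' _ hf' z hze hzf

theorem not_free_iff {x : ℕ} : ¬ Free N x ↔ ∃ y, s(x, y) ∈ N := by
  constructor
  · intro h
    simp only [Free, not_forall, not_not] at h
    obtain ⟨e, he, hx⟩ := h
    obtain ⟨y, rfl⟩ := Sym2.mem_iff_exists.1 hx
    exact ⟨y, he⟩
  · rintro ⟨y, hy⟩ h
    exact h _ hy (by simp)

theorem DynGraph.mem_removeVerts {S : Finset ℕ} {e : Sym2 ℕ} :
    e ∈ (H.removeVerts S).edges ↔ e ∈ H.edges ∧ ∀ x ∈ S, x ∉ e := by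
  simp [DynGraph.removeVerts]

theorem DynGraph.IsMatching.of_removeVerts {S : Finset ℕ}
    (h : (H.removeVerts S).IsMatching N) : H.IsMatching N :=
  ⟨fun _ he => (DynGraph.mem_removeVerts.1 (h.1 he)).1, h.2⟩

theorem DynGraph.IsMatching.removeVerts (h : H.IsMatching N) {S : Finset ℕ}
    (hS : ∀ x ∈ S, Free N x) : (H.removeVerts S).IsMatching N :=
  ⟨fun e he => DynGraph.mem_removeVerts.2 ⟨h.1 he, fun x hx => hS x hx e he⟩, h.2⟩

theorem DynGraph.IsMatching.free_of_removeVerts {S : Finset ℕ}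
    (h : (H.removeVerts S).IsMatching N) {x : ℕ} (hx : x ∈ S) : Free N x :=
  fun e he => (DynGraph.mem_removeVerts.1 (h.1 he)).2 x hx

/-- If some matching covers the free vertex `v`, then an augmenting path starts at `v`, or a
matching of the same size leaves `v` free. -/
theorem exists_evenPath_or_free (n : ℕ) : ∀ (H : DynGraph) (M N : Finset (Sym2 ℕ)) (v : ℕ),
    M.card = n → (∀ e ∈ H.edges, ¬ e.IsDiag) → H.IsMatching M → H.IsMatching N →
    Free M v → ¬ Free N v →
    (∃ x l E z, EvenPath H M v x l E ∧ (v :: l ++ [z]).Nodup ∧ s(x, z) ∈ H.edges ∧ Free M z) ∨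
      ∃ N', H.IsMatching N' ∧ N'.card = N.card ∧ Free N' v := by
  induction n with
  | zero =>
    intro H M N v hM hd _ hN _ hv'
    obtain ⟨u, hu⟩ := not_free_iff.1 hv'
    obtain rfl := Finset.card_eq_zero.1 hM
    refine Or.inl ⟨v, [], [], u, .nil, ?_, hN.1 hu, by simp [Free]⟩
    have := hd _ (hN.1 hu)
    simpa using this
  | succ n ih =>
    intro H M N v hcard hd hM hN hv hv'
    obtain ⟨u, hu⟩ := not_free_iff.1 hv'
    have hvu : v ≠ u := by simpa using hd _ (hN.1 hu)
    -- If the partner `u` of `v` in `N` is free in `M`, the edge `vu` alone is augmenting.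
    by_cases hfu : Free M u
    · exact Or.inl ⟨v, [], [], u, .nil, by simpa using hvu, hN.1 hu, hfu⟩
    obtain ⟨w, hw⟩ := not_free_iff.1 hfu
    have hwu : u ≠ w := by simpa using hd _ (hM.1 hw)
    have hwv : v ≠ w := by
      rintro rfl
      exact hv _ hw (by simp)
    have hNu : ∀ f ∈ N.erase s(v, u), u ∉ f := fun f hf huf =>
      (Finset.mem_erase.1 hf).1 (hN.2 _ (Finset.mem_erase.1 hf).2 _ hu u huf (by simp))
    have hNv : ∀ f ∈ N.erase s(v, u), v ∉ f := fun f hf hvf =>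
      (Finset.mem_erase.1 hf).1 (hN.2 _ (Finset.mem_erase.1 hf).2 _ hu v hvf (by simp))
    have hcN : (N.erase s(v, u)).card + 1 = N.card := Finset.card_erase_add_one hu
    -- If `N` misses `w`, exchanging `vu` for `uw` frees `v` and keeps the size.
    by_cases hfw : Free N w
    · refine Or.inr ⟨insert s(u, w) (N.erase s(v, u)),
        (hN.erase _).insert (hM.1 hw) hNu fun f hf => hfw f (Finset.mem_of_mem_erase hf), ?_, ?_⟩
      · rw [Finset.card_insert_of_notMem, hcN]
        exact fun h => hNu _ h (by simp)
      · intro f hf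
        rcases Finset.mem_insert.1 hf with rfl | hf
        · simp [hvu, hwv]
        · exact hNv f hf
    have hMu : ∀ f ∈ M.erase s(u, w), u ∉ f := fun f hf huf =>
      (Finset.mem_erase.1 hf).1 (hM.2 _ (Finset.mem_erase.1 hf).2 _ hw u huf (by simp))
    have hMw : ∀ f ∈ M.erase s(u, w), w ∉ f := fun f hf huf =>
      (Finset.mem_erase.1 hf).1 (hM.2 _ (Finset.mem_erase.1 hf).2 _ hw w huf (by simp))
    have hS : ∀ {y}, y ∈ ({v, u} : Finset ℕ) ↔ y = v ∨ y = u := by simp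
    have hM' : (H.removeVerts {v, u}).IsMatching (M.erase s(u, w)) :=
      (hM.erase _).removeVerts fun y hy => by
        rcases hS.1 hy with rfl | rfl
        · exact fun f hf => hv f (Finset.mem_of_mem_erase hf)
        · exact hMu
    have hN' : (H.removeVerts {v, u}).IsMatching (N.erase s(v, u)) :=
      (hN.erase _).removeVerts fun y hy => by
        rcases hS.1 hy with rfl | rfl
        · exact hNv
        · exact hNu
    have hfw' : ¬ Free (N.erase s(v, u)) w := by
      obtain ⟨z, hz⟩ := not_free_iff.1 hfw
      refine not_free_iff.2 ⟨z, Finset.mem_erase.2 ⟨?_, hz⟩⟩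
      intro h
      have : w ∈ s(v, u) := h ▸ (by simp)
      simp [hwv.symm, hwu.symm] at this
    -- Once `v` and `u` are deleted, `w` takes over the role of `v`: it is free in the rest of `M`
    -- and covered by the rest of `N`. A path from `w` is prolonged by `v` and `u`; a matching that
    -- misses `w` receives the edge `uw` and still misses `v`.
    rcases ih (H.removeVerts {v, u}) (M.erase s(u, w)) (N.erase s(v, u)) w
      (by rw [Finset.card_erase_of_mem hw, hcard]; rfl)
      (fun e he => hd e (DynGraph.mem_removeVerts.1 he).1) hM' hN' hMw hfw' with
      ⟨x, l, E, z, hp, hnd, hxz, hz⟩ | ⟨N₃, h1, h2, h3⟩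
    · left
      have hz1 : z ≠ u := by
        rintro rfl
        have := (DynGraph.mem_removeVerts.1 hxz).2 z (by simp)
        simp at this
      have hz2 : z ≠ v := by
        rintro rfl
        have := (DynGraph.mem_removeVerts.1 hxz).2 z (by simp)
        simp at this
      have hz3 : z ≠ w := by
        rintro rfl
        simp at hnd
      have hl : ∀ y ∈ l, y ≠ v ∧ y ≠ u := by
        intro y hy
        obtain ⟨e, he, hye⟩ := hp.mem_edge hM'.1 hy
        have := (DynGraph.mem_removeVerts.1 he).2
        constructor
        · rintro rfl
          exact this _ (by simp) hye
        · rintro rfl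
          exact this _ (by simp) hye
      have hp' : EvenPath H M w x l E := by
        clear hnd hxz hl
        induction hp with
        | nil => exact .nil
        | @snoc x u' o l E h h1 h2 h3 ih =>
          refine .snoc ih (DynGraph.mem_removeVerts.1 h1).1 (fun h => h2 ?_)
            (Finset.mem_of_mem_erase h3)
          refine Finset.mem_erase.2 ⟨?_, h⟩
          intro he
          have := (DynGraph.mem_removeVerts.1 h1).2 u (by simp)
          rw [he] at this
          simp at this
      refine ⟨x, u :: w :: l, _, z, hp'.cons (hN.1 hu) (fun h => hv _ h (by simp)) hw, ?_,
        (DynGraph.mem_removeVerts.1 hxz).1, fun f hf hzf => ?_⟩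
      · have hvl : v ∉ l := fun h => (hl v h).1 rfl
        have hul : u ∉ l := fun h => (hl u h).2 rfl
        simp only [List.cons_append, List.nodup_cons, List.mem_cons, List.mem_append,
          List.not_mem_nil, or_false, not_or] at hnd ⊢
        exact ⟨⟨hvu, hwv, hvl, hz2.symm⟩, ⟨hwu, hul, hz1.symm⟩, hnd.1, hnd.2⟩
      · refine hz f (Finset.mem_erase.2 ⟨?_, hf⟩) hzf
        rintro rfl
        simp [hz1, hz3] at hzf
    · right
      refine ⟨insert s(u, w) N₃, h1.of_removeVerts.insert (hM.1 hw)
        (h1.free_of_removeVerts (by simp)) h3, ?_, ?_⟩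
      · rw [Finset.card_insert_of_notMem, h2, hcN]
        exact fun h => h3 _ h (by simp)
      · intro f hf
        rcases Finset.mem_insert.1 hf with rfl | hf
        · simp [hvu, hwv]
        · exact h1.free_of_removeVerts (by simp) f hf

/-- The graph has no loops. -/
def DynGraph.Loopless (H : DynGraph) : Prop := ∀ e ∈ H.edges, ¬ e.IsDiag

theorem DynGraph.Loopless.ne (hd : H.Loopless) {x y : ℕ} (h : s(x, y) ∈ H.edges) : x ≠ y := by
  simpa using hd _ h

theorem DynGraph.Loopless.adj (hd : H.Loopless) {x y : ℕ} :
    H.graph.Adj x y ↔ s(x, y) ∈ H.edges := by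
  simp only [DynGraph.graph, SimpleGraph.fromEdgeSet_adj, Finset.mem_coe, and_iff_left_iff_imp]
  exact fun h => hd.ne h

theorem EvenPath.exists_walk (hd : H.Loopless) (hM : N ⊆ H.edges) {s x : ℕ} {l : List ℕ}
    {E : List (Sym2 ℕ)} (h : EvenPath H N s x l E) :
    ∃ p : H.graph.Walk s x, p.support = s :: l ∧ p.edges = E ∧
      Even E.length ∧ ∀ (i : ℕ) (hi : i < E.length), E[i] ∈ N ↔ Odd i := by
  induction h with
  | nil => exact ⟨.nil, by simp⟩
  | @snoc x u o l E h h1 h2 h3 ih =>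
    obtain ⟨p, hp1, hp2, hp3, hp4⟩ := ih
    refine ⟨(p.concat (hd.adj.2 h1)).concat (hd.adj.2 (hM h3)), ?_, ?_, ?_, ?_⟩
    · simp [SimpleGraph.Walk.support_concat, hp1]
    · simp [SimpleGraph.Walk.edges_concat, hp2]
    · simp [hp3, Nat.even_add]
    · intro i hi
      simp only [List.length_append, List.length_cons, List.length_nil] at hi
      rcases lt_or_ge i E.length with hlt | hge
      · rw [List.getElem_append_left hlt]
        exact hp4 i hlt
      · have : i = E.length ∨ i = E.length + 1 := by omega
        rcases this with rfl | rfl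
        · simpa [h2] using hp3
        · simpa [h3] using hp3.add_one

/-- An even alternating path followed by an edge to a free vertex is an augmenting path. -/
theorem EvenPath.exists_augmenting (hd : H.Loopless) (hM : N ⊆ H.edges) {v x z : ℕ} {l : List ℕ}
    {E : List (Sym2 ℕ)} (h : EvenPath H N v x l E) (hnd : (v :: l ++ [z]).Nodup)
    (hxz : s(x, z) ∈ H.edges) (hv : Free N v) (hz : Free N z) :
    ∃ p : H.graph.Walk v z, IsAugmentingPath N p ∧ p.support = v :: l ++ [z] ∧
      p.edges = E ++ [s(x, z)] := by
  obtain ⟨p, hp1, hp2, hp3, hp4⟩ := h.exists_walk hd hM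
  have hs : (p.concat (hd.adj.2 hxz)).support = v :: l ++ [z] := by
    simp [SimpleGraph.Walk.support_concat, hp1]
  have he : (p.concat (hd.adj.2 hxz)).edges = E ++ [s(x, z)] := by
    simp [SimpleGraph.Walk.edges_concat, hp2]
  refine ⟨p.concat (hd.adj.2 hxz), ⟨?_, ?_, hv, hz, ?_⟩, hs, he⟩
  · rw [SimpleGraph.Walk.isPath_def, hs]
    exact hnd
  · rintro rfl
    simp at hnd
  · rw [he]
    intro i hi
    simp only [List.length_append, List.length_cons, List.length_nil] at hi
    rcases lt_or_ge i E.length with hlt | hge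
    · rw [List.getElem_append_left hlt]
      exact hp4 i hlt
    · obtain rfl : i = E.length := by omega
      have : s(x, z) ∉ N := fun h => hz _ h (by simp)
      simpa [this] using hp3

/-- The walk is consumed two edges at a time, one unmatched and one matched; what remains is nothing
or a single edge, according to the parity of the length. -/
theorem evenPath_of_walk (hd : H.Loopless) : ∀ {v x : ℕ} (p : H.graph.Walk v x),
    (∀ (i : ℕ) (hi : i < p.edges.length), p.edges[i] ∈ N ↔ Odd i) →
    EvenPath H N v x p.support.tail p.edges ∨ ∃ y l E, EvenPath H N v y l E ∧
      p.support = v :: l ++ [x] ∧ p.edges = E ++ [s(y, x)] ∧ s(y, x) ∈ H.edges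
  | _, _, .nil, _ => Or.inl (by simpa using EvenPath.nil)
  | _, _, .cons h .nil, _ => Or.inr ⟨_, [], [], .nil, by simp, by simp, hd.adj.1 h⟩
  | _, _, .cons (v := u) h (.cons (v := w) h' q), hp => by
    have h0 := hp 0 (by simp)
    have h1 := hp 1 (by simp)
    simp only [SimpleGraph.Walk.edges_cons, List.getElem_cons_zero, Nat.not_odd_zero,
      List.getElem_cons_succ, odd_one, iff_true, iff_false] at h0 h1
    rcases evenPath_of_walk hd q (fun i hi => by
      have := hp (i + 2) (by simpa using hi)
      simpa [Nat.odd_add] using this) with hq | ⟨y, l, E, h2, h3, h4, h5⟩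
    · left
      have := hq.cons (hd.adj.1 h) h0 h1
      simpa [SimpleGraph.Walk.cons_tail_support] using this
    · exact Or.inr ⟨y, _, _, h2.cons (hd.adj.1 h) h0 h1, by simp [h3], by simp [h4], h5⟩

theorem EvenPath.not_free {v x : ℕ} {l : List ℕ} {E : List (Sym2 ℕ)}
    (h : EvenPath H N v x l E) (hvx : v ≠ x) : ¬ Free N x := by
  cases h with
  | nil => exact absurd rfl hvx
  | snoc _ _ _ h3 => exact fun h => h _ h3 (by simp)

/-- The length cannot be even, because an even alternating path of positive length ends with a
matched edge, whereas `z` is free. -/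
theorem IsAugmentingPath.exists_evenPath (hd : H.Loopless) {v z : ℕ} {p : H.graph.Walk v z}
    (hp : IsAugmentingPath N p) : ∃ y l E, EvenPath H N v y l E ∧
      (v :: l ++ [z]).Nodup ∧ p.edges = E ++ [s(y, z)] ∧ s(y, z) ∈ H.edges := by
  obtain ⟨h1, h2, h3, h4, h5⟩ := hp
  rcases evenPath_of_walk hd p h5 with h | ⟨y, l, E, h6, h7, h8, h9⟩
  · exact absurd h4 (h.not_free h2)
  · refine ⟨y, l, E, h6, ?_, h8, h9⟩
    rw [← h7]
    exact (SimpleGraph.Walk.isPath_def _).1 h1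

/-- Flipping an even alternating path moves the free vertex to its other end. -/
theorem EvenPath.symmDiff {v x : ℕ} {l : List ℕ} {E : List (Sym2 ℕ)}
    (h : EvenPath H N v x l E) (hd : H.Loopless) (hM : H.IsMatching N) (hv : Free N v)
    (hnd : (v :: l).Nodup) :
    H.IsMatching (symmDiff N E.toFinset) ∧ (symmDiff N E.toFinset).card = N.card ∧
      Free (symmDiff N E.toFinset) x ∧
      ∀ y, y ∉ v :: l → ∀ e, y ∈ e → (e ∈ symmDiff N E.toFinset ↔ e ∈ N) := by
  induction h with
  | nil =>
    have : _root_.symmDiff N ([] : List (Sym2 ℕ)).toFinset = N := by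
      ext e
      simp [Finset.mem_symmDiff]
    rw [this]
    exact ⟨hM, rfl, hv, fun _ _ _ _ => Iff.rfl⟩
  | @snoc x u o l E h h1 h2 h3 ih =>
    have hnd' : (v :: l).Nodup := by
      rw [← List.cons_append] at hnd
      exact hnd.of_append_left
    obtain ⟨i1, i2, i3, i4⟩ := ih hnd'
    have hul : u ∉ v :: l := by
      rw [← List.cons_append, List.nodup_append] at hnd
      exact fun h => hnd.2.2 u h u (by simp) rfl
    have hol : o ∉ v :: l := by
      rw [← List.cons_append, List.nodup_append] at hnd
      exact fun h => hnd.2.2 o h o (by simp) rfl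
    have huo : u ≠ o := hd.ne (hM.1 h3)
    have hxu : x ≠ u := hd.ne h1
    have hxo : x ≠ o := fun h' => hol (h' ▸ h.mem_cons)
    have hE1 : s(x, u) ∉ E := fun he => hul (h.mem_of_mem_edges he (by simp))
    have hE2 : s(u, o) ∉ E := fun he => hul (h.mem_of_mem_edges he (by simp))
    have hne : s(x, u) ≠ s(u, o) := by
      intro he
      have : x ∈ s(u, o) := he ▸ (by simp)
      simp [hxu, hxo] at this
    -- Prolonging the flipped path by two edges exchanges `uo` for `xu`, which moves the free vertex
    -- from `x` to `o`.
    have key : _root_.symmDiff N (E ++ [s(x, u), s(u, o)]).toFinset =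
        insert s(x, u) ((_root_.symmDiff N E.toFinset).erase s(u, o)) := by
      ext e
      simp only [Finset.mem_symmDiff, List.mem_toFinset, List.mem_append, List.mem_cons,
        List.not_mem_nil, or_false, Finset.mem_insert, Finset.mem_erase]
      by_cases he1 : e = s(x, u)
      · subst he1
        simp [h2]
      · by_cases he2 : e = s(u, o)
        · subst he2
          simp [h3, hne.symm]
        · simp [he1, he2]
    have huo' : s(u, o) ∈ _root_.symmDiff N E.toFinset := (i4 u hul _ (by simp)).2 h3
    have hxu' : s(x, u) ∉ _root_.symmDiff N E.toFinset := fun h => i3 _ h (by simp)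
    have hfree : ∀ y, y ∈ s(u, o) →
        Free ((_root_.symmDiff N E.toFinset).erase s(u, o)) y := fun y hy f hf hyf =>
      (Finset.mem_erase.1 hf).1 (i1.2 _ (Finset.mem_erase.1 hf).2 _ huo' y hyf hy)
    rw [key]
    refine ⟨(i1.erase _).insert h1 (fun f hf => i3 f (Finset.mem_of_mem_erase hf))
      (hfree u (by simp)), ?_, ?_, ?_⟩
    · rw [Finset.card_insert_of_notMem (fun h => hxu' (Finset.mem_of_mem_erase h)),
        Finset.card_erase_add_one huo', i2]
    · intro f hf
      rcases Finset.mem_insert.1 hf with rfl | hf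
      · simp [hxo.symm, huo.symm]
      · exact hfree o (by simp) f hf
    · intro y hy e hye
      simp only [List.mem_cons, List.mem_append, List.not_mem_nil, or_false, not_or] at hy
      have he1 : e ≠ s(x, u) := by
        rintro rfl
        have := h.mem_cons
        rcases Sym2.mem_iff.1 hye with rfl | rfl
        · simp [hy.1, hy.2.1] at this
        · exact hy.2.2.1 rfl
      have he2 : e ≠ s(u, o) := by
        rintro rfl
        simp [hy.2.2.1, hy.2.2.2] at hye
      rw [Finset.mem_insert, Finset.mem_erase]
      simp only [he1, he2, false_or, ne_eq, not_false_eq_true, true_and]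
      exact i4 y (by simp [hy.1, hy.2.1]) e hye

theorem IsAugmentingPath.symmDiff (hd : H.Loopless) (hM : H.IsMatching N) {v z : ℕ}
    {p : H.graph.Walk v z} (hp : IsAugmentingPath N p) :
    H.IsMatching (symmDiff N p.edges.toFinset) ∧
      (symmDiff N p.edges.toFinset).card = N.card + 1 ∧
      ¬ Free (symmDiff N p.edges.toFinset) v := by
  obtain ⟨y, l, E, h1, h2, h3, h4⟩ := hp.exists_evenPath hd
  have hz : z ∉ v :: l := by
    rw [List.nodup_append] at h2
    exact fun h => h2.2.2 z h z (by simp) rfl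
  obtain ⟨i1, i2, i3, i4⟩ := h1.symmDiff hd hM hp.2.2.1 h2.of_append_left
  have hE : s(y, z) ∉ E := fun he => hz (h1.mem_of_mem_edges he (by simp))
  have hN : s(y, z) ∉ N := fun h => hp.2.2.2.1 _ h (by simp)
  have hfz : Free (_root_.symmDiff N E.toFinset) z :=
    fun f hf hzf => hp.2.2.2.1 f ((i4 z hz f hzf).1 hf) hzf
  have key : _root_.symmDiff N p.edges.toFinset =
      insert s(y, z) (_root_.symmDiff N E.toFinset) := by
    rw [h3]
    ext e
    simp only [Finset.mem_symmDiff, List.mem_toFinset, List.mem_append, List.mem_cons,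
      List.not_mem_nil, or_false, Finset.mem_insert]
    by_cases he1 : e = s(y, z)
    · subst he1
      simp [hN]
    · simp [he1]
  refine ⟨?_, ?_, ?_⟩
  · rw [key]
    exact i1.insert h4 i3 hfz
  · rw [key, Finset.card_insert_of_notMem (fun h => hfz _ h (by simp)), i2]
  · cases p with
    | nil => exact absurd rfl hp.2.1
    | @cons _ u _ h q =>
      have h0 := hp.2.2.2.2 0 (by simp)
      simp only [SimpleGraph.Walk.edges_cons, List.getElem_cons_zero, Nat.not_odd_zero,
        iff_false] at h0
      refine fun hf => hf s(v, u) ?_ (by simp)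
      simp [Finset.mem_symmDiff, h0]

theorem DynGraph.Loopless.removeVerts (hd : H.Loopless) (S : Finset ℕ) :
    (H.removeVerts S).Loopless := fun e he => hd e (DynGraph.mem_removeVerts.1 he).1

theorem DynGraph.IsMatching.exists_removeVerts {K : Finset (Sym2 ℕ)} (hK : H.IsMatching K)
    (v : ℕ) : ∃ K', (H.removeVerts {v}).IsMatching K' ∧ K.card ≤ K'.card + 1 := by
  by_cases hf : Free K v
  · exact ⟨K, hK.removeVerts (by simpa using hf), by omega⟩
  · obtain ⟨u, hu⟩ := not_free_iff.1 hf
    refine ⟨K.erase s(v, u), (hK.erase _).removeVerts ?_, by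
      rw [Finset.card_erase_add_one hu]⟩
    intro x hx
    obtain rfl := Finset.mem_singleton.1 hx
    exact fun f hf hvf => (Finset.mem_erase.1 hf).1
      (hK.2 _ (Finset.mem_erase.1 hf).2 _ hu _ hvf (by simp))

/-- A matching that is maximum without `v` is maximum if no augmenting path starts at `v`. -/
theorem DynGraph.IsMaxMatching.of_removeVerts (hd : H.Loopless) {v : ℕ}
    (hN : (H.removeVerts {v}).IsMaxMatching N)
    (hp : ¬ ∃ (z : ℕ) (p : H.graph.Walk v z), IsAugmentingPath N p) : H.IsMaxMatching N := by
  have hM : H.IsMatching N := hN.1.of_removeVerts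
  have hv : Free N v := hN.1.free_of_removeVerts (by simp)
  refine ⟨hM, fun K hK => ?_⟩
  by_cases hf : Free K v
  · exact hN.2 K (hK.removeVerts (by simpa using hf))
  -- A competitor that covers `v` is replaced by an equally large one that misses `v` and therefore
  -- lives in the graph without `v`.
  · rcases exists_evenPath_or_free _ H N K v rfl hd hM hK hv hf with
      ⟨x, l, E, z, h1, h2, h3, h4⟩ | ⟨K', h1, h2, h3⟩
    · obtain ⟨p, h5, -⟩ := h1.exists_augmenting hd hM.1 h2 h3 hv h4
      exact absurd ⟨z, p, h5⟩ hp
    · rw [← h2]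
      exact hN.2 K' (h1.removeVerts (by simpa using h3))

/-- The engine of all updates. Restoring `v` raises the maximum size by at most one, so the result
of an augmentation is optimal; and without an augmenting path from `v` the old matching remains
optimal. -/
theorem AugmentingSearch.isMaxMatching (hd : H.Loopless) {v : ℕ} {N' : Finset (Sym2 ℕ)}
    (h : AugmentingSearch H v N N') (hN : (H.removeVerts {v}).IsMaxMatching N) :
    H.IsMaxMatching N' := by
  obtain ⟨-, h2, h3, ⟨z, p, hp, rfl⟩ | ⟨h4, rfl⟩⟩ := h
  · obtain ⟨h4, h5, -⟩ := hp.symmDiff hd h2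
    refine ⟨h4, fun K hK => ?_⟩
    obtain ⟨K', h6, h7⟩ := hK.exists_removeVerts v
    have := hN.2 K' h6
    omega
  · exact hN.of_removeVerts hd h4

end

end DynMatch

namespace DynMatch

section

/-! ### The memory layout -/

notation "aMate" => (0 : ℕ)
notation "aInput" => (1 : ℕ)
notation "aT" => (2 : ℕ)
notation "aHead" => (3 : ℕ)
notation "aNxt" => (4 : ℕ)
notation "aNod" => (5 : ℕ)
notation "aInn" => (6 : ℕ)
notation "aOut" => (7 : ℕ)
notation "aPv" => (8 : ℕ)
notation "aBa" => (9 : ℕ)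
notation "aBb" => (10 : ℕ)
notation "aQu" => (11 : ℕ)
notation "aTab" => (12 : ℕ)
notation "aSx" => (13 : ℕ)
notation "aSs" => (14 : ℕ)
notation "aPn" => (20 : ℕ)
notation "aAb" => (21 : ℕ)
notation "aMic" => (22 : ℕ)
notation "aLoc" => (23 : ℕ)
notation "aAnc" => (24 : ℕ)
notation "aUnm" => (25 : ℕ)
notation "aSz" => (26 : ℕ)
notation "aUp" => (27 : ℕ)
notation "aAt" => (28 : ℕ)
notation "aLab" => (29 : ℕ)
notation "aHd" => (30 : ℕ)
notation "aNx" => (31 : ℕ)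
notation "aSsz" => (32 : ℕ)
notation "aTop" => (33 : ℕ)

/-! ### Ancestors in a tree given by a parent function -/

/-- `Anc p i j`: the node `j` is `i` or an ancestor of `i`, where `0` is the root. -/
inductive Anc (p : ℕ → ℕ) : ℕ → ℕ → Prop
  | refl (i : ℕ) : Anc p i i
  | step {i j : ℕ} (hi : 0 < i) (h : Anc p (p i) j) : Anc p i j

namespace Anc

variable {p p' : ℕ → ℕ} {i j l k : ℕ}

theorem trans (h : Anc p i j) (h' : Anc p j l) : Anc p i l := by
  induction h with
  | refl i => exact h'
  | step hi _ ih => exact .step hi (ih h')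

theorem le (hp : ∀ i, 0 < i → i < k → p i < i) (h : Anc p i j) (hi : i < k) : j ≤ i := by
  induction h with
  | refl i => exact le_rfl
  | step h0 _ ih =>
    have := hp _ h0 hi
    have := ih (by omega)
    omega

theorem comparable (h : Anc p i j) (h' : Anc p i l) : Anc p j l ∨ Anc p l j := by
  induction h with
  | refl i => exact Or.inl h'
  | @step i j hi h ih =>
    cases h' with
    | refl => exact Or.inr (.step hi h)
    | step _ h' => exact ih h'

/-- Parents have smaller indices, so among the ancestors of one node the order of the indices is the
order along the way to the root. This is why nearest ancestors appear below as greatest elements. -/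
theorem of_le (hp : ∀ i, 0 < i → i < k → p i < i) (h : Anc p i j) (h' : Anc p i l) (hi : i < k)
    (hjl : l ≤ j) : Anc p j l := by
  rcases h.comparable h' with h1 | h1
  · exact h1
  · have h2 := h'.le hp hi
    have := h1.le hp (by omega)
    obtain rfl : l = j := by omega
    exact .refl _

theorem zero (hp : ∀ i, 0 < i → i < k → p i < i) (hi : i < k) : Anc p i 0 := by
  induction i using Nat.strong_induction_on with
  | _ i ih =>
    rcases Nat.eq_zero_or_pos i with rfl | h
    · exact .refl _
    · exact .step h (ih _ (hp i h hi) (by have := hp i h hi; omega))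

/-- The way from an old node to the root never visits nodes that are added later. -/
theorem congr_of_lt (hp : ∀ i, 0 < i → i < k → p i < i) (hpp : ∀ i, i < k → p' i = p i)
    (hi : i < k) : Anc p' i j ↔ Anc p i j := by
  constructor
  · intro h
    induction h with
    | refl i => exact .refl _
    | step h0 _ ih =>
      rw [hpp _ hi] at ih
      exact .step h0 (ih (by have := hp _ h0 hi; omega))
  · intro h
    induction h with
    | refl i => exact .refl _
    | step h0 _ ih =>
      refine .step h0 ?_
      rw [hpp _ hi]
      exact ih (by have := hp _ h0 hi; omega)

theorem iff_of_pos (hi : 0 < i) : Anc p i j ↔ j = i ∨ Anc p (p i) j := by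
  constructor
  · intro h
    cases h with
    | refl => exact Or.inl rfl
    | step _ h => exact Or.inr h
  · rintro (rfl | h)
    · exact .refl _
    · exact .step hi h

end Anc

/-! ### Nearest unabsorbed ancestors -/

/-- The list `l` is stored as a linked list with the pointers `nx`, starting with `h`. -/
def IsList (nx : ℕ → ℕ) : ℕ → List ℕ → Prop
  | h, [] => h = 0
  | h, e :: l => h = e + 1 ∧ IsList nx (nx e) l

theorem IsList.congr {nx nx' : ℕ → ℕ} {h : ℕ} {l : List ℕ} (hl : IsList nx h l)
    (hn : ∀ e ∈ l, nx' e = nx e) : IsList nx' h l := by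
  induction l generalizing h with
  | nil => exact hl
  | cons e l ih =>
    refine ⟨hl.1, ?_⟩
    rw [hn e (by simp)]
    exact ih hl.2 fun e' he' => hn e' (by simp [he'])

/-- `j` is an unabsorbed ancestor of `i`. -/
def UAnc (A : ℕ → ℕ → ℕ) (i j : ℕ) : Prop := Anc (A aPn) i j ∧ A aAb j = 0

/-- The sets of microtrees are stored as linked lists, with their sizes. -/
structure SetLists (A : ℕ → ℕ → ℕ) (nm : ℕ) : Prop where
  lab_lt : ∀ μ < nm, A aLab μ < nm
  lists : ∀ s < nm, ∃ l : List ℕ, IsList (A aNx) (A aHd s) l ∧ l.Nodup ∧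
    (∀ e, e ∈ l ↔ e < nm ∧ A aLab e = s) ∧ A aSsz s = l.length

/-- The nodes `0, …, k - 1` of a tree with parents `A aPn`, of which some are absorbed, are
partitioned into `nm` connected microtrees of at most `b` nodes.  The microtrees of size `b` are
combined to sets such that all nodes on the way from the root of a microtree to the top microtree
of its set are absorbed. -/
structure Micro (A : ℕ → ℕ → ℕ) (b k nm : ℕ) : Prop where
  b_pos : 0 < b
  pn_lt : ∀ i, 0 < i → i < k → A aPn i < i
  ab_zero : 0 < k → A aAb 0 = 0
  mic_lt : ∀ i < k, A aMic i < nm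
  mic_zero : 0 < k → A aMic 0 = 0
  nm_le : nm ≤ k
  loc_lt : ∀ i < k, A aLoc i < A aSz (A aMic i)
  sz_le : ∀ μ < nm, A aSz μ ≤ b
  at_eq : ∀ i < k, A aAt (A aMic i * b + A aLoc i) = i
  loc_mono : ∀ i j, i < j → j < k → A aMic i = A aMic j → A aLoc i < A aLoc j
  anc_bit : ∀ i < k, ∀ l, (A aAnc i).testBit l = true ↔
    ∃ j < k, A aMic j = A aMic i ∧ A aLoc j = l ∧ Anc (A aPn) i j
  unm_bit : ∀ μ < nm, ∀ l, (A aUnm μ).testBit l = true ↔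
    ∃ j < k, A aMic j = μ ∧ A aLoc j = l ∧ A aAb j = 0
  up_lt : ∀ μ, 0 < μ → μ < nm → A aUp μ < k ∧ A aMic (A aUp μ) < μ ∧
    A aSz (A aMic (A aUp μ)) = b
  anc_mic : ∀ i < k, ∀ j, Anc (A aPn) i j →
    A aMic j = A aMic i ∨ (0 < A aMic i ∧ Anc (A aPn) (A aUp (A aMic i)) j)
  anc_up : ∀ i < k, 0 < A aMic i → Anc (A aPn) i (A aUp (A aMic i))
  lists : SetLists A nm
  small : ∀ μ < nm, A aSz μ < b → ∀ μ' < nm, A aLab μ' = A aLab μ → μ' = μ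
  top_le : ∀ μ < nm, A aTop (A aLab μ) ≤ μ ∧ A aLab (A aTop (A aLab μ)) = A aLab μ
  top_pos : ∀ μ, 0 < μ → μ < nm → 0 < A aTop (A aLab μ) ∧
    ∀ j, UAnc A (A aUp μ) j ↔ UAnc A (A aUp (A aTop (A aLab μ))) j

/-- The work that merging sets of microtrees may still cause. -/
def potential (A : ℕ → ℕ → ℕ) (nm : ℕ) : ℕ :=
  ∑ μ ∈ Finset.range nm, (A aSz μ - Nat.log 2 (A aSsz (A aLab μ)))

theorem SetLists.congr {A A' : ℕ → ℕ → ℕ} {nm : ℕ} (h : SetLists A nm)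
    (h29 : A' aLab = A aLab) (h30 : A' aHd = A aHd) (h31 : A' aNx = A aNx)
    (h32 : A' aSsz = A aSsz) : SetLists A' nm := by
  constructor
  · rw [h29]; exact h.lab_lt
  · rw [h29, h30, h31, h32]; exact h.lists

theorem SetLists.ssz_pos {A : ℕ → ℕ → ℕ} {nm : ℕ} (h : SetLists A nm) {μ : ℕ} (hμ : μ < nm) :
    0 < A aSsz (A aLab μ) := by
  obtain ⟨l, -, -, h3, h4⟩ := h.lists _ (h.lab_lt μ hμ)
  rw [h4]
  exact List.length_pos_of_mem ((h3 μ).2 ⟨hμ, rfl⟩)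

theorem SetLists.ssz_eq {A : ℕ → ℕ → ℕ} {nm : ℕ} (h : SetLists A nm) {s : ℕ} (hs : s < nm) :
    A aSsz s = ((Finset.range nm).filter fun μ => A aLab μ = s).card := by
  obtain ⟨l, -, h2, h3, h4⟩ := h.lists s hs
  rw [h4, ← List.toFinset_card_of_nodup h2]
  congr 1
  ext μ
  simp [h3]

theorem SetLists.ssz_le {A : ℕ → ℕ → ℕ} {nm : ℕ} (h : SetLists A nm) {s : ℕ} (hs : s < nm) :
    A aSsz s ≤ nm := by
  rw [h.ssz_eq hs]
  simpa using Finset.card_filter_le (Finset.range nm) fun μ => A aLab μ = s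

theorem SetLists.hd_ne_zero {A : ℕ → ℕ → ℕ} {nm : ℕ} (h : SetLists A nm) {s : ℕ} (hs : s < nm)
    (h0 : A aHd s ≠ 0) : A aHd s - 1 < nm ∧ A aLab (A aHd s - 1) = s ∧ 0 < A aSsz s := by
  obtain ⟨l, h1, h2, h3, h4⟩ := h.lists s hs
  cases l with
  | nil => exact absurd h1 h0
  | cons e l =>
    have := (h3 e).1 (by simp)
    rw [h1.1]
    simp only [Nat.add_sub_cancel]
    exact ⟨this.1, this.2, by rw [h4]; simp⟩

theorem SetLists.hd_eq_zero {A : ℕ → ℕ → ℕ} {nm : ℕ} (h : SetLists A nm) {s : ℕ} (hs : s < nm) :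
    A aHd s = 0 ↔ ∀ μ < nm, A aLab μ ≠ s := by
  obtain ⟨l, h1, h2, h3, h4⟩ := h.lists s hs
  cases l with
  | nil =>
    refine ⟨fun _ μ hμ he => ?_, fun _ => h1⟩
    have := (h3 μ).2 ⟨hμ, he⟩
    simp at this
  | cons e l =>
    have := (h3 e).1 (by simp)
    refine ⟨fun h0 => ?_, fun h => absurd this.2 (h e this.1)⟩
    have := h1.1
    omega

/-- Moving the first element of the set `s` to the set `l`. -/
theorem SetLists.move {A A' : ℕ → ℕ → ℕ} {nm s l : ℕ} (h : SetLists A nm) (hs : s < nm)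
    (hl : l < nm) (hsl : s ≠ l) (h0 : A aHd s ≠ 0)
    (h29 : A' aLab = Function.update (A aLab) (A aHd s - 1) l)
    (h30 : A' aHd = Function.update (Function.update (A aHd) s (A aNx (A aHd s - 1))) l (A aHd s))
    (h31 : A' aNx = Function.update (A aNx) (A aHd s - 1) (A aHd l))
    (h32 : A' aSsz = Function.update (Function.update (A aSsz) s (A aSsz s - 1)) l
      (A aSsz l + 1)) : SetLists A' nm := by
  obtain ⟨l₁, h1, h2, h3, h4⟩ := h.lists s hs
  obtain ⟨l₂, h5, h6, h7, h8⟩ := h.lists l hl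
  cases l₁ with
  | nil => exact absurd h1 h0
  | cons e l₁ =>
    obtain ⟨he, h1⟩ := h1
    have he' := (h3 e).1 (by simp)
    have hel₂ : e ∉ l₂ := fun h => hsl (he'.2.symm.trans ((h7 e).1 h).2)
    have hel₁ : e ∉ l₁ := (List.nodup_cons.1 h2).1
    rw [he] at h29 h30 h31
    simp only [Nat.add_sub_cancel] at h29 h30 h31
    constructor
    · intro μ hμ
      rw [h29, Function.update_apply]
      split_ifs
      · exact hl
      · exact h.lab_lt μ hμ
    · intro t ht
      by_cases hts : t = s
      · subst hts
        refine ⟨l₁, ?_, (List.nodup_cons.1 h2).2, ?_, ?_⟩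
        · rw [h30, Function.update_of_ne hsl, Function.update_self]
          refine h1.congr fun e' hm => ?_
          rw [h31, Function.update_of_ne]
          rintro rfl
          exact hel₁ hm
        · intro x
          have := h3 x
          rw [h29, Function.update_apply]
          by_cases hx : x = e
          · subst hx
            simp [hel₁, hsl.symm]
          · simpa [hx] using this
        · rw [h32, Function.update_of_ne hsl, Function.update_self, h4]
          simp
      · by_cases htl : t = l
        · subst htl
          refine ⟨e :: l₂, ⟨?_, ?_⟩, List.nodup_cons.2 ⟨hel₂, h6⟩, ?_, ?_⟩
          · rw [h30, Function.update_self]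
          · rw [h31, Function.update_self]
            refine h5.congr fun e' hm => ?_
            rw [Function.update_of_ne]
            rintro rfl
            exact hel₂ hm
          · intro x
            have := h7 x
            rw [h29, Function.update_apply]
            by_cases hx : x = e
            · subst hx
              simp [he'.1]
            · simpa [hx] using this
          · rw [h32, Function.update_self, h8]
            simp
        · obtain ⟨l₃, g1, g2, g3, g4⟩ := h.lists t ht
          have hel₃ : e ∉ l₃ := fun h => hts (((g3 e).1 h).2.symm.trans he'.2)
          refine ⟨l₃, ?_, g2, ?_, ?_⟩
          · rw [h30, Function.update_of_ne htl, Function.update_of_ne hts]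
            refine g1.congr fun e' hm => ?_
            rw [h31, Function.update_of_ne]
            rintro rfl
            exact hel₃ hm
          · intro x
            have := g3 x
            rw [h29, Function.update_apply]
            by_cases hx : x = e
            · subst hx
              simp [hel₃, Ne.symm htl]
            · simpa [hx] using this
          · rw [h32, Function.update_of_ne htl, Function.update_of_ne hts, g4]

end

end DynMatch

/-! ### Absorbing nodes and merging sets of microtrees -/

namespace DynMatch

section

variable {A A' : ℕ → ℕ → ℕ} {b k nm : ℕ}

theorem UAnc.congr_of_lt (hp : ∀ i, 0 < i → i < k → A aPn i < i)
    (h20 : ∀ i < k, A' aPn i = A aPn i) (h21 : ∀ i < k, A' aAb i = A aAb i) {i : ℕ} (hi : i < k)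
    (j : ℕ) : UAnc A' i j ↔ UAnc A i j := by
  unfold UAnc
  rw [Anc.congr_of_lt hp h20 hi]
  refine and_congr_right fun h => ?_
  rw [h21 j (lt_of_le_of_lt (h.le hp hi) hi)]

theorem Micro.congr (h : Micro A b k nm) (hA : ∀ a, 20 ≤ a → a ≤ 33 → A' a = A a) :
    Micro A' b k nm := by
  have h20 := hA 20 (by norm_num) (by norm_num)
  have h21 := hA 21 (by norm_num) (by norm_num)
  have h22 := hA 22 (by norm_num) (by norm_num)
  have h23 := hA 23 (by norm_num) (by norm_num)
  have h24 := hA 24 (by norm_num) (by norm_num)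
  have h25 := hA 25 (by norm_num) (by norm_num)
  have h26 := hA 26 (by norm_num) (by norm_num)
  have h27 := hA 27 (by norm_num) (by norm_num)
  have h28 := hA 28 (by norm_num) (by norm_num)
  have h29 := hA 29 (by norm_num) (by norm_num)
  have h30 := hA 30 (by norm_num) (by norm_num)
  have h31 := hA 31 (by norm_num) (by norm_num)
  have h32 := hA 32 (by norm_num) (by norm_num)
  have h33 := hA 33 (by norm_num) (by norm_num)
  have hU : ∀ i j, UAnc A' i j ↔ UAnc A i j := fun i j => by rw [UAnc, UAnc, h20, h21]
  exact
  { b_pos := h.b_pos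
    pn_lt := by rw [h20]; exact h.pn_lt
    ab_zero := by rw [h21]; exact h.ab_zero
    mic_lt := by rw [h22]; exact h.mic_lt
    mic_zero := by rw [h22]; exact h.mic_zero
    nm_le := h.nm_le
    loc_lt := by rw [h22, h23, h26]; exact h.loc_lt
    sz_le := by rw [h26]; exact h.sz_le
    at_eq := by rw [h22, h23, h28]; exact h.at_eq
    loc_mono := by rw [h22, h23]; exact h.loc_mono
    anc_bit := by rw [h20, h22, h23, h24]; exact h.anc_bit
    unm_bit := by rw [h21, h22, h23, h25]; exact h.unm_bit
    up_lt := by rw [h22, h26, h27]; exact h.up_lt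
    anc_mic := by rw [h20, h22, h27]; exact h.anc_mic
    anc_up := by rw [h20, h22, h27]; exact h.anc_up
    lists := h.lists.congr h29 h30 h31 h32
    small := by rw [h26, h29]; exact h.small
    top_le := by rw [h29, h33]; exact h.top_le
    top_pos := by
      rw [h27, h29, h33]
      intro μ h0 hμ
      refine ⟨(h.top_pos μ h0 hμ).1, fun j => ?_⟩
      rw [hU, hU]
      exact (h.top_pos μ h0 hμ).2 j }

theorem Micro.top_lt (h : Micro A b k nm) {μ : ℕ} (hμ : μ < nm) :
    A aTop (A aLab μ) < nm := lt_of_le_of_lt (h.top_le μ hμ).1 hμ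

/-- Only locations below the size of a microtree carry a bit, so masks are words of `b` bits and can
be used as indices of a table with `2 ^ b` entries. -/
theorem Micro.unm_lt (h : Micro A b k nm) {μ : ℕ} (hμ : μ < nm) : A aUnm μ < 2 ^ b := by
  refine Nat.lt_pow_two_of_testBit _ fun l hl => ?_
  by_contra hb
  obtain ⟨j, hj, h1, h2, h3⟩ := (h.unm_bit μ hμ l).1 (by simpa using hb)
  have := h.loc_lt j hj
  have := h.sz_le μ hμ
  rw [h1] at *
  omega

theorem Micro.anc_lt (h : Micro A b k nm) {i : ℕ} (hi : i < k) : A aAnc i < 2 ^ b := by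
  refine Nat.lt_pow_two_of_testBit _ fun l hl => ?_
  by_contra hb
  obtain ⟨j, hj, h1, h2, h3⟩ := (h.anc_bit i hi l).1 (by simpa using hb)
  have := h.loc_lt j hj
  have := h.sz_le _ (h.mic_lt i hi)
  rw [h1] at *
  omega

theorem Micro.loc_inj (h : Micro A b k nm) {i j : ℕ} (hi : i < k) (hj : j < k)
    (hm : A aMic i = A aMic j) (hl : A aLoc i = A aLoc j) : i = j := by
  rw [← h.at_eq i hi, ← h.at_eq j hj, hm, hl]

/-- Absorbing a node. -/
theorem Micro.absorb (h : Micro A b k nm) {i : ℕ} (h0 : 0 < i) (hi : i < k) (hab : A aAb i = 0)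
    (h21 : A' aAb = Function.update (A aAb) i 1)
    (h25 : A' aUnm = Function.update (A aUnm) (A aMic i) (A aUnm (A aMic i) ^^^ 1 <<< A aLoc i))
    (hA : ∀ a, 20 ≤ a → a ≠ 21 → a ≠ 25 → a ≤ 33 → A' a = A a) : Micro A' b k nm := by
  have h20 := hA 20 (by norm_num) (by norm_num) (by norm_num) (by norm_num)
  have h22 := hA 22 (by norm_num) (by norm_num) (by norm_num) (by norm_num)
  have h23 := hA 23 (by norm_num) (by norm_num) (by norm_num) (by norm_num)
  have h24 := hA 24 (by norm_num) (by norm_num) (by norm_num) (by norm_num)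
  have h26 := hA 26 (by norm_num) (by norm_num) (by norm_num) (by norm_num)
  have h27 := hA 27 (by norm_num) (by norm_num) (by norm_num) (by norm_num)
  have h28 := hA 28 (by norm_num) (by norm_num) (by norm_num) (by norm_num)
  have h29 := hA 29 (by norm_num) (by norm_num) (by norm_num) (by norm_num)
  have h30 := hA 30 (by norm_num) (by norm_num) (by norm_num) (by norm_num)
  have h31 := hA 31 (by norm_num) (by norm_num) (by norm_num) (by norm_num)
  have h32 := hA 32 (by norm_num) (by norm_num) (by norm_num) (by norm_num)
  have h33 := hA 33 (by norm_num) (by norm_num) (by norm_num) (by norm_num)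
  have hU : ∀ i' j, UAnc A' i' j ↔ UAnc A i' j ∧ j ≠ i := fun i' j => by
    rw [UAnc, UAnc, h20, h21, Function.update_apply]
    by_cases hj : j = i <;> simp [hj]
  exact
  { b_pos := h.b_pos
    pn_lt := by rw [h20]; exact h.pn_lt
    ab_zero := fun hk => by rw [h21, Function.update_of_ne h0.ne]; exact h.ab_zero hk
    mic_lt := by rw [h22]; exact h.mic_lt
    mic_zero := by rw [h22]; exact h.mic_zero
    nm_le := h.nm_le
    loc_lt := by rw [h22, h23, h26]; exact h.loc_lt
    sz_le := by rw [h26]; exact h.sz_le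
    at_eq := by rw [h22, h23, h28]; exact h.at_eq
    loc_mono := by rw [h22, h23]; exact h.loc_mono
    anc_bit := by rw [h20, h22, h23, h24]; exact h.anc_bit
    unm_bit := by
      rw [h21, h22, h23, h25]
      intro μ hμ l
      have key := h.unm_bit μ hμ l
      by_cases hm : μ = A aMic i
      · subst hm
        rw [Function.update_self, Nat.testBit_xor, Nat.one_shiftLeft, Nat.testBit_two_pow]
        by_cases hl : A aLoc i = l
        · subst hl
          -- The bit of `i` is set because `i` is still unabsorbed, so the exclusive or clears it.
          rw [key.2 ⟨i, hi, rfl, rfl, hab⟩]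
          simp only [decide_true, bne_self_eq_false, Bool.false_eq_true, false_iff, not_exists,
            not_and]
          intro j hj h1 h2
          rw [h.loc_inj hj hi h1 h2, Function.update_self]
          exact one_ne_zero
        · simp only [hl, decide_false, Bool.bne_false, key]
          refine exists_congr fun j => and_congr_right fun _ => and_congr_right fun _ =>
            and_congr_right fun h2 => ?_
          rw [Function.update_of_ne]
          rintro rfl
          exact hl h2
      · rw [Function.update_of_ne hm, key]
        refine exists_congr fun j => and_congr_right fun _ => and_congr_right fun h2 => ?_
        rw [Function.update_of_ne]
        rintro rfl
        exact hm h2.symm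
    up_lt := by rw [h22, h26, h27]; exact h.up_lt
    anc_mic := by rw [h20, h22, h27]; exact h.anc_mic
    anc_up := by rw [h20, h22, h27]; exact h.anc_up
    lists := h.lists.congr h29 h30 h31 h32
    small := by rw [h26, h29]; exact h.small
    top_le := by rw [h29, h33]; exact h.top_le
    top_pos := by
      rw [h27, h29, h33]
      intro μ h0 hμ
      refine ⟨(h.top_pos μ h0 hμ).1, fun j => ?_⟩
      rw [hU, hU, (h.top_pos μ h0 hμ).2 j] }

theorem potential_congr (h26 : A' aSz = A aSz) (h29 : A' aLab = A aLab)
    (h32 : A' aSsz = A aSsz) : potential A' nm = potential A nm := by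
  rw [potential, potential, h26, h29, h32]

/-- Merging two sets of full microtrees, where the second one contains the microtree above the
top of the first one. -/
theorem Micro.union (h : Micro A b k nm) {μ ν ls ll : ℕ} (hμ : μ < nm) (hμ0 : 0 < μ)
    (hs : A aSz μ = b)
    (hν : ν = A aMic (A aUp (A aTop (A aLab μ))))
    (hA0 : ∀ j, UAnc A (A aUp (A aTop (A aLab μ))) j → A aMic j ≠ ν)
    (hl : (ls = A aLab μ ∧ ll = A aLab ν) ∨ (ls = A aLab ν ∧ ll = A aLab μ))
    (h29 : ∀ e < nm, A' aLab e = if A aLab e = ls then ll else A aLab e)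
    (h33 : A' aTop = Function.update (A aTop) ll (A aTop (A aLab ν)))
    (hL : SetLists A' nm)
    (hA : ∀ a, 20 ≤ a → a ≠ 29 → a ≠ 30 → a ≠ 31 → a ≠ 32 → a ≠ 33 → a ≤ 33 → A' a = A a) :
    Micro A' b k nm := by
  have h20 := hA 20 (by norm_num) (by norm_num) (by norm_num) (by norm_num) (by norm_num) (by norm_num) (by norm_num)
  have h21 := hA 21 (by norm_num) (by norm_num) (by norm_num) (by norm_num) (by norm_num) (by norm_num) (by norm_num)
  have h22 := hA 22 (by norm_num) (by norm_num) (by norm_num) (by norm_num) (by norm_num) (by norm_num) (by norm_num)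
  have h23 := hA 23 (by norm_num) (by norm_num) (by norm_num) (by norm_num) (by norm_num) (by norm_num) (by norm_num)
  have h24 := hA 24 (by norm_num) (by norm_num) (by norm_num) (by norm_num) (by norm_num) (by norm_num) (by norm_num)
  have h25 := hA 25 (by norm_num) (by norm_num) (by norm_num) (by norm_num) (by norm_num) (by norm_num) (by norm_num)
  have h26 := hA 26 (by norm_num) (by norm_num) (by norm_num) (by norm_num) (by norm_num) (by norm_num) (by norm_num)
  have h27 := hA 27 (by norm_num) (by norm_num) (by norm_num) (by norm_num) (by norm_num) (by norm_num) (by norm_num)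
  have h28 := hA 28 (by norm_num) (by norm_num) (by norm_num) (by norm_num) (by norm_num) (by norm_num) (by norm_num)
  have hU : ∀ i' j, UAnc A' i' j ↔ UAnc A i' j := fun i' j => by rw [UAnc, UAnc, h20, h21]
  obtain ⟨ht1, ht2⟩ := h.top_le μ hμ
  obtain ⟨ht3, ht4⟩ := h.top_pos μ hμ0 hμ
  set t := A aTop (A aLab μ) with ht
  have htn : t < nm := by omega
  obtain ⟨hu1, hu2, hu3⟩ := h.up_lt t ht3 htn
  rw [← hν] at hu2 hu3
  have hνn : ν < nm := by omega
  -- Microtree `0` contains the root, which is never absorbed and is an ancestor of everything,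
  -- while `ν` contains no unabsorbed ancestor.
  have hν0 : 0 < ν := by
    rcases Nat.eq_zero_or_pos ν with h0 | h0
    · exfalso
      have hk : 0 < k := by omega
      exact hA0 0 ⟨Anc.zero h.pn_lt hu1, h.ab_zero hk⟩ (by rw [h.mic_zero hk, h0])
    · exact h0
  obtain ⟨hv1, hv2⟩ := h.top_le ν hνn
  obtain ⟨hv3, hv4⟩ := h.top_pos ν hν0 hνn
  -- With equal labels the common top `t` would be at most `ν`, but `ν` lies above `t` and precedes
  -- it.
  have hne : A aLab μ ≠ A aLab ν := by
    intro he
    rw [← he] at hv1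
    omega
  -- the unabsorbed ancestors above the two old tops agree
  have hstep : ∀ j, UAnc A (A aUp t) j ↔ UAnc A (A aUp ν) j := by
    intro j
    constructor
    · intro hj
      rcases h.anc_mic _ hu1 j hj.1 with h1 | h1
      · exact absurd (h1.trans hν.symm) (hA0 j hj)
      · rw [← hν] at h1
        exact ⟨h1.2, hj.2⟩
    · intro hj
      have := h.anc_up _ hu1 (by rw [← hν]; exact hν0)
      rw [← hν] at this
      exact ⟨this.trans hj.1, hj.2⟩
  have hlab : ∀ e < nm, (A aLab e = A aLab μ ∨ A aLab e = A aLab ν) ∧ A' aLab e = ll ∨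
      (A aLab e ≠ A aLab μ ∧ A aLab e ≠ A aLab ν) ∧ A' aLab e = A aLab e ∧ A aLab e ≠ ll := by
    intro e he
    rw [h29 e he]
    rcases hl with ⟨rfl, rfl⟩ | ⟨rfl, rfl⟩ <;> by_cases h1 : A aLab e = A aLab μ <;>
      by_cases h2 : A aLab e = A aLab ν <;> simp_all
  -- A microtree that is not full is alone in its set; so the sets of the full microtrees `μ` and
  -- `ν` have only full members.
  have hfull : ∀ e < nm, A aLab e = A aLab μ ∨ A aLab e = A aLab ν → ¬ A aSz e < b := by
    rintro e he (h1 | h1) hlt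
    · have := h.small e he hlt μ hμ h1.symm
      subst this
      omega
    · have := h.small e he hlt ν hνn h1.symm
      subst this
      omega
  have hvll : A' aLab (A aTop (A aLab ν)) = ll := by
    rcases hlab _ (lt_of_le_of_lt hv1 hνn) with h1 | h1
    · exact h1.2
    · exact absurd hv2 h1.1.2
  exact
  { b_pos := h.b_pos
    pn_lt := by rw [h20]; exact h.pn_lt
    ab_zero := by rw [h21]; exact h.ab_zero
    mic_lt := by rw [h22]; exact h.mic_lt
    mic_zero := by rw [h22]; exact h.mic_zero
    nm_le := h.nm_le
    loc_lt := by rw [h22, h23, h26]; exact h.loc_lt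
    sz_le := by rw [h26]; exact h.sz_le
    at_eq := by rw [h22, h23, h28]; exact h.at_eq
    loc_mono := by rw [h22, h23]; exact h.loc_mono
    anc_bit := by rw [h20, h22, h23, h24]; exact h.anc_bit
    unm_bit := by rw [h21, h22, h23, h25]; exact h.unm_bit
    up_lt := by rw [h22, h26, h27]; exact h.up_lt
    anc_mic := by rw [h20, h22, h27]; exact h.anc_mic
    anc_up := by rw [h20, h22, h27]; exact h.anc_up
    lists := hL
    small := by
      rw [h26]
      intro e he hlt e' he' hee
      rcases hlab e he with h1 | h1
      · exact absurd hlt (hfull e he h1.1)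
      · rcases hlab e' he' with h2 | h2
        · exact absurd (h1.2.1.symm.trans (hee.symm.trans h2.2)) h1.2.2
        · exact h.small e he hlt e' he' (by rw [← h1.2.1, ← h2.2.1, hee])
    top_le := by
      intro e he
      rcases hlab e he with h1 | h1
      · rw [h1.2, h33, Function.update_self]
        refine ⟨?_, hvll⟩
        rcases h1.1 with h2 | h2
        · have := (h.top_le e he).1
          rw [h2, ← ht] at this
          omega
        · have := (h.top_le e he).1
          rwa [h2] at this
      · rw [h1.2.1, h33, Function.update_of_ne h1.2.2]
        obtain ⟨h2, h3⟩ := h.top_le e he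
        refine ⟨h2, ?_⟩
        rcases hlab _ (lt_of_le_of_lt h2 he) with h4 | h4
        · rcases h4.1 with h5 | h5
          · exact absurd (h3.symm.trans h5) h1.1.1
          · exact absurd (h3.symm.trans h5) h1.1.2
        · rw [h4.2.1, h3]
    top_pos := by
      intro e he0 he
      rcases hlab e he with h1 | h1
      · rw [h1.2, h33, Function.update_self]
        refine ⟨hv3, fun j => ?_⟩
        rw [hU, hU, h27, ← hv4 j]
        rcases h1.1 with h2 | h2
        · rw [(h.top_pos e he0 he).2 j, h2, ← ht]
          exact hstep j
        · rw [(h.top_pos e he0 he).2 j, h2, ← hv4 j]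
      · rw [h1.2.1, h33, Function.update_of_ne h1.2.2]
        refine ⟨(h.top_pos e he0 he).1, fun j => ?_⟩
        rw [hU, hU, h27]
        exact (h.top_pos e he0 he).2 j }

/-- Merging sets of full microtrees by relabeling the smaller one. -/
theorem potential_union (hL : SetLists A nm) (hL' : SetLists A' nm) {ls ll : ℕ} (hls : ls < nm)
    (hll : ll < nm) (hne : ls ≠ ll)
    (hle : A aSsz ls ≤ A aSsz ll) (hb : Nat.log 2 nm ≤ b)
    (hfull : ∀ e < nm, A aLab e = ls ∨ A aLab e = ll → A aSz e = b)
    (h29 : ∀ e < nm, A' aLab e = if A aLab e = ls then ll else A aLab e)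
    (h26 : A' aSz = A aSz) :
    potential A' nm + A aSsz ls ≤ potential A nm := by
  rw [potential, potential, hL.ssz_eq hls, Finset.card_filter, ← Finset.sum_add_distrib]
  have hnew : A' aSsz ll = A aSsz ls + A aSsz ll := by
    rw [hL'.ssz_eq hll, hL.ssz_eq hls, hL.ssz_eq hll, ← Finset.card_union_of_disjoint]
    · congr 1
      ext e
      simp only [Finset.mem_filter, Finset.mem_range, Finset.mem_union]
      constructor
      · rintro ⟨he, h1⟩
        rw [h29 e he] at h1
        split_ifs at h1 with h2
        · exact Or.inl ⟨he, h2⟩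
        · exact Or.inr ⟨he, h1⟩
      · rintro (⟨he, h1⟩ | ⟨he, h1⟩)
        · exact ⟨he, by rw [h29 e he, if_pos h1]⟩
        · refine ⟨he, ?_⟩
          rw [h29 e he]
          split_ifs
          · rfl
          · exact h1
    · rw [Finset.disjoint_filter]
      rintro e - h1 h2
      exact hne (h1.symm.trans h2)
  refine Finset.sum_le_sum fun e he => ?_
  rw [Finset.mem_range] at he
  rw [h26, h29 e he]
  -- This keeps the truncated subtraction in the potential harmless: the logarithm never exceeds
  -- `b`, the size of the full microtrees concerned.
  have hbd : Nat.log 2 (A' aSsz ll) ≤ b := (Nat.log_mono_right (hL'.ssz_le hll)).trans hb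
  by_cases h1 : A aLab e = ls
  · rw [if_pos h1, if_pos h1, h1]
    have hpos := hL.ssz_pos he
    rw [h1] at hpos
    -- A relabelled microtree ends up in a set at least twice as large as before, so its term in the
    -- potential falls by at least one.
    have h2 : Nat.log 2 (A aSsz ls) + 1 ≤ Nat.log 2 (A' aSsz ll) := by
      rw [← Nat.log_mul_base (by norm_num) hpos.ne', hnew]
      exact Nat.log_mono_right (by omega)
    have := hfull e he (Or.inl h1)
    omega
  · rw [if_neg h1, if_neg h1, add_zero]
    by_cases h2 : A aLab e = ll
    · rw [h2]
      have : Nat.log 2 (A aSsz ll) ≤ Nat.log 2 (A' aSsz ll) := Nat.log_mono_right (by omega)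
      omega
    · have : A' aSsz (A aLab e) = A aSsz (A aLab e) := by
        rw [hL'.ssz_eq (hL.lab_lt e he), hL.ssz_eq (hL.lab_lt e he)]
        congr 1
        ext e'
        simp only [Finset.mem_filter, Finset.mem_range]
        refine and_congr_right fun he' => ?_
        rw [h29 e' he']
        split_ifs with h3
        · rw [h3]
          exact ⟨fun h => absurd h.symm h2, fun h => absurd h.symm h1⟩
        · rfl
      rw [this]

end

end DynMatch

/-! ### Adding leaves to the tree of nodes -/

namespace DynMatch

section

variable {A A' : ℕ → ℕ → ℕ} {b k nm : ℕ}

theorem Anc.update_lt {p p' : ℕ → ℕ} {q i j : ℕ} (hp : ∀ i, 0 < i → i < k → p i < i)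
    (h20 : p' = Function.update p k q) (hi : i < k) : Anc p' i j ↔ Anc p i j :=
  Anc.congr_of_lt hp (fun i hi => by rw [h20, Function.update_of_ne hi.ne]) hi

theorem Anc.update_self {p p' : ℕ → ℕ} {q j : ℕ} (hp : ∀ i, 0 < i → i < k → p i < i)
    (h20 : p' = Function.update p k q) (hk : 0 < k) (hq : q < k) :
    Anc p' k j ↔ j = k ∨ Anc p q j := by
  rw [Anc.iff_of_pos hk]
  have : p' k = q := by rw [h20, Function.update_self]
  rw [this, Anc.update_lt hp h20 hq]

/-- Adding a leaf to the microtree of its parent. -/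
theorem Micro.join (h : Micro A b k nm) {p μ : ℕ} (hp : p < k) (hμ : μ = A aMic p)
    (hsz : A aSz μ < b)
    (h20 : A' aPn = Function.update (A aPn) k p)
    (h21 : A' aAb = Function.update (A aAb) k 0)
    (h22 : A' aMic = Function.update (A aMic) k μ)
    (h23 : A' aLoc = Function.update (A aLoc) k (A aSz μ))
    (h24 : A' aAnc = Function.update (A aAnc) k (A aAnc p ||| 1 <<< A aSz μ))
    (h25 : A' aUnm = Function.update (A aUnm) μ (A aUnm μ ||| 1 <<< A aSz μ))
    (h26 : A' aSz = Function.update (A aSz) μ (A aSz μ + 1))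
    (h28 : A' aAt = Function.update (A aAt) (μ * b + A aSz μ) k)
    (hA : ∀ a ∈ [27, 29, 30, 31, 32, 33], A' a = A a) : Micro A' b (k + 1) nm := by
  have h27 := hA 27 (by simp)
  have h29 := hA 29 (by simp)
  have h30 := hA 30 (by simp)
  have h31 := hA 31 (by simp)
  have h32 := hA 32 (by simp)
  have h33 := hA 33 (by simp)
  have hk : 0 < k := by omega
  have hμn : μ < nm := hμ ▸ h.mic_lt p hp
  have hanc : ∀ {i j}, i < k → (Anc (A' aPn) i j ↔ Anc (A aPn) i j) :=
    fun hi => Anc.update_lt h.pn_lt h20 hi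
  have hanck : ∀ {j}, Anc (A' aPn) k j ↔ j = k ∨ Anc (A aPn) p j :=
    Anc.update_self h.pn_lt h20 hk hp
  have hle : ∀ {i j}, i < k → Anc (A aPn) i j → j < k := fun hi hj =>
    lt_of_le_of_lt (hj.le h.pn_lt hi) hi
  have hlt : ∀ {a i v}, i < k → Function.update (A a) k v i = A a i := fun hi =>
    Function.update_of_ne hi.ne _ _
  have hszle : ∀ ν, A aSz ν ≤ A' aSz ν := by
    intro ν
    rw [h26, Function.update_apply]
    split_ifs with h'
    · rw [h']; omega
    · rfl
  have hU : ∀ {i}, i < k → ∀ j, UAnc A' i j ↔ UAnc A i j := fun hi j =>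
    UAnc.congr_of_lt h.pn_lt (fun i hi => by rw [h20, hlt hi]) (fun i hi => by rw [h21, hlt hi])
      hi j
  have hlock : ∀ {j}, j < k → A aMic j = μ → A aLoc j < A aSz μ := fun hj h1 =>
    h1 ▸ h.loc_lt _ hj
  exact
  { b_pos := h.b_pos
    pn_lt := by
      intro i h0 hi
      rw [h20, Function.update_apply]
      split_ifs with h'
      · omega
      · exact h.pn_lt i h0 (by omega)
    ab_zero := fun _ => by rw [h21, hlt hk]; exact h.ab_zero hk
    mic_lt := by
      intro i hi
      rw [h22, Function.update_apply]
      split_ifs with h'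
      · exact hμn
      · exact h.mic_lt i (by omega)
    mic_zero := fun _ => by rw [h22, hlt hk]; exact h.mic_zero hk
    nm_le := by have := h.nm_le; omega
    loc_lt := by
      intro i hi
      rcases Nat.lt_succ_iff_lt_or_eq.1 hi with hi | rfl
      · rw [h22, h23, hlt hi, hlt hi]
        exact lt_of_lt_of_le (h.loc_lt i hi) (hszle _)
      · rw [h22, h23, Function.update_self, Function.update_self, h26, Function.update_self]
        omega
    sz_le := by
      intro ν hν
      rw [h26, Function.update_apply]
      split_ifs
      · omega
      · exact h.sz_le ν hν
    at_eq := by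
      intro i hi
      rcases Nat.lt_succ_iff_lt_or_eq.1 hi with hi | rfl
      · rw [h22, h23, h28, hlt hi, hlt hi, Function.update_of_ne]
        · exact h.at_eq i hi
        · intro he
          have h1 := h.loc_lt i hi
          have h2 := h.sz_le _ (h.mic_lt i hi)
          -- Locations are below `b`, so dividing an address by `b` recovers the microtree; hence
          -- the new cell differs from all the old ones.
          have h3 : (A aMic i * b + A aLoc i) / b = A aMic i := by
            rw [mul_comm, Nat.mul_add_div h.b_pos, Nat.div_eq_of_lt (by omega), add_zero]
          have h4 : (μ * b + A aSz μ) / b = μ := by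
            rw [mul_comm, Nat.mul_add_div h.b_pos, Nat.div_eq_of_lt hsz, add_zero]
          rw [he, h4] at h3
          rw [← h3] at he h1
          omega
      · rw [h22, h23, h28, Function.update_self, Function.update_self, Function.update_self]
    loc_mono := by
      intro i j hij hj
      have hi : i < k := by omega
      rw [h22, h23, hlt hi, hlt hi]
      rcases Nat.lt_succ_iff_lt_or_eq.1 hj with hj | rfl
      · rw [hlt hj, hlt hj]
        exact h.loc_mono i j hij hj
      · rw [Function.update_self, Function.update_self]
        exact fun h1 => hlock hi h1
    anc_bit := by
      intro i hi l
      rcases Nat.lt_succ_iff_lt_or_eq.1 hi with hi | rfl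
      · rw [h24, hlt hi, h.anc_bit i hi l]
        constructor
        · rintro ⟨j, hj, h1, h2, h3⟩
          refine ⟨j, by omega, ?_, ?_, (hanc hi).2 h3⟩
          · rw [h22, hlt hi, hlt hj, h1]
          · rw [h23, hlt hj, h2]
        · rintro ⟨j, hj, h1, h2, h3⟩
          have h3 := (hanc hi).1 h3
          have hj := hle hi h3
          rw [h22, hlt hi, hlt hj] at h1
          rw [h23, hlt hj] at h2
          exact ⟨j, hj, h1, h2, h3⟩
      · rw [h24, Function.update_self, Nat.testBit_or, Bool.or_eq_true, h.anc_bit p hp l,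
          Nat.one_shiftLeft, Nat.testBit_two_pow, decide_eq_true_eq, h22, h23,
          Function.update_self]
        constructor
        · rintro (⟨j, hj, h1, h2, h3⟩ | h1)
          · refine ⟨j, by omega, ?_, ?_, hanck.2 (Or.inr h3)⟩
            · rw [hlt hj, h1, hμ]
            · rw [hlt hj, h2]
          · exact ⟨i, by omega, Function.update_self .., by rw [Function.update_self, h1],
              .refl _⟩
        · rintro ⟨j, hj, h1, h2, h3⟩
          rcases hanck.1 h3 with rfl | h3
          · right
            rwa [Function.update_self] at h2
          · have hj := hle hp h3
            rw [hlt hj] at h1 h2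
            exact Or.inl ⟨j, hj, by rw [h1, hμ], h2, h3⟩
    unm_bit := by
      intro ν hν l
      have key := h.unm_bit ν hν l
      rw [h25, Function.update_apply, h21, h22, h23]
      have hold : (∃ j < k, A aMic j = ν ∧ A aLoc j = l ∧ A aAb j = 0) →
          ∃ j < k + 1, Function.update (A aMic) k μ j = ν ∧
            Function.update (A aLoc) k (A aSz μ) j = l ∧ Function.update (A aAb) k 0 j = 0 := by
        rintro ⟨j, hj, h1⟩
        refine ⟨j, by omega, ?_⟩
        rw [hlt hj, hlt hj, hlt hj]
        exact h1
      split_ifs with h'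
      · subst h'
        rw [Nat.testBit_or, Bool.or_eq_true, key, Nat.one_shiftLeft, Nat.testBit_two_pow,
          decide_eq_true_eq]
        constructor
        · rintro (h1 | h1)
          · exact hold h1
          · exact ⟨k, by omega, by simp [h1]⟩
        · rintro ⟨j, hj, h1, h2, h3⟩
          rcases Nat.lt_succ_iff_lt_or_eq.1 hj with hj | rfl
          · rw [hlt hj] at h1 h2 h3
            exact Or.inl ⟨j, hj, h1, h2, h3⟩
          · rw [Function.update_self] at h2
            exact Or.inr h2
      · rw [key]
        refine ⟨hold, ?_⟩
        rintro ⟨j, hj, h1, h2, h3⟩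
        rcases Nat.lt_succ_iff_lt_or_eq.1 hj with hj | rfl
        · rw [hlt hj] at h1 h2 h3
          exact ⟨j, hj, h1, h2, h3⟩
        · rw [Function.update_self] at h1
          exact absurd h1.symm h'
    up_lt := by
      intro ν h0 hν
      obtain ⟨h1, h2, h3⟩ := h.up_lt ν h0 hν
      rw [h27, h22, hlt h1]
      refine ⟨by omega, h2, ?_⟩
      -- Only full microtrees have others hanging below them, so the microtree `μ`, which still
      -- grows, is not the one above `ν`.
      rw [h26, Function.update_of_ne, h3]
      intro he
      rw [he] at h3
      omega
    anc_mic := by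
      intro i hi j hij
      rw [h27]
      rcases Nat.lt_succ_iff_lt_or_eq.1 hi with hi | rfl
      · have hij := (hanc hi).1 hij
        rw [h22, hlt hi, hlt (hle hi hij)]
        rcases h.anc_mic i hi j hij with h1 | ⟨h1, h2⟩
        · exact Or.inl h1
        · exact Or.inr ⟨h1, (hanc (h.up_lt _ h1 (h.mic_lt i hi)).1).2 h2⟩
      · rw [h22, Function.update_self]
        rcases hanck.1 hij with rfl | hij
        · exact Or.inl (Function.update_self ..)
        · rw [hlt (hle hp hij)]
          rcases h.anc_mic p hp j hij with h1 | ⟨h1, h2⟩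
          · exact Or.inl (h1.trans hμ.symm)
          · rw [← hμ] at h1 h2
            exact Or.inr ⟨h1, (hanc (h.up_lt _ h1 hμn).1).2 h2⟩
    anc_up := by
      intro i hi
      rw [h27]
      rcases Nat.lt_succ_iff_lt_or_eq.1 hi with hi | rfl
      · rw [h22, hlt hi]
        exact fun h0 => (hanc hi).2 (h.anc_up i hi h0)
      · rw [h22, Function.update_self]
        intro h0
        rw [hμ] at h0 ⊢
        exact hanck.2 (Or.inr (h.anc_up p hp h0))
    lists := h.lists.congr h29 h30 h31 h32
    small := by
      rw [h29]
      exact fun ν hν hlt' => h.small ν hν (lt_of_le_of_lt (hszle ν) hlt')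
    top_le := by rw [h29, h33]; exact h.top_le
    top_pos := by
      rw [h27, h29, h33]
      intro ν h0 hν
      refine ⟨(h.top_pos ν h0 hν).1, fun j => ?_⟩
      rw [hU (h.up_lt ν h0 hν).1, hU (h.up_lt _ (h.top_pos ν h0 hν).1 (h.top_lt hν)).1]
      exact (h.top_pos ν h0 hν).2 j }

theorem Micro.potential_join (h : Micro A b k nm) {p μ : ℕ} (hp : p < k) (hμ : μ = A aMic p)
    (h26 : A' aSz = Function.update (A aSz) μ (A aSz μ + 1))
    (h29 : A' aLab = A aLab) (h32 : A' aSsz = A aSsz) :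
    potential A' nm ≤ potential A nm + 1 := by
  have hμn : μ < nm := hμ ▸ h.mic_lt p hp
  have : potential A nm + 1 = ∑ ν ∈ Finset.range nm,
      ((A aSz ν - Nat.log 2 (A aSsz (A aLab ν))) + if ν = μ then 1 else 0) := by
    rw [Finset.sum_add_distrib, Finset.sum_ite_eq' (Finset.range nm) μ fun _ => 1,
      if_pos (Finset.mem_range.2 hμn)]
    rfl
  rw [this, potential, h29, h32]
  refine Finset.sum_le_sum fun ν _ => ?_
  rw [h26, Function.update_apply]
  split_ifs with h'
  · subst h'
    omega
  · omega

/-- Adding a leaf to a new microtree. -/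
theorem Micro.newMicro (h : Micro A b k nm) {p : ℕ}
    (hp : k = 0 ∨ (p < k ∧ A aSz (A aMic p) = b))
    (h20 : A' aPn = Function.update (A aPn) k p)
    (h21 : A' aAb = Function.update (A aAb) k 0)
    (h22 : A' aMic = Function.update (A aMic) k nm)
    (h23 : A' aLoc = Function.update (A aLoc) k 0)
    (h24 : A' aAnc = Function.update (A aAnc) k 1)
    (h25 : A' aUnm = Function.update (A aUnm) nm 1)
    (h26 : A' aSz = Function.update (A aSz) nm 1)
    (h27 : A' aUp = Function.update (A aUp) nm p)
    (h28 : A' aAt = Function.update (A aAt) (nm * b) k)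
    (h29 : A' aLab = Function.update (A aLab) nm nm)
    (h30 : A' aHd = Function.update (A aHd) nm (nm + 1))
    (h31 : A' aNx = Function.update (A aNx) nm 0)
    (h32 : A' aSsz = Function.update (A aSsz) nm 1)
    (h33 : A' aTop = Function.update (A aTop) nm nm) : Micro A' b (k + 1) (nm + 1) := by
  have hanc : ∀ {i j}, i < k → (Anc (A' aPn) i j ↔ Anc (A aPn) i j) :=
    fun hi => Anc.update_lt h.pn_lt h20 hi
  have hanck : ∀ {j}, Anc (A' aPn) k j ↔ j = k ∨ (0 < k ∧ Anc (A aPn) p j) := by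
    intro j
    rcases hp with rfl | hp
    · simp only [lt_irrefl, false_and, or_false]
      constructor
      · rintro (_ | ⟨h0, -⟩)
        · rfl
        · exact absurd h0 (lt_irrefl _)
      · rintro rfl
        exact .refl _
    · rw [Anc.update_self h.pn_lt h20 (by omega) hp.1]
      simp [show 0 < k by omega]
  have hle : ∀ {i j}, i < k → Anc (A aPn) i j → j < k := fun hi hj =>
    lt_of_le_of_lt (hj.le h.pn_lt hi) hi
  have hlt : ∀ {a i v}, i < k → Function.update (A a) k v i = A a i := fun hi =>
    Function.update_of_ne hi.ne _ _
  have hltn : ∀ {a i v}, i < nm → Function.update (A a) nm v i = A a i := fun hi =>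
    Function.update_of_ne hi.ne _ _
  have hU : ∀ {i}, i < k → ∀ j, UAnc A' i j ↔ UAnc A i j := fun hi j =>
    UAnc.congr_of_lt h.pn_lt (fun i hi => by rw [h20, hlt hi]) (fun i hi => by rw [h21, hlt hi])
      hi j
  have hnk : k = 0 → nm = 0 := fun hk => by have := h.nm_le; omega
  have hpk : 0 < k → p < k ∧ A aSz (A aMic p) = b := fun h0 => hp.resolve_left h0.ne'
  exact
  { b_pos := h.b_pos
    pn_lt := by
      intro i h0 hi
      rw [h20, Function.update_apply]
      split_ifs with h'
      · have := hpk (by omega)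
        omega
      · exact h.pn_lt i h0 (by omega)
    ab_zero := fun _ => by
      rw [h21, Function.update_apply]
      split_ifs with h'
      · rfl
      · exact h.ab_zero (by omega)
    mic_lt := by
      intro i hi
      rw [h22, Function.update_apply]
      split_ifs with h'
      · omega
      · have := h.mic_lt i (by omega)
        omega
    mic_zero := fun _ => by
      rw [h22, Function.update_apply]
      split_ifs with h'
      · exact hnk h'.symm
      · exact h.mic_zero (by omega)
    nm_le := by have := h.nm_le; omega
    loc_lt := by
      intro i hi
      rcases Nat.lt_succ_iff_lt_or_eq.1 hi with hi | rfl
      · rw [h22, h23, hlt hi, hlt hi, h26, hltn (h.mic_lt i hi)]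
        exact h.loc_lt i hi
      · rw [h22, h23, Function.update_self, Function.update_self, h26, Function.update_self]
        omega
    sz_le := by
      intro ν hν
      rw [h26, Function.update_apply]
      split_ifs
      · exact h.b_pos
      · exact h.sz_le ν (by omega)
    at_eq := by
      intro i hi
      rcases Nat.lt_succ_iff_lt_or_eq.1 hi with hi | rfl
      · rw [h22, h23, h28, hlt hi, hlt hi, Function.update_of_ne]
        · exact h.at_eq i hi
        · have h1 := h.loc_lt i hi
          have h2 := h.sz_le _ (h.mic_lt i hi)
          have h3 := h.mic_lt i hi
          -- The block of the new microtree starts at `nm * b`, behind the blocks of all older ones.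
          have : (A aMic i + 1) * b ≤ nm * b := Nat.mul_le_mul_right _ h3
          rw [add_mul] at this
          omega
      · rw [h22, h23, h28, Function.update_self, Function.update_self, add_zero,
          Function.update_self]
    loc_mono := by
      intro i j hij hj
      have hi : i < k := by omega
      rw [h22, h23, hlt hi, hlt hi]
      rcases Nat.lt_succ_iff_lt_or_eq.1 hj with hj | rfl
      · rw [hlt hj, hlt hj]
        exact h.loc_mono i j hij hj
      · rw [Function.update_self]
        intro h1
        have := h.mic_lt i hi
        omega
    anc_bit := by
      intro i hi l
      rcases Nat.lt_succ_iff_lt_or_eq.1 hi with hi | rfl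
      · rw [h24, hlt hi, h.anc_bit i hi l]
        constructor
        · rintro ⟨j, hj, h1, h2, h3⟩
          refine ⟨j, by omega, ?_, ?_, (hanc hi).2 h3⟩
          · rw [h22, hlt hi, hlt hj, h1]
          · rw [h23, hlt hj, h2]
        · rintro ⟨j, hj, h1, h2, h3⟩
          have h3 := (hanc hi).1 h3
          have hj := hle hi h3
          rw [h22, hlt hi, hlt hj] at h1
          rw [h23, hlt hj] at h2
          exact ⟨j, hj, h1, h2, h3⟩
      · have h1 : (1 : ℕ) = 2 ^ 0 := rfl
        rw [h24, Function.update_self, h1, Nat.testBit_two_pow, decide_eq_true_eq, h22, h23,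
          Function.update_self]
        constructor
        · intro h1
          exact ⟨i, by omega, Function.update_self .., by rw [Function.update_self, h1],
              .refl _⟩
        · rintro ⟨j, hj, h1, h2, h3⟩
          rcases hanck.1 h3 with rfl | ⟨h0, h3⟩
          · rwa [Function.update_self] at h2
          · have hj := hle (hpk h0).1 h3
            rw [hlt hj] at h1
            have := h.mic_lt j hj
            omega
    unm_bit := by
      intro ν hν l
      rw [h25, Function.update_apply, h21, h22, h23]
      split_ifs with h'
      · subst h'
        have h1 : (1 : ℕ) = 2 ^ 0 := rfl
        rw [h1, Nat.testBit_two_pow, decide_eq_true_eq]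
        constructor
        · intro h1
          exact ⟨k, by omega, by simp [h1]⟩
        · rintro ⟨j, hj, h1, h2, h3⟩
          rcases Nat.lt_succ_iff_lt_or_eq.1 hj with hj | rfl
          · rw [hlt hj] at h1
            have := h.mic_lt j hj
            omega
          · rwa [Function.update_self] at h2
      · rw [h.unm_bit ν (by omega) l]
        constructor
        · rintro ⟨j, hj, h1⟩
          refine ⟨j, by omega, ?_⟩
          rw [hlt hj, hlt hj, hlt hj]
          exact h1
        · rintro ⟨j, hj, h1, h2, h3⟩
          rcases Nat.lt_succ_iff_lt_or_eq.1 hj with hj | rfl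
          · rw [hlt hj] at h1 h2 h3
            exact ⟨j, hj, h1, h2, h3⟩
          · rw [Function.update_self] at h1
            exact absurd h1.symm h'
    up_lt := by
      intro ν h0 hν
      rcases Nat.lt_succ_iff_lt_or_eq.1 hν with hν | rfl
      · obtain ⟨h1, h2, h3⟩ := h.up_lt ν h0 hν
        rw [h27, hltn hν, h22, hlt h1, h26, hltn (by omega)]
        exact ⟨by omega, h2, h3⟩
      · have hk := hpk (by have := h.nm_le; omega)
        have := h.mic_lt p hk.1
        rw [h27, Function.update_self, h22, hlt hk.1, h26, hltn this]
        exact ⟨by omega, this, hk.2⟩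
    anc_mic := by
      intro i hi j hij
      rcases Nat.lt_succ_iff_lt_or_eq.1 hi with hi | rfl
      · have hij := (hanc hi).1 hij
        rw [h27, h22, hlt hi, hlt (hle hi hij), hltn (h.mic_lt i hi)]
        rcases h.anc_mic i hi j hij with h1 | ⟨h1, h2⟩
        · exact Or.inl h1
        · exact Or.inr ⟨h1, (hanc (h.up_lt _ h1 (h.mic_lt i hi)).1).2 h2⟩
      · rw [h27, h22, Function.update_self, Function.update_self]
        rcases hanck.1 hij with rfl | ⟨h0, hij⟩
        · exact Or.inl (Function.update_self ..)
        · have := h.mic_lt 0 h0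
          exact Or.inr ⟨by omega, (hanc (hpk h0).1).2 hij⟩
    anc_up := by
      intro i hi
      rcases Nat.lt_succ_iff_lt_or_eq.1 hi with hi | rfl
      · rw [h27, h22, hlt hi, hltn (h.mic_lt i hi)]
        exact fun h0 => (hanc hi).2 (h.anc_up i hi h0)
      · rw [h27, h22, Function.update_self, Function.update_self]
        intro h0
        exact hanck.2 (Or.inr ⟨by have := h.nm_le; omega, .refl _⟩)
    lists := by
      constructor
      · intro ν hν
        rw [h29, Function.update_apply]
        split_ifs with h'
        · omega
        · have := h.lists.lab_lt ν (by omega)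
          omega
      · intro s hs
        rcases Nat.lt_succ_iff_lt_or_eq.1 hs with hs | rfl
        · obtain ⟨l, h1, h2, h3, h4⟩ := h.lists.lists s hs
          refine ⟨l, ?_, h2, ?_, ?_⟩
          · rw [h30, hltn hs]
            refine h1.congr fun e he => ?_
            rw [h31, hltn ((h3 e).1 he).1]
          · intro e
            rw [h3, h29]
            constructor
            · rintro ⟨he, h5⟩
              rw [hltn he]
              exact ⟨by omega, h5⟩
            · rintro ⟨he, h5⟩
              rcases Nat.lt_succ_iff_lt_or_eq.1 he with he | rfl
              · rw [hltn he] at h5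
                exact ⟨he, h5⟩
              · rw [Function.update_self] at h5
                omega
          · rw [h32, hltn hs, h4]
        · refine ⟨[s], ⟨by rw [h30, Function.update_self], ?_⟩, by simp, ?_, ?_⟩
          · rw [h31, Function.update_self]
            rfl
          · intro e
            rw [h29, List.mem_singleton]
            constructor
            · rintro rfl
              exact ⟨by omega, Function.update_self ..⟩
            · rintro ⟨he, h5⟩
              rcases Nat.lt_succ_iff_lt_or_eq.1 he with he | rfl
              · rw [hltn he] at h5
                have := h.lists.lab_lt e he
                omega
              · rfl
          · rw [h32, Function.update_self]
            rfl
    small := by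
      intro ν hν hs ν' hν'
      rw [h29]
      rcases Nat.lt_succ_iff_lt_or_eq.1 hν with hν | rfl <;>
        rcases Nat.lt_succ_iff_lt_or_eq.1 hν' with hν' | rfl
      · rw [h26, hltn hν] at hs
        rw [hltn hν, hltn hν']
        exact h.small ν hν hs ν' hν'
      · rw [hltn hν, Function.update_self]
        intro h1
        have := h.lists.lab_lt ν hν
        omega
      · rw [hltn hν', Function.update_self]
        intro h1
        have := h.lists.lab_lt ν' hν'
        omega
      · exact fun _ => rfl
    top_le := by
      intro ν hν
      rw [h29, h33]
      rcases Nat.lt_succ_iff_lt_or_eq.1 hν with hν | rfl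
      · rw [hltn hν, hltn (h.lists.lab_lt ν hν), hltn (h.top_lt hν)]
        exact h.top_le ν hν
      · simp
    top_pos := by
      intro ν h0 hν
      rw [h27, h29, h33]
      rcases Nat.lt_succ_iff_lt_or_eq.1 hν with hν | rfl
      · rw [hltn hν, hltn (h.lists.lab_lt ν hν), hltn (h.top_lt hν), hltn hν]
        refine ⟨(h.top_pos ν h0 hν).1, fun j => ?_⟩
        rw [hU (h.up_lt ν h0 hν).1, hU (h.up_lt _ (h.top_pos ν h0 hν).1 (h.top_lt hν)).1]
        exact (h.top_pos ν h0 hν).2 j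
      · simp [h0] }

theorem Micro.potential_newMicro (h : Micro A b k nm)
    (h26 : A' aSz = Function.update (A aSz) nm 1)
    (h29 : A' aLab = Function.update (A aLab) nm nm)
    (h32 : A' aSsz = Function.update (A aSsz) nm 1) :
    potential A' (nm + 1) ≤ potential A nm + 1 := by
  rw [potential, potential, Finset.sum_range_succ, h29, Function.update_self, h26, h32,
    Function.update_self]
  refine Nat.add_le_add (Finset.sum_le_sum fun ν hν => ?_) (by simp)
  have hν := Finset.mem_range.1 hν
  rw [Function.update_of_ne hν.ne, Function.update_of_ne hν.ne,
    Function.update_of_ne (h.lists.lab_lt ν hν).ne]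

end

end DynMatch

namespace DynMatch

section

notation "rRoot" => (3 : ℕ)
notation "rM" => (4 : ℕ)
notation "rEx" => (5 : ℕ)
notation "rH" => (6 : ℕ)
notation "rB" => (7 : ℕ)
notation "rK" => (8 : ℕ)
notation "rNm" => (9 : ℕ)
notation "rQh" => (10 : ℕ)
notation "rQt" => (11 : ℕ)
notation "rX" => (12 : ℕ)
notation "rC" => (13 : ℕ)
notation "rY" => (14 : ℕ)
notation "rFnd" => (15 : ℕ)
notation "rArg" => (16 : ℕ)
notation "rRes" => (17 : ℕ)
notation "rMu" => (18 : ℕ)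
notation "rMask" => (19 : ℕ)
notation "rNu" => (20 : ℕ)
notation "rLs" => (21 : ℕ)
notation "rLl" => (22 : ℕ)
notation "rTt" => (23 : ℕ)
notation "rE" => (24 : ℕ)

/-! ### Programs for the tree of nodes -/

/-- Move the first element of the set `rLs` to the set `rLl`. -/
def moveCmd : Cmd :=
  .set rE (.get aHd (.reg rLs) -ₑ .lit 1) ;;
  .put aHd (.reg rLs) (.get aNx (.reg rE)) ;;
  .put aNx (.reg rE) (.get aHd (.reg rLl)) ;;
  .put aHd (.reg rLl) (.reg rE +ₑ .lit 1) ;;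
  .put aLab (.reg rE) (.reg rLl) ;;
  .put aSsz (.reg rLs) (.get aSsz (.reg rLs) -ₑ .lit 1) ;;
  .put aSsz (.reg rLl) (.get aSsz (.reg rLl) +ₑ .lit 1)

theorem moveCmd_spec {B nm ls ll : ℕ} {s : State} (hB : nm + 1 < B)
    (hL : SetLists s.arr nm) (hls : ls < nm) (hll : ll < nm) (hne : ls ≠ ll)
    (h21 : s.reg rLs = ls) (h22 : s.reg rLl = ll) (h0 : s.arr aHd ls ≠ 0) :
    Run B .skip moveCmd s fun t _ s' => t ≤ 40 ∧ SetLists s'.arr nm ∧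
      s'.arr aLab = Function.update (s.arr aLab) (s.arr aHd ls - 1) ll ∧
      s'.arr aSsz ls + 1 = s.arr aSsz ls := by
  subst h21 h22
  obtain ⟨h1, h2, h3⟩ := hL.hd_ne_zero hls h0
  have h4 := hL.ssz_le hll
  refine Run.of_pre ?_
  simp only [moveCmd, Pre, Expr.Ok, Expr.eval, Expr.cost, Op.eval_simps, State.simps]
  simp only [Nat.reduceEqDiff, if_true, if_false, Function.update_of_ne hne.symm,
    true_and]
  refine ⟨⟨by omega, by omega⟩, ⟨by omega, by omega⟩, ⟨by omega, by omega⟩,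
    ⟨by omega, by omega⟩, by omega, ?_, ?_⟩
  · refine hL.move hls hll hne h0 ?_ ?_ ?_ ?_
    · simp [State.setArr_arr]
    · simp only [State.setArr_arr, State.setReg_arr]
      simp only [Nat.reduceEqDiff, if_true, if_false]
      rw [Nat.sub_add_cancel (Nat.pos_of_ne_zero h0)]
    · simp [State.setArr_arr]
    · simp [State.setArr_arr, Function.update_of_ne hne.symm]
  · rw [Function.update_of_ne hne, Function.update_self]
    omega

/-- Merge the sets of the microtrees `rMu` and `rNu`, and keep the top of the latter. -/
def unionCmd : Cmd :=
  .set rLs (.get aLab (.reg rMu)) ;;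
  .set rLl (.get aLab (.reg rNu)) ;;
  .set rTt (.get aTop (.reg rLl)) ;;
  .ite (.get aSsz (.reg rLl) <ₑ .get aSsz (.reg rLs))
    (.set rE (.reg rLs) ;; .set rLs (.reg rLl) ;; .set rLl (.reg rE)) .skip ;;
  .loop (.get aHd (.reg rLs)) moveCmd ;;
  .put aTop (.reg rLl) (.reg rTt)

theorem moveLoop_spec {B nm ls ll : ℕ} {s : State} (hB : nm + 1 < B)
    (hL : SetLists s.arr nm) (hls : ls < nm) (hll : ll < nm) (hne : ls ≠ ll)
    (h21 : s.reg rLs = ls) (h22 : s.reg rLl = ll) :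
    Run B .skip (.loop (.get aHd (.reg rLs)) moveCmd) s fun t _ s' =>
      t ≤ 50 * s.arr aSsz ls + 10 ∧ SetLists s'.arr nm ∧
      ∀ e < nm, s'.arr aLab e = if s.arr aLab e = ls then ll else s.arr aLab e := by
  -- While the list is being emptied, a member of the first set carries the old or the new label; at
  -- the end the empty list rules out the old one.
  refine Run.loop rfl (fun s' => SetLists s'.arr nm ∧ ∀ e < nm,
      (s.arr aLab e ≠ ls → s'.arr aLab e = s.arr aLab e) ∧
      (s.arr aLab e = ls → s'.arr aLab e = ls ∨ s'.arr aLab e = ll))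
    (fun s' => 50 * s'.arr aSsz ls) ⟨hL, fun e _ => ⟨fun _ => rfl, fun h => Or.inl h⟩⟩ ?_ ?_ ?_
  · intro s' _ _
    trivial
  · rintro s' hsame ⟨hL', hI⟩ h0
    have e21 : s'.reg rLs = ls := (hsame.reg 21 rfl rfl).trans h21
    have e22 : s'.reg rLl = ll := (hsame.reg 22 rfl rfl).trans h22
    simp only [Expr.eval, e21] at h0
    refine (moveCmd_spec hB hL' hls hll hne e21 e22 h0).mono ?_
    rintro t tr s'' - - - ⟨ht, hL'', hlab, hsz⟩
    refine ⟨⟨hL'', fun e he => ?_⟩, ?_⟩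
    · have h1 := (hL'.hd_ne_zero hls h0).2.1
      rw [hlab, Function.update_apply]
      split_ifs with h'
      · subst h'
        refine ⟨fun h2 => ?_, fun _ => Or.inr rfl⟩
        rw [(hI _ he).1 h2] at h1
        exact absurd h1 h2
      · exact hI e he
    · simp only [Expr.cost]
      omega
  · rintro t s' hsame ⟨hL', hI⟩ h0 ht
    have e21 : s'.reg rLs = ls := (hsame.reg 21 rfl rfl).trans h21
    simp only [Expr.eval, e21] at h0
    simp only [Expr.cost] at ht
    refine ⟨by omega, hL', fun e he => ?_⟩
    split_ifs with h1
    · rcases (hI e he).2 h1 with h2 | h2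
      · exact absurd h2 ((hL'.hd_eq_zero hls).1 h0 e he)
      · exact h2
    · exact (hI e he).1 h1

/-- Each relabelling takes at most 50 steps and lowers the potential by at least one. At least one
microtree is relabelled, so the factor 200 also covers the overhead and leaves 100 steps for the
search that caused the merging. -/
theorem unionCmd_spec {B b k nm μ ν : ℕ} {s : State} (hB : nm + 1 < B)
    (h : Micro s.arr b k nm) (hb : Nat.log 2 nm ≤ b) (h18 : s.reg rMu = μ) (h20 : s.reg rNu = ν)
    (hμ : μ < nm) (hμ0 : 0 < μ) (hs : s.arr aSz μ = b)
    (hν : ν = s.arr aMic (s.arr aUp (s.arr aTop (s.arr aLab μ))))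
    (hA0 : ∀ j, UAnc s.arr (s.arr aUp (s.arr aTop (s.arr aLab μ))) j → s.arr aMic j ≠ ν) :
    Run B .skip unionCmd s fun t _ s' => Micro s'.arr b k nm ∧
      t + 100 + 200 * potential s'.arr nm ≤ 200 * potential s.arr nm := by
  obtain ⟨ht1, ht2⟩ := h.top_le μ hμ
  obtain ⟨ht3, -⟩ := h.top_pos μ hμ0 hμ
  obtain ⟨hu1, hu2, hu3⟩ := h.up_lt _ ht3 (by omega)
  rw [← hν] at hu2 hu3
  have hνn : ν < nm := by omega
  have hne : s.arr aLab μ ≠ s.arr aLab ν := by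
    intro he
    have := (h.top_le ν hνn).1
    rw [← he] at this
    omega
  have hfull : ∀ e < nm, s.arr aLab e = s.arr aLab μ ∨ s.arr aLab e = s.arr aLab ν →
      s.arr aSz e = b := by
    intro e he h1
    refine le_antisymm (h.sz_le e he) (not_lt.1 fun hlt => ?_)
    rcases h1 with h1 | h1
    · have := h.small e he hlt μ hμ h1.symm
      subst this
      omega
    · have := h.small e he hlt ν hνn h1.symm
      subst this
      omega
  refine Run.of_pre ?_
  simp only [unionCmd, Pre, Expr.Ok, Expr.eval, Expr.cost, Op.eval_simps, State.simps, h18, h20]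
  simp only [Nat.reduceEqDiff, if_true, if_false]
  refine ⟨trivial, trivial, trivial, ⟨trivial, trivial, by omega⟩, fun hlt => ?_, fun hge => ?_⟩
  · refine ⟨trivial, trivial, trivial, ?_⟩
    refine (moveLoop_spec (ls := s.arr aLab ν) (ll := s.arr aLab μ) hB (by exact h.lists)
      (h.lists.lab_lt ν hνn) (h.lists.lab_lt μ hμ) hne.symm (by simp) (by simp)).mono ?_
    rintro t tr s' - - hsame ⟨ht, hL, hlab⟩
    simp only [State.setReg_arr] at ht hlab
    have e22 : s'.reg rLl = s.arr aLab μ := by rw [hsame.reg 22 rfl rfl]; simp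
    have e23 : s'.reg rTt = s.arr aTop (s.arr aLab ν) := by rw [hsame.reg 23 rfl rfl]; simp
    have hA : ∀ a, moveCmd.warr a = false → s'.arr a = s.arr a := fun a h => hsame.arr a h rfl
    have hsz : s'.arr aSz = s.arr aSz := hA 26 rfl
    have hp := potential_union h.lists hL (h.lists.lab_lt ν hνn) (h.lists.lab_lt μ hμ) hne.symm
      hlt.le hb (fun e he h' => hfull e he h'.symm) hlab hsz
    have hpos := h.lists.ssz_pos hνn
    refine ⟨trivial, trivial, ?_, ?_⟩
    · rw [e22, e23]
      refine h.union hμ hμ0 hs hν hA0 (Or.inr ⟨rfl, rfl⟩) (fun e he => by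
          rw [State.setArr_arr, if_neg (by decide)]
          exact hlab e he)
        ?_ (hL.congr ?_ ?_ ?_ ?_) ?_
      · simp only [State.setArr_arr, if_true, hA 33 rfl]
      · simp [State.setArr_arr]
      · simp [State.setArr_arr]
      · simp [State.setArr_arr]
      · simp [State.setArr_arr]
      · intro a h1 h2 h3 h4 h5 h6 h7
        rw [State.setArr_arr, if_neg h6]
        refine hA a ?_
        simp [moveCmd, Cmd.warr, h2.symm, h3.symm, h4.symm, h5.symm]
    · rw [potential_congr (A := s'.arr) (by simp [State.setArr_arr]) (by simp [State.setArr_arr])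
        (by simp [State.setArr_arr])]
      omega
  · refine (moveLoop_spec (ls := s.arr aLab μ) (ll := s.arr aLab ν) hB (by exact h.lists)
      (h.lists.lab_lt μ hμ) (h.lists.lab_lt ν hνn) hne (by simp) (by simp)).mono ?_
    rintro t tr s' - - hsame ⟨ht, hL, hlab⟩
    simp only [State.setReg_arr] at ht hlab
    have e22 : s'.reg rLl = s.arr aLab ν := by rw [hsame.reg 22 rfl rfl]; simp
    have e23 : s'.reg rTt = s.arr aTop (s.arr aLab ν) := by rw [hsame.reg 23 rfl rfl]; simp
    have hA : ∀ a, moveCmd.warr a = false → s'.arr a = s.arr a := fun a h => hsame.arr a h rfl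
    have hsz : s'.arr aSz = s.arr aSz := hA 26 rfl
    have hp := potential_union h.lists hL (h.lists.lab_lt μ hμ) (h.lists.lab_lt ν hνn) hne
      hge hb hfull hlab hsz
    have hpos := h.lists.ssz_pos hμ
    refine ⟨trivial, trivial, ?_, ?_⟩
    · rw [e22, e23]
      refine h.union hμ hμ0 hs hν hA0 (Or.inl ⟨rfl, rfl⟩) (fun e he => by
          rw [State.setArr_arr, if_neg (by decide)]
          exact hlab e he)
        ?_ (hL.congr ?_ ?_ ?_ ?_) ?_
      · simp only [State.setArr_arr, if_true, hA 33 rfl]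
      · simp [State.setArr_arr]
      · simp [State.setArr_arr]
      · simp [State.setArr_arr]
      · simp [State.setArr_arr]
      · intro a h1 h2 h3 h4 h5 h6 h7
        rw [State.setArr_arr, if_neg h6]
        refine hA a ?_
        simp [moveCmd, Cmd.warr, h2.symm, h3.symm, h4.symm, h5.symm]
    · rw [potential_congr (A := s'.arr) (by simp [State.setArr_arr]) (by simp [State.setArr_arr])
        (by simp [State.setArr_arr])]
      omega

end

end DynMatch

/-! ### Finding the nearest unabsorbed ancestor -/

namespace DynMatch

section

variable {A : ℕ → ℕ → ℕ} {b k nm : ℕ}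

theorem Micro.mask_bit (h : Micro A b k nm) {i : ℕ} (hi : i < k) (l : ℕ) :
    (A aAnc i &&& A aUnm (A aMic i)).testBit l = true ↔
      ∃ j < k, A aMic j = A aMic i ∧ A aLoc j = l ∧ UAnc A i j := by
  rw [Nat.testBit_and, Bool.and_eq_true, h.anc_bit i hi, h.unm_bit _ (h.mic_lt i hi)]
  constructor
  · rintro ⟨⟨j, hj, h1, h2, h3⟩, j', hj', h1', h2', h3'⟩
    obtain rfl := h.loc_inj hj hj' (h1.trans h1'.symm) (h2.trans h2'.symm)
    exact ⟨j, hj, h1, h2, h3, h3'⟩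
  · rintro ⟨j, hj, h1, h2, h3, h4⟩
    exact ⟨⟨j, hj, h1, h2, h3⟩, j, hj, h1, h2, h4⟩

theorem UAnc.lt (h : Micro A b k nm) {i j : ℕ} (hi : i < k) (hj : UAnc A i j) : j < k :=
  lt_of_le_of_lt (hj.1.le h.pn_lt hi) hi

/-- The unabsorbed root is in microtree `0` and above every node, so an empty mask can occur only in
another microtree. All unabsorbed ancestors are then found from the node above that microtree. -/
theorem Micro.of_mask_eq_zero (h : Micro A b k nm) {i : ℕ} (hi : i < k)
    (h0 : A aAnc i &&& A aUnm (A aMic i) = 0) :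
    (∀ j, UAnc A i j → A aMic j ≠ A aMic i) ∧ 0 < A aMic i ∧
      ∀ j, UAnc A i j ↔ UAnc A (A aUp (A aMic i)) j := by
  have h1 : ∀ j, UAnc A i j → A aMic j ≠ A aMic i := by
    intro j hj hm
    have := (h.mask_bit hi (A aLoc j)).2 ⟨j, hj.lt h hi, hm, rfl, hj⟩
    rw [h0] at this
    simp at this
  have hk : 0 < k := by omega
  have h2 : 0 < A aMic i := by
    refine Nat.pos_of_ne_zero fun h2 => ?_
    exact h1 0 ⟨Anc.zero h.pn_lt hi, h.ab_zero hk⟩ (by rw [h.mic_zero hk, h2])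
  refine ⟨h1, h2, fun j => ⟨fun hj => ?_, fun hj => ⟨(h.anc_up i hi h2).trans hj.1, hj.2⟩⟩⟩
  rcases h.anc_mic i hi j hj.1 with h3 | h3
  · exact absurd h3 (h1 j hj)
  · exact ⟨h3.2, hj.2⟩

/-- Locations increase with indices within a microtree, so the highest bit belongs to the nearest
unabsorbed ancestor there. Ancestors in other microtrees lie above this microtree and have smaller
indices. -/
theorem Micro.of_mask_ne_zero (h : Micro A b k nm) {i : ℕ} (hi : i < k)
    (h0 : A aAnc i &&& A aUnm (A aMic i) ≠ 0) :
    Nat.log 2 (A aAnc i &&& A aUnm (A aMic i)) < b ∧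
    IsGreatest {j | UAnc A i j}
      (A aAt (A aMic i * b + Nat.log 2 (A aAnc i &&& A aUnm (A aMic i)))) := by
  set x := A aAnc i &&& A aUnm (A aMic i) with hx
  have hbit : x.testBit (Nat.log 2 x) = true := by
    rw [← Nat.log2_eq_log_two]
    exact Nat.testBit_log2 h0
  obtain ⟨j, hj, h1, h2, h3⟩ := (h.mask_bit hi _).1 hbit
  have h4 := h.at_eq j hj
  rw [h1, h2] at h4
  rw [h4]
  have h5 := h.loc_lt j hj
  have h6 := h.sz_le _ (h.mic_lt j hj)
  refine ⟨by omega, h3, fun j' hj' => ?_⟩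
  rcases h.anc_mic i hi j' hj'.1 with h7 | ⟨h7, h8⟩
  · have h9 := (h.mask_bit hi (A aLoc j')).2 ⟨j', hj'.lt h hi, h7, rfl, hj'⟩
    have h10 : A aLoc j' ≤ Nat.log 2 x :=
      Nat.le_log_of_pow_le (by norm_num) (Nat.ge_two_pow_of_testBit h9)
    by_contra hlt
    have := h.loc_mono j j' (not_le.1 hlt) (hj'.lt h hi) (h1.trans h7.symm)
    omega
  · have h9 := h.anc_up j hj (by omega)
    rw [h1] at h9
    exact (h8.le h.pn_lt (h.up_lt _ h7 (h.mic_lt i hi)).1).trans (h9.le h.pn_lt hj)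

/-- One step of the search for an unabsorbed ancestor, from the microtree `rMu`. -/
def findStepCmd : Cmd :=
  .set rArg (.get aUp (.get aTop (.get aLab (.reg rMu)))) ;;
  .set rNu (.get aMic (.reg rArg)) ;;
  .set rMask (.get aAnc (.reg rArg) &ₑ .get aUnm (.reg rNu)) ;;
  .ite (.reg rMask =ₑ .lit 0) (.skip ;; unionCmd) .skip ;;
  .set rMu (.reg rNu)

/-- Find the nearest unabsorbed ancestor `rRes` of the node `rArg`. -/
def findCmd : Cmd :=
  .set rMu (.get aMic (.reg rArg)) ;;
  .set rMask (.get aAnc (.reg rArg) &ₑ .get aUnm (.reg rMu)) ;;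
  .ite (.reg rMask =ₑ .lit 0)
    (.ite (.get aSz (.reg rMu) <ₑ .reg rB)
      (.set rArg (.get aUp (.reg rMu)) ;;
        .set rMu (.get aMic (.reg rArg)) ;;
        .set rMask (.get aAnc (.reg rArg) &ₑ .get aUnm (.reg rMu)))
      .skip)
    .skip ;;
  .loop (.reg rMask =ₑ .lit 0) findStepCmd ;;
  .set rRes (.get aAt (.reg rMu *ₑ .reg rB +ₑ .get aTab (.reg rMask)))

/-- The current position of the search for an unabsorbed ancestor. -/
structure Finding (U : ℕ → Prop) (b k nm : ℕ) (s : State) : Prop where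
  micro : Micro s.arr b k nm
  arg : s.reg rArg < k
  mu : s.reg rMu = s.arr aMic (s.reg rArg)
  mask : s.reg rMask = s.arr aAnc (s.reg rArg) &&& s.arr aUnm (s.reg rMu)
  anc : ∀ j, U j ↔ UAnc s.arr (s.reg rArg) j
  full : s.reg rMask = 0 → s.arr aSz (s.reg rMu) = b

/-- A step that meets an empty mask again merges two sets and is paid for by the potential. The 60
units that are held as long as the mask is empty pay for the last step. -/
theorem findStepCmd_spec {B : ℕ} {U : ℕ → Prop} {s : State} (hB : nm + 1 < B)
    (hb : Nat.log 2 nm ≤ b) (hf : Finding U b k nm s) (h0 : s.reg rMask = 0) :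
    Run B .skip findStepCmd s fun t _ s' => Finding U b k nm s' ∧
      t + 200 * potential s'.arr nm + (if s'.reg rMask = 0 then 60 else 0) ≤
        200 * potential s.arr nm + 40 := by
  obtain ⟨h, harg, hmu, hmask, hanc, hfull⟩ := hf
  have hm0 := h0
  rw [hmask, hmu] at hm0
  obtain ⟨h1, h2, h3⟩ := h.of_mask_eq_zero harg hm0
  have hμn := h.mic_lt _ harg
  rw [← hmu] at h1 h2 h3 hμn
  obtain ⟨h4, h5⟩ := h.top_pos _ h2 hμn
  obtain ⟨h6, h7, h8⟩ := h.up_lt _ h4 (h.top_lt hμn)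
  set μ := s.reg rMu with hμ
  set q := s.arr aUp (s.arr aTop (s.arr aLab μ)) with hq
  have hanc' : ∀ j, U j ↔ UAnc s.arr q j := fun j => by rw [hanc, h3, h5]
  refine Run.of_pre ?_
  simp only [findStepCmd, Pre, Expr.Ok, Expr.eval, Expr.cost, Op.eval_simps, State.simps, Nat.reduceEqDiff, if_true, if_false, true_and, ← hμ, ← hq]
  refine ⟨by omega, ⟨by omega, by omega⟩, fun hz => ?_, fun hz => ?_⟩
  · refine Run.mono (unionCmd_spec (k := k) (μ := μ) (ν := s.arr aMic q) hB ?_ hb ?_ ?_ hμn h2 (hfull h0)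
      rfl (h.of_mask_eq_zero h6 hz).1) ?_
    · exact h
    · simp [hμ]
    · simp
    rintro t tr s' - - hsame ⟨h', ht⟩
    simp only [State.setReg_arr] at ht
    have e16 : s'.reg rArg = q := by rw [hsame.reg 16 rfl rfl]; simp
    have e19 : s'.reg rMask = 0 := by rw [hsame.reg 19 rfl rfl]; simp [hz]
    have e20 : s'.reg rNu = s.arr aMic q := by rw [hsame.reg 20 rfl rfl]; simp
    have hA : ∀ a, unionCmd.warr a = false → s'.arr a = s.arr a := fun a h => hsame.arr a h rfl
    refine ⟨⟨h', ?_, ?_, ?_, ?_, ?_⟩, ?_⟩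
    · simpa [e16] using h6
    · simp [e16, e20, hA 22 rfl]
    · simp [e16, e19, e20, hA 24 rfl, hA 25 rfl, hz]
    · simp only [State.setReg_arr, State.setReg_reg, Nat.reduceEqDiff, if_false, e16, UAnc,
        hA 20 rfl, hA 21 rfl]
      exact hanc'
    · simp [e20, hA 26 rfl, h8]
    · rw [e19, if_pos rfl]
      omega
  · refine ⟨⟨h, h6, ?_, ?_, ?_, ?_⟩, ?_⟩
    all_goals simp [hz, hanc']
    omega

/-- `aTab` holds the logarithms of the positive numbers that are smaller than `2 ^ b`. -/
def LogTable (A : ℕ → ℕ → ℕ) (b : ℕ) : Prop :=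
  ∀ i, 0 < i → i < 2 ^ b → A aTab i = Nat.log 2 i

/-- A microtree that is not full must not be merged, so it is left by a plain step to the node above
it. By `up_lt` the microtree reached there is full, and so are all later ones; this is the field
`full` of `Finding`. Apart from the payments of the potential the time is constant. -/
theorem findCmd_spec {B p : ℕ} {s : State} (hB : (nm + 1) * (b + 1) < B)
    (hb : Nat.log 2 nm ≤ b) (hT : LogTable s.arr b) (h : Micro s.arr b k nm) (hp : p < k)
    (h16 : s.reg rArg = p) (h7 : s.reg rB = b) :
    Run B .skip findCmd s fun t _ s' => Micro s'.arr b k nm ∧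
      IsGreatest {j | UAnc s.arr p j} (s'.reg rRes) ∧
      t + 200 * potential s'.arr nm ≤ 200 * potential s.arr nm + 200 := by
  have hB1 : nm + 1 < B := lt_of_le_of_lt (Nat.le_mul_of_pos_right _ (by omega)) hB
  set φ : State → ℕ := fun s' => 200 * potential s'.arr nm + if s'.reg rMask = 0 then 60 else 0
    with hφ
  -- The loop is entered in three ways; `c` stands for an upper bound on the steps made before it.
  have key : ∀ (s₀ : State) (c : ℕ), Finding (UAnc s.arr p) b k nm s₀ → c ≤ 80 →
      s₀.reg rB = b → s₀.arr aTab = s.arr aTab → s₀.arr = s.arr →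
      Run B .skip (.loop (.reg rMask =ₑ .lit 0) findStepCmd) s₀ fun t _ s' =>
        (s'.reg rMu * s'.reg rB < B ∧ s'.reg rMu * s'.reg rB + s'.arr aTab (s'.reg rMask) < B) ∧
          Micro s'.arr b k nm ∧ IsGreatest {j | UAnc s.arr p j}
            (s'.arr aAt (s'.reg rMu * s'.reg rB + s'.arr aTab (s'.reg rMask))) ∧
          c + t + 200 * potential s'.arr nm ≤ 200 * potential s.arr nm + 180 := by
    intro s₀ c hf hc hr7 hr12 hsa
    refine Run.loop rfl (Finding (UAnc s.arr p) b k nm) φ hf ?_ ?_ ?_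
    · intro s' _ _
      exact ⟨trivial, by simp only [Expr.Ok]; omega, by omega⟩
    · intro s' hsame hf' h0
      simp only [Expr.eval, Op.eval_simps] at h0
      refine (findStepCmd_spec hB1 hb hf' h0).mono ?_
      rintro t tr s'' - - - ⟨hf'', ht⟩
      refine ⟨hf'', ?_⟩
      simp only [hφ, if_pos h0, Expr.cost]
      omega
    · intro t s' hsame hf' h0 ht
      simp only [Expr.eval, Op.eval_simps] at h0
      obtain ⟨h', harg, hmu, hmask, hanc, -⟩ := hf'
      rw [hmask, hmu] at h0
      obtain ⟨hlog, hgr⟩ := h'.of_mask_ne_zero harg h0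
      have hlt : s'.reg rMask < 2 ^ b := by
        rw [hmask, hmu]
        exact lt_of_le_of_lt Nat.and_le_left (h'.anc_lt harg)
      have htab : s'.arr aTab (s'.reg rMask) =
          Nat.log 2 (s'.arr aAnc (s'.reg rArg) &&& s'.arr aUnm (s'.arr aMic (s'.reg rArg))) := by
        rw [hsame.arr 12 rfl rfl, hr12, hT _ _ hlt, hmask, hmu]
        rw [hmask, hmu]
        exact Nat.pos_of_ne_zero h0
      have e7 : s'.reg rB = b := (hsame.reg 7 rfl rfl).trans hr7
      have hmn := h'.mic_lt _ harg
      have hbd : s'.arr aMic (s'.reg rArg) * b + b ≤ nm * b := by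
        rw [← Nat.succ_mul]
        exact Nat.mul_le_mul_right _ hmn
      have hbd' : nm * b ≤ (nm + 1) * (b + 1) := Nat.mul_le_mul (by omega) (by omega)
      rw [htab, e7, hmu]
      refine ⟨⟨by omega, by omega⟩, h', ?_, ?_⟩
      · have : {j | UAnc s.arr p j} = {j | UAnc s'.arr (s'.reg rArg) j} :=
          Set.ext fun j => hanc j
        rw [this]
        exact hgr
      · simp only [hφ, Expr.cost, hsa] at ht
        have : (if s₀.reg rMask = 0 then 60 else 0) ≤ 60 := by split_ifs <;> omega
        omega
  have hmn := h.mic_lt p hp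
  refine Run.of_pre ?_
  simp only [findCmd, Pre, Expr.Ok, Expr.eval, Expr.cost, Op.eval_simps, State.simps, Nat.reduceEqDiff, if_true, if_false, true_and, h16, h7]
  refine ⟨by omega, ⟨by omega, by omega⟩, fun hz => ?_, fun hz => ?_⟩
  · obtain ⟨h1, h2, h3⟩ := h.of_mask_eq_zero hp hz
    obtain ⟨h4, h5, h6⟩ := h.up_lt _ h2 hmn
    refine ⟨by omega, fun hlt => ⟨by omega, ?_⟩, fun hlt => ?_⟩
    · refine Run.mono (key _ 80 ⟨?_, ?_, ?_, ?_, ?_, ?_⟩ (by omega) ?_ ?_ ?_) ?_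
      · exact h
      · simpa using h4
      · simp
      · simp
      · simpa using h3
      · simpa using fun _ => h6
      · simpa using h7
      · rfl
      · rfl
      · rintro t tr s' - - - ⟨h1, h2, h3, h4⟩
        refine ⟨h1, h2, h3, ?_⟩
        omega
    · refine Run.mono (key _ 80 ⟨?_, ?_, ?_, ?_, ?_, ?_⟩ (by omega) ?_ ?_ ?_) ?_
      · exact h
      · simpa [h16] using hp
      · simp [h16]
      · simp [h16]
      · simp [h16]
      · simpa using fun _ => le_antisymm (h.sz_le _ hmn) hlt
      · simpa using h7
      · rfl
      · rfl
      · rintro t tr s' - - - ⟨h1, h2, h3, h4⟩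
        refine ⟨h1, h2, h3, ?_⟩
        omega
  · refine Run.mono (key _ 80 ⟨?_, ?_, ?_, ?_, ?_, ?_⟩ (by omega) ?_ ?_ ?_) ?_
    · exact h
    · simpa [h16] using hp
    · simp [h16]
    · simp [h16]
    · simp [h16]
    · simp [hz]
    · simpa using h7
    · rfl
    · rfl
    · rintro t tr s' - - - ⟨h1, h2, h3, h4⟩
      refine ⟨h1, h2, h3, ?_⟩
      omega

/-- Absorb the node `rRes`. -/
def absorbCmd : Cmd :=
  .put aAb (.reg rRes) (.lit 1) ;;
  .set rMu (.get aMic (.reg rRes)) ;;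
  .put aUnm (.reg rMu)
    (.op .xor (.get aUnm (.reg rMu)) (.op .shl (.lit 1) (.get aLoc (.reg rRes))))

theorem absorbCmd_spec {B i : ℕ} {s : State} (hB : 2 ^ b < B) (h : Micro s.arr b k nm)
    (h0 : 0 < i) (hi : i < k) (hab : s.arr aAb i = 0) (h17 : s.reg rRes = i) :
    Run B .skip absorbCmd s fun t _ s' => Micro s'.arr b k nm ∧
      s'.arr aAb = Function.update (s.arr aAb) i 1 ∧
      t ≤ 20 ∧ potential s'.arr nm = potential s.arr nm := by
  have h1 := h.unm_lt (h.mic_lt i hi)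
  have h2 : (1 : ℕ) <<< s.arr aLoc i < 2 ^ b := by
    rw [Nat.one_shiftLeft]
    exact Nat.pow_lt_pow_right (by norm_num)
      ((h.loc_lt i hi).trans_le (h.sz_le _ (h.mic_lt i hi)))
  have h3 := Nat.xor_lt_two_pow h1 h2
  have h4 := h.b_pos
  have h5 : 1 < 2 ^ b := Nat.one_lt_two_pow (by omega)
  refine Run.of_pre ?_
  simp only [absorbCmd, Pre, Expr.Ok, Expr.eval, Expr.cost, Op.eval_simps, State.simps, Nat.reduceEqDiff, if_true, if_false,
    true_and, h17]
  refine ⟨by omega, ⟨⟨by omega, by omega⟩, by omega⟩, ?_, by omega, ?_⟩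
  · refine h.absorb h0 hi hab ?_ ?_ ?_
    · simp [State.setArr_arr]
    · simp [State.setArr_arr]
    · intro a h1 h2 h3 h4
      simp [State.setArr_arr, h2, h3]
  · refine potential_congr ?_ ?_ ?_
    all_goals simp [State.setArr_arr]

/-- Add a node to the microtree `rMu` of its parent `rArg`. -/
def joinCmd : Cmd :=
  .set rE (.get aSz (.reg rMu)) ;;
  .put aLoc (.reg rK) (.reg rE) ;;
  .put aMic (.reg rK) (.reg rMu) ;;
  .put aAnc (.reg rK) (.op .lor (.get aAnc (.reg rArg)) (.op .shl (.lit 1) (.reg rE))) ;;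
  .put aUnm (.reg rMu) (.op .lor (.get aUnm (.reg rMu)) (.op .shl (.lit 1) (.reg rE))) ;;
  .put aAt (.reg rMu *ₑ .reg rB +ₑ .reg rE) (.reg rK) ;;
  .put aSz (.reg rMu) (.reg rE +ₑ .lit 1)

/-- Add a node to a new microtree below the node `rArg`. -/
def newMicroCmd : Cmd :=
  .put aUp (.reg rNm) (.reg rArg) ;;
  .put aMic (.reg rK) (.reg rNm) ;;
  .put aLoc (.reg rK) (.lit 0) ;;
  .put aAnc (.reg rK) (.lit 1) ;;
  .put aUnm (.reg rNm) (.lit 1) ;;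
  .put aAt (.reg rNm *ₑ .reg rB) (.reg rK) ;;
  .put aSz (.reg rNm) (.lit 1) ;;
  .put aLab (.reg rNm) (.reg rNm) ;;
  .put aHd (.reg rNm) (.reg rNm +ₑ .lit 1) ;;
  .put aNx (.reg rNm) (.lit 0) ;;
  .put aSsz (.reg rNm) (.lit 1) ;;
  .put aTop (.reg rNm) (.reg rNm) ;;
  .set rNm (.reg rNm +ₑ .lit 1)

/-- Add the node `rK` below the node `rArg`. -/
def addCmd : Cmd :=
  .put aPn (.reg rK) (.reg rArg) ;;
  .put aAb (.reg rK) (.lit 0) ;;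
  .set rMu (.get aMic (.reg rArg)) ;;
  .ite (.get aSz (.reg rMu) <ₑ .reg rB) joinCmd newMicroCmd ;;
  .set rK (.reg rK +ₑ .lit 1)

/-- A leaf joins the microtree of its parent while there is room and opens a new one otherwise.
Therefore new microtrees are attached only to full ones. Either way the potential rises by at most
one. -/
theorem addCmd_spec {B p : ℕ} {s : State} (hB : (nm + 2) * (b + 2) < B) (hB' : 2 ^ b < B)
    (hkB : k + 1 < B) (h : Micro s.arr b k nm) (hp : p < k) (h16 : s.reg rArg = p)
    (h7 : s.reg rB = b) (h8 : s.reg rK = k) (h9 : s.reg rNm = nm) :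
    Run B .skip addCmd s fun t _ s' => s'.reg rK = k + 1 ∧
      Micro s'.arr b (k + 1) (s'.reg rNm) ∧
      s'.arr aPn = Function.update (s.arr aPn) k p ∧
      s'.arr aAb = Function.update (s.arr aAb) k 0 ∧ t ≤ 100 ∧
      potential s'.arr (s'.reg rNm) ≤ potential s.arr nm + 1 := by
  have hbp := h.b_pos
  have hmn := h.mic_lt p hp
  have hszb := h.sz_le _ hmn
  have hnk := h.nm_le
  have hbd : s.arr aMic p * b + b ≤ nm * b := by
    rw [← Nat.succ_mul]
    exact Nat.mul_le_mul_right _ hmn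
  have hbd' : nm * b + nm * 2 + (2 * b + 2 * 2) < B := by
    calc _ = (nm + 2) * (b + 2) := by ring
      _ < B := hB
  have h5 : 1 < 2 ^ b := Nat.one_lt_two_pow (by omega)
  have hne : p ≠ k := hp.ne
  have hanc := h.anc_lt hp
  have hunm := h.unm_lt hmn
  refine Run.of_pre ?_
  simp only [addCmd, joinCmd, newMicroCmd, Pre, Expr.Ok, Expr.eval, Expr.cost, Op.eval_simps,
    State.simps, Nat.reduceEqDiff,
    if_true, if_false, true_and, h7, h8, h9, h16]
  refine ⟨by omega, by omega, fun hlt => ?_, fun hlt => ?_⟩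
  · have h2 : (1 : ℕ) <<< s.arr aSz (s.arr aMic p) < 2 ^ b := by
      rw [Nat.one_shiftLeft]
      exact Nat.pow_lt_pow_right (by norm_num) hlt
    have h3 := Nat.or_lt_two_pow hanc h2
    have h4 := Nat.or_lt_two_pow hunm h2
    have hsp : s.arr aMic p * b ≤ nm * b := Nat.mul_le_mul_right _ hmn.le
    refine ⟨⟨⟨by omega, by omega⟩, by omega⟩, ⟨⟨by omega, by omega⟩, by omega⟩,
      ⟨by omega, by omega⟩, ⟨by omega, by omega⟩, ⟨by omega, by omega⟩, ?_,
      by omega, ?_⟩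
    · refine h.join hp rfl hlt ?_ ?_ ?_ ?_ ?_ ?_ ?_ ?_ ?_
      all_goals simp [State.setArr_arr]
    · refine h.potential_join hp (μ := s.arr aMic p) rfl ?_ ?_ ?_
      all_goals simp [State.setArr_arr]
  · refine ⟨by omega, by omega, by omega, by omega, by omega, by omega, by omega, by omega,
      by omega, by omega, ?_, by omega, ?_⟩
    · refine h.newMicro (p := p) (Or.inr ⟨hp, le_antisymm hszb hlt⟩) ?_ ?_ ?_ ?_ ?_ ?_ ?_ ?_ ?_ ?_ ?_
        ?_ ?_ ?_
      all_goals simp [State.setArr_arr]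
    · refine h.potential_newMicro ?_ ?_ ?_
      all_goals simp [State.setArr_arr]

end

end DynMatch

namespace DynMatch

section

/-! ### Alternating forests with contracted blossoms -/

/-- `x` is one of the two vertices of the node `i`; the root `0` has an outer vertex only. -/
def InNode (A : ℕ → ℕ → ℕ) (x i : ℕ) : Prop := x = A aOut i ∨ (0 < i ∧ x = A aInn i)

/-- `x` is a vertex of the node `i` that can be reached by an alternating path of even length. -/
def OuterAt (A : ℕ → ℕ → ℕ) (x i : ℕ) : Prop :=
  x = A aOut i ∨ (0 < i ∧ x = A aInn i ∧ A aAb i ≠ 0)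

theorem OuterAt.inNode {A : ℕ → ℕ → ℕ} {x i : ℕ} (h : OuterAt A x i) : InNode A x i := by
  rcases h with h | ⟨h, h', -⟩
  · exact Or.inl h
  · exact Or.inr ⟨h, h'⟩

/-- The vertices after `s` of the alternating path from `s` to `x` that is obtained from the
parents of the nodes and from the bridges of the absorbed nodes. -/
inductive Trace (A : ℕ → ℕ → ℕ) (k : ℕ) : ℕ → ℕ → List ℕ → Prop
  | nil (s : ℕ) : Trace A k s s []
  | grow {s i : ℕ} {l : List ℕ} (h0 : 0 < i) (hi : i < k) (h : Trace A k s (A aPv i) l) :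
      Trace A k s (A aOut i) (l ++ [A aInn i, A aOut i])
  | bridge {s i : ℕ} {l₁ l₂ : List ℕ} (h0 : 0 < i) (hi : i < k) (hab : A aAb i ≠ 0)
      (h1 : Trace A k (A aOut i) (A aBa i) l₁) (h2 : Trace A k s (A aBb i) l₂) :
      Trace A k s (A aInn i) (l₂ ++ l₁.reverse ++ [A aOut i, A aInn i])

/-- The arrays `A'` extend the forest with the `k` nodes that is stored in `A`. -/
structure Extends (A A' : ℕ → ℕ → ℕ) (k : ℕ) : Prop where
  inn : ∀ i < k, A' aInn i = A aInn i
  out : ∀ i < k, A' aOut i = A aOut i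
  pv : ∀ i < k, A' aPv i = A aPv i
  pn : ∀ i < k, A' aPn i = A aPn i
  ab : ∀ i < k, A aAb i ≠ 0 → A' aAb i ≠ 0 ∧ A' aBa i = A aBa i ∧ A' aBb i = A aBb i

theorem Extends.inNode {A A' : ℕ → ℕ → ℕ} {k x i : ℕ} (h : Extends A A' k) (hi : i < k) :
    InNode A' x i ↔ InNode A x i := by
  rw [InNode, InNode, h.inn i hi, h.out i hi]

/-- Parents are never changed and bridges of absorbed nodes are never rewritten, so a path once
found survives all later changes of the forest. -/
theorem Trace.mono {A A' : ℕ → ℕ → ℕ} {k k' s x : ℕ} {l : List ℕ} (ht : Trace A k s x l)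
    (h : Extends A A' k) (hk : k ≤ k') : Trace A' k' s x l := by
  induction ht with
  | nil => exact .nil _
  | @grow s i l h0 hi _ ih =>
    rw [← h.pv i hi] at ih
    have := Trace.grow h0 (hi.trans_le hk) ih
    rwa [h.out i hi, h.inn i hi] at this
  | @bridge s i l₁ l₂ h0 hi hab _ _ ih1 ih2 =>
    obtain ⟨h1, h2, h3⟩ := h.ab i hi hab
    rw [← h2, ← h.out i hi] at ih1
    rw [← h3] at ih2
    have := Trace.bridge h0 (hi.trans_le hk) h1 ih1 ih2
    rwa [h.out i hi, h.inn i hi] at this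

theorem Trace.inNode {A : ℕ → ℕ → ℕ} {k s x : ℕ} {l : List ℕ} (ht : Trace A k s x l) :
    ∀ y ∈ l, ∃ i < k, InNode A y i := by
  induction ht with
  | nil => simp
  | @grow s i l h0 hi _ ih =>
    intro y hy
    simp only [List.mem_append, List.mem_cons, List.not_mem_nil, or_false] at hy
    rcases hy with hy | rfl | rfl
    · exact ih y hy
    · exact ⟨i, hi, Or.inr ⟨h0, rfl⟩⟩
    · exact ⟨i, hi, Or.inl rfl⟩
  | @bridge s i l₁ l₂ h0 hi hab _ _ ih1 ih2 =>
    intro y hy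
    simp only [List.mem_append, List.mem_cons, List.not_mem_nil, or_false,
      List.mem_reverse] at hy
    rcases hy with (hy | hy) | rfl | rfl
    · exact ih2 y hy
    · exact ih1 y hy
    · exact ⟨i, hi, Or.inl rfl⟩
    · exact ⟨i, hi, Or.inr ⟨h0, rfl⟩⟩

theorem Trace.mem {A : ℕ → ℕ → ℕ} {k s x : ℕ} {l : List ℕ} (ht : Trace A k s x l) :
    x ∈ s :: l := by
  cases ht <;> simp

/-- An alternating path from the root `v` to the vertex `x` of the node `i` that enters only the
blossoms of its unabsorbed ancestors. -/
structure GoodPath (A : ℕ → ℕ → ℕ) (k v x i : ℕ) (l : List ℕ) : Prop where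
  trace : Trace A k v x l
  nodup : (v :: l).Nodup
  anc : ∀ y ∈ v :: l, ∀ i' < k, InNode A y i' → ∀ j, UAnc A i' j → Anc (A aPn) i j
  split : ∀ j, UAnc A i j → ∃ l₁ l₂, l = l₁ ++ l₂ ∧ Trace A k v (A aOut j) l₁ ∧
    Trace A k (A aOut j) x l₂ ∧ ∀ y ∈ l₂, ∀ i' < k, InNode A y i' → Anc (A aPn) i' j

/-- The arrays store an alternating tree with the root `v` and the `k` nodes `0, …, k - 1`. -/
structure Forest (H : DynGraph) (N : Finset (Sym2 ℕ)) (v : ℕ) (D : ℕ → Prop) (A : ℕ → ℕ → ℕ)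
    (k : ℕ) : Prop where
  k_pos : 0 < k
  out_zero : A aOut 0 = v
  pn_lt : ∀ i, 0 < i → i < k → A aPn i < i
  ab_zero : A aAb 0 = 0
  dom : ∀ x, ∀ i < k, InNode A x i → D x
  nod : ∀ x, D x → ∀ i, A aNod x = i + 1 ↔ i < k ∧ InNode A x i
  matched : ∀ i, 0 < i → i < k → s(A aInn i, A aOut i) ∈ N
  edge : ∀ i, 0 < i → i < k → s(A aPv i, A aInn i) ∈ H.edges ∧ s(A aPv i, A aInn i) ∉ N
  pv_in : ∀ i, 0 < i → i < k → InNode A (A aPv i) (A aPn i)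
  bridge : ∀ i < k, A aAb i ≠ 0 → s(A aBa i, A aBb i) ∈ H.edges ∧ s(A aBa i, A aBb i) ∉ N
  path : ∀ x, ∀ i < k, OuterAt A x i → ∃ l, GoodPath A k v x i l

variable {H : DynGraph} {N : Finset (Sym2 ℕ)} {v : ℕ} {D : ℕ → Prop} {A A' : ℕ → ℕ → ℕ} {k : ℕ}

theorem Forest.unique (h : Forest H N v D A k) {x i j : ℕ} (hi : i < k) (hj : j < k)
    (h1 : InNode A x i) (h2 : InNode A x j) : i = j := by
  have hD := h.dom x i hi h1
  have h3 := (h.nod x hD i).2 ⟨hi, h1⟩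
  have h4 := (h.nod x hD j).2 ⟨hj, h2⟩
  omega

theorem Forest.nod_eq_zero (h : Forest H N v D A k) {x : ℕ} (hx : D x) (h0 : A aNod x = 0)
    {i : ℕ} (hi : i < k) : ¬ InNode A x i := by
  intro h1
  have := (h.nod x hx i).2 ⟨hi, h1⟩
  omega

theorem Forest.inNode_root (h : Forest H N v D A k) : InNode A v 0 := Or.inl h.out_zero.symm

/-- The vertices of a node other than the root are matched with each other. -/
theorem Forest.mate (h : Forest H N v D A k) (hN : H.IsMatching N) (hv : Free N v) {u o i : ℕ}
    (huo : s(u, o) ∈ N) (hi : i < k) (hu : InNode A u i) : 0 < i ∧ InNode A o i ∧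
      ((u = A aInn i ∧ o = A aOut i) ∨ (u = A aOut i ∧ o = A aInn i)) := by
  rcases hu with rfl | ⟨h0, rfl⟩
  · rcases Nat.eq_zero_or_pos i with rfl | h0
    · rw [h.out_zero] at huo
      exact absurd (by simp) (hv _ huo)
    · have h1 := h.matched i h0 hi
      rw [Sym2.eq_swap] at h1
      obtain rfl := hN.eq_right huo h1
      exact ⟨h0, Or.inr ⟨h0, rfl⟩, Or.inr ⟨rfl, rfl⟩⟩
  · obtain rfl := hN.eq_right huo (h.matched i h0 hi)
    exact ⟨h0, Or.inl rfl, Or.inl ⟨rfl, rfl⟩⟩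

theorem Forest.inn_ne_out (h : Forest H N v D A k) (hd : H.Loopless) (hN : H.IsMatching N)
    {i : ℕ} (h0 : 0 < i) (hi : i < k) : A aInn i ≠ A aOut i :=
  hd.ne (hN.1 (h.matched i h0 hi))

/-- Neither new nodes nor absorptions give an old node new unabsorbed ancestors. The conditions
`anc` and `split` quantify over unabsorbed ancestors and can only become weaker. -/
theorem GoodPath.mono {x i k' : ℕ} {l : List ℕ} (hg : GoodPath A k v x i l)
    (h : Forest H N v D A k) (he : Extends A A' k) (hk : k ≤ k') (hi : i < k)
    (hin : ∀ y i', i' < k' → InNode A' y i' → (∃ j < k, InNode A y j) → InNode A y i' ∧ i' < k)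
    (hu : ∀ i < k, ∀ j, UAnc A' i j → UAnc A i j) : GoodPath A' k' v x i l := by
  have hanc : ∀ {i j}, i < k → (Anc (A' aPn) i j ↔ Anc (A aPn) i j) := fun hi =>
    Anc.congr_of_lt h.pn_lt he.pn hi
  have hv : ∀ y ∈ v :: l, ∃ j < k, InNode A y j := by
    intro y hy
    rcases List.mem_cons.1 hy with rfl | hy
    · exact ⟨0, h.k_pos, h.inNode_root⟩
    · exact hg.trace.inNode y hy
  refine ⟨hg.trace.mono he hk, hg.nodup, ?_, ?_⟩
  · intro y hy i' hi' hy' j hj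
    obtain ⟨h1, h2⟩ := hin y i' hi' hy' (hv y hy)
    rw [hanc hi]
    exact hg.anc y hy i' h2 h1 j (hu i' h2 j hj)
  · intro j hj
    have hj' := hu i hi j hj
    have hjk : j < k := (hj'.1.le h.pn_lt hi).trans_lt hi
    obtain ⟨l₁, l₂, h1, h2, h3, h4⟩ := hg.split j hj'
    rw [← he.out j hjk] at h2 h3
    refine ⟨l₁, l₂, h1, h2.mono he hk, h3.mono he hk, ?_⟩
    intro y hy i' hi' hy'
    obtain ⟨h5, h6⟩ := hin y i' hi' hy' (hv y (by rw [h1]; simp [hy]))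
    rw [hanc h6]
    exact h4 y hy i' h6 h5

/-- Adding a node. -/
theorem Forest.grow (h : Forest H N v D A k) (hd : H.Loopless) (hN : H.IsMatching N)
    (hv : Free N v) {x p u o : ℕ} (hp : p < k) (hx : OuterAt A x p) (hxu : s(x, u) ∈ H.edges)
    (huo : s(u, o) ∈ N) (hu : D u) (ho : D o) (hu0 : A aNod u = 0)
    (h5 : A' aNod = Function.update (Function.update (A aNod) u (k + 1)) o (k + 1))
    (h6 : A' aInn = Function.update (A aInn) k u)
    (h7 : A' aOut = Function.update (A aOut) k o)
    (h8 : A' aPv = Function.update (A aPv) k x)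
    (h9 : A' aBa = A aBa) (h10 : A' aBb = A aBb)
    (h20 : A' aPn = Function.update (A aPn) k p)
    (h21 : A' aAb = Function.update (A aAb) k 0) : Forest H N v D A' (k + 1) := by
  have hk := h.k_pos
  have hul : ∀ i < k, ¬ InNode A u i := fun i hi => h.nod_eq_zero hu hu0 hi
  -- Nodes are matched pairs: if `o` were in the forest, so would be its partner `u`.
  have hol : ∀ i < k, ¬ InNode A o i := by
    intro i hi hoi
    rw [Sym2.eq_swap] at huo
    exact hul i hi (h.mate hN hv huo hi hoi).2.1
  have hne : u ≠ o := hd.ne (hN.1 huo)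
  have he : Extends A A' k := by
    constructor
    all_goals intro i hi
    · rw [h6, Function.update_of_ne hi.ne]
    · rw [h7, Function.update_of_ne hi.ne]
    · rw [h8, Function.update_of_ne hi.ne]
    · rw [h20, Function.update_of_ne hi.ne]
    · rw [h21, Function.update_of_ne hi.ne, h9, h10]
      exact fun h => ⟨h, rfl, rfl⟩
  have hink : ∀ y, InNode A' y k ↔ y = u ∨ y = o := by
    intro y
    rw [InNode, h6, h7, Function.update_self, Function.update_self]
    simp only [hk, true_and]
    exact or_comm
  have hin : ∀ y i', i' < k + 1 → InNode A' y i' → (∃ j < k, InNode A y j) →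
      InNode A y i' ∧ i' < k := by
    rintro y i' hi' hy ⟨j, hj, hyj⟩
    rcases Nat.lt_succ_iff_lt_or_eq.1 hi' with hi' | rfl
    · exact ⟨(he.inNode hi').1 hy, hi'⟩
    · rcases (hink y).1 hy with rfl | rfl
      · exact absurd hyj (hul j hj)
      · exact absurd hyj (hol j hj)
  have hanc : ∀ {i j}, i < k → (Anc (A' aPn) i j ↔ Anc (A aPn) i j) := fun hi =>
    Anc.congr_of_lt h.pn_lt he.pn hi
  have hpk : A' aPn k = p := by rw [h20, Function.update_self]
  have hanck : ∀ {j}, Anc (A' aPn) k j ↔ j = k ∨ Anc (A aPn) p j := by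
    intro j
    rw [Anc.iff_of_pos hk, hpk, hanc hp]
  have hu' : ∀ i < k, ∀ j, UAnc A' i j → UAnc A i j := by
    rintro i hi j ⟨hj, hj'⟩
    rw [hanc hi] at hj
    have := hj.le h.pn_lt hi
    rw [h21, Function.update_of_ne (by omega)] at hj'
    exact ⟨hj, hj'⟩
  refine ⟨by omega, ?_, ?_, ?_, ?_, ?_, ?_, ?_, ?_, ?_, ?_⟩
  · rw [he.out 0 hk, h.out_zero]
  · intro i h0 hi
    rcases Nat.lt_succ_iff_lt_or_eq.1 hi with hi | rfl
    · rw [he.pn i hi]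
      exact h.pn_lt i h0 hi
    · rw [hpk]
      exact hp
  · rw [h21, Function.update_of_ne (by omega), h.ab_zero]
  · intro y i hi hy
    rcases Nat.lt_succ_iff_lt_or_eq.1 hi with hi | rfl
    · exact h.dom y i hi ((he.inNode hi).1 hy)
    · rcases (hink y).1 hy with rfl | rfl
      · exact hu
      · exact ho
  · intro y hy i
    rw [h5, Function.update_apply, Function.update_apply]
    have hyk : (y = u ∨ y = o) → (k + 1 = i + 1 ↔ i < k + 1 ∧ InNode A' y i) := by
      intro hyk
      constructor
      · intro h
        obtain rfl : k = i := by omega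
        exact ⟨by omega, (hink y).2 hyk⟩
      · rintro ⟨hi, hyi⟩
        rcases Nat.lt_succ_iff_lt_or_eq.1 hi with hi | rfl
        · rw [he.inNode hi] at hyi
          rcases hyk with rfl | rfl
          · exact absurd hyi (hul i hi)
          · exact absurd hyi (hol i hi)
        · rfl
    split_ifs with h1 h2
    · exact hyk (Or.inr h1)
    · exact hyk (Or.inl h2)
    · rw [h.nod y hy i]
      constructor
      · rintro ⟨hi, hyi⟩
        exact ⟨by omega, (he.inNode hi).2 hyi⟩
      · rintro ⟨hi, hyi⟩
        rcases Nat.lt_succ_iff_lt_or_eq.1 hi with hi | rfl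
        · exact ⟨hi, (he.inNode hi).1 hyi⟩
        · rcases (hink y).1 hyi with h3 | h3
          · exact absurd h3 h2
          · exact absurd h3 h1
  · intro i h0 hi
    rcases Nat.lt_succ_iff_lt_or_eq.1 hi with hi | rfl
    · rw [he.inn i hi, he.out i hi]
      exact h.matched i h0 hi
    · rwa [h6, h7, Function.update_self, Function.update_self]
  · intro i h0 hi
    rcases Nat.lt_succ_iff_lt_or_eq.1 hi with hi | rfl
    · rw [he.inn i hi, he.pv i hi]
      exact h.edge i h0 hi
    · rw [h6, h8, Function.update_self, Function.update_self]
      refine ⟨hxu, fun hxN => ?_⟩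
      -- A matched edge stays within one node, so `u` would already be a vertex of `p`.
      exact hul p hp (h.mate hN hv hxN hp hx.inNode).2.1
  · intro i h0 hi
    rcases Nat.lt_succ_iff_lt_or_eq.1 hi with hi | rfl
    · rw [he.pv i hi, he.pn i hi, he.inNode ((h.pn_lt i h0 hi).trans hi)]
      exact h.pv_in i h0 hi
    · rw [hpk, h8, Function.update_self, he.inNode hp]
      exact hx.inNode
  · intro i hi hab
    rcases Nat.lt_succ_iff_lt_or_eq.1 hi with hi | rfl
    · rw [h21, Function.update_of_ne hi.ne] at hab
      rw [h9, h10]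
      exact h.bridge i hi hab
    · rw [h21, Function.update_self] at hab
      exact absurd rfl hab
  · intro y i hi hy
    rcases Nat.lt_succ_iff_lt_or_eq.1 hi with hi | rfl
    · rw [OuterAt, he.inn i hi, he.out i hi, h21, Function.update_of_ne hi.ne] at hy
      obtain ⟨l, hl⟩ := h.path y i hi hy
      exact ⟨l, hl.mono h he (by omega) hi hin hu'⟩
    · obtain ⟨l, hl⟩ := h.path x p hp hx
      have hl' := hl.mono h he (Nat.le_succ i) hp hin hu'
      have hyo : y = o := by
        rcases hy with hy | ⟨-, -, hy⟩
        · rwa [h7, Function.update_self] at hy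
        · rw [h21, Function.update_self] at hy
          exact absurd rfl hy
      subst hyo
      have hxt : Trace A' (i + 1) v (A' aPv i) l := by
        rw [h8, Function.update_self]
        exact hl'.trace
      have ht := Trace.grow hk (by omega) hxt
      rw [h6, h7, Function.update_self, Function.update_self] at ht
      have hvl : ∀ w ∈ v :: l, ∃ j < i, InNode A w j := by
        intro w hw
        rcases List.mem_cons.1 hw with rfl | hw
        · exact ⟨0, hk, h.inNode_root⟩
        · exact hl.trace.inNode w hw
      refine ⟨l ++ [u, y], ht, ?_, ?_, ?_⟩
      · rw [← List.cons_append, List.nodup_append]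
        refine ⟨hl.nodup, by simpa using hne, ?_⟩
        rintro w hw w' hw' rfl
        obtain ⟨j, hj, hwj⟩ := hvl w hw
        simp only [List.mem_cons, List.not_mem_nil, or_false] at hw'
        rcases hw' with rfl | rfl
        · exact hul j hj hwj
        · exact hol j hj hwj
      · intro w hw i' hi' hw' j hj
        rcases Nat.lt_succ_iff_lt_or_eq.1 hi' with hi'' | rfl
        · rw [← List.cons_append, List.mem_append] at hw
          have hw2 := (he.inNode hi'').1 hw'
          rcases hw with hw | hw
          · exact hanck.2 (Or.inr (hl.anc w hw i' hi'' hw2 j (hu' i' hi'' j hj)))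
          · simp only [List.mem_cons, List.not_mem_nil, or_false] at hw
            rcases hw with rfl | rfl
            · exact absurd hw2 (hul i' hi'')
            · exact absurd hw2 (hol i' hi'')
        · exact hj.1
      · intro j hj
        rcases hanck.1 hj.1 with rfl | hj1
        · refine ⟨l ++ [u, y], [], by simp, ?_, ?_, by simp⟩
          · rwa [h7, Function.update_self]
          · rw [h7, Function.update_self]
            exact .nil _
        · have hj2 : UAnc A' p j := ⟨(hanc hp).2 hj1, hj.2⟩
          obtain ⟨l₁, l₂, h11, h12, h13, h14⟩ := hl'.split j hj2
          refine ⟨l₁, l₂ ++ [u, y], by simp [h11], h12, ?_, ?_⟩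
          · have hxt : Trace A' (i + 1) (A' aOut j) (A' aPv i) l₂ := by
              rwa [h8, Function.update_self]
            have ht := Trace.grow hk (by omega) hxt
            rwa [h6, Function.update_self, show A' aOut i = y by rw [h7, Function.update_self]]
              at ht
          · intro w hw i' hi' hw'
            rw [List.mem_append] at hw
            rcases hw with hw | hw
            · exact h14 w hw i' hi' hw'
            · rcases Nat.lt_succ_iff_lt_or_eq.1 hi' with hi'' | rfl
              · have hw2 := (he.inNode hi'').1 hw'
                simp only [List.mem_cons, List.not_mem_nil, or_false] at hw
                rcases hw with rfl | rfl
                · exact absurd hw2 (hul i' hi'')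
                · exact absurd hw2 (hol i' hi'')
              · exact hj.1

end

end DynMatch

/-! ### Contracting blossoms, and why a complete forest is a certificate -/

namespace DynMatch

section

variable {H : DynGraph} {N : Finset (Sym2 ℕ)} {v : ℕ} {D : ℕ → Prop} {A A' : ℕ → ℕ → ℕ} {k : ℕ}

/-- A trace from the root can end at the outer vertex of a node only by `grow`, which passes through
the inner vertex: a `bridge` ends at an inner vertex, and every vertex belongs to one node only. -/
theorem Trace.inn_mem (h : Forest H N v D A k) (hd : H.Loopless) (hN : H.IsMatching N)
    (hv : Free N v) {i : ℕ} (h0 : 0 < i) (hi : i < k) {l : List ℕ}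
    (ht : Trace A k v (A aOut i) l) : A aInn i ∈ l := by
  generalize hx : A aOut i = x at ht
  cases ht with
  | nil =>
    have := h.unique hi h.k_pos (Or.inl hx.symm) h.inNode_root
    omega
  | @grow _ j l h0' hj ht =>
    obtain rfl := h.unique hi hj (Or.inl rfl) (Or.inl hx)
    simp
  | @bridge _ j l₁ l₂ h0' hj hab h1 h2 =>
    obtain rfl := h.unique hi hj (Or.inl rfl) (Or.inr ⟨h0', hx⟩)
    exact absurd hx.symm (h.inn_ne_out hd hN h0' hj)

/-- The arrays `A'` differ from `A` in that, for the edge `xy` between outer vertices of the nodes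
`p` and `q`, the unabsorbed ancestors of exactly one of `p` and `q` have been absorbed. -/
structure Contracts (A A' : ℕ → ℕ → ℕ) (k x y p q : ℕ) : Prop where
  nod : A' aNod = A aNod
  inn : A' aInn = A aInn
  out : A' aOut = A aOut
  pv : A' aPv = A aPv
  pn : A' aPn = A aPn
  ab : ∀ i < k, A' aAb i = 0 ↔ A aAb i = 0 ∧ (Anc (A aPn) p i ↔ Anc (A aPn) q i)
  old : ∀ i < k, A aAb i ≠ 0 → A' aBa i = A aBa i ∧ A' aBb i = A aBb i
  left : ∀ i < k, A aAb i = 0 → Anc (A aPn) p i → ¬ Anc (A aPn) q i →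
    A' aBa i = x ∧ A' aBb i = y
  right : ∀ i < k, A aAb i = 0 → Anc (A aPn) q i → ¬ Anc (A aPn) p i →
    A' aBa i = y ∧ A' aBb i = x

theorem Contracts.symm {x y p q : ℕ} (h : Contracts A A' k x y p q) : Contracts A A' k y x q p :=
  ⟨h.nod, h.inn, h.out, h.pv, h.pn, fun i hi => by rw [h.ab i hi, iff_comm (a := Anc _ p i)],
    h.old, h.right, h.left⟩

theorem Contracts.extends {x y p q : ℕ} (h : Contracts A A' k x y p q) : Extends A A' k := by
  refine ⟨fun i _ => by rw [h.inn], fun i _ => by rw [h.out], fun i _ => by rw [h.pv],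
    fun i _ => by rw [h.pn], fun i hi hab => ⟨fun h0 => hab ((h.ab i hi).1 h0).1, h.old i hi hab⟩⟩

theorem Contracts.inNode {x y p q : ℕ} (h : Contracts A A' k x y p q) {z i : ℕ} :
    InNode A' z i ↔ InNode A z i := by
  rw [InNode, InNode, h.inn, h.out]

theorem Contracts.uAnc {x y p q : ℕ} (h : Contracts A A' k x y p q)
    (hp : ∀ i, 0 < i → i < k → A aPn i < i) {i j : ℕ} (hi : i < k) :
    UAnc A' i j ↔ UAnc A i j ∧ (Anc (A aPn) p j ↔ Anc (A aPn) q j) := by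
  rw [UAnc, UAnc, h.pn]
  constructor
  · rintro ⟨h1, h2⟩
    obtain ⟨h3, h4⟩ := (h.ab j ((h1.le hp hi).trans_lt hi)).1 h2
    exact ⟨⟨h1, h3⟩, h4⟩
  · rintro ⟨⟨h1, h2⟩, h3⟩
    exact ⟨h1, (h.ab j ((h1.le hp hi).trans_lt hi)).2 ⟨h2, h3⟩⟩

/-- The new path follows the path to `y`, crosses the edge `yx`, runs backwards along the part of
the path to `x` behind the outer vertex of `i`, and ends with the two vertices of `i`. Its second
half stays below `i`. Its first half never meets a node below `i`, since by `GoodPath.anc` the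
unabsorbed node `i` would then be an ancestor of `q`. Hence the two halves are disjoint. -/
theorem Forest.exists_goodPath (h : Forest H N v D A k) (hd : H.Loopless) (hN : H.IsMatching N)
    (hv : Free N v) {x y p q : ℕ} (hc : Contracts A A' k x y p q) (hp : p < k) (hq : q < k)
    (hx : OuterAt A x p) (hy : OuterAt A y q) {i : ℕ} (hi : i < k) (hab : A aAb i = 0)
    (hpi : Anc (A aPn) p i) (hqi : ¬ Anc (A aPn) q i) :
    ∃ l, GoodPath A' k v (A aInn i) i l := by
  have h0 : 0 < i := by
    refine Nat.pos_of_ne_zero ?_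
    rintro rfl
    exact hqi (Anc.zero h.pn_lt hq)
  obtain ⟨lx, hlx⟩ := h.path x p hp hx
  obtain ⟨ly, hly⟩ := h.path y q hq hy
  have he := hc.extends
  have hin : ∀ y i', i' < k → InNode A' y i' → (∃ j < k, InNode A y j) →
      InNode A y i' ∧ i' < k := fun y i' hi' hy _ => ⟨hc.inNode.1 hy, hi'⟩
  have hu : ∀ i < k, ∀ j, UAnc A' i j → UAnc A i j := fun i hi j hj =>
    ((hc.uAnc h.pn_lt hi).1 hj).1
  have hly' := hly.mono h he le_rfl hq hin hu
  obtain ⟨l₁, l₂, h1, h2, h3, h4⟩ := hlx.split i ⟨hpi, hab⟩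
  obtain ⟨h5, h6⟩ := hc.left i hi hab hpi hqi
  have hab' : A' aAb i ≠ 0 := fun h7 => hqi (((hc.ab i hi).1 h7).2.1 hpi)
  have hinni : InNode A (A aInn i) i := Or.inr ⟨h0, rfl⟩
  have houti : InNode A (A aOut i) i := Or.inl rfl
  have hbr : ∀ s l, Trace A' k s y l →
      Trace A' k s (A aInn i) (l ++ (l₂.reverse ++ [A aOut i, A aInn i])) := by
    intro s l hs
    have h3' := h3.mono he le_rfl
    rw [← h5, ← hc.out] at h3'
    rw [← h6] at hs
    have := Trace.bridge h0 hi hab' h3' hs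
    rwa [hc.inn, hc.out, List.append_assoc] at this
  have hsub : ∀ w ∈ v :: ly, ¬ ∃ i' < k, InNode A w i' ∧ Anc (A aPn) i' i := by
    rintro w hw ⟨i', hi', hw', h7⟩
    exact hqi (hly.anc w hw i' hi' hw' i ⟨h7, hab⟩)
  have hsub2 : ∀ w ∈ l₂.reverse ++ [A aOut i, A aInn i], ∃ i' < k, InNode A w i' ∧
      Anc (A aPn) i' i := by
    intro w hw
    simp only [List.mem_append, List.mem_reverse, List.mem_cons, List.not_mem_nil,
      or_false] at hw
    rcases hw with hw | rfl | rfl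
    · obtain ⟨i', hi', hw'⟩ := h3.inNode w hw
      exact ⟨i', hi', hw', h4 w hw i' hi' hw'⟩
    · exact ⟨i, hi, houti, .refl _⟩
    · exact ⟨i, hi, hinni, .refl _⟩
  have hxanc : ∀ w ∈ l₂.reverse ++ [A aOut i, A aInn i], w ∈ v :: lx := by
    intro w hw
    simp only [List.mem_append, List.mem_reverse, List.mem_cons, List.not_mem_nil,
      or_false] at hw
    rw [h1, ← List.cons_append, List.mem_append]
    rcases hw with hw | rfl | rfl
    · exact Or.inr hw
    · exact Or.inl h2.mem
    · exact Or.inl (List.mem_cons_of_mem _ (Trace.inn_mem h hd hN hv h0 hi h2))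
  -- Two ancestors of `p` are comparable, and `i` is not above `q`; so whatever is above both `p`
  -- and `q` is above `i`.
  have hcomp : ∀ j, Anc (A aPn) p j → Anc (A aPn) q j → Anc (A aPn) i j := by
    intro j hj hj'
    rcases hj.comparable hpi with h7 | h7
    · exact absurd (hj'.trans h7) hqi
    · exact h7
  refine ⟨ly ++ (l₂.reverse ++ [A aOut i, A aInn i]), hbr v ly hly'.trace, ?_, ?_, ?_⟩
  · rw [← List.cons_append, List.nodup_append]
    refine ⟨hly.nodup, ?_, ?_⟩
    · have hnd := hlx.nodup
      rw [h1, ← List.cons_append, List.nodup_append] at hnd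
      obtain ⟨-, hnd2, hnd3⟩ := hnd
      rw [List.nodup_append]
      refine ⟨List.nodup_reverse.2 hnd2, by simpa using (h.inn_ne_out hd hN h0 hi).symm, ?_⟩
      intro a ha b hb
      rw [List.mem_reverse] at ha
      simp only [List.mem_cons, List.not_mem_nil, or_false] at hb
      rcases hb with rfl | rfl
      · exact (hnd3 _ h2.mem a ha).symm
      · exact (hnd3 _ (List.mem_cons_of_mem _ (Trace.inn_mem h hd hN hv h0 hi h2)) a ha).symm
    · rintro a ha b hb rfl
      exact hsub a ha (hsub2 a hb)
  · intro w hw i' hi' hw' j hj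
    rw [hc.inNode] at hw'
    obtain ⟨hj1, hj2⟩ := (hc.uAnc h.pn_lt hi').1 hj
    rw [hc.pn]
    rw [← List.cons_append, List.mem_append] at hw
    rcases hw with hw | hw
    · have := hly.anc w hw i' hi' hw' j hj1
      exact hcomp j (hj2.2 this) this
    · have := hlx.anc w (hxanc w hw) i' hi' hw' j hj1
      exact hcomp j this (hj2.1 this)
  · intro j hj
    obtain ⟨hj1, hj2⟩ := (hc.uAnc h.pn_lt hi).1 hj
    have hpj := hpi.trans hj1.1
    have hqj : UAnc A' q j := (hc.uAnc h.pn_lt hq).2 ⟨⟨hj2.1 hpj, hj1.2⟩, hj2⟩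
    -- An ancestor of `i` that is still unabsorbed is also above `q`. It splits the path to `y`, and
    -- the rest of the new path stays below `i` and hence below it.
    obtain ⟨m₁, m₂, g1, g2, g3, g4⟩ := hly'.split j hqj
    refine ⟨m₁, m₂ ++ (l₂.reverse ++ [A aOut i, A aInn i]), by simp [g1], g2, hbr _ _ g3, ?_⟩
    intro w hw i' hi' hw'
    rcases List.mem_append.1 hw with hw | hw
    · exact g4 w hw i' hi' hw'
    · obtain ⟨i'', hi'', hw'', h7⟩ := hsub2 w hw
      rw [hc.inNode] at hw'
      obtain rfl := h.unique hi' hi'' hw' hw''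
      rw [hc.pn]
      exact h7.trans hj1.1

/-- Contracting the blossom that is closed by an edge between outer vertices. -/
theorem Forest.contract (h : Forest H N v D A k) (hd : H.Loopless) (hN : H.IsMatching N)
    (hv : Free N v) {x y p q : ℕ} (hc : Contracts A A' k x y p q) (hp : p < k) (hq : q < k)
    (hx : OuterAt A x p) (hy : OuterAt A y q) (hxy : s(x, y) ∈ H.edges) :
    Forest H N v D A' k := by
  have he := hc.extends
  -- Matched edges do not lead from one node of the forest to another.
  have hxyN : p ≠ q → s(x, y) ∉ N := by
    intro hpq hm
    have := (h.mate hN hv hm hp hx.inNode).2.1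
    exact hpq (h.unique hp hq this hy.inNode)
  refine ⟨h.k_pos, by rw [hc.out, h.out_zero], by rw [hc.pn]; exact h.pn_lt, ?_, ?_, ?_, ?_, ?_,
    ?_, ?_, ?_⟩
  · rw [hc.ab 0 h.k_pos]
    exact ⟨h.ab_zero, iff_of_true (Anc.zero h.pn_lt hp) (Anc.zero h.pn_lt hq)⟩
  · intro z i hi hz
    exact h.dom z i hi (hc.inNode.1 hz)
  · intro z hz i
    rw [hc.nod, hc.inNode]
    exact h.nod z hz i
  · rw [hc.inn, hc.out]
    exact h.matched
  · rw [hc.inn, hc.pv]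
    exact h.edge
  · intro i h0 hi
    rw [hc.pv, hc.pn, hc.inNode]
    exact h.pv_in i h0 hi
  · intro i hi hab
    by_cases h1 : A aAb i = 0
    · have h2 : ¬ (Anc (A aPn) p i ↔ Anc (A aPn) q i) := fun h2 => hab ((hc.ab i hi).2 ⟨h1, h2⟩)
      have hpq : p ≠ q := by
        rintro rfl
        exact h2 Iff.rfl
      by_cases h3 : Anc (A aPn) p i
      · obtain ⟨h4, h5⟩ := hc.left i hi h1 h3 fun h4 => h2 (iff_of_true h3 h4)
        rw [h4, h5]
        exact ⟨hxy, hxyN hpq⟩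
      · have h3' : Anc (A aPn) q i := by
          by_contra h4
          exact h2 (iff_of_false h3 h4)
        obtain ⟨h4, h5⟩ := hc.right i hi h1 h3' h3
        rw [h4, h5, Sym2.eq_swap]
        exact ⟨hxy, hxyN hpq⟩
    · obtain ⟨h2, h3⟩ := hc.old i hi h1
      rw [h2, h3]
      exact h.bridge i hi h1
  · intro z i hi hz
    by_cases h1 : OuterAt A z i
    · obtain ⟨l, hl⟩ := h.path z i hi h1
      exact ⟨l, hl.mono h he le_rfl hi (fun y i' hi' hy _ => ⟨hc.inNode.1 hy, hi'⟩)
        fun i hi j hj => ((hc.uAnc h.pn_lt hi).1 hj).1⟩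
    · rw [OuterAt, hc.inn, hc.out] at hz
      rcases hz with hz | ⟨h0, rfl, hab⟩
      · exact absurd (Or.inl hz) h1
      · have h2 : A aAb i = 0 := by
          by_contra h2
          exact h1 (Or.inr ⟨h0, rfl, h2⟩)
        have h3 : ¬ (Anc (A aPn) p i ↔ Anc (A aPn) q i) :=
          fun h3 => hab ((hc.ab i hi).2 ⟨h2, h3⟩)
        by_cases h4 : Anc (A aPn) p i
        · exact h.exists_goodPath hd hN hv hc hp hq hx hy hi h2 h4 fun h5 =>
            h3 (iff_of_true h4 h5)
        · refine h.exists_goodPath hd hN hv hc.symm hq hp hy hx hi h2 ?_ h4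
          by_contra h5
          exact h3 (iff_of_false h4 h5)

/-- The forest is complete: it cannot grow, and all blossoms have been contracted. -/
structure Complete (H : DynGraph) (A : ℕ → ℕ → ℕ) (k : ℕ) : Prop where
  closed : ∀ x, ∀ i < k, OuterAt A x i → ∀ y, s(x, y) ∈ H.edges → ∃ j < k, InNode A y j
  contracted : ∀ x, ∀ i < k, OuterAt A x i → ∀ y, s(x, y) ∈ H.edges → ∀ i' < k, OuterAt A y i' →
    ∀ j, UAnc A i j ↔ UAnc A i' j

/-- The induction needs more than that the end vertex is outer: the base of its blossom is the root,
or the inner vertex of the base already lies on the path. If the next vertex `u` is outer, it is in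
the same blossom. Its partner is then outer, too, unless it is the inner vertex of the base, and
that vertex cannot occur again on a simple path. If `u` is not outer, it is the inner vertex of an
unabsorbed node, which becomes the new base and has just been entered through `u`. -/
theorem Forest.outer_of_evenPath (h : Forest H N v D A k) (hd : H.Loopless)
    (hN : H.IsMatching N) (hv : Free N v) (hc : Complete H A k) {x : ℕ} {l : List ℕ}
    {E : List (Sym2 ℕ)} (hE : EvenPath H N v x l E) (hl : (v :: l).Nodup) :
    ∃ i < k, OuterAt A x i ∧ ∃ b, IsGreatest {j | UAnc A i j} b ∧
      (b = 0 ∨ A aInn b ∈ v :: l) := by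
  induction hE with
  | nil =>
    refine ⟨0, h.k_pos, Or.inl h.out_zero.symm, 0, ⟨⟨.refl _, h.ab_zero⟩, ?_⟩, Or.inl rfl⟩
    rintro j ⟨hj, -⟩
    exact hj.le h.pn_lt h.k_pos
  | @snoc x u o l E hE hxu hxuN huo ih =>
    rw [← List.cons_append, List.nodup_append] at hl
    obtain ⟨hl1, hl2, hl3⟩ := hl
    obtain ⟨i, hi, hx, b, hb, hb'⟩ := ih hl1
    obtain ⟨i', hi', hu⟩ := hc.closed x i hi hx u hxu
    obtain ⟨h0, ho, hio⟩ := h.mate hN hv huo hi' hu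
    have hself : A aAb i' = 0 → IsGreatest {j | UAnc A i' j} i' := fun hab =>
      ⟨⟨.refl _, hab⟩, fun j hj => hj.1.le h.pn_lt hi'⟩
    by_cases huO : OuterAt A u i'
    · have hS : {j | UAnc A i j} = {j | UAnc A i' j} :=
        Set.ext fun j => hc.contracted x i hi hx u hxu i' hi' huO j
      rw [hS] at hb
      have hoO : OuterAt A o i' := by
        rcases hio with ⟨-, ho⟩ | ⟨hu', ho⟩
        · exact Or.inl ho
        · refine Or.inr ⟨h0, ho, fun hab => ?_⟩
          obtain rfl := hb.unique (hself hab)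
          rcases hb' with hb' | hb'
          · omega
          · exact hl3 _ hb' o (by simp) ho.symm
      refine ⟨i', hi', hoO, b, hb, hb'.imp_right fun h => ?_⟩
      rw [← List.cons_append]
      exact List.mem_append_left _ h
    · have hab : A aAb i' = 0 := by
        by_contra hab
        rcases hu with hu | ⟨-, hu⟩
        · exact huO (Or.inl hu)
        · exact huO (Or.inr ⟨h0, hu, hab⟩)
      rcases hio with ⟨hu', ho⟩ | ⟨hu', -⟩
      · refine ⟨i', hi', Or.inl ho, i', hself hab, Or.inr ?_⟩
        simp [hu']
      · exact absurd (Or.inl hu') huO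

/-- There is no augmenting path from the root of a complete forest. -/
theorem Forest.not_exists_augmenting (h : Forest H N v D A k) (hd : H.Loopless)
    (hN : H.IsMatching N) (hv : Free N v) (hc : Complete H A k) :
    ¬ ∃ (z : ℕ) (p : H.graph.Walk v z), IsAugmentingPath N p := by
  rintro ⟨z, p, hp⟩
  have hz := hp.2.2.2.1
  obtain ⟨x, l, E, h1, h2, -, h4⟩ := hp.exists_evenPath hd
  rw [List.nodup_append] at h2
  obtain ⟨h2, -, h3⟩ := h2
  obtain ⟨i, hi, hx, -⟩ := h.outer_of_evenPath hd hN hv hc h1 h2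
  obtain ⟨j, hj, hzj⟩ := hc.closed x i hi hx z h4
  -- The root is the only free vertex of the forest, and a simple path does not return to it.
  rcases Nat.eq_zero_or_pos j with rfl | h0
  · rcases hzj with hzj | ⟨h0, -⟩
    · rw [h.out_zero] at hzj
      exact h3 v (by simp) z (by simp) hzj.symm
    · exact absurd h0 (lt_irrefl _)
  · have hm := h.matched j h0 hj
    rcases hzj with rfl | ⟨-, rfl⟩
    · exact hz _ hm (by simp)
    · exact hz _ hm (by simp)

/-- The nodes other than the root are distinct edges of the matching. This bounds all that a search
builds in terms of the number of edges. -/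
theorem Forest.card_le (h : Forest H N v D A k) : k ≤ N.card + 1 := by
  have hinj : Set.InjOn (fun i => s(A aInn i, A aOut i)) (Finset.Ioo 0 k : Set ℕ) := by
    intro i hi j hj hij
    simp only [Finset.coe_Ioo, Set.mem_Ioo] at hi hj
    rcases Sym2.eq_iff.1 hij with ⟨-, h1⟩ | ⟨h1, -⟩
    · exact h.unique hi.2 hj.2 (Or.inl rfl) (Or.inl h1)
    · exact h.unique hi.2 hj.2 (Or.inr ⟨hi.1, rfl⟩) (Or.inl h1)
  have h1 := Finset.card_le_card_of_injOn (t := N) _ (fun i hi => ?_) hinj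
  · simp only [Nat.card_Ioo] at h1
    omega
  · simp only [Finset.coe_Ioo, Set.mem_Ioo] at hi
    exact h.matched i hi.1 hi.2

end

end DynMatch

namespace DynMatch

section

variable {H : DynGraph} {N : Finset (Sym2 ℕ)} {v : ℕ} {D : ℕ → Prop} {A A' A'' : ℕ → ℕ → ℕ}
  {k : ℕ}

/-! ### The queue of outer vertices -/

/-- The number of unabsorbed nodes. -/
def unabsorbed (A : ℕ → ℕ → ℕ) (k : ℕ) : ℕ := ((Finset.range k).filter fun i => A aAb i = 0).card

theorem unabsorbed_absorb {i : ℕ} (hi : i < k) (hab : A aAb i = 0)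
    (h : A' aAb = Function.update (A aAb) i 1) : unabsorbed A' k + 1 = unabsorbed A k := by
  rw [unabsorbed, unabsorbed]
  have : ((Finset.range k).filter fun i => A aAb i = 0) =
      insert i ((Finset.range k).filter fun i => A' aAb i = 0) := by
    ext j
    simp only [Finset.mem_filter, Finset.mem_range, Finset.mem_insert, h, Function.update_apply]
    split_ifs with hj
    · subst hj
      simp [hi, hab]
    · simp [hj]
  rw [this, Finset.card_insert_of_notMem]
  simp [h]

theorem unabsorbed_grow (h : A' aAb = Function.update (A aAb) k 0) :
    unabsorbed A' (k + 1) = unabsorbed A k + 1 := by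
  rw [unabsorbed, unabsorbed, Finset.range_add_one, Finset.filter_insert, if_pos (by simp [h]),
    Finset.card_insert_of_notMem (by simp)]
  congr 2
  refine Finset.filter_congr fun j hj => ?_
  rw [h, Function.update_of_ne (Finset.mem_range.1 hj).ne]

/-- The first `qt` entries of the queue are the outer vertices, each of them once. -/
structure Queue (A : ℕ → ℕ → ℕ) (k qt : ℕ) : Prop where
  mem : ∀ x, ∀ i < k, OuterAt A x i → ∃ a < qt, A aQu a = x
  outer : ∀ a < qt, ∃ i < k, OuterAt A (A aQu a) i
  inj : ∀ a < qt, ∀ a' < qt, A aQu a = A aQu a' → a = a'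
  count : qt + unabsorbed A k = 2 * k

/-- An absorbed node has two outer vertices and any other node, the root included, has one; this is
what `count` says. A new entry therefore comes with exactly one absorption or with exactly one new
node. -/
theorem Queue.push {k' qt z : ℕ} (h : Queue A k qt)
    (h11 : A' aQu = Function.update (A aQu) qt z)
    (hz : ∃ i < k', OuterAt A' z i) (hz' : ∀ i < k, ¬ OuterAt A z i)
    (h1 : ∀ x, ∀ i < k', OuterAt A' x i → x = z ∨ ∃ i < k, OuterAt A x i)
    (h2 : ∀ x, ∀ i < k, OuterAt A x i → ∃ i < k', OuterAt A' x i)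
    (hc : qt + 1 + unabsorbed A' k' = 2 * k') : Queue A' k' (qt + 1) := by
  have hqu : ∀ a < qt, A' aQu a = A aQu a := fun a ha => by
    rw [h11, Function.update_of_ne ha.ne]
  have hqt : A' aQu qt = z := by rw [h11, Function.update_self]
  have hnew : ∀ a < qt, A aQu a ≠ z := by
    rintro a ha rfl
    obtain ⟨i, hi, hai⟩ := h.outer a ha
    exact hz' i hi hai
  refine ⟨?_, ?_, ?_, hc⟩
  · intro x i hi hx
    rcases h1 x i hi hx with rfl | ⟨i', hi', hx'⟩
    · exact ⟨qt, by omega, hqt⟩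
    · obtain ⟨a, ha, ha'⟩ := h.mem x i' hi' hx'
      exact ⟨a, by omega, (hqu a ha).trans ha'⟩
  · intro a ha
    rcases Nat.lt_succ_iff_lt_or_eq.1 ha with ha | rfl
    · rw [hqu a ha]
      obtain ⟨i, hi, hai⟩ := h.outer a ha
      exact h2 _ i hi hai
    · rwa [hqt]
  · intro a ha a' ha' haa
    rcases Nat.lt_succ_iff_lt_or_eq.1 ha with ha | rfl <;>
      rcases Nat.lt_succ_iff_lt_or_eq.1 ha' with ha' | rfl
    · rw [hqu a ha, hqu a' ha'] at haa
      exact h.inj a ha a' ha' haa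
    · rw [hqu a ha, hqt] at haa
      exact absurd haa (hnew a ha)
    · rw [hqu a' ha', hqt] at haa
      exact absurd haa.symm (hnew a' ha')
    · rfl

/-! ### Contracting a blossom -/

/-- An intermediate stage `A'` of contracting the blossom of the edge `xy` in `A`: what remains is
to absorb ancestors of `p` and `q`. -/
structure Bridging (A A' : ℕ → ℕ → ℕ) (k x y p₀ q₀ p q : ℕ) : Prop where
  nod : A' aNod = A aNod
  inn : A' aInn = A aInn
  out : A' aOut = A aOut
  pv : A' aPv = A aPv
  pn : A' aPn = A aPn
  old : ∀ i < k, A aAb i ≠ 0 → A' aAb i ≠ 0 ∧ A' aBa i = A aBa i ∧ A' aBb i = A aBb i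
  new : ∀ i < k, A aAb i = 0 → A' aAb i ≠ 0 →
    (Anc (A aPn) p₀ i ∧ ¬ Anc (A aPn) q₀ i ∧ A' aBa i = x ∧ A' aBb i = y) ∨
      (Anc (A aPn) q₀ i ∧ ¬ Anc (A aPn) p₀ i ∧ A' aBa i = y ∧ A' aBb i = x)
  p_lt : p < k
  q_lt : q < k
  p_anc : ∀ j, UAnc A' p₀ j ↔ UAnc A' p j
  q_anc : ∀ j, UAnc A' q₀ j ↔ UAnc A' q j

theorem Bridging.refl {p q : ℕ} (x y : ℕ) (hp : p < k) (hq : q < k) :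
    Bridging A A k x y p q p q :=
  ⟨rfl, rfl, rfl, rfl, rfl, fun _ _ h => ⟨h, rfl, rfl⟩, fun _ _ h h' => absurd h h', hp, hq,
    fun _ => Iff.rfl, fun _ => Iff.rfl⟩

theorem Bridging.symm {x y p₀ q₀ p q : ℕ} (h : Bridging A A' k x y p₀ q₀ p q) :
    Bridging A A' k y x q₀ p₀ q p :=
  ⟨h.nod, h.inn, h.out, h.pv, h.pn, h.old, fun i hi h1 h2 => (h.new i hi h1 h2).symm, h.q_lt,
    h.p_lt, h.q_anc, h.p_anc⟩

theorem Bridging.congr {x y p₀ q₀ p q : ℕ} (h : Bridging A A' k x y p₀ q₀ p q)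
    (h5 : A'' aNod = A' aNod) (h6 : A'' aInn = A' aInn) (h7 : A'' aOut = A' aOut)
    (h8 : A'' aPv = A' aPv) (h9 : A'' aBa = A' aBa) (h10 : A'' aBb = A' aBb)
    (h20 : A'' aPn = A' aPn) (h21 : A'' aAb = A' aAb) : Bridging A A'' k x y p₀ q₀ p q := by
  obtain ⟨g1, g2, g3, g4, g5, g6, g7, g8, g9, g10, g11⟩ := h
  constructor <;> simp only [UAnc, h5, h6, h7, h8, h9, h10, h20, h21] at * <;> assumption

/-- Unabsorbed ancestors of `q` have indices at most `j`, so the base `i` with the greater index is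
not above `q`: it lies on the blossom, strictly below the meeting point. Comparing two indices thus
replaces the computation of a common ancestor, and each comparison that finds different bases
absorbs a node. -/
theorem Bridging.absorb_left {x y p₀ q₀ p q i j : ℕ} (h : Bridging A A' k x y p₀ q₀ p q)
    (hpn : ∀ i, 0 < i → i < k → A aPn i < i)
    (hi : IsGreatest {j | UAnc A' p j} i) (hj : IsGreatest {j | UAnc A' q j} j) (hji : j < i)
    (h5 : A'' aNod = A' aNod) (h6 : A'' aInn = A' aInn) (h7 : A'' aOut = A' aOut)
    (h8 : A'' aPv = A' aPv) (h9 : A'' aBa = Function.update (A' aBa) i x)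
    (h10 : A'' aBb = Function.update (A' aBb) i y)
    (h20 : A'' aPn = A' aPn) (h21 : A'' aAb = Function.update (A' aAb) i 1) :
    Bridging A A'' k x y p₀ q₀ (A' aPn i) q := by
  have hpn' : ∀ i, 0 < i → i < k → A' aPn i < i := by rw [h.pn]; exact hpn
  have hi1 : UAnc A' p i := hi.1
  have hik : i < k := (hi1.1.le hpn' h.p_lt).trans_lt h.p_lt
  have hpi : Anc (A aPn) p₀ i := by
    rw [← h.pn]
    exact ((h.p_anc i).2 hi1).1
  have hqi' : ¬ UAnc A' q i := fun hqi => by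
    have : i ≤ j := hj.2 hqi
    omega
  have hqi : ¬ Anc (A aPn) q₀ i := by
    rw [← h.pn]
    exact fun hqi => hqi' ((h.q_anc i).1 ⟨hqi, hi1.2⟩)
  have hu : ∀ a l, UAnc A'' a l ↔ UAnc A' a l ∧ l ≠ i := by
    intro a l
    rw [UAnc, UAnc, h20, h21, Function.update_apply]
    split_ifs with h1 <;> simp [h1]
  refine ⟨by rw [h5, h.nod], by rw [h6, h.inn], by rw [h7, h.out], by rw [h8, h.pv],
    by rw [h20, h.pn], ?_, ?_, (hpn' i (by omega) hik).trans hik, h.q_lt, ?_, ?_⟩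
  · intro l hl hab
    obtain ⟨h1, h2, h3⟩ := h.old l hl hab
    have hli : l ≠ i := by
      rintro rfl
      exact h1 hi1.2
    rw [h9, h10, h21, Function.update_of_ne hli, Function.update_of_ne hli,
      Function.update_of_ne hli]
    exact ⟨h1, h2, h3⟩
  · intro l hl h1 h2
    by_cases hli : l = i
    · subst hli
      left
      rw [h9, h10, Function.update_self, Function.update_self]
      exact ⟨hpi, hqi, rfl, rfl⟩
    · rw [h21, Function.update_of_ne hli] at h2
      rw [h9, h10, Function.update_of_ne hli, Function.update_of_ne hli]
      exact h.new l hl h1 h2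
  · intro l
    rw [hu, hu, h.p_anc]
    have hpi' := hpn' i (by omega) hik
    constructor
    · rintro ⟨h1, h2⟩
      -- As `i` is the nearest unabsorbed ancestor, all the others are above `i`; the walk may go on
      -- at the parent of `i` without losing any of them.
      have h3 : Anc (A' aPn) i l := hi1.1.of_le hpn' h1.1 h.p_lt (hi.2 h1)
      rcases (Anc.iff_of_pos (by omega)).1 h3 with h3 | h3
      · exact absurd h3 h2
      · exact ⟨⟨h3, h1.2⟩, h2⟩
    · rintro ⟨h1, h2⟩
      exact ⟨⟨hi1.1.trans (.step (by omega) h1.1), h1.2⟩, h2⟩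
  · intro l
    rw [hu, hu, h.q_anc]

/-- As soon as the nearest unabsorbed ancestors coincide, all unabsorbed ancestors do. No unabsorbed
node is then above only one of the two ends, so the contraction is finished. -/
theorem Bridging.contracts {x y p₀ q₀ p q i : ℕ} (h : Bridging A A' k x y p₀ q₀ p q)
    (hpn : ∀ i, 0 < i → i < k → A aPn i < i) (hp : p₀ < k) (hq : q₀ < k)
    (hi : IsGreatest {j | UAnc A' p j} i) (hj : IsGreatest {j | UAnc A' q j} i) :
    Contracts A A' k x y p₀ q₀ ∧ ∀ j, UAnc A' p₀ j ↔ UAnc A' q₀ j := by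
  have hpn' : ∀ i, 0 < i → i < k → A' aPn i < i := by rw [h.pn]; exact hpn
  have hi1 : UAnc A' p i := hi.1
  have hj1 : UAnc A' q i := hj.1
  have hu : ∀ j, UAnc A' p₀ j ↔ UAnc A' q₀ j := by
    intro l
    rw [h.p_anc, h.q_anc]
    constructor
    · intro hl
      exact ⟨hj1.1.trans (hi1.1.of_le hpn' hl.1 h.p_lt (hi.2 hl)), hl.2⟩
    · intro hl
      exact ⟨hi1.1.trans (hj1.1.of_le hpn' hl.1 h.q_lt (hj.2 hl)), hl.2⟩
  have hab : ∀ l, A' aAb l = 0 → (Anc (A aPn) p₀ l ↔ Anc (A aPn) q₀ l) := by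
    intro l hl
    rw [← h.pn]
    exact ⟨fun h1 => ((hu l).1 ⟨h1, hl⟩).1, fun h1 => ((hu l).2 ⟨h1, hl⟩).1⟩
  refine ⟨⟨h.nod, h.inn, h.out, h.pv, h.pn, ?_, fun l hl h1 => (h.old l hl h1).2, ?_, ?_⟩, hu⟩
  · intro l hl
    constructor
    · intro h1
      refine ⟨?_, hab l h1⟩
      by_contra h2
      exact (h.old l hl h2).1 h1
    · rintro ⟨h1, h2⟩
      by_contra h3
      rcases h.new l hl h1 h3 with ⟨h4, h5, -⟩ | ⟨h4, h5, -⟩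
      · exact h5 (h2.1 h4)
      · exact h5 (h2.2 h4)
  · intro l hl h1 h2 h3
    rcases h.new l hl h1 (fun h4 => h3 ((hab l h4).1 h2)) with ⟨-, -, h4⟩ | ⟨h4, -⟩
    · exact h4
    · exact absurd h4 h3
  · intro l hl h1 h2 h3
    rcases h.new l hl h1 (fun h4 => h3 ((hab l h4).2 h2)) with ⟨h4, -⟩ | ⟨-, -, h4⟩
    · exact absurd h4 h3
    · exact h4

/-- The inner vertex of a node that is being absorbed becomes an outer vertex. -/
theorem Queue.absorb {x y p₀ q₀ p q i qt : ℕ} (hQ : Queue A' k qt)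
    (h : Bridging A A' k x y p₀ q₀ p q) (hF : Forest H N v D A k) (hd : H.Loopless)
    (hN : H.IsMatching N) (h0 : 0 < i) (hi : i < k) (hab : A' aAb i = 0)
    (h6 : A'' aInn = A' aInn) (h7 : A'' aOut = A' aOut)
    (h11 : A'' aQu = Function.update (A' aQu) qt (A' aInn i))
    (h21 : A'' aAb = Function.update (A' aAb) i 1) : Queue A'' k (qt + 1) := by
  have hO : ∀ x l, OuterAt A'' x l ↔ OuterAt A' x l ∨ (l = i ∧ x = A' aInn i) := by
    intro x l
    rw [OuterAt, OuterAt, h6, h7, h21, Function.update_apply]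
    by_cases hl : l = i
    · subst hl
      simp [h0, hab]
    · simp [hl]
  refine hQ.push h11 ⟨i, hi, (hO _ _).2 (Or.inr ⟨rfl, rfl⟩)⟩ ?_ ?_ ?_ ?_
  · intro l hl hil
    have h1 : InNode A (A' aInn i) l := by
      have := hil.inNode
      rwa [InNode, h.inn, h.out, ← InNode, ← h.inn] at this
    obtain rfl := hF.unique hl hi h1 (Or.inr ⟨h0, by rw [h.inn]⟩)
    rcases hil with hil | ⟨-, -, hil⟩
    · rw [h.inn, h.out] at hil
      exact hF.inn_ne_out hd hN h0 hi hil
    · exact hil hab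
  · intro x l hl hx
    rcases (hO x l).1 hx with hx | ⟨-, hx⟩
    · exact Or.inr ⟨l, hl, hx⟩
    · exact Or.inl hx
  · intro x l hl hx
    exact ⟨l, hl, (hO x l).2 (Or.inl hx)⟩
  · have := hQ.count
    have := unabsorbed_absorb hi hab h21
    omega

notation "rGo" => (25 : ℕ)
notation "rFl" => (26 : ℕ)
notation "rP" => (27 : ℕ)
notation "rQ" => (28 : ℕ)
notation "rI" => (29 : ℕ)

/-- Absorb the node `rRes`, whose bridge has just been recorded. -/
def closeCmd : Cmd :=
  .put aQu (.reg rQt) (.get aInn (.reg rRes)) ;;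
  .set rQt (.reg rQt +ₑ .lit 1) ;;
  (.skip ;; absorbCmd)

/-- Absorb the lower one of the nearest unabsorbed ancestors of `rP` and `rQ`. -/
def bridgeStepCmd : Cmd :=
  .set rArg (.reg rP) ;;
  (.skip ;; findCmd) ;;
  .set rI (.reg rRes) ;;
  .set rArg (.reg rQ) ;;
  (.skip ;; findCmd) ;;
  .ite (.reg rI =ₑ .reg rRes) (.set rFl (.lit 0))
    (.ite (.reg rRes <ₑ .reg rI)
      (.set rRes (.reg rI) ;;
        .put aBa (.reg rRes) (.reg rX) ;;
        .put aBb (.reg rRes) (.reg rY) ;;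
        .set rP (.get aPn (.reg rRes)) ;;
        (.skip ;; closeCmd))
      (.put aBa (.reg rRes) (.reg rY) ;;
        .put aBb (.reg rRes) (.reg rX) ;;
        .set rQ (.get aPn (.reg rRes)) ;;
        (.skip ;; closeCmd)))

def bridgeCmd : Cmd := .loop (.reg rFl) bridgeStepCmd

variable {B b nm : ℕ}

theorem closeCmd_spec {i : ℕ} {s : State} (hB : 2 ^ b < B) (hqt : s.reg rQt + 1 < B)
    (h : Micro s.arr b k nm) (h0 : 0 < i) (hi : i < k) (hab : s.arr aAb i = 0)
    (h17 : s.reg rRes = i) :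
    Run B .skip closeCmd s fun t _ s' => Micro s'.arr b k nm ∧
      s'.arr aAb = Function.update (s.arr aAb) i 1 ∧
      s'.arr aQu = Function.update (s.arr aQu) (s.reg rQt) (s.arr aInn i) ∧
      s'.reg rQt = s.reg rQt + 1 ∧
      t ≤ 40 ∧ potential s'.arr nm = potential s.arr nm := by
  refine Run.of_pre ?_
  simp only [closeCmd, Pre, Expr.Ok, Expr.eval, Expr.cost, Op.eval_simps, State.simps,
    Nat.reduceEqDiff, if_true, if_false, true_and, h17]
  refine ⟨by omega, ?_⟩
  refine Run.mono (absorbCmd_spec (i := i) (k := k) (nm := nm) hB ?_ h0 hi ?_ ?_) ?_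
  · exact h.congr fun a h1 _ => by simp [State.setArr_arr, show a ≠ 11 by omega]
  · simpa [State.setArr_arr] using hab
  · simpa using h17
  · rintro t tr s' - - hsame ⟨h1, h2, h3, h4⟩
    refine ⟨h1, ?_, ?_, ?_, by omega, ?_⟩
    · rw [h2]; simp [State.setArr_arr]
    · rw [hsame.arr 11 rfl rfl]; simp [State.setArr_arr]
    · rw [hsame.reg 11 rfl rfl]; simp
    · rw [h4]
      refine potential_congr ?_ ?_ ?_ <;> simp [State.setArr_arr]


theorem Queue.congr {qt : ℕ} (h : Queue A k qt) (h6 : A' aInn = A aInn) (h7 : A' aOut = A aOut)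
    (h11 : A' aQu = A aQu) (h21 : A' aAb = A aAb) : Queue A' k qt := by
  obtain ⟨g1, g2, g3, g4⟩ := h
  constructor <;> simp only [OuterAt, unabsorbed, h6, h7, h11, h21] at * <;> assumption

/-- The invariant of the contraction of the blossom of the edge `xy`. -/
structure BridgeInv (A : ℕ → ℕ → ℕ) (b k nm x y p₀ q₀ qt₀ : ℕ) (s : State) : Prop where
  bridging : Bridging A s.arr k x y p₀ q₀ (s.reg rP) (s.reg rQ)
  micro : Micro s.arr b k nm
  queue : Queue s.arr k (s.reg rQt)
  qt_le : qt₀ ≤ s.reg rQt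
  qu : ∀ a < qt₀, s.arr aQu a = A aQu a
  done : s.reg rFl = 0 → ∃ i, IsGreatest {j | UAnc s.arr (s.reg rP) j} i ∧
    IsGreatest {j | UAnc s.arr (s.reg rQ) j} i

/-- Every step but the last absorbs a node, whose 660 units pay for two finds and the bookkeeping.
The 600 units held by the flag pay for the last step. -/
theorem bridgeStepCmd_spec {x y p₀ q₀ qt₀ : ℕ} {s : State} (hB : (nm + 1) * (b + 1) < B)
    (hB' : 2 ^ b < B) (hkB : 2 * k + 1 < B) (hb : Nat.log 2 nm ≤ b) (hT : LogTable s.arr b)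
    (hF : Forest H N v D A k) (hd : H.Loopless) (hN : H.IsMatching N)
    (h7 : s.reg rB = b) (h12 : s.reg rX = x) (h14 : s.reg rY = y)
    (h : BridgeInv A b k nm x y p₀ q₀ qt₀ s) (hfl : s.reg rFl ≠ 0) :
    Run B .skip bridgeStepCmd s fun t _ s' => BridgeInv A b k nm x y p₀ q₀ qt₀ s' ∧
      t + 10 + 200 * potential s'.arr nm + 660 * unabsorbed s'.arr k +
        (if s'.reg rFl = 0 then 0 else 600) ≤
      200 * potential s.arr nm + 660 * unabsorbed s.arr k + 600 := by
  obtain ⟨hbr, hm, hQ, hle, hqu, -⟩ := h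
  have hkp := hF.k_pos
  refine Run.of_pre ?_
  simp only [bridgeStepCmd, Pre, Expr.Ok, Expr.eval, Expr.cost, Op.eval_simps, State.simps,
    Nat.reduceEqDiff, if_true, if_false, true_and]
  refine Run.mono (findCmd_spec (p := s.reg rP) (k := k) hB hb ?_ ?_ hbr.p_lt ?_ ?_) ?_
  · exact hT
  · exact hm
  · simp
  · simpa using h7
  rintro t1 tr1 s1 - - hs1 ⟨hm1, hi, ht1⟩
  have e28 : s1.reg rQ = s.reg rQ := by rw [hs1.reg 28 rfl rfl]; simp
  have hQq := hbr.q_lt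
  refine Run.mono (findCmd_spec (p := s.reg rQ) (k := k) (nm := nm) (b := b) hB hb ?_ ?_ hQq
    ?_ ?_) ?_
  · intro i h0 h1
    rw [← hT i h0 h1]
    change s1.arr aTab i = _
    rw [hs1.arr 12 rfl rfl]
    rfl
  · exact hm1
  · simpa using e28
  · simp only [State.simps, Nat.reduceEqDiff, if_false]
    rw [hs1.reg 7 rfl rfl]
    simpa using h7
  rintro t2 tr2 s2 - - hs2 ⟨hm2, hj, ht2⟩
  simp only [State.setReg_arr] at hi ht1 hj ht2
  set i := s1.reg rRes with hidef
  set j := s2.reg rRes with hjdef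
  have hA : ∀ a, findCmd.warr a = false → s2.arr a = s.arr a := fun a ha => by
    rw [hs2.arr a ha rfl]
    change s1.arr a = _
    rw [hs1.arr a ha rfl]
    rfl
  have hR : ∀ r, findCmd.wreg r = false → r ≠ 16 → r ≠ 29 → s2.reg r = s.reg r := by
    intro r hr h1 h2
    rw [hs2.reg r hr rfl]
    simp only [State.setReg_reg, h1, h2, if_false]
    rw [hs1.reg r hr rfl]
    simp [h1]
  have e29 : s2.reg rI = i := by
    rw [hs2.reg 29 rfl rfl]
    simp [hidef]
  have hj : IsGreatest {l | UAnc s2.arr (s.reg rQ) l} j := by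
    have : UAnc s2.arr = UAnc s1.arr := by
      funext a l
      simp only [UAnc, hs2.arr 20 rfl rfl, hs2.arr 21 rfl rfl, State.setReg_arr]
    rw [this]
    exact hj
  have hi : IsGreatest {l | UAnc s2.arr (s.reg rP) l} i := by
    have : UAnc s2.arr = UAnc s.arr := by
      funext a l
      simp only [UAnc, hA 20 rfl, hA 21 rfl]
    rw [this]
    exact hi
  have hbr2 : Bridging A s2.arr k x y p₀ q₀ (s.reg rP) (s.reg rQ) :=
    hbr.congr (hA 5 rfl) (hA 6 rfl) (hA 7 rfl) (hA 8 rfl) (hA 9 rfl) (hA 10 rfl) (hA 20 rfl)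
      (hA 21 rfl)
  have hQ2 : Queue s2.arr k (s.reg rQt) := hQ.congr (hA 6 rfl) (hA 7 rfl) (hA 11 rfl) (hA 21 rfl)
  have hun : unabsorbed s2.arr k = unabsorbed s.arr k := by
    rw [unabsorbed, unabsorbed, hA 21 rfl]
  have hqt : s.reg rQt + 1 < B := by
    have := hQ.count
    omega
  have hpn : ∀ i, 0 < i → i < k → s2.arr aPn i < i := by rw [hbr2.pn]; exact hF.pn_lt
  have hik : i < k := (hi.1.1.le hpn hbr2.p_lt).trans_lt hbr2.p_lt
  have hjk : j < k := (hj.1.1.le hpn hbr2.q_lt).trans_lt hbr2.q_lt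
  simp only [e29, hR 12 rfl (by omega) (by omega), hR 14 rfl (by omega) (by omega), h12, h14, ← hjdef]
  refine ⟨by omega, fun hij => ?_, fun hij => ⟨by omega, fun hlt => ?_, fun hlt => ?_⟩⟩
  · refine ⟨by omega, ⟨?_, hm2, ?_, ?_, ?_, fun _ => ⟨i, ?_, ?_⟩⟩, ?_⟩
    · simpa [hR 27 rfl, hR 28 rfl] using hbr2
    · simpa [hR 11 rfl] using hQ2
    · simpa [hR 11 rfl] using hle
    · simpa [hA 11 rfl] using hqu
    · simpa [hR 27 rfl] using hi
    · rw [hij]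
      simpa [hR 28 rfl] using hj
    · simp [hun]
      omega
  · refine Run.mono (closeCmd_spec (i := i) (k := k) (nm := nm) (b := b) hB' ?_ ?_ (by omega) hik
      ?_ ?_) ?_
    · simpa [hR 11 rfl] using hqt
    · exact hm2.congr fun a h1 _ => by
        simp [State.setArr_arr, show a ≠ 9 by omega, show a ≠ 10 by omega]
    · simpa [State.setArr_arr] using hi.1.2
    · simp
    rintro t3 tr3 s3 - - hs3 ⟨hm3, h21, h11, hr11, ht3, hpot⟩
    have hA3 : ∀ a, a ≠ 9 → a ≠ 10 → closeCmd.warr a = false → s3.arr a = s2.arr a := by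
      intro a h1 h2 ha
      rw [hs3.arr a ha rfl]
      simp [State.setArr_arr, h1, h2]
    have e9 : s3.arr aBa = Function.update (s2.arr aBa) i x := by
      rw [hs3.arr 9 rfl rfl]
      simp [State.setArr_arr]
    have e10 : s3.arr aBb = Function.update (s2.arr aBb) i y := by
      rw [hs3.arr 10 rfl rfl]
      simp [State.setArr_arr]
    have e27 : s3.reg rP = s2.arr aPn i := by
      rw [hs3.reg 27 rfl rfl]
      simp [State.setArr_arr]
    have e28 : s3.reg rQ = s.reg rQ := by
      rw [hs3.reg 28 rfl rfl]
      simp [hR 28 rfl]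
    have e11 : s3.reg rQt = s.reg rQt + 1 := by
      rw [hr11]
      simp [hR 11 rfl]
    have e26 : s3.reg rFl = s.reg rFl := by
      rw [hs3.reg 26 rfl rfl]
      simp [hR 26 rfl]
    have h21' : s3.arr aAb = Function.update (s2.arr aAb) i 1 := by
      rw [h21]; simp [State.setArr_arr]
    have h11' : s3.arr aQu = Function.update (s2.arr aQu) (s.reg rQt) (s2.arr aInn i) := by
      rw [h11]; simp [State.setArr_arr, hR 11 rfl]
    have hun3 := unabsorbed_absorb hik hi.1.2 h21'
    refine ⟨⟨?_, hm3, ?_, ?_, ?_, fun h => absurd (e26 ▸ h) hfl⟩, ?_⟩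
    · rw [e27, e28]
      exact hbr2.absorb_left hF.pn_lt hi hj hlt (hA3 5 (by omega) (by omega) rfl)
        (hA3 6 (by omega) (by omega) rfl) (hA3 7 (by omega) (by omega) rfl)
        (hA3 8 (by omega) (by omega) rfl) e9 e10 (hA3 20 (by omega) (by omega) rfl) h21'
    · rw [e11]
      exact hQ2.absorb hbr2 hF hd hN (by omega) hik hi.1.2
        (hA3 6 (by omega) (by omega) rfl) (hA3 7 (by omega) (by omega) rfl) h11' h21'
    · omega
    · intro a ha
      rw [h11', Function.update_of_ne (by omega), hA 11 rfl, hqu a ha]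
    · rw [e26, if_neg hfl, hpot]
      have : potential (((((s2.setReg 17 i).setArr 9 i x).setArr 10 i y).setReg 27
          (s2.arr aPn i)).arr) nm = potential s2.arr nm :=
        potential_congr (by simp [State.setArr_arr]) (by simp [State.setArr_arr])
          (by simp [State.setArr_arr])
      simp only [State.simps, Nat.reduceEqDiff, if_false] at this ⊢
      omega
  · have hlt' : i < j := lt_of_le_of_ne hlt hij
    refine Run.mono (closeCmd_spec (i := j) (k := k) (nm := nm) (b := b) hB' ?_ ?_ (by omega) hjk
      ?_ ?_) ?_
    · simpa [hR 11 rfl] using hqt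
    · exact hm2.congr fun a h1 _ => by
        simp [State.setArr_arr, show a ≠ 9 by omega, show a ≠ 10 by omega]
    · simpa [State.setArr_arr] using hj.1.2
    · simp [← hjdef]
    rintro t3 tr3 s3 - - hs3 ⟨hm3, h21, h11, hr11, ht3, hpot⟩
    have hA3 : ∀ a, a ≠ 9 → a ≠ 10 → closeCmd.warr a = false → s3.arr a = s2.arr a := by
      intro a h1 h2 ha
      rw [hs3.arr a ha rfl]
      simp [State.setArr_arr, h1, h2]
    have e9 : s3.arr aBa = Function.update (s2.arr aBa) j y := by
      rw [hs3.arr 9 rfl rfl]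
      simp [State.setArr_arr]
    have e10 : s3.arr aBb = Function.update (s2.arr aBb) j x := by
      rw [hs3.arr 10 rfl rfl]
      simp [State.setArr_arr]
    have e28 : s3.reg rQ = s2.arr aPn j := by
      rw [hs3.reg 28 rfl rfl]
      simp [State.setArr_arr]
    have e27 : s3.reg rP = s.reg rP := by
      rw [hs3.reg 27 rfl rfl]
      simp [hR 27 rfl]
    have e11 : s3.reg rQt = s.reg rQt + 1 := by
      rw [hr11]
      simp [hR 11 rfl]
    have e26 : s3.reg rFl = s.reg rFl := by
      rw [hs3.reg 26 rfl rfl]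
      simp [hR 26 rfl]
    have h21' : s3.arr aAb = Function.update (s2.arr aAb) j 1 := by
      rw [h21]; simp [State.setArr_arr]
    have h11' : s3.arr aQu = Function.update (s2.arr aQu) (s.reg rQt) (s2.arr aInn j) := by
      rw [h11]; simp [State.setArr_arr, hR 11 rfl]
    have hun3 := unabsorbed_absorb hjk hj.1.2 h21'
    refine ⟨⟨?_, hm3, ?_, ?_, ?_, fun h => absurd (e26 ▸ h) hfl⟩, ?_⟩
    · rw [e27, e28]
      exact (hbr2.symm.absorb_left hF.pn_lt hj hi hlt' (hA3 5 (by omega) (by omega) rfl)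
        (hA3 6 (by omega) (by omega) rfl) (hA3 7 (by omega) (by omega) rfl)
        (hA3 8 (by omega) (by omega) rfl) e9 e10 (hA3 20 (by omega) (by omega) rfl) h21').symm
    · rw [e11]
      exact hQ2.absorb hbr2 hF hd hN (by omega) hjk hj.1.2
        (hA3 6 (by omega) (by omega) rfl) (hA3 7 (by omega) (by omega) rfl) h11' h21'
    · omega
    · intro a ha
      rw [h11', Function.update_of_ne (by omega), hA 11 rfl, hqu a ha]
    · rw [e26, if_neg hfl, hpot]
      have : potential ((((s2.setArr 9 j y).setArr 10 j x).setReg 28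
          (s2.arr aPn j)).arr) nm = potential s2.arr nm :=
        potential_congr (by simp [State.setArr_arr]) (by simp [State.setArr_arr])
          (by simp [State.setArr_arr])
      simp only [State.simps, Nat.reduceEqDiff, if_false] at this ⊢
      omega

theorem bridgeCmd_spec {x y p q : ℕ} {s : State} (hB : (nm + 1) * (b + 1) < B)
    (hB' : 2 ^ b < B) (hkB : 2 * k + 1 < B) (hb : Nat.log 2 nm ≤ b) (hT : LogTable s.arr b)
    (hF : Forest H N v D s.arr k) (hd : H.Loopless) (hN : H.IsMatching N)
    (h7 : s.reg rB = b) (h12 : s.reg rX = x) (h14 : s.reg rY = y)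
    (hp : p < k) (hq : q < k) (h27 : s.reg rP = p) (h28 : s.reg rQ = q)
    (hm : Micro s.arr b k nm) (hQ : Queue s.arr k (s.reg rQt)) (hfl : s.reg rFl ≠ 0) :
    Run B .skip bridgeCmd s fun t _ s' => Contracts s.arr s'.arr k x y p q ∧
      (∀ j, UAnc s'.arr p j ↔ UAnc s'.arr q j) ∧ Micro s'.arr b k nm ∧
      Queue s'.arr k (s'.reg rQt) ∧ s.reg rQt ≤ s'.reg rQt ∧
      (∀ a < s.reg rQt, s'.arr aQu a = s.arr aQu a) ∧
      t + 200 * potential s'.arr nm + 660 * unabsorbed s'.arr k ≤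
        200 * potential s.arr nm + 660 * unabsorbed s.arr k + 610 := by
  refine Run.loop rfl (BridgeInv s.arr b k nm x y p q (s.reg rQt)) (fun s' => 200 * potential s'.arr nm +
    660 * unabsorbed s'.arr k + if s'.reg rFl = 0 then 0 else 600) ?_ ?_ ?_ ?_
  · refine ⟨?_, hm, hQ, le_rfl, fun _ _ => rfl, fun h => absurd h hfl⟩
    rw [h27, h28]
    exact .refl x y hp hq
  · intro s' _ _
    trivial
  · intro s' hsame hI h0
    simp only [Expr.eval] at h0
    refine (bridgeStepCmd_spec hB hB' hkB hb ?_ hF hd hN ?_ ?_ ?_ hI h0).mono ?_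
    · rw [LogTable, hsame.arr 12 rfl rfl]
      exact hT
    · rw [hsame.reg 7 rfl rfl, h7]
    · rw [hsame.reg 12 rfl rfl, h12]
    · rw [hsame.reg 14 rfl rfl, h14]
    · rintro t tr s'' - - - ⟨h1, h2⟩
      refine ⟨h1, ?_⟩
      simp only [if_neg h0, Expr.cost]
      omega
  · intro t s' hsame hI h0 ht
    simp only [Expr.eval] at h0
    obtain ⟨i, hi, hj⟩ := hI.done h0
    obtain ⟨h1, h2⟩ := hI.bridging.contracts hF.pn_lt hp hq hi hj
    refine ⟨h1, h2, hI.micro, hI.queue, hI.qt_le, hI.qu, ?_⟩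
    simp only [h0, if_true, if_neg hfl, Expr.cost] at ht
    omega

end

end DynMatch

namespace DynMatch

section

variable {H : DynGraph} {N : Finset (Sym2 ℕ)} {v : ℕ} {D : ℕ → Prop} {A A' A'' : ℕ → ℕ → ℕ}
  {k m ex b nm qh qt c X : ℕ}

/-! ### Lists of half-edges -/

/-- The half-edges `2 * j` and `2 * j + 1` of one edge are exchanged by `^^^ 1`, while the quotient
by two, the number of the edge, is kept. -/
theorem xor_one_div_two (h : ℕ) : (h ^^^ 1) / 2 = h / 2 := by
  have := Nat.shiftRight_xor_distrib (a := h) (b := 1) (i := 1)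
  simpa [Nat.shiftRight_eq_div_pow] using this

theorem xor_one_lt {h : ℕ} (hm : h < 2 * m) : h ^^^ 1 < 2 * m := by
  have := xor_one_div_two h
  omega

theorem xor_one_xor_one (h : ℕ) : h ^^^ 1 ^^^ 1 = h := by
  rw [Nat.xor_assoc]; simp

/-- The edges of `H` are the edges listed in `T` that do not contain the vertex `ex - 1`; the ends
of an edge are stored in neighbouring cells. -/
def HalfEdges (H : DynGraph) (T : ℕ → ℕ) (m ex : ℕ) : Prop :=
  ∀ x y, s(x, y) ∈ H.edges ↔
    ∃ h < 2 * m, T h = x ∧ T (h ^^^ 1) = y ∧ x + 1 ≠ ex ∧ y + 1 ≠ ex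

/-- For each vertex, the half-edges that start there form a linked list. -/
structure Adjacency (A : ℕ → ℕ → ℕ) (m : ℕ) (D : ℕ → Prop) : Prop where
  dom : ∀ h < 2 * m, D (A aT h)
  head_gt : ∀ h < 2 * m, h < A aHead (A aT h)
  head_eq : ∀ x, D x → ∀ h, A aHead x = h + 1 → h < 2 * m ∧ A aT h = x
  nxt_eq : ∀ h < 2 * m, ∀ h', A aNxt h = h' + 1 → h' < h ∧ A aT h' = A aT h
  nxt_gt : ∀ h < 2 * m, ∀ h' < h, A aT h' = A aT h → h' < A aNxt h

theorem Forest.not_excluded (h : Forest H N v D A k) (hN : N ⊆ H.edges)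
    {T : ℕ → ℕ} (hT : HalfEdges H T m ex) (hv : v + 1 ≠ ex) {x i : ℕ} (hi : i < k)
    (hx : InNode A x i) : x + 1 ≠ ex := by
  rcases Nat.eq_zero_or_pos i with rfl | h0
  · rcases hx with rfl | ⟨h0, -⟩
    · rwa [h.out_zero]
    · exact absurd h0 (lt_irrefl _)
  · obtain ⟨_, -, -, -, h1, h2⟩ := (hT _ _).1 (hN (h.matched i h0 hi))
    rcases hx with rfl | ⟨-, rfl⟩
    · exact h2
    · exact h1

/-- The half-edge `h` has been examined. -/
def Examined (A : ℕ → ℕ → ℕ) (qh c h : ℕ) : Prop :=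
  ∃ a < qh, A aQu a = A aT h ∧ (a + 1 = qh → c ≤ h)

open Classical in
/-- The number of half-edges that have not been examined. -/
noncomputable def unexamined (A : ℕ → ℕ → ℕ) (m qh c : ℕ) : ℕ :=
  ((Finset.range (2 * m)).filter fun h => ¬ Examined A qh c h).card

/-- The invariant of the search for an augmenting path. -/
structure MainInv (H : DynGraph) (N : Finset (Sym2 ℕ)) (v : ℕ) (D : ℕ → Prop) (m b : ℕ)
    (ex : ℕ) (A : ℕ → ℕ → ℕ) (k nm qh qt c X : ℕ) : Prop where
  forest : Forest H N v D A k
  micro : Micro A b k nm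
  queue : Queue A k qt
  qh_le : qh ≤ qt
  cur : 0 < qh → A aQu (qh - 1) = X
  cur_c : ∀ h, c = h + 1 → 0 < qh ∧ h < 2 * m ∧ A aT h = X
  closed : ∀ h < 2 * m, Examined A qh c h → A aT (h ^^^ 1) + 1 ≠ ex →
    ∃ j < k, InNode A (A aT (h ^^^ 1)) j
  contracted : ∀ h < 2 * m, Examined A qh c h → Examined A qh c (h ^^^ 1) →
    ∀ i < k, ∀ i' < k, InNode A (A aT h) i → InNode A (A aT (h ^^^ 1)) i' →
      ∀ j, UAnc A i j ↔ UAnc A i' j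

theorem MainInv.outer_of_examined (h : MainInv H N v D m b ex A k nm qh qt c X) {h' : ℕ}
    (he : Examined A qh c h') : ∃ i < k, OuterAt A (A aT h') i := by
  obtain ⟨a, ha, ha', -⟩ := he
  rw [← ha']
  exact h.queue.outer a (ha.trans_le h.qh_le)

/-- Taking a vertex from the queue examines nothing: the cursor is placed above all half-edges of
the new vertex, and the value `0` of the old cursor says that the previous vertex is finished. -/
theorem MainInv.examined_dequeue (h : MainInv H N v D m b ex A k nm qh qt c X)
    (hA : Adjacency A m D) (hc : c = 0) {h' : ℕ} (hh : h' < 2 * m) :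
    Examined A (qh + 1) (A aHead (A aQu qh)) h' ↔ Examined A qh c h' := by
  constructor
  · rintro ⟨a, ha, h1, h2⟩
    rcases Nat.lt_succ_iff_lt_or_eq.1 ha with ha | rfl
    · exact ⟨a, ha, h1, fun _ => by omega⟩
    · have := hA.head_gt h' hh
      rw [← h1] at this
      have := h2 rfl
      omega
  · rintro ⟨a, ha, h1, h2⟩
    exact ⟨a, by omega, h1, fun h => by omega⟩

theorem MainInv.dequeue (h : MainInv H N v D m b ex A k nm qh qt c X) (hA : Adjacency A m D)
    (hc : c = 0) (hq : qh < qt) : MainInv H N v D m b ex A k nm (qh + 1) qt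
      (A aHead (A aQu qh)) (A aQu qh) := by
  refine ⟨h.forest, h.micro, h.queue, hq, fun _ => rfl, ?_, ?_, ?_⟩
  · intro h' hh
    obtain ⟨i, hi, hx⟩ := h.queue.outer qh hq
    exact ⟨by omega, hA.head_eq _ (h.forest.dom _ i hi hx.inNode) h' hh⟩
  · intro h' hh he
    rw [h.examined_dequeue hA hc hh] at he
    exact h.closed h' hh he
  · intro h' hh he he'
    rw [h.examined_dequeue hA hc hh] at he
    rw [h.examined_dequeue hA hc (xor_one_lt hh)] at he'
    exact h.contracted h' hh he he'

theorem MainInv.unexamined_dequeue (h : MainInv H N v D m b ex A k nm qh qt c X)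
    (hA : Adjacency A m D) (hc : c = 0) :
    unexamined A m (qh + 1) (A aHead (A aQu qh)) = unexamined A m qh c := by
  classical
  rw [unexamined, unexamined]
  congr 1
  refine Finset.filter_congr fun h' hh => ?_
  rw [h.examined_dequeue hA hc (Finset.mem_range.1 hh)]

/-- The half-edges of a vertex are listed in decreasing order. Moving the cursor from `e + 1` to the
next entry therefore adds `e` to the examined ones and nothing else. -/
theorem MainInv.examined_next (h : MainInv H N v D m b ex A k nm qh qt c X)
    (hA : Adjacency A m D) {e : ℕ} (hc : c = e + 1) {h' : ℕ} (hh : h' < 2 * m) :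
    Examined A qh (A aNxt e) h' ↔ Examined A qh c h' ∨ h' = e := by
  obtain ⟨h0, he, hX⟩ := h.cur_c e hc
  have hle : A aNxt e ≤ e := by
    rcases hn : A aNxt e with _ | f
    · omega
    · have := (hA.nxt_eq e he f hn).1
      omega
  constructor
  · rintro ⟨a, ha, h1, h2⟩
    by_cases h3 : h' = e
    · exact Or.inr h3
    · refine Or.inl ⟨a, ha, h1, fun h4 => ?_⟩
      have h5 := h2 h4
      by_contra h6
      have h7 := hA.nxt_gt e he h' (by omega) (by rw [← h1, hX, ← h.cur h0, ← h4]; simp)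
      omega
  · rintro (⟨a, ha, h1, h2⟩ | rfl)
    · exact ⟨a, ha, h1, fun h3 => by have := h2 h3; omega⟩
    · exact ⟨qh - 1, by omega, by rw [h.cur h0, hX], fun _ => hle⟩

/-- No vertex is queued twice, so the half-edge could only have been examined from the last entry
taken, where the cursor has not yet passed it. -/
theorem MainInv.not_examined (h : MainInv H N v D m b ex A k nm qh qt c X) {e : ℕ}
    (hc : c = e + 1) : ¬ Examined A qh c e := by
  obtain ⟨h0, he, hX⟩ := h.cur_c e hc
  rintro ⟨a, ha, h1, h2⟩
  have h3 := h.qh_le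
  have := h.queue.inj a (by omega) (qh - 1) (by omega) (by rw [h1, hX, h.cur h0])
  have := h2 (by omega)
  omega

theorem MainInv.unexamined_next (h : MainInv H N v D m b ex A k nm qh qt c X)
    (hA : Adjacency A m D) {e : ℕ} (hc : c = e + 1)
    (hT : A' aT = A aT) (hqu : ∀ a < qt, A' aQu a = A aQu a) :
    unexamined A' m qh (A aNxt e) + 1 = unexamined A m qh c := by
  classical
  obtain ⟨h0, he, hX⟩ := h.cur_c e hc
  have hq : ∀ f, Examined A' qh (A aNxt e) f ↔ Examined A qh (A aNxt e) f := by
    intro f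
    refine exists_congr fun a => and_congr_right fun ha => ?_
    rw [hT, hqu a (ha.trans_le h.qh_le)]
  have : ((Finset.range (2 * m)).filter fun h => ¬ Examined A qh c h) = insert e
      ((Finset.range (2 * m)).filter fun h => ¬ Examined A' qh (A aNxt e) h) := by
    ext f
    simp only [Finset.mem_filter, Finset.mem_range, Finset.mem_insert, hq]
    by_cases hf : f = e
    · subst hf
      simp [he, h.not_examined hc]
    · simp only [hf, false_or]
      refine and_congr_right fun hf' => ?_
      rw [h.examined_next hA hc hf']
      simp [hf]
  rw [unexamined, unexamined, this, Finset.card_insert_of_notMem]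
  simp [hq, h.examined_next hA hc he]

/-- The half-edge `e` is examined, with which the forest `A` turns into `A'`. -/
theorem MainInv.next {k' nm' qt' : ℕ} (h : MainInv H N v D m b ex A k nm qh qt c X)
    (hA : Adjacency A m D) {e : ℕ} (hc : c = e + 1) (hN : N ⊆ H.edges)
    (hF : Forest H N v D A' k') (hM : Micro A' b k' nm') (hQ : Queue A' k' qt') (hqt : qt ≤ qt')
    (hk : k ≤ k') (hT : A' aT = A aT) (hqu : ∀ a < qt, A' aQu a = A aQu a)
    (hin : ∀ x, ∀ i < k, InNode A x i → InNode A' x i)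
    (hkeep : ∀ i < k, ∀ i' < k, (∀ j, UAnc A i j ↔ UAnc A i' j) →
      ∀ j, UAnc A' i j ↔ UAnc A' i' j)
    (hlab : A aT (e ^^^ 1) + 1 ≠ ex → ∃ j < k', InNode A' (A aT (e ^^^ 1)) j)
    (hcon : ∀ i < k, InNode A (A aT e) i → ∀ i' < k, OuterAt A (A aT (e ^^^ 1)) i' →
      ∀ j, UAnc A' i j ↔ UAnc A' i' j) :
    MainInv H N v D m b ex A' k' nm' qh qt' (A aNxt e) X := by
  obtain ⟨h0, he, hX⟩ := h.cur_c e hc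
  have hqh := h.qh_le
  have hq : ∀ f c, Examined A' qh c f ↔ Examined A qh c f := by
    intro f c
    refine exists_congr fun a => and_congr_right fun ha => ?_
    rw [hT, hqu a (ha.trans_le hqh)]
  have hXo : ∃ i < k, OuterAt A (A aT e) i := by
    rw [hX, ← h.cur h0]
    exact h.queue.outer _ (by omega)
  have hcon' : ∀ i < k', InNode A' (A aT e) i → ∀ i' < k', InNode A' (A aT (e ^^^ 1)) i' →
      (∃ i' < k, OuterAt A (A aT (e ^^^ 1)) i') → ∀ j, UAnc A' i j ↔ UAnc A' i' j := by
    intro i hi hei i' hi' hei' ⟨l', hl', hel'⟩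
    obtain ⟨l, hl, hel⟩ := hXo
    obtain rfl := hF.unique hi (hl.trans_le hk) hei (hin _ l hl hel.inNode)
    obtain rfl := hF.unique hi' (hl'.trans_le hk) hei' (hin _ l' hl' hel'.inNode)
    exact hcon i hl hel.inNode i' hl' hel'
  have hne : e ^^^ 1 ≠ e := by
    intro h1
    have h2 : e ^^^ e ^^^ 1 = e ^^^ e := by
      rw [Nat.xor_assoc, h1]
    simp at h2
  refine ⟨hF, hM, hQ, by omega, fun _ => ?_, ?_, ?_, ?_⟩
  · rw [hqu _ (by omega), h.cur h0]
  · intro f hf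
    obtain ⟨h1, h2⟩ := hA.nxt_eq e he f hf
    rw [hT]
    exact ⟨h0, by omega, h2.trans hX⟩
  · intro f hf hef hex
    rw [hT] at hex ⊢
    rw [hq, h.examined_next hA hc hf] at hef
    rcases hef with hef | rfl
    · obtain ⟨j, hj, hfj⟩ := h.closed f hf hef hex
      exact ⟨j, hj.trans_le hk, hin _ j hj hfj⟩
    · exact hlab hex
  · intro f hf hef hef' i hi i' hi' hfi hfi'
    rw [hT] at hfi hfi'
    rw [hq, h.examined_next hA hc hf] at hef
    rw [hq, h.examined_next hA hc (xor_one_lt hf)] at hef'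
    rcases hef with hef | rfl
    · obtain ⟨l, hl, hfl⟩ := h.outer_of_examined hef
      rcases hef' with hef' | hef'
      · obtain ⟨l', hl', hfl'⟩ := h.outer_of_examined hef'
        obtain rfl := hF.unique hi (hl.trans_le hk) hfi (hin _ l hl hfl.inNode)
        obtain rfl := hF.unique hi' (hl'.trans_le hk) hfi' (hin _ l' hl' hfl'.inNode)
        exact hkeep _ hl _ hl' (h.contracted f hf hef hef' i hl i' hl' hfl.inNode hfl'.inNode)
      -- Here the reverse of the current half-edge was examined earlier; the claim is symmetric in
      -- the two directions.
      · have hfe : f = e ^^^ 1 := by rw [← hef', xor_one_xor_one]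
        subst hfe
        rw [hef'] at hfi'
        exact fun j => (hcon' i' hi' hfi' i hi hfi ⟨l, hl, hfl⟩ j).symm
    · rcases hef' with hef' | hef'
      · exact hcon' i hi hfi i' hi' hfi' (h.outer_of_examined hef')
      · exact absurd hef' hne

/-- When all half-edges that start at outer vertices have been examined, the forest is
complete. -/
theorem MainInv.complete (h : MainInv H N v D m b ex A k nm qh qt c X)
    (hT : HalfEdges H (A aT) m ex) (hc : c = 0) (hq : qh = qt) : Complete H A k := by
  have hex : ∀ h' x i, i < k → OuterAt A x i → A aT h' = x → Examined A qh c h' := by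
    rintro h' x i hi hx rfl
    obtain ⟨a, ha, ha'⟩ := h.queue.mem _ i hi hx
    exact ⟨a, by omega, ha', fun _ => by omega⟩
  constructor
  · intro x i hi hx y hxy
    obtain ⟨h', hh, h1, h2, h3, h4⟩ := (hT x y).1 hxy
    rw [← h2] at h4 ⊢
    exact h.closed h' hh (hex h' x i hi hx h1) h4
  · intro x i hi hx y hxy i' hi' hy
    obtain ⟨h', hh, h1, h2, h3, h4⟩ := (hT x y).1 hxy
    exact h.contracted h' hh (hex h' x i hi hx h1) (hex _ y i' hi' hy h2) i hi i' hi'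
      (h1 ▸ hx.inNode) (h2 ▸ hy.inNode)

end

end DynMatch

namespace DynMatch

section

variable {H : DynGraph} {N : Finset (Sym2 ℕ)} {v : ℕ} {D : ℕ → Prop} {A A' A'' : ℕ → ℕ → ℕ}
  {k m ex b nm B : ℕ}

/-! ### The search for an augmenting path -/

/-- Add the free half of the graph that is reached by the edge from `rX` to `rY`. -/
def growCmd : Cmd :=
  .put aInn (.reg rK) (.reg rY) ;;
  .put aOut (.reg rK) (.get aMate (.reg rY) -ₑ .lit 1) ;;
  .put aPv (.reg rK) (.reg rX) ;;
  .set rArg (.get aNod (.reg rX) -ₑ .lit 1) ;;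
  .put aNod (.reg rY) (.reg rK +ₑ .lit 1) ;;
  .put aNod (.get aMate (.reg rY) -ₑ .lit 1) (.reg rK +ₑ .lit 1) ;;
  .put aQu (.reg rQt) (.get aMate (.reg rY) -ₑ .lit 1) ;;
  .set rQt (.reg rQt +ₑ .lit 1) ;;
  (.skip ;; addCmd)

theorem growCmd_spec {p x y o : ℕ} {s : State} (hB : (nm + 2) * (b + 2) < B) (hB' : 2 ^ b < B)
    (hkB : 2 * k + 1 < B) (hF : Forest H N v D s.arr k) (hd : H.Loopless) (hN : H.IsMatching N)
    (hv : Free N v) (hm : Micro s.arr b k nm) (hQ : Queue s.arr k (s.reg rQt))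
    (h7 : s.reg rB = b) (h8 : s.reg rK = k) (h9 : s.reg rNm = nm) (h12 : s.reg rX = x)
    (h14 : s.reg rY = y) (hp : p < k) (hx : OuterAt s.arr x p) (hxy : s(x, y) ∈ H.edges)
    (hyo : s(y, o) ∈ N) (hDy : D y) (hDo : D o) (hy : s.arr aNod y = 0)
    (h0 : s.arr aMate y = o + 1) :
    Run B .skip growCmd s fun t _ s' => Forest H N v D s'.arr (k + 1) ∧
      Micro s'.arr b (k + 1) (s'.reg rNm) ∧ Queue s'.arr (k + 1) (s'.reg rQt) ∧
      s'.reg rK = k + 1 ∧ s'.reg rQt = s.reg rQt + 1 ∧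
      (∀ a < s.reg rQt, s'.arr aQu a = s.arr aQu a) ∧
      InNode s'.arr y k ∧ (∀ i < k, ∀ z, InNode s'.arr z i ↔ InNode s.arr z i) ∧
      (∀ i < k, ∀ j, UAnc s'.arr i j ↔ UAnc s.arr i j) ∧
      unabsorbed s'.arr (k + 1) = unabsorbed s.arr k + 1 ∧ t ≤ 200 ∧
      potential s'.arr (s'.reg rNm) ≤ potential s.arr nm + 1 := by
  have hnod : s.arr aNod x = p + 1 := (hF.nod x (hF.dom x p hp hx.inNode) p).2 ⟨hp, hx.inNode⟩
  have hqc := hQ.count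
  have hol : ∀ i < k, ¬ InNode s.arr o i := by
    intro i hi hoi
    have hyo' := hyo
    rw [Sym2.eq_swap] at hyo'
    exact hF.nod_eq_zero hDy hy hi (hF.mate hN hv hyo' hi hoi).2.1
  refine Run.of_pre ?_
  simp only [growCmd, Pre, Expr.Ok, Expr.eval, Expr.cost, Op.eval_simps, State.simps,
    Nat.reduceEqDiff, if_true, if_false, true_and, h8, h12, h14, h0, hnod,
    Nat.add_sub_cancel]
  refine ⟨by omega, by omega, by omega, by omega, by omega, by omega, by omega, ?_⟩
  refine Run.mono (addCmd_spec (p := p) (k := k) (nm := nm) (b := b) hB hB' (by omega) ?_ hp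
    ?_ ?_ ?_ ?_) ?_
  · exact hm.congr fun a h1 _ => by
      simp [State.setArr_arr, show a ≠ 5 by omega, show a ≠ 6 by omega, show a ≠ 7 by omega,
        show a ≠ 8 by omega, show a ≠ 11 by omega]
  · simp
  · simpa using h7
  · simpa using h8
  · simpa using h9
  rintro t tr s' - - hs ⟨g1, g2, g3, g4, g5, g6⟩
  have e5 : s'.arr aNod = Function.update (Function.update (s.arr aNod) y (k + 1)) o (k + 1) := by
    rw [hs.arr 5 rfl rfl]; simp [State.setArr_arr]
  have e6 : s'.arr aInn = Function.update (s.arr aInn) k y := by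
    rw [hs.arr 6 rfl rfl]; simp [State.setArr_arr]
  have e7 : s'.arr aOut = Function.update (s.arr aOut) k o := by
    rw [hs.arr 7 rfl rfl]; simp [State.setArr_arr]
  have e8 : s'.arr aPv = Function.update (s.arr aPv) k x := by
    rw [hs.arr 8 rfl rfl]; simp [State.setArr_arr]
  have e9 : s'.arr aBa = s.arr aBa := by
    rw [hs.arr 9 rfl rfl]; simp [State.setArr_arr]
  have e10 : s'.arr aBb = s.arr aBb := by
    rw [hs.arr 10 rfl rfl]; simp [State.setArr_arr]
  have e11 : s'.arr aQu = Function.update (s.arr aQu) (s.reg rQt) o := by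
    rw [hs.arr 11 rfl rfl]; simp [State.setArr_arr]
  have er11 : s'.reg rQt = s.reg rQt + 1 := by
    rw [hs.reg 11 rfl rfl]; simp
  have e20 : s'.arr aPn = Function.update (s.arr aPn) k p := by
    rw [g3]; simp [State.setArr_arr]
  have e21 : s'.arr aAb = Function.update (s.arr aAb) k 0 := by
    rw [g4]; simp [State.setArr_arr]
  have hF' := hF.grow hd hN hv hp hx hxy hyo hDy hDo hy e5 e6 e7 e8 e9 e10 e20 e21
  have hun := unabsorbed_grow (A := s.arr) (A' := s'.arr) (k := k) e21
  have hpot : potential ((((((((((s.setArr 6 k y).setArr 7 k o).setArr 8 k x).setReg 16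
      p).setArr 5 y (k + 1)).setArr 5 o (k + 1)).setArr 11 (s.reg 11) o).setReg 11
      (s.reg 11 + 1))).arr) nm = potential s.arr nm :=
    potential_congr (by simp [State.setArr_arr]) (by simp [State.setArr_arr])
      (by simp [State.setArr_arr])
  have hOlt : ∀ z, ∀ i < k, OuterAt s'.arr z i ↔ OuterAt s.arr z i := by
    intro z i hi
    rw [OuterAt, OuterAt, e6, e7, e21, Function.update_of_ne hi.ne, Function.update_of_ne hi.ne,
      Function.update_of_ne hi.ne]
  have hkk : OuterAt s'.arr o k := Or.inl (by rw [e7, Function.update_self])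
  refine ⟨hF', g2, ?_, g1, er11, ?_, ?_, ?_, ?_, hun, by omega, ?_⟩
  · rw [er11]
    refine hQ.push e11 ⟨k, by omega, hkk⟩ ?_ ?_ ?_ ?_
    · exact fun i hi h => hol i hi h.inNode
    · intro z i hi hz
      rcases Nat.lt_succ_iff_lt_or_eq.1 hi with hi | rfl
      · exact Or.inr ⟨i, hi, (hOlt z i hi).1 hz⟩
      · rcases hz with hz | ⟨-, -, hz⟩
        · rw [e7, Function.update_self] at hz
          exact Or.inl hz
        · rw [e21, Function.update_self] at hz
          exact absurd rfl hz
    · intro z i hi hz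
      exact ⟨i, by omega, (hOlt z i hi).2 hz⟩
    · omega
  · intro a ha
    rw [e11, Function.update_of_ne ha.ne]
  · exact Or.inr ⟨hF.k_pos, by rw [e6, Function.update_self]⟩
  · intro i hi z
    rw [InNode, InNode, e6, e7, Function.update_of_ne hi.ne, Function.update_of_ne hi.ne]
  · intro i hi j
    have h1 : Anc (s'.arr aPn) i j ↔ Anc (s.arr aPn) i j :=
      Anc.congr_of_lt hF.pn_lt (fun l hl => by rw [e20, Function.update_of_ne hl.ne]) hi
    rw [UAnc, UAnc, h1]
    refine and_congr_right fun h2 => ?_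
    have := h2.le hF.pn_lt hi
    rw [e21, Function.update_of_ne (by omega)]
  · rw [hpot] at g6
    exact g6

/-- Examine the edge from the outer vertex `rX` to the vertex `rY` of the forest. -/
def meetCmd : Cmd :=
  .set rP (.get aNod (.reg rX) -ₑ .lit 1) ;;
  .set rQ (.get aNod (.reg rY) -ₑ .lit 1) ;;
  .set rFl (.lit 1) ;;
  .ite (.get aOut (.reg rQ) =ₑ .reg rY) (.skip ;; bridgeCmd)
    (.ite (.get aAb (.reg rQ) =ₑ .lit 0) .skip (.skip ;; bridgeCmd))

/-- Examine the edge from the outer vertex `rX` to `rY`. -/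
def visitCmd : Cmd :=
  .ite (.get aNod (.reg rY) =ₑ .lit 0)
    (.ite (.get aMate (.reg rY) =ₑ .lit 0)
      (.set rFnd (.reg rY +ₑ .lit 1) ;; .set rGo (.lit 0))
      (.skip ;; growCmd))
    (.skip ;; meetCmd)

/-- Examine an edge, or take a vertex from the queue. -/
def mainStepCmd : Cmd :=
  .ite (.reg rC =ₑ .lit 0)
    (.ite (.reg rQh <ₑ .reg rQt)
      (.set rX (.get aQu (.reg rQh)) ;;
        .set rC (.get aHead (.reg rX)) ;;
        .set rQh (.reg rQh +ₑ .lit 1))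
      (.set rGo (.lit 0)))
    (.set rY (.get aT (.op .xor (.reg rC -ₑ .lit 1) (.lit 1))) ;;
      .set rC (.get aNxt (.reg rC -ₑ .lit 1)) ;;
      .ite (.reg rY +ₑ .lit 1 =ₑ .reg rEx) .skip (.skip ;; visitCmd))

def mainCmd : Cmd := .loop (.reg rGo) mainStepCmd

/-- The part of the memory that the search does not change. -/
structure Static (H : DynGraph) (N : Finset (Sym2 ℕ)) (D : ℕ → Prop) (m ex b : ℕ) (s : State) :
    Prop where
  holds : s.Holds N
  half : HalfEdges H (s.arr aT) m ex
  adj : Adjacency s.arr m D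
  tab : LogTable s.arr b
  reg_b : s.reg rB = b
  reg_ex : s.reg rEx = ex

theorem Static.congr {s s' : State} (h : Static H N D m ex b s) (h0 : s'.arr 0 = s.arr 0)
    (h2 : s'.arr aT = s.arr aT) (h3 : s'.arr aHead = s.arr aHead) (h4 : s'.arr aNxt = s.arr aNxt)
    (h12 : s'.arr aTab = s.arr aTab) (h7 : s'.reg rB = s.reg rB) (h5 : s'.reg rEx = s.reg rEx) :
    Static H N D m ex b s' := by
  obtain ⟨g1, g2, g3, g4, g5, g6⟩ := h
  refine ⟨?_, by rw [h2]; exact g2, ?_, ?_, h7.trans g5, h5.trans g6⟩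
  · simpa only [State.Holds, h0] using g1
  · obtain ⟨a1, a2, a3, a4, a5⟩ := g3
    constructor <;> simp only [h2, h3, h4] <;> assumption
  · simpa only [LogTable, h12] using g4

/-- An augmenting path has been found. -/
def Found (H : DynGraph) (N : Finset (Sym2 ℕ)) (s : State) : Prop :=
  ∃ z, s.reg rFnd = z + 1 ∧ (∃ i < s.reg rK, OuterAt s.arr (s.reg rX) i) ∧
    s(s.reg rX, z) ∈ H.edges ∧ Free N z ∧ ∀ i < s.reg rK, ¬ InNode s.arr z i

/-- The invariant of the search for an augmenting path, including its final states. -/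
structure LoopInv (H : DynGraph) (N : Finset (Sym2 ℕ)) (v : ℕ) (D : ℕ → Prop) (m b ex : ℕ)
    (s : State) : Prop where
  forest : Forest H N v D s.arr (s.reg rK)
  state : (s.reg rFnd = 0 ∧ MainInv H N v D m b ex s.arr (s.reg rK) (s.reg rNm) (s.reg rQh)
      (s.reg rQt) (s.reg rC) (s.reg rX) ∧ (s.reg rGo = 0 → s.reg rC = 0 ∧ s.reg rQh = s.reg rQt)) ∨
    (s.reg rGo = 0 ∧ Found H N s)

/-- The time that the search may still need. -/
noncomputable def remaining (m : ℕ) (s : State) : ℕ :=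
  1000 * unexamined s.arr m (s.reg rQh) (s.reg rC) + 1200 * (m + 1 - s.reg rK) +
    700 * unabsorbed s.arr (s.reg rK) + 40 * (s.reg rQt - s.reg rQh) +
    200 * potential s.arr (s.reg rNm) + if s.reg rGo = 0 then 0 else 60

theorem Forest.of_outer_test (h : Forest H N v D A k) {y q : ℕ} (hq : q < k)
    (hy : InNode A y q) : (A aOut q = y ∨ A aAb q ≠ 0) ↔ OuterAt A y q := by
  constructor
  · rintro (h1 | h1)
    · exact Or.inl h1.symm
    · rcases hy with hy | ⟨h0, hy⟩
      · exact Or.inl hy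
      · exact Or.inr ⟨h0, hy, h1⟩
  · rintro (h1 | ⟨-, -, h1⟩)
    · exact Or.inl h1.symm
    · exact Or.inr h1

/-- An edge to a vertex of the forest that is not outer needs no action. Should that vertex become
outer later, it enters the queue, and the edge is then examined from its side. -/
theorem meetCmd_spec {p q x y : ℕ} {s : State} (hB : (nm + 1) * (b + 1) < B) (hB' : 2 ^ b < B)
    (hkB : 2 * k + 1 < B) (hb : Nat.log 2 nm ≤ b) (hT : LogTable s.arr b)
    (hF : Forest H N v D s.arr k) (hd : H.Loopless) (hN : H.IsMatching N)
    (hv : Free N v) (hm : Micro s.arr b k nm) (hQ : Queue s.arr k (s.reg rQt))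
    (h7 : s.reg rB = b) (h12 : s.reg rX = x)
    (h14 : s.reg rY = y) (hp : p < k) (hx : OuterAt s.arr x p) (hxy : s(x, y) ∈ H.edges)
    (hq : q < k) (hy : InNode s.arr y q) :
    Run B .skip meetCmd s fun t _ s' => Forest H N v D s'.arr k ∧
      Micro s'.arr b k nm ∧ Queue s'.arr k (s'.reg rQt) ∧
      (∀ i z, InNode s'.arr z i ↔ InNode s.arr z i) ∧
      (∀ i < k, ∀ i' < k, (∀ j, UAnc s.arr i j ↔ UAnc s.arr i' j) →
        ∀ j, UAnc s'.arr i j ↔ UAnc s'.arr i' j) ∧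
      (OuterAt s.arr y q → ∀ j, UAnc s'.arr p j ↔ UAnc s'.arr q j) ∧
      s.reg rQt ≤ s'.reg rQt ∧ (∀ a < s.reg rQt, s'.arr aQu a = s.arr aQu a) ∧
      t + 200 * potential s'.arr nm + 660 * unabsorbed s'.arr k ≤
        200 * potential s.arr nm + 660 * unabsorbed s.arr k + 700 := by
  have hnx := (hF.nod x (hF.dom x p hp hx.inNode) p).2 ⟨hp, hx.inNode⟩
  have hny := (hF.nod y (hF.dom y q hq hy) q).2 ⟨hq, hy⟩
  have key : ∀ (s₁ : State) (c : ℕ), s₁.arr = s.arr → s₁.reg rB = b → s₁.reg rX = x →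
      s₁.reg rY = y → s₁.reg rP = p → s₁.reg rQ = q → s₁.reg rFl ≠ 0 → s₁.reg rQt = s.reg rQt →
      OuterAt s.arr y q → c ≤ 60 →
      Run B .skip bridgeCmd s₁ fun t _ s' => Forest H N v D s'.arr k ∧
        Micro s'.arr b k nm ∧ Queue s'.arr k (s'.reg rQt) ∧
        (∀ i z, InNode s'.arr z i ↔ InNode s.arr z i) ∧
        (∀ i < k, ∀ i' < k, (∀ j, UAnc s.arr i j ↔ UAnc s.arr i' j) →
          ∀ j, UAnc s'.arr i j ↔ UAnc s'.arr i' j) ∧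
        (OuterAt s.arr y q → ∀ j, UAnc s'.arr p j ↔ UAnc s'.arr q j) ∧
        s.reg rQt ≤ s'.reg rQt ∧ (∀ a < s.reg rQt, s'.arr aQu a = s.arr aQu a) ∧
        c + t + 200 * potential s'.arr nm + 660 * unabsorbed s'.arr k ≤
          200 * potential s.arr nm + 660 * unabsorbed s.arr k + 700 := by
    intro s₁ c hs g7 g12 g14 g27 g28 g26 g11 hyO hc
    rw [← hs] at hT hF hm hQ hyO hx ⊢
    rw [← g11] at hQ ⊢
    refine (bridgeCmd_spec hB hB' hkB hb hT hF hd hN g7 g12 g14 hp hq g27 g28 hm hQ g26).mono ?_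
    rintro t tr s' - - - ⟨h1, h2, h3, h4, h5, h6, h7⟩
    refine ⟨hF.contract hd hN hv h1 hp hq hx hyO hxy, h3, h4, fun i z => h1.inNode, ?_,
      fun _ => h2, h5, h6, by omega⟩
    intro i hi i' hi' h8 j
    rw [h1.uAnc hF.pn_lt hi, h1.uAnc hF.pn_lt hi', h8]
  refine Run.of_pre ?_
  simp only [meetCmd, Pre, Expr.Ok, Expr.eval, Expr.cost, Op.eval_simps, State.simps,
    Nat.reduceEqDiff, if_true, if_false, true_and, h12, h14, hnx, hny, Nat.add_sub_cancel]
  refine ⟨by omega, by omega, by omega, by omega, fun h1 => ?_, fun h1 => ⟨by omega, fun h2 => ?_,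
    fun h2 => ?_⟩⟩
  · have hyO := (hF.of_outer_test hq hy).1 (Or.inl h1)
    refine Run.mono (key _ 60 (by rfl) (by simpa using h7) (by simpa using h12)
      (by simpa using h14) (by simp) (by simp) (by simp) (by simp) hyO le_rfl) ?_
    rintro t tr s' - - - ⟨g1, g2, g3, g4, g5, g6, g7, g8, g9⟩
    exact ⟨g1, g2, g3, g4, g5, g6, g7, g8, by omega⟩
  · refine ⟨hF, hm, hQ, by simp, fun _ _ _ _ h => h, fun h => ?_, le_rfl, by simp, by omega⟩
    rcases (hF.of_outer_test hq hy).2 h with h | h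
    · exact absurd h h1
    · exact absurd h2 h
  · have hyO := (hF.of_outer_test hq hy).1 (Or.inr h2)
    refine Run.mono (key _ 60 (by rfl) (by simpa using h7) (by simpa using h12)
      (by simpa using h14) (by simp) (by simp) (by simp) (by simp) hyO le_rfl) ?_
    rintro t tr s' - - - ⟨g1, g2, g3, g4, g5, g6, g7, g8, g9⟩
    exact ⟨g1, g2, g3, g4, g5, g6, g7, g8, by omega⟩

/-- The accounts in `remaining`: an unexamined half-edge holds 1000 units for its examination. A
node yet to be added holds 1200, of which 700 are set aside for its absorption, 40 for the queue
entry of its outer vertex and 200 for the potential. Of the 700 units released by an absorption, 660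
pay for the absorption itself and 40 for the queue entry of the inner vertex. -/
theorem mainStepCmd_spec {s : State} (hb : b = Nat.log 2 (m + 2)) (hB : (m + 4) * (m + 4) < B)
    (hd : H.Loopless) (hN : H.IsMatching N) (hv : Free N v) (hvx : v + 1 ≠ ex)
    (hNm : N.card ≤ m) (hS : Static H N D m ex b s) (hI : LoopInv H N v D m b ex s)
    (hgo : s.reg rGo ≠ 0) (hTB : ∀ h < 2 * m, s.arr aT h + 1 < B) :
    Run B .skip mainStepCmd s fun t _ s' => LoopInv H N v D m b ex s' ∧
      t + 3 + remaining m s' ≤ remaining m s := by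
  obtain ⟨hF, hI⟩ := hI
  obtain ⟨hfnd, hM, -⟩ := hI.resolve_right fun h => hgo h.1
  have hkm := hF.card_le
  have hnk := hM.micro.nm_le
  have hbm : b ≤ m + 2 := by rw [hb]; exact Nat.log_le_self 2 _
  have h2b : 2 ^ b ≤ m + 2 := by rw [hb]; exact Nat.pow_log_le_self 2 (by omega)
  have hBB : 2 * m + 16 < B := by nlinarith
  have hlog : Nat.log 2 (s.reg rNm) ≤ b := by
    rw [hb]; exact Nat.log_mono_right (by omega)
  have hmul : (s.reg rNm + 2) * (b + 2) < B :=
    lt_of_le_of_lt (Nat.mul_le_mul (by omega) (by omega)) hB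
  have hmul' : (s.reg rNm + 1) * (b + 1) < B :=
    lt_of_le_of_lt (Nat.mul_le_mul (by omega) (by omega)) hB
  have hqc := hM.queue.count
  have hqle := hM.qh_le
  have hex := hS.reg_ex
  refine Run.of_pre ?_
  simp only [mainStepCmd, Pre, Expr.Ok, Expr.eval, Expr.cost, Op.eval_simps, State.simps,
    Nat.reduceEqDiff, if_true, if_false, true_and, hex]
  refine ⟨⟨by omega, by omega⟩, fun hc => ⟨by omega, fun hq => ⟨by omega, ?_, ?_⟩, fun hq =>
    ⟨by omega, ?_, ?_⟩⟩, fun hc => ?_⟩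
  · have := hM.dequeue hS.adj hc hq
    refine ⟨?_, Or.inl ⟨?_, ?_, ?_⟩⟩
    · simpa using hF
    · simpa using hfnd
    · simpa using this
    · intro h
      exact absurd (by simpa using h) hgo
  · have := hM.unexamined_dequeue hS.adj hc
    simp only [remaining, State.simps, Nat.reduceEqDiff, if_true, if_false, this, if_neg hgo]
    omega
  · refine ⟨by simpa using hF, Or.inl ⟨by simpa using hfnd, by simpa using hM, ?_⟩⟩
    simp only [State.simps, Nat.reduceEqDiff, if_false]
    exact fun _ => ⟨hc, by omega⟩
  · simp only [remaining, State.simps, Nat.reduceEqDiff, if_true, if_false, if_neg hgo]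
    omega
  · obtain ⟨e, he⟩ := Nat.exists_eq_succ_of_ne_zero hc
    obtain ⟨h0, hem, hX⟩ := hM.cur_c e he
    have hxe := xor_one_lt hem
    set y := s.arr aT (e ^^^ 1) with hy
    obtain ⟨p, hp, hx⟩ := hM.queue.outer (s.reg rQh - 1) (by omega)
    rw [hM.cur h0] at hx
    simp only [he, Nat.succ_eq_add_one, Nat.add_sub_cancel, ← hy]
    have hyB : y + 1 < B := hTB _ hxe
    have hDy : D y := hS.adj.dom _ hxe
    have hXi := hx.inNode
    have hXe : y + 1 ≠ ex → s(s.reg rX, y) ∈ H.edges := fun h =>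
      (hS.half _ _).2 ⟨e, hem, hX, rfl, hF.not_excluded hN.1 hS.half hvx hp hXi, h⟩
    have hyO : ∀ i < s.reg rK, OuterAt s.arr y i → y + 1 ≠ ex := fun i hi h =>
      hF.not_excluded hN.1 hS.half hvx hi h.inNode
    refine ⟨by omega, by omega, ⟨by omega, by omega⟩, fun hex => ?_, fun hex => ?_⟩
    · refine ⟨⟨by simpa using hF, Or.inl ⟨by simpa using hfnd, ?_, fun h =>
        absurd (by simpa using h) hgo⟩⟩, ?_⟩
      · simp only [State.simps, Nat.reduceEqDiff, if_true, if_false]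
        exact hM.next hS.adj he hN.1 hF hM.micro hM.queue le_rfl le_rfl rfl (fun _ _ => rfl)
          (fun _ _ _ h => h) (fun _ _ _ _ h => h) (fun h => absurd hex h)
          fun _ _ _ i hi h => absurd hex (hyO i hi h)
      · have := hM.unexamined_next (A' := s.arr) hS.adj he rfl fun _ _ => rfl
        simp only [remaining, State.simps, Nat.reduceEqDiff, if_true, if_false, if_neg hgo, he]
          at this ⊢
        omega
    have hXe := hXe hex
    refine Run.of_pre ?_
    simp only [visitCmd, Pre, Expr.Ok, Expr.eval, Expr.cost, Op.eval_simps, State.simps,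
      Nat.reduceEqDiff, if_true, if_false, true_and]
    refine ⟨⟨by omega, by omega⟩, fun hnod => ⟨⟨by omega, by omega⟩, fun hmate => ?_,
      fun hmate => ?_⟩, fun hnod => ?_⟩
    · refine ⟨⟨by omega, by omega⟩, by omega, ⟨by simpa using hF, Or.inr ⟨by simp, y, by simp,
        ?_, ?_, ?_, ?_⟩⟩, ?_⟩
      · simpa using ⟨p, hp, hx⟩
      · simpa using hXe
      · by_contra hf
        obtain ⟨z, hz⟩ := not_free_iff.1 hf
        have := (hS.holds y z).2 hz
        omega
      · simpa using fun i hi => hF.nod_eq_zero hDy hnod hi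
      · have := hM.unexamined_next (A' := s.arr) hS.adj he rfl fun _ _ => rfl
        simp only [remaining, State.simps, Nat.reduceEqDiff, if_true, if_false, if_neg hgo, he]
          at this ⊢
        omega
    · obtain ⟨o, ho⟩ := Nat.exists_eq_succ_of_ne_zero hmate
      have hyo := (hS.holds y o).1 ho
      have hDo : D o := by
        obtain ⟨h', hh', -, h2, -⟩ := (hS.half _ _).1 (hN.1 hyo)
        rw [← h2]
        exact hS.adj.dom _ (xor_one_lt hh')
      refine Run.mono (growCmd_spec (p := p) (x := s.reg rX) (y := y) (o := o) (k := s.reg rK)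
        (nm := s.reg rNm) (b := b) (H := H) (N := N) (v := v) (D := D) hmul (by omega)
        (by omega) ?_ hd hN hv ?_ ?_ ?_ ?_ ?_ ?_ ?_ hp ?_ hXe hyo hDy hDo ?_ ?_) ?_
      · exact hF
      · exact hM.micro
      · simpa using hM.queue
      · simpa using hS.reg_b
      · simp
      · simp
      · simp
      · simp
      · simpa using hx
      · simpa using hnod
      · simpa using ho
      rintro t tr s' - - hs ⟨g1, g2, g3, g4, g5, g6, g7, g8, g9, g10, g11, g12⟩
      have r10 : s'.reg rQh = s.reg rQh := by rw [hs.reg 10 rfl rfl]; simp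
      have r12 : s'.reg rX = s.reg rX := by rw [hs.reg 12 rfl rfl]; simp
      have r13 : s'.reg rC = s.arr aNxt e := by rw [hs.reg 13 rfl rfl]; simp
      have r15 : s'.reg rFnd = 0 := by rw [hs.reg 15 rfl rfl]; simpa using hfnd
      have r25 : s'.reg rGo = s.reg rGo := by rw [hs.reg 25 rfl rfl]; simp
      have a2 : s'.arr aT = s.arr aT := by rw [hs.arr 2 rfl rfl]; simp
      simp only [State.simps, Nat.reduceEqDiff, if_false] at g5 g6 g8 g9 g10 g12
      have hkc := g1.card_le
      refine ⟨⟨by rwa [g4], Or.inl ⟨r15, ?_, fun h => absurd (r25 ▸ h) hgo⟩⟩, ?_⟩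
      · rw [g4, r10, r12, r13]
        refine hM.next hS.adj he hN.1 g1 g2 g3 (by omega) (by omega) a2 g6
          (fun x i hi h => (g8 i hi x).2 h) (fun i hi i' hi' h j => by
            rw [g9 i hi, g9 i' hi', h]) (fun _ => ⟨_, by omega, g7⟩) ?_
        -- Before this step `y` was in no node, so the edge does not close a blossom.
        intro i hi hei i' hi' hei'
        exact absurd hei'.inNode (hF.nod_eq_zero hDy hnod hi')
      · have := hM.unexamined_next (A' := s'.arr) hS.adj he a2 g6
        simp only [remaining, g4, r10, r13, r25, g10, if_neg hgo, g5] at this ⊢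
        omega
    · obtain ⟨q, hq⟩ := Nat.exists_eq_succ_of_ne_zero hnod
      obtain ⟨hqk, hyq⟩ := (hF.nod y hDy q).1 hq
      refine Run.mono (meetCmd_spec (p := p) (q := q) (x := s.reg rX) (y := y) (k := s.reg rK)
        (nm := s.reg rNm) (b := b) (H := H) (N := N) (v := v) (D := D) hmul' (by omega)
        (by omega) hlog ?_ ?_ hd hN hv ?_ ?_ ?_ ?_ ?_ hp ?_ hXe hqk ?_) ?_
      · exact hS.tab
      · exact hF
      · exact hM.micro
      · simpa using hM.queue
      · simpa using hS.reg_b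
      · simp
      · simp
      · simpa using hx
      · simpa using hyq
      rintro t tr s' - - hs ⟨g1, g2, g3, g4, g5, g6, g7, g8, g9⟩
      have r8 : s'.reg rK = s.reg rK := by rw [hs.reg 8 rfl rfl]; simp
      have r9 : s'.reg rNm = s.reg rNm := by rw [hs.reg 9 rfl rfl]; simp
      have r10 : s'.reg rQh = s.reg rQh := by rw [hs.reg 10 rfl rfl]; simp
      have r12 : s'.reg rX = s.reg rX := by rw [hs.reg 12 rfl rfl]; simp
      have r13 : s'.reg rC = s.arr aNxt e := by rw [hs.reg 13 rfl rfl]; simp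
      have r15 : s'.reg rFnd = 0 := by rw [hs.reg 15 rfl rfl]; simpa using hfnd
      have r25 : s'.reg rGo = s.reg rGo := by rw [hs.reg 25 rfl rfl]; simp
      have a2 : s'.arr aT = s.arr aT := by rw [hs.arr 2 rfl rfl]; simp
      simp only [State.simps, Nat.reduceEqDiff, if_false] at g4 g5 g6 g7 g8 g9
      refine ⟨⟨by rwa [r8], Or.inl ⟨r15, ?_, fun h => absurd (r25 ▸ h) hgo⟩⟩, ?_⟩
      · rw [r8, r9, r10, r12, r13]
        refine hM.next hS.adj he hN.1 g1 g2 g3 g7 le_rfl a2 g8 (fun x i hi h => (g4 i x).2 h) g5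
          (fun _ => ⟨q, hqk, (g4 q y).2 hyq⟩) ?_
        intro i hi hei i' hi' hei'
        rw [hX] at hei
        obtain rfl := hF.unique hi hp hei hXi
        obtain rfl := hF.unique hi' hqk hei'.inNode hyq
        exact g6 hei'
      · have := hM.unexamined_next (A' := s'.arr) hS.adj he a2 g8
        have hc3 := g3.count
        simp only [remaining, r8, r9, r10, r13, r25, if_neg hgo] at this ⊢
        omega

theorem mainCmd_spec {s : State} (hb : b = Nat.log 2 (m + 2)) (hB : (m + 4) * (m + 4) < B)
    (hd : H.Loopless) (hN : H.IsMatching N) (hv : Free N v) (hvx : v + 1 ≠ ex)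
    (hNm : N.card ≤ m) (hS : Static H N D m ex b s) (hI : LoopInv H N v D m b ex s)
    (hTB : ∀ h < 2 * m, s.arr aT h + 1 < B) :
    Run B .skip mainCmd s fun t _ s' => t ≤ remaining m s + 2 ∧
      ((s'.reg rFnd = 0 ∧ ¬ ∃ (z : ℕ) (p : H.graph.Walk v z), IsAugmentingPath N p) ∨
        (Forest H N v D s'.arr (s'.reg rK) ∧ Found H N s')) := by
  refine Run.loop rfl (LoopInv H N v D m b ex) (remaining m) hI ?_ ?_ ?_
  · intro s' _ _
    trivial
  · intro s' hsame hI' h0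
    refine (mainStepCmd_spec hb hB hd hN hv hvx hNm ?_ hI' h0 ?_).mono ?_
    · exact hS.congr (hsame.arr 0 rfl rfl) (hsame.arr 2 rfl rfl) (hsame.arr 3 rfl rfl)
        (hsame.arr 4 rfl rfl) (hsame.arr 12 rfl rfl) (hsame.reg 7 rfl rfl) (hsame.reg 5 rfl rfl)
    · rw [hsame.arr 2 rfl rfl]
      exact hTB
    · rintro t tr s'' - - - ⟨h1, h2⟩
      refine ⟨h1, ?_⟩
      simp only [Expr.cost]
      omega
  · intro t s' hsame hI' h0 ht
    simp only [Expr.eval] at h0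
    simp only [Expr.cost] at ht
    refine ⟨by omega, ?_⟩
    rcases hI'.state with ⟨h1, h2, h3⟩ | ⟨-, h1⟩
    · obtain ⟨h4, h5⟩ := h3 h0
      refine Or.inl ⟨h1, hI'.forest.not_exists_augmenting hd hN hv (h2.complete ?_ h4 h5)⟩
      rw [hsame.arr 2 rfl rfl]
      exact hS.half
    · exact Or.inr ⟨hI'.forest, h1⟩

end

end DynMatch

namespace DynMatch

section

variable {H : DynGraph} {N : Finset (Sym2 ℕ)} {v : ℕ} {D : ℕ → Prop} {A A' A'' : ℕ → ℕ → ℕ}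
  {k m ex b nm B : ℕ}

/-! ### Preparing a search -/

/-- The vertices that are known to the search. -/
def Known (T : ℕ → ℕ) (m v x : ℕ) : Prop := x = v ∨ ∃ h < 2 * m, T h = x

/-- Unlabel all vertices and clear their lists of edges. -/
def clearCmd : Cmd :=
  .put aNod (.reg rRoot) (.lit 0) ;;
  .put aHead (.reg rRoot) (.lit 0) ;;
  .set rH (.lit 0) ;;
  .loop (.reg rH <ₑ .reg rM +ₑ .reg rM)
    (.put aNod (.get aT (.reg rH)) (.lit 0) ;;
      .put aHead (.get aT (.reg rH)) (.lit 0) ;;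
      .set rH (.reg rH +ₑ .lit 1))

/-- Only the root and the ends of listed edges are reset, which takes time in terms of `m` and not
of `n`. All other cells may hold remnants of earlier searches; this is why the invariants of the
labels and the lists are restricted to a domain `D`. -/
theorem clearCmd_spec {s : State} (hB : 2 * m + 1 < B) (h4 : s.reg rM = m)
    (h3 : s.reg rRoot = v) :
    Run B .skip clearCmd s fun t _ s' => (∀ x, Known (s.arr aT) m v x →
      s'.arr aNod x = 0 ∧ s'.arr aHead x = 0) ∧ t ≤ 100 * m + 50 := by
  refine Run.of_pre ?_
  simp only [clearCmd, Pre, Expr.Ok, Expr.eval, Expr.cost, Op.eval_simps, State.simps,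
    Nat.reduceEqDiff, if_true, if_false, true_and, h3]
  refine ⟨by omega, by omega, by omega, ?_⟩
  refine Run.loop rfl (fun s' => s'.reg rH ≤ 2 * m ∧ s'.arr aNod v = 0 ∧ s'.arr aHead v = 0 ∧
      ∀ h < s'.reg rH, s'.arr aNod (s.arr aT h) = 0 ∧ s'.arr aHead (s.arr aT h) = 0)
    (fun s' => 50 * (2 * m - s'.reg rH)) ?_ ?_ ?_ ?_
  · simp [State.setArr_arr]
  · intro s' hsame hI
    have e4 : s'.reg rM = m := by rw [hsame.reg 4 rfl rfl]; simpa using h4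
    simp only [Expr.Ok, Expr.eval, Op.eval_simps, e4, true_and]
    omega
  · intro s' hsame ⟨hI1, hI2, hI3, hI4⟩ h0
    have e4 : s'.reg rM = m := by rw [hsame.reg 4 rfl rfl]; simpa using h4
    have eT : s'.arr aT = s.arr aT := by rw [hsame.arr 2 rfl rfl]; simp [State.setArr_arr]
    simp only [Expr.eval, Op.eval_simps, e4] at h0
    refine Run.of_pre ?_
    simp only [Pre, Expr.Ok, Expr.eval, Expr.cost, Op.eval_simps, State.simps,
      Nat.reduceEqDiff, if_true, if_false, true_and, eT]
    refine ⟨by omega, by omega, by omega, ⟨by omega, ?_, ?_, ?_⟩, by omega⟩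
    · rw [Function.update_apply]; split_ifs <;> simp [hI2]
    · rw [Function.update_apply]; split_ifs <;> simp [hI3]
    · intro h hh
      rcases Nat.lt_succ_iff_lt_or_eq.1 hh with hh | rfl
      · obtain ⟨g1, g2⟩ := hI4 h hh
        rw [Function.update_apply, Function.update_apply]
        split_ifs <;> simp [g1, g2]
      · simp
  · intro t s' hsame ⟨hI1, hI2, hI3, hI4⟩ h0 ht
    have e4 : s'.reg rM = m := by rw [hsame.reg 4 rfl rfl]; simpa using h4
    simp only [Expr.eval, Op.eval_simps, e4] at h0
    simp only [Expr.cost, State.simps, if_true] at ht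
    refine ⟨?_, by omega⟩
    rintro x (rfl | ⟨h, hh, rfl⟩)
    · exact ⟨hI2, hI3⟩
    · exact hI4 h (by omega)

/-- Make the lists of edges. -/
def fillCmd : Cmd :=
  .set rH (.lit 0) ;;
  .loop (.reg rH <ₑ .reg rM +ₑ .reg rM)
    (.put aNxt (.reg rH) (.get aHead (.get aT (.reg rH))) ;;
      .put aHead (.get aT (.reg rH)) (.reg rH +ₑ .lit 1) ;;
      .set rH (.reg rH +ₑ .lit 1))

/-- Half-edges are pushed to the front in increasing order, so that every list is decreasing. It is
this order that lets a single cursor separate the examined part from the rest. -/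
theorem fillCmd_spec {s : State} (hB : 2 * m + 1 < B) (h4 : s.reg rM = m)
    (h0 : ∀ x, Known (s.arr aT) m v x → s.arr aHead x = 0) :
    Run B .skip fillCmd s fun t _ s' => Adjacency s'.arr m (Known (s.arr aT) m v) ∧
      t ≤ 100 * m + 50 := by
  set T := s.arr aT with hT
  refine Run.of_pre ?_
  simp only [fillCmd, Pre, Expr.Ok, Expr.eval, Expr.cost, Op.eval_simps, State.simps,
    Nat.reduceEqDiff, if_true, if_false, true_and]
  refine ⟨by omega, ?_⟩
  refine Run.loop rfl (fun s' => s'.reg rH ≤ 2 * m ∧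
      (∀ x, Known T m v x → (∀ h < s'.reg rH, T h = x → h < s'.arr aHead x) ∧
        ∀ f, s'.arr aHead x = f + 1 → f < s'.reg rH ∧ T f = x) ∧
      ∀ h < s'.reg rH, (∀ f, s'.arr aNxt h = f + 1 → f < h ∧ T f = T h) ∧
        ∀ f < h, T f = T h → f < s'.arr aNxt h)
    (fun s' => 50 * (2 * m - s'.reg rH)) ?_ ?_ ?_ ?_
  · simp only [State.simps, if_true]
    refine ⟨by omega, fun x hx => ⟨fun h hh => by omega, fun f hf => ?_⟩, fun h hh => by omega⟩
    rw [h0 x hx] at hf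
    omega
  · intro s' hsame hI
    have e4 : s'.reg rM = m := by rw [hsame.reg 4 rfl rfl]; simpa using h4
    simp only [Expr.Ok, Expr.eval, Op.eval_simps, e4, true_and]
    omega
  · intro s' hsame ⟨hI1, hI2, hI3⟩ h0
    have e4 : s'.reg rM = m := by rw [hsame.reg 4 rfl rfl]; simpa using h4
    have eT : s'.arr aT = T := by rw [hsame.arr 2 rfl rfl]; simp [hT]
    simp only [Expr.eval, Op.eval_simps, e4] at h0
    refine Run.of_pre ?_
    simp only [Pre, Expr.Ok, Expr.eval, Expr.cost, Op.eval_simps, State.simps,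
      Nat.reduceEqDiff, if_true, if_false, true_and, eT]
    set h := s'.reg rH with hh
    obtain ⟨g1, g2⟩ := hI2 (T h) (Or.inr ⟨h, by omega, rfl⟩)
    refine ⟨by omega, by omega, ⟨by omega, ?_, ?_⟩, by omega⟩
    · intro x hx
      obtain ⟨g3, g4⟩ := hI2 x hx
      rw [Function.update_apply]
      split_ifs with hxh
      · subst hxh
        exact ⟨fun h' hh' _ => hh', fun f hf => ⟨by omega, by rw [show f = h by omega]⟩⟩
      · refine ⟨fun h' hh' he => ?_, fun f hf => ?_⟩
        · rcases Nat.lt_succ_iff_lt_or_eq.1 hh' with hh' | rfl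
          · exact g3 h' hh' he
          · exact absurd he.symm hxh
        · obtain ⟨g5, g6⟩ := g4 f hf
          exact ⟨by omega, g6⟩
    · intro h' hh'
      rcases Nat.lt_succ_iff_lt_or_eq.1 hh' with hh' | rfl
      · rw [Function.update_of_ne hh'.ne]
        exact hI3 h' hh'
      · rw [Function.update_self]
        exact ⟨g2, g1⟩
  · intro t s' hsame ⟨hI1, hI2, hI3⟩ h0 ht
    have e4 : s'.reg rM = m := by rw [hsame.reg 4 rfl rfl]; simpa using h4
    have eT : s'.arr aT = T := by rw [hsame.arr 2 rfl rfl]; simp [hT]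
    simp only [Expr.eval, Op.eval_simps, e4] at h0
    simp only [Expr.cost, State.simps, if_true] at ht
    have hr : s'.reg rH = 2 * m := by omega
    rw [hr] at hI2 hI3
    refine ⟨⟨?_, ?_, ?_, ?_, ?_⟩, by omega⟩
    all_goals rw [eT]
    · exact fun h hh => Or.inr ⟨h, hh, rfl⟩
    · exact fun h hh => (hI2 _ (Or.inr ⟨h, hh, rfl⟩)).1 h hh rfl
    · exact fun x hx => (hI2 x hx).2
    · exact fun h hh => (hI3 h hh).1
    · exact fun h hh => (hI3 h hh).2

/-- Make a table of logarithms. -/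
def tableCmd : Cmd :=
  .put aTab (.lit 1) (.lit 0) ;;
  .set rH (.lit 2) ;;
  .loop (.reg rH ≤ₑ .reg rM +ₑ .lit 2)
    (.put aTab (.reg rH) (.get aTab (.reg rH /ₑ .lit 2) +ₑ .lit 1) ;;
      .set rH (.reg rH +ₑ .lit 1)) ;;
  .set rB (.get aTab (.reg rM +ₑ .lit 2))

/-- For `h ≥ 2` the logarithm of `h` is one more than that of `h / 2`. The table reaches up to `m +
2`, hence beyond all masks of `b` bits, and its last entry is `b` itself. -/
theorem tableCmd_spec {s : State} (hB : 2 * m + 8 < B) (h4 : s.reg rM = m) :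
    Run B .skip tableCmd s fun t _ s' => s'.reg rB = Nat.log 2 (m + 2) ∧
      LogTable s'.arr (Nat.log 2 (m + 2)) ∧ t ≤ 100 * m + 100 := by
  refine Run.of_pre ?_
  simp only [tableCmd, Pre, Expr.Ok, Expr.eval, Expr.cost, Op.eval_simps, State.simps,
    Nat.reduceEqDiff, if_true, if_false, true_and]
  refine ⟨by omega, by omega, by omega, ?_⟩
  refine Run.loop rfl (fun s' => 2 ≤ s'.reg rH ∧ s'.reg rH ≤ m + 3 ∧
      ∀ i, 0 < i → i < s'.reg rH → s'.arr aTab i = Nat.log 2 i)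
    (fun s' => 50 * (m + 3 - s'.reg rH)) ?_ ?_ ?_ ?_
  · simp only [State.simps, if_true]
    refine ⟨by omega, by omega, fun i h0 h1 => ?_⟩
    obtain rfl : i = 1 := by omega
    simp
  · intro s' hsame hI
    have e4 : s'.reg rM = m := by rw [hsame.reg 4 rfl rfl]; simpa using h4
    simp only [Expr.Ok, Expr.eval, Op.eval_simps, e4, true_and]
    omega
  · intro s' hsame ⟨hI1, hI2, hI3⟩ h0
    have e4 : s'.reg rM = m := by rw [hsame.reg 4 rfl rfl]; simpa using h4
    simp only [Expr.eval, Op.eval_simps, e4] at h0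
    have hlog : s'.arr aTab (s'.reg rH / 2) = Nat.log 2 (s'.reg rH / 2) :=
      hI3 _ (by omega) (by omega)
    have hle := Nat.log_le_self 2 (s'.reg rH / 2)
    refine Run.of_pre ?_
    simp only [Pre, Expr.Ok, Expr.eval, Expr.cost, Op.eval_simps, State.simps,
      Nat.reduceEqDiff, if_true, if_false, true_and, hlog]
    refine ⟨⟨by omega, by omega, by omega⟩, by omega, ⟨by omega, by omega, ?_⟩, by omega⟩
    intro i h1 h2
    rcases Nat.lt_succ_iff_lt_or_eq.1 h2 with h2 | rfl
    · rw [Function.update_of_ne h2.ne]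
      exact hI3 i h1 h2
    · rw [Function.update_self, ← Nat.log_of_one_lt_of_le (by norm_num) hI1]
  · intro t s' hsame ⟨hI1, hI2, hI3⟩ h0 ht
    have e4 : s'.reg rM = m := by rw [hsame.reg 4 rfl rfl]; simpa using h4
    simp only [Expr.eval, Op.eval_simps, e4] at h0
    simp only [Expr.cost, State.simps, if_true] at ht
    have hp := Nat.pow_log_le_self 2 (x := m + 2) (by omega)
    refine ⟨by omega, ?_, ?_, by omega⟩
    · rw [e4]
      exact hI3 _ (by omega) (by omega)
    · exact fun i h1 h2 => hI3 i h1 (by omega)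

/-- Make the root of the forest. -/
def rootCmd : Cmd :=
  .set rK (.lit 0) ;;
  .set rNm (.lit 0) ;;
  .set rArg (.lit 0) ;;
  .put aPn (.reg rK) (.reg rArg) ;;
  .put aAb (.reg rK) (.lit 0) ;;
  newMicroCmd ;;
  .set rK (.lit 1) ;;
  .put aOut (.lit 0) (.reg rRoot) ;;
  .put aNod (.reg rRoot) (.lit 1) ;;
  .put aQu (.lit 0) (.reg rRoot) ;;
  .set rQh (.lit 0) ;;
  .set rQt (.lit 1) ;;
  .set rC (.lit 0) ;;
  .set rFnd (.lit 0) ;;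
  .set rGo (.lit 1)

theorem Forest.root (hv : D v) (h7 : A aOut 0 = v) (h5 : ∀ x, D x → A aNod x = if x = v then 1 else 0)
    (h21 : A aAb 0 = 0) : Forest H N v D A 1 := by
  have hin : ∀ x, InNode A x 0 ↔ x = v := by
    intro x
    simp [InNode, h7]
  refine ⟨by omega, h7, fun i h0 h1 => by omega, h21, ?_, ?_, fun i h0 h1 => by omega,
    fun i h0 h1 => by omega, fun i h0 h1 => by omega, ?_, ?_⟩
  · intro x i hi hx
    obtain rfl : i = 0 := by omega
    rw [hin] at hx
    exact hx ▸ hv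
  · intro x hx i
    rw [h5 x hx]
    by_cases hxv : x = v
    · rw [if_pos hxv]
      constructor
      · intro h
        obtain rfl : i = 0 := by omega
        exact ⟨by omega, (hin x).2 hxv⟩
      · rintro ⟨hi, -⟩
        omega
    · rw [if_neg hxv]
      refine iff_of_false (by omega) ?_
      rintro ⟨hi, hx⟩
      obtain rfl : i = 0 := by omega
      exact hxv ((hin x).1 hx)
  · intro i hi hab
    obtain rfl : i = 0 := by omega
    exact absurd h21 hab
  · intro x i hi hx
    obtain rfl : i = 0 := by omega
    obtain rfl := (hin x).1 hx.inNode
    refine ⟨[], .nil _, by simp, ?_, ?_⟩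
    · intro y hy i' hi' hy' j hj
      obtain rfl : i' = 0 := by omega
      exact hj.1
    · intro j hj
      have : j = 0 := by
        have := hj.1
        cases this with
        | refl => rfl
        | step h => omega
      subst this
      refine ⟨[], [], rfl, ?_, ?_, by simp⟩
      · rw [h7]; exact .nil _
      · rw [h7]; exact .nil _

theorem rootCmd_spec {s : State} (hB : 2 * m + 8 < B) (hb : 0 < b) (h3 : s.reg rRoot = v)
    (h7 : s.reg rB = b) (hv : D v) (h5 : ∀ x, D x → s.arr aNod x = 0) :
    Run B .skip rootCmd s fun t _ s' => LoopInv H N v D m b ex s' ∧ t ≤ 200 ∧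
      remaining m s' ≤ 4000 * (m + 1) := by
  refine Run.of_pre ?_
  simp only [rootCmd, newMicroCmd, Pre, Expr.Ok, Expr.eval, Expr.cost, Op.eval_simps, State.simps,
    Nat.reduceEqDiff, if_true, if_false, true_and, h3, h7, Nat.zero_mul, Nat.zero_add]
  -- For a tree without nodes every condition is vacuous; the root is then a new microtree in the
  -- case `k = 0` of `Micro.newMicro`.
  have hM0 : Micro s.arr b 0 0 := by
    constructor
    all_goals first
      | exact hb
      | exact ⟨fun _ h => absurd h (by omega), fun _ h => absurd h (by omega)⟩
      | (intros; omega)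
  -- Stated for an arbitrary memory, to keep the long composition of assignments out of the
  -- argument.
  have hr : ∀ s' : State, s'.arr aPn = Function.update (s.arr aPn) 0 0 →
      s'.arr aAb = Function.update (s.arr aAb) 0 0 →
      s'.arr aMic = Function.update (s.arr aMic) 0 0 →
      s'.arr aLoc = Function.update (s.arr aLoc) 0 0 →
      s'.arr aAnc = Function.update (s.arr aAnc) 0 1 →
      s'.arr aUnm = Function.update (s.arr aUnm) 0 1 →
      s'.arr aSz = Function.update (s.arr aSz) 0 1 →
      s'.arr aUp = Function.update (s.arr aUp) 0 0 →
      s'.arr aAt = Function.update (s.arr aAt) (0 * b) 0 →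
      s'.arr aLab = Function.update (s.arr aLab) 0 0 →
      s'.arr aHd = Function.update (s.arr aHd) 0 (0 + 1) →
      s'.arr aNx = Function.update (s.arr aNx) 0 0 →
      s'.arr aSsz = Function.update (s.arr aSsz) 0 1 →
      s'.arr aTop = Function.update (s.arr aTop) 0 0 →
      s'.arr aOut 0 = v → s'.arr aNod = Function.update (s.arr aNod) v 1 →
      s'.arr aQu 0 = v → s'.reg rK = 1 → s'.reg rNm = 1 → s'.reg rQh = 0 → s'.reg rQt = 1 →
      s'.reg rC = 0 → s'.reg rFnd = 0 → s'.reg rGo = 1 →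
      LoopInv H N v D m b ex s' ∧ remaining m s' ≤ 4000 * (m + 1) := by
    intro s' a20 a21 a22 a23 a24 a25 a26 a27 a28 a29 a30 a31 a32 a33 a7 a5 a11 r8 r9 r10 r11 r13
      r15 r25
    have hM := hM0.newMicro (A' := s'.arr) (p := 0) (Or.inl rfl) a20 a21 a22 a23 a24 a25 a26 a27
      a28 a29 a30 a31 a32 a33
    have hpot := hM0.potential_newMicro (A' := s'.arr) a26 a29 a32
    have hF : Forest H N v D s'.arr 1 := by
      refine Forest.root hv a7 (fun x hx => ?_) (by rw [a21, Function.update_self])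
      rw [a5, Function.update_apply, h5 x hx]
    have hun : unabsorbed s'.arr 1 = 1 := by
      simp [unabsorbed, hF.ab_zero, Finset.filter_singleton]
    have hQ : Queue s'.arr 1 1 := by
      have hO : OuterAt s'.arr v 0 := Or.inl a7.symm
      refine ⟨?_, ?_, fun a ha a' ha' _ => by omega, by omega⟩
      · intro x i hi hx
        obtain rfl : i = 0 := by omega
        refine ⟨0, by omega, ?_⟩
        rcases hx with hx | ⟨h0, -⟩
        · rw [a11, hx, a7]
        · omega
      · intro a ha
        obtain rfl : a = 0 := by omega
        exact ⟨0, by omega, a11 ▸ hO⟩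
    refine ⟨⟨by rw [r8]; exact hF, Or.inl ⟨r15, ?_, fun h => by omega⟩⟩, ?_⟩
    · rw [r8, r9, r10, r11, r13]
      have hne : ∀ h', ¬ Examined s'.arr 0 0 h' := by
        rintro h' ⟨a, ha, -⟩
        omega
      exact ⟨hF, hM, hQ, by omega, fun h => by omega, fun h hh => by omega,
        fun h' _ he => absurd he (hne h'), fun h' _ he => absurd he (hne h')⟩
    · have h1 : unexamined s'.arr m 0 0 ≤ 2 * m := by
        classical
        rw [unexamined]
        exact (Finset.card_filter_le _ _).trans (by simp)
      have h2 : potential s.arr 0 = 0 := by simp [potential]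
      simp only [Nat.zero_add] at hpot
      simp only [remaining, r8, r9, r10, r11, r13, r25, hun, one_ne_zero, if_false]
      omega
  refine ⟨by omega, by omega, by omega, by omega, by omega, by omega, by omega, by omega, by omega,
    by omega, by omega, by omega, by omega, by omega, by omega, by omega, by omega, by omega,
    by omega, by omega, by omega, by omega, ?_⟩
  refine and_assoc.1 (and_right_comm.1 ⟨hr _ ?_ ?_ ?_ ?_ ?_ ?_ ?_ ?_ ?_ ?_ ?_ ?_ ?_ ?_ ?_ ?_ ?_ ?_
    ?_ ?_ ?_ ?_ ?_ ?_, by omega⟩)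
  all_goals simp [State.setArr_arr]

/-- Prepare a search from `rRoot`. -/
def setupCmd : Cmd :=
  (.skip ;; clearCmd) ;; (.skip ;; fillCmd) ;; (.skip ;; tableCmd) ;; (.skip ;; rootCmd)

theorem setupCmd_spec {s : State} (hB : 2 * m + 8 < B) (h3 : s.reg rRoot = v)
    (h4 : s.reg rM = m) (h5 : s.reg rEx = ex) (hN : s.Holds N)
    (hT : HalfEdges H (s.arr aT) m ex) :
    Run B .skip setupCmd s fun t _ s' =>
      Static H N (Known (s.arr aT) m v) m ex (Nat.log 2 (m + 2)) s' ∧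
      LoopInv H N v (Known (s.arr aT) m v) m (Nat.log 2 (m + 2)) ex s' ∧
      t + remaining m s' ≤ 5000 * (m + 1) := by
  refine Run.of_pre ?_
  simp only [setupCmd, Pre]
  refine (clearCmd_spec (by omega) h4 h3).mono ?_
  rintro t1 tr1 s1 - - hs1 ⟨h1, ht1⟩
  have e4 : s1.reg rM = m := (hs1.reg 4 rfl rfl).trans h4
  have e2 : s1.arr aT = s.arr aT := hs1.arr 2 rfl rfl
  refine (fillCmd_spec (v := v) (by omega) e4 (by rw [e2]; exact fun x hx => (h1 x hx).2)).mono ?_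
  rintro t2 tr2 s2 - - hs2 ⟨h2, ht2⟩
  have e4 : s2.reg rM = m := (hs2.reg 4 rfl rfl).trans e4
  rw [e2] at h2
  refine (tableCmd_spec (by omega) e4).mono ?_
  rintro t3 tr3 s3 - - hs3 ⟨h7, h12, ht3⟩
  have e3 : s3.reg rRoot = v := by rw [hs3.reg 3 rfl rfl, hs2.reg 3 rfl rfl, hs1.reg 3 rfl rfl, h3]
  refine (rootCmd_spec (H := H) (N := N) (ex := ex) (D := Known (s.arr aT) m v) hB
    (Nat.log_pos (by norm_num) (by omega)) e3 h7 (Or.inl rfl) ?_).mono ?_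
  · intro x hx
    rw [hs3.arr 5 rfl rfl, hs2.arr 5 rfl rfl]
    exact (h1 x hx).1
  rintro t4 tr4 s4 - - hs4 ⟨h8, ht4, ht4'⟩
  refine ⟨?_, h8, by omega⟩
  have hA : ∀ a, clearCmd.warr a = false → fillCmd.warr a = false → tableCmd.warr a = false →
      rootCmd.warr a = false → s4.arr a = s.arr a := fun a g1 g2 g3 g4 => by
    rw [hs4.arr a g4 rfl, hs3.arr a g3 rfl, hs2.arr a g2 rfl, hs1.arr a g1 rfl]
  have hS : Static H N (Known (s.arr aT) m v) m ex (Nat.log 2 (m + 2)) s3 := by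
    refine ⟨?_, ?_, ?_, h12, h7, ?_⟩
    · intro x y
      rw [hs3.arr 0 rfl rfl, hs2.arr 0 rfl rfl, hs1.arr 0 rfl rfl]
      exact hN x y
    · rw [hs3.arr 2 rfl rfl, hs2.arr 2 rfl rfl, hs1.arr 2 rfl rfl]
      exact hT
    · obtain ⟨a1, a2, a3, a4, a5⟩ := h2
      constructor <;> simp only [hs3.arr 2 rfl rfl, hs3.arr 3 rfl rfl, hs3.arr 4 rfl rfl] <;>
        assumption
    · rw [hs3.reg 5 rfl rfl, hs2.reg 5 rfl rfl, hs1.reg 5 rfl rfl, h5]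
  exact hS.congr (hs4.arr 0 rfl rfl) (hs4.arr 2 rfl rfl) (hs4.arr 3 rfl rfl) (hs4.arr 4 rfl rfl)
    (hs4.arr 12 rfl rfl) (hs4.reg 7 rfl rfl) (hs4.reg 5 rfl rfl)

end

end DynMatch

namespace DynMatch

section

variable {H : DynGraph} {N : Finset (Sym2 ℕ)} {v : ℕ} {D : ℕ → Prop} {A A' A'' : ℕ → ℕ → ℕ}
  {k m ex b nm B : ℕ}

/-! ### Augmenting -/

/-- Loops whose remaining time is bounded in terms of an invariant `I` with a parameter. -/
theorem Run.loop_fuel {B : ℕ} {sub : Cmd} {e : Expr} {c : Cmd} {s : State}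
    {Q : ℕ → List (State × State) → State → Prop} (hf : c.callFree = true)
    (I : ℕ → State → Prop) (n : ℕ) (hI : I n s)
    (hok : ∀ n s', Same c sub s s' → I n s' → e.Ok B s')
    (step : ∀ n s', Same c sub s s' → I n s' → e.eval s' ≠ 0 →
      Run B sub c s' fun t _ s'' => ∃ n', I n' s'' ∧ e.cost + 1 + t + n' ≤ n)
    (done : ∀ t n' s', Same c sub s s' → I n' s' → e.eval s' = 0 → t ≤ n + (e.cost + 1) →
      Q t [] s') :
    Run B sub (.loop e c) s Q := by
  -- The parameter is not a function of the memory; the least admissible value serves as the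
  -- remaining time.
  have hmin : ∀ s', (∃ n, I n s') → I (sInf {n | I n s'}) s' := fun s' h => Nat.sInf_mem h
  refine Run.loop hf (fun s' => ∃ n, I n s') (fun s' => sInf {n | I n s'}) ⟨n, hI⟩ ?_ ?_ ?_
  · rintro s' hs ⟨n', hn'⟩
    exact hok n' s' hs hn'
  · intro s' hs hn' h0
    refine (step _ s' hs (hmin s' hn') h0).mono ?_
    rintro t tr s'' - - - ⟨n', h1, h2⟩
    have : sInf {n | I n s''} ≤ n' := Nat.sInf_le h1
    exact ⟨⟨n', h1⟩, by omega⟩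
  · intro t s' hs hn' h0 ht
    have : sInf {n | I n s} ≤ n := Nat.sInf_le hI
    exact done t _ s' hs (hmin s' hn') h0 (by omega)

/-- `Trace` together with the list of the unmatched edges of the path. -/
inductive Flips (A : ℕ → ℕ → ℕ) (k : ℕ) : ℕ → ℕ → List ℕ → List (ℕ × ℕ) → Prop
  | nil (s : ℕ) : Flips A k s s [] []
  | grow {s i : ℕ} {l : List ℕ} {U : List (ℕ × ℕ)} (h0 : 0 < i) (hi : i < k)
      (h : Flips A k s (A aPv i) l U) :
      Flips A k s (A aOut i) (l ++ [A aInn i, A aOut i]) ((A aPv i, A aInn i) :: U)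
  | bridge {s i : ℕ} {l₁ l₂ : List ℕ} {U₁ U₂ : List (ℕ × ℕ)} (h0 : 0 < i) (hi : i < k)
      (hab : A aAb i ≠ 0) (h1 : Flips A k (A aOut i) (A aBa i) l₁ U₁)
      (h2 : Flips A k s (A aBb i) l₂ U₂) :
      Flips A k s (A aInn i) (l₂ ++ l₁.reverse ++ [A aOut i, A aInn i])
        ((A aBa i, A aBb i) :: (U₁ ++ U₂))

theorem Trace.exists_flips {s x : ℕ} {l : List ℕ} (h : Trace A k s x l) :
    ∃ U, Flips A k s x l U := by
  induction h with
  | nil => exact ⟨_, .nil _⟩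
  | grow h0 hi _ ih =>
    obtain ⟨U, hU⟩ := ih
    exact ⟨_, .grow h0 hi hU⟩
  | bridge h0 hi hab _ _ ih1 ih2 =>
    obtain ⟨U₁, h1⟩ := ih1
    obtain ⟨U₂, h2⟩ := ih2
    exact ⟨_, .bridge h0 hi hab h1 h2⟩

theorem Flips.trace {s x : ℕ} {l : List ℕ} {U : List (ℕ × ℕ)} (h : Flips A k s x l U) :
    Trace A k s x l := by
  induction h with
  | nil => exact .nil _
  | grow h0 hi _ ih => exact .grow h0 hi ih
  | bridge h0 hi hab _ _ ih1 ih2 => exact .bridge h0 hi hab ih1 ih2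

/-- The list of the ends of the edges in a list. -/
def ends (U : List (ℕ × ℕ)) : List ℕ := U.flatMap fun p => [p.1, p.2]

@[simp] theorem ends_nil : ends [] = [] := rfl

@[simp] theorem ends_cons (p : ℕ × ℕ) (U : List (ℕ × ℕ)) :
    ends (p :: U) = p.1 :: p.2 :: ends U := rfl

@[simp] theorem ends_append (U V : List (ℕ × ℕ)) : ends (U ++ V) = ends U ++ ends V := by
  simp [ends]

theorem mem_ends {U : List (ℕ × ℕ)} {a : ℕ} :
    a ∈ ends U ↔ ∃ p ∈ U, a = p.1 ∨ a = p.2 := by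
  simp [ends]

/-- The unmatched edges of the path cover all of its vertices but the last one. Writing the two mate
entries of each of these edges, in any order and regardless of their direction on the path,
therefore rewrites all mates that have to change. -/
theorem Flips.perm {s x : ℕ} {l : List ℕ} {U : List (ℕ × ℕ)} (h : Flips A k s x l U) :
    (s :: l).Perm (x :: ends U) := by
  induction h with
  | nil => simp
  | @grow s i l U h0 hi _ ih =>
    rw [List.perm_iff_count] at ih ⊢
    intro a
    have := ih a
    simp only [List.count_cons, List.count_append, ends_cons, List.count_nil] at this ⊢
    omega
  | @bridge s i l₁ l₂ U₁ U₂ h0 hi hab _ _ ih1 ih2 =>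
    rw [List.perm_iff_count] at ih1 ih2 ⊢
    intro a
    have h1 := ih1 a
    have h2 := ih2 a
    simp only [List.count_cons, List.count_append, ends_cons, List.count_nil, ends_append,
      List.count_reverse] at h1 h2 ⊢
    omega

/-- Induction on the path that is reversed: its last two vertices are moved to the end of the other
path, after which the connecting edge is the unmatched edge that preceded them. -/
theorem EvenPath.append_reverse_edges {o a : ℕ} {l₁ : List ℕ} {E₁ : List (Sym2 ℕ)}
    (h1 : EvenPath H N o a l₁ E₁) {s c w : ℕ} {l₂ : List ℕ} {E₂ : List (Sym2 ℕ)}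
    (h2 : EvenPath H N s c l₂ E₂) (hca : s(c, a) ∈ H.edges) (hN : s(c, a) ∉ N)
    (how : s(o, w) ∈ N) : ∃ E, EvenPath H N s w (l₂ ++ l₁.reverse ++ [o, w]) E ∧
      (∀ e ∈ E₁, e ∈ E) ∧ (∀ e ∈ E₂, e ∈ E) ∧ s(c, a) ∈ E := by
  induction h1 generalizing c l₂ E₂ with
  | nil => exact ⟨_, by simpa using h2.snoc hca hN how, by simp, by simp +contextual, by simp⟩
  | @snoc x u o' l E h h3 h4 h5 ih =>
    rw [Sym2.eq_swap] at h3 h4 h5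
    obtain ⟨E', hE, hE1, hE2, hE3⟩ := ih (h2.snoc hca hN h5) h3 h4
    refine ⟨E', by simpa using hE, ?_, fun e he => hE2 e (by simp [he]), hE2 _ (by simp)⟩
    intro e he
    simp only [List.mem_append, List.mem_cons, List.not_mem_nil, or_false] at he
    rcases he with he | rfl | rfl
    · exact hE1 e he
    · rw [Sym2.eq_swap]
      exact hE3
    · rw [Sym2.eq_swap]
      exact hE2 _ (by simp)

theorem Flips.evenPath (h : Forest H N v D A k) {s x : ℕ} {l : List ℕ} {U : List (ℕ × ℕ)}
    (ht : Flips A k s x l U) :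
    ∃ E, EvenPath H N s x l E ∧ ∀ p ∈ U, s(p.1, p.2) ∈ E ∧ s(p.1, p.2) ∉ N := by
  induction ht with
  | nil => exact ⟨[], .nil, by simp⟩
  | @grow s i l U h0 hi _ ih =>
    obtain ⟨E, hE, hU⟩ := ih
    refine ⟨_, hE.snoc (h.edge i h0 hi).1 (h.edge i h0 hi).2 (h.matched i h0 hi), ?_⟩
    intro p hp
    rcases List.mem_cons.1 hp with rfl | hp
    · exact ⟨by simp, (h.edge i h0 hi).2⟩
    · exact ⟨by simp [(hU p hp).1], (hU p hp).2⟩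
  | @bridge s i l₁ l₂ U₁ U₂ h0 hi hab _ _ ih1 ih2 =>
    obtain ⟨E1, h1, hU1⟩ := ih1
    obtain ⟨E2, h2, hU2⟩ := ih2
    have hm := h.matched i h0 hi
    rw [Sym2.eq_swap] at hm
    have hb := h.bridge i hi hab
    obtain ⟨hb1, hb2⟩ := hb
    rw [Sym2.eq_swap] at hb1 hb2
    obtain ⟨E, hE, hE1, hE2, hE3⟩ := h1.append_reverse_edges h2 hb1 hb2 hm
    refine ⟨E, hE, ?_⟩
    intro p hp
    simp only [List.mem_cons, List.mem_append] at hp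
    rcases hp with rfl | hp | hp
    · rw [Sym2.eq_swap]
      exact ⟨hE3, hb2⟩
    · exact ⟨hE1 _ (hU1 p hp).1, (hU1 p hp).2⟩
    · exact ⟨hE2 _ (hU2 p hp).1, (hU2 p hp).2⟩

/-- The tasks on the stack: `t` paths, with the list of all of their unmatched edges. -/
inductive Pending (D : ℕ → Prop) (A : ℕ → ℕ → ℕ) (k : ℕ) (Sx Ss : ℕ → ℕ) :
    ℕ → List (ℕ × ℕ) → Prop
  | zero : Pending D A k Sx Ss 0 []
  | succ {t : ℕ} {U V : List (ℕ × ℕ)} {l : List ℕ} (h : Pending D A k Sx Ss t U)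
      (hs : D (Ss t)) (hl : (Ss t :: l).Nodup) (hf : Flips A k (Ss t) (Sx t) l V) :
      Pending D A k Sx Ss (t + 1) (V ++ U)

theorem Pending.congr {Sx Ss Sx' Ss' : ℕ → ℕ} {t : ℕ} {U : List (ℕ × ℕ)}
    (h : Pending D A k Sx Ss t U) (hx : ∀ i < t, Sx' i = Sx i) (hs : ∀ i < t, Ss' i = Ss i) :
    Pending D A k Sx' Ss' t U := by
  induction h with
  | zero => exact .zero
  | @succ t U V l h h1 h2 h3 ih =>
    refine .succ (l := l) (ih (fun i hi => hx i (by omega)) fun i hi => hs i (by omega)) ?_ ?_ ?_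
    · rw [hs t (by omega)]; exact h1
    · rw [hs t (by omega)]; exact h2
    · rw [hs t (by omega), hx t (by omega)]; exact h3

/-- The mates after matching the pairs in `P`. -/
structure Mates (f g : ℕ → ℕ) (P : List (ℕ × ℕ)) : Prop where
  pairs : ∀ p ∈ P, g p.1 = p.2 + 1 ∧ g p.2 = p.1 + 1
  other : ∀ a, a ∉ ends P → g a = f a

theorem Mates.cons {f g : ℕ → ℕ} {P : List (ℕ × ℕ)} (h : Mates f g P) {a c : ℕ} (hac : a ≠ c)
    (ha : a ∉ ends P) (hc : c ∉ ends P) :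
    Mates f (Function.update (Function.update g a (c + 1)) c (a + 1)) ((a, c) :: P) := by
  constructor
  · intro p hp
    rcases List.mem_cons.1 hp with rfl | hp
    · simp [Function.update_apply, hac]
    · have h1 : p.1 ∈ ends P := mem_ends.2 ⟨p, hp, Or.inl rfl⟩
      have h2 : p.2 ∈ ends P := mem_ends.2 ⟨p, hp, Or.inr rfl⟩
      rw [Function.update_of_ne, Function.update_of_ne, Function.update_of_ne,
        Function.update_of_ne]
      · exact h.pairs p hp
      all_goals rintro rfl; contradiction
  · intro x hx
    simp only [ends_cons, List.mem_cons, not_or] at hx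
    rw [Function.update_of_ne hx.2.1, Function.update_of_ne hx.1, h.other x hx.2.2]

notation "rTop" => (30 : ℕ)
notation "rA" => (31 : ℕ)
notation "rZ" => (32 : ℕ)

/-- One step on the path of the topmost task. -/
def augmentStepCmd : Cmd :=
  .set rX (.get aSx (.reg rTop -ₑ .lit 1)) ;;
  .ite (.reg rX =ₑ .get aSs (.reg rTop -ₑ .lit 1)) (.set rTop (.reg rTop -ₑ .lit 1))
    (.set rP (.get aNod (.reg rX) -ₑ .lit 1) ;;
      .ite (.get aOut (.reg rP) =ₑ .reg rX)
        (.set rA (.get aPv (.reg rP)) ;;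
          .set rZ (.get aInn (.reg rP)) ;;
          .put aSx (.reg rTop -ₑ .lit 1) (.reg rA))
        (.set rA (.get aBa (.reg rP)) ;;
          .set rZ (.get aBb (.reg rP)) ;;
          .put aSx (.reg rTop -ₑ .lit 1) (.reg rZ) ;;
          .put aSx (.reg rTop) (.reg rA) ;;
          .put aSs (.reg rTop) (.get aOut (.reg rP)) ;;
          .set rTop (.reg rTop +ₑ .lit 1)) ;;
      .put aMate (.reg rA) (.reg rZ +ₑ .lit 1) ;;
      .put aMate (.reg rZ) (.reg rA +ₑ .lit 1))

/-- Augment along the path that has been found, if any. -/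
def augmentCmd : Cmd :=
  .ite (.reg rFnd =ₑ .lit 0) .skip
    (.put aMate (.reg rX) (.reg rFnd) ;;
      .put aMate (.reg rFnd -ₑ .lit 1) (.reg rX +ₑ .lit 1) ;;
      .put aSx (.lit 0) (.reg rX) ;;
      .put aSs (.lit 0) (.reg rRoot) ;;
      .set rTop (.lit 1) ;;
      .loop (.reg rTop) augmentStepCmd)

/-- The pairs in `P` have been matched, those in `U` are left. -/
def AugInv (D : ℕ → Prop) (A : ℕ → ℕ → ℕ) (k : ℕ) (W : List (ℕ × ℕ)) (n : ℕ) (s : State) : Prop :=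
  ∃ P U, Mates (A aMate) (s.arr aMate) P ∧
    Pending D A k (s.arr aSx) (s.arr aSs) (s.reg rTop) U ∧ (P ++ U).Perm W ∧
    n = 300 * U.length + 100 * s.reg rTop

/-- If the end of the current path was reached by `grow`, the path becomes one unmatched edge
shorter. If it was reached by a bridge, the path falls into two tasks; one of them is traversed in
the other direction, which does not affect its set of unmatched edges. Since the paths are simple,
end and start agree only when nothing is left. An edge is worth 300 units because it may create a
further task, worth 100. -/
theorem augmentStepCmd_spec {W : List (ℕ × ℕ)} {n : ℕ} {s : State} (hF : Forest H N v D A k)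
    (hd : H.Loopless) (hN : H.IsMatching N) (hDB : ∀ x, D x → x + 1 < B) (hW : (ends W).Nodup)
    (hn : n + 1 < B) (hA : ∀ a, 5 ≤ a → a ≤ 10 → s.arr a = A a)
    (hI : AugInv D A k W n s) (h0 : s.reg rTop ≠ 0) :
    Run B .skip augmentStepCmd s fun t _ s' => ∃ n', AugInv D A k W n' s' ∧ 1 + 1 + t + n' ≤ n := by
  obtain ⟨P, U, hM, hP, hperm, hnn⟩ := hI
  have hnod : (ends (P ++ U)).Nodup := by
    have : (ends (P ++ U)).Perm (ends W) := List.Perm.flatMap_right _ hperm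
    exact this.nodup_iff.2 hW
  generalize htop : s.reg rTop = top at hP h0 hnn
  cases hP with
  | zero => exact absurd rfl h0
  | @succ t U V l hP hs hl hf =>
  have hlen := congrArg (· ≤ 0) hnn
  simp only [List.length_append] at hnn
  have hDl : ∀ y ∈ s.arr aSs t :: l, D y := by
    intro y hy
    rcases List.mem_cons.1 hy with rfl | hy
    · exact hs
    · obtain ⟨i, hi, hyi⟩ := hf.trace.inNode y hy
      exact hF.dom y i hi hyi
  have hA5 := hA 5 (by omega) (by omega)
  have hA6 := hA 6 (by omega) (by omega)
  have hA7 := hA 7 (by omega) (by omega)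
  have hA8 := hA 8 (by omega) (by omega)
  have hA9 := hA 9 (by omega) (by omega)
  have hA10 := hA 10 (by omega) (by omega)
  refine Run.of_pre ?_
  simp only [augmentStepCmd, Pre, Expr.Ok, Expr.eval, Expr.cost, Op.eval_simps, State.simps,
    Nat.reduceEqDiff, if_true, if_false, true_and, htop, Nat.add_sub_cancel, hA5, hA6, hA7, hA8,
    hA9, hA10]
  generalize hx : s.arr aSx t = x at hf ⊢
  generalize hst : s.arr aSs t = st at hf hl hDl hs ⊢
  have hmem := hf.trace.mem
  have hxD := hDl x hmem
  cases hf with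
  | nil =>
    refine ⟨by omega, ⟨by omega, by omega⟩, fun _ => ⟨by omega, _, ⟨P, U, hM, ?_, ?_, rfl⟩, ?_⟩,
      fun h => absurd rfl h⟩
    · simpa using hP
    · simpa using hperm
    · simp only [State.simps, if_true]
      simp only [List.length_nil] at hnn
      omega
  | @grow _ i l' V' h0 hi hf =>
    have hne : A aOut i ≠ st := by
      rintro rfl
      simp at hl
    have hnodx : A aNod (A aOut i) = i + 1 := (hF.nod _ hxD i).2 ⟨hi, Or.inl rfl⟩
    have hu : D (A aInn i) := hDl _ (by simp)
    have hpD : D (A aPv i) := by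
      have := hf.trace.mem
      refine hDl _ ?_
      rw [← List.cons_append]
      exact List.mem_append_left _ this
    have hB1 := hDB _ hu
    have hB2 := hDB _ hpD
    simp only [hnodx, Nat.add_sub_cancel]
    refine ⟨by omega, ⟨by omega, by omega⟩, fun h => absurd h hne, fun _ => ⟨by omega, by omega,
      fun _ => ⟨by omega, by omega, by omega, _, ⟨(A aPv i, A aInn i) :: P, V' ++ U, ?_, ?_, ?_,
        rfl⟩, ?_⟩, fun h => absurd rfl h⟩⟩
    · simp only [List.append_assoc, ends_append, ends_cons, List.cons_append, List.nodup_append,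
        List.mem_cons, List.nodup_cons, List.mem_append] at hnod
      refine hM.cons ?_ ?_ ?_
      · intro h
        exact hnod.2.1.1 (by simp [h])
      · exact fun h => hnod.2.2 _ h _ (by simp) rfl
      · exact fun h => hnod.2.2 _ h _ (by simp) rfl
    · have hl' : (st :: l').Nodup := by
        rw [← List.cons_append] at hl
        exact hl.of_append_left
      simp only [State.simps, Nat.reduceEqDiff, if_false, if_true, htop]
      refine .succ (l := l') (hP.congr (fun j hj => ?_) fun _ _ => rfl) ?_ ?_ ?_
      · rw [Function.update_of_ne hj.ne]
      · rwa [hst]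
      · rwa [hst]
      · rwa [hst, Function.update_self]
    · exact (List.perm_middle.symm).trans hperm
    · simp only [State.simps, Nat.reduceEqDiff, if_false, htop, List.length_append]
      simp only [List.length_cons] at hnn
      omega
  | @bridge _ i l₁ l₂ U₁ U₂ h0 hi hab h1 h2 =>
    have hne : A aInn i ≠ st := by
      rintro rfl
      simp at hl
    have hne' : A aOut i ≠ A aInn i := (hF.inn_ne_out hd hN h0 hi).symm
    have hnodx : A aNod (A aInn i) = i + 1 := (hF.nod _ hxD i).2 ⟨hi, Or.inr ⟨h0, rfl⟩⟩
    have ho : D (A aOut i) := hDl _ (by simp)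
    have haD : D (A aBa i) := by
      have := h1.trace.mem
      refine hDl _ ?_
      simp only [List.mem_cons, List.mem_append, List.mem_reverse] at this ⊢
      tauto
    have hbD : D (A aBb i) := by
      have := h2.trace.mem
      refine hDl _ ?_
      rw [List.append_assoc, ← List.cons_append]
      exact List.mem_append_left _ this
    have hB1 := hDB _ haD
    have hB2 := hDB _ hbD
    simp only [hnodx, Nat.add_sub_cancel]
    refine ⟨by omega, ⟨by omega, by omega⟩, fun h => absurd h hne, fun _ => ⟨by omega, by omega,
      fun h => absurd h hne', fun _ => ⟨by omega, by omega, by omega, by omega, _,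
        ⟨(A aBa i, A aBb i) :: P, U₁ ++ (U₂ ++ U), ?_, ?_, ?_, rfl⟩, ?_⟩⟩⟩
    · simp only [List.append_assoc, ends_append, ends_cons, List.cons_append, List.nodup_append,
        List.mem_cons, List.nodup_cons, List.mem_append] at hnod
      refine hM.cons ?_ ?_ ?_
      · intro h
        exact hnod.2.1.1 (by simp [h])
      · exact fun h => hnod.2.2 _ h _ (by simp) rfl
      · exact fun h => hnod.2.2 _ h _ (by simp) rfl
    · have hl2 : (st :: l₂).Nodup := by
        rw [List.append_assoc, ← List.cons_append] at hl
        exact hl.of_append_left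
      have hl1 : (A aOut i :: l₁).Nodup := by
        have h3 : (st :: (l₂ ++ l₁.reverse ++ [A aOut i, A aInn i])) =
            (st :: l₂) ++ ((l₁.reverse ++ [A aOut i]) ++ [A aInn i]) := by simp
        rw [h3] at hl
        have h4 := hl.of_append_right.of_append_left
        rw [← List.reverse_cons] at h4
        exact List.nodup_reverse.1 h4
      simp only [State.simps, Nat.reduceEqDiff, if_false, if_true, htop]
      refine .succ (l := l₁) (.succ (l := l₂) (hP.congr (fun j hj => ?_) fun j hj => ?_) ?_ ?_ ?_)
        ?_ ?_ ?_
      · rw [Function.update_of_ne (by omega), Function.update_of_ne (by omega)]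
      · rw [Function.update_of_ne (by omega)]
      · rwa [Function.update_of_ne (by omega), hst]
      · rwa [Function.update_of_ne (by omega), hst]
      · rwa [Function.update_of_ne (by omega), hst, Function.update_of_ne (by omega),
          Function.update_self]
      · rwa [Function.update_self]
      · rwa [Function.update_self]
      · rwa [Function.update_self, Function.update_self]
    · refine (List.perm_middle.symm).trans ?_
      simpa using hperm
    · simp only [State.simps, Nat.reduceEqDiff, if_false, if_true, htop, List.length_append]
      simp only [List.length_cons, List.length_append] at hnn
      omega

theorem ends_length (U : List (ℕ × ℕ)) : (ends U).length = 2 * U.length := by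
  induction U with
  | nil => rfl
  | cons p U ih => simp [ih]; omega

theorem Flips.length_le {s x : ℕ} {l : List ℕ} {U : List (ℕ × ℕ)} (h : Flips A k s x l U)
    (hl : l.Nodup) : U.length ≤ k := by
  have h1 := h.perm.length_eq
  simp only [List.length_cons, ends_length] at h1
  have h2 : l.toFinset ⊆ (Finset.range k).image (A aOut) ∪ (Finset.range k).image (A aInn) := by
    intro y hy
    obtain ⟨i, hi, hyi⟩ := h.trace.inNode y (List.mem_toFinset.1 hy)
    rw [Finset.mem_union, Finset.mem_image, Finset.mem_image]
    rcases hyi with rfl | ⟨-, rfl⟩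
    · exact Or.inl ⟨i, Finset.mem_range.2 hi, rfl⟩
    · exact Or.inr ⟨i, Finset.mem_range.2 hi, rfl⟩
  have h3 := Finset.card_le_card h2
  have h4 := Finset.card_union_le ((Finset.range k).image (A aOut))
    ((Finset.range k).image (A aInn))
  have h5 := Finset.card_image_le (s := Finset.range k) (f := A aOut)
  have h6 := Finset.card_image_le (s := Finset.range k) (f := A aInn)
  rw [List.toFinset_card_of_nodup hl] at h3
  rw [Finset.card_range] at h5 h6
  omega

theorem augmentCmd_spec {s : State} (hF : Forest H N v D s.arr k)
    (hd : H.Loopless) (hN : H.IsMatching N) (hv : Free N v) (hDB : ∀ x, D x → x + 1 < B)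
    (hBk : 300 * k + 1000 < B) (hh : s.Holds N) (h3 : s.reg rRoot = v) (h8 : s.reg rK = k)
    (hf : Found H N s) (hvH : v ∈ H.verts) :
    Run B .skip augmentCmd s fun t _ s' => t ≤ 300 * k + 500 ∧
      ∃ N', AugmentingSearch H v N N' ∧ s'.Holds N' := by
  obtain ⟨z, hz, ⟨i, hi, hx⟩, hxz, hzf, hzn⟩ := hf
  rw [h8] at hi hzn
  obtain ⟨l, hl⟩ := hF.path _ i hi hx
  obtain ⟨U, hU⟩ := hl.trace.exists_flips
  obtain ⟨E, hE, hUE⟩ := hU.evenPath hF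
  set x := s.reg rX with hxdef
  have hvl : ∀ y ∈ v :: l, ∃ j < k, InNode s.arr y j := by
    intro y hy
    rcases List.mem_cons.1 hy with rfl | hy
    · exact ⟨0, hF.k_pos, hF.inNode_root⟩
    · exact hl.trace.inNode y hy
  have hzl : z ∉ v :: l := fun h => by
    obtain ⟨j, hj, hzj⟩ := hvl z h
    exact hzn j hj hzj
  have hnd : (v :: l ++ [z]).Nodup := by
    rw [List.nodup_append]
    refine ⟨hl.nodup, by simp, ?_⟩
    rintro a ha b hb rfl
    simp only [List.mem_cons, List.not_mem_nil, or_false] at hb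
    exact hzl (hb ▸ ha)
  obtain ⟨p, hp, -, hpe⟩ := hE.exists_augmenting hd hN.1 hnd hxz hv hzf
  obtain ⟨hN', -, -⟩ := hp.symmDiff hd hN
  have hUlen := hU.length_le (List.nodup_cons.1 hl.nodup).2
  have hxD : D x := hF.dom x i hi hx.inNode
  have hxB := hDB x hxD
  have hvD : D v := hF.dom v 0 hF.k_pos hF.inNode_root
  have hxz' : x ≠ z := fun h => hzn i hi (h ▸ hx.inNode)
  -- Together with the final edge `xz` the unmatched edges cover each vertex of the augmenting path
  -- exactly once.
  have hperm : (ends ((x, z) :: U)).Perm (v :: l ++ [z]) := by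
    have h1 := hU.perm
    rw [List.perm_iff_count] at h1 ⊢
    intro a
    have := h1 a
    simp only [List.count_cons, List.count_append, ends_cons, List.count_nil] at this ⊢
    omega
  have hWnd : (ends ((x, z) :: U)).Nodup := hperm.nodup_iff.2 hnd
  have hxzN : s(x, z) ∉ N := fun h => hzf _ h (by simp)
  have hWE : ∀ q ∈ (x, z) :: U, s(q.1, q.2) ∈ symmDiff N p.edges.toFinset := by
    intro q hq
    rw [hpe, Finset.mem_symmDiff]
    right
    rcases List.mem_cons.1 hq with rfl | hq
    · exact ⟨by simp, hxzN⟩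
    · exact ⟨by simp [(hUE q hq).1], (hUE q hq).2⟩
  have hoff : ∀ a, a ∉ ends ((x, z) :: U) → ∀ c,
      s(a, c) ∈ symmDiff N p.edges.toFinset ↔ s(a, c) ∈ N := by
    intro a ha c
    have h1 : s(a, c) ∉ p.edges.toFinset := by
      intro h1
      rw [List.mem_toFinset, hpe, List.mem_append] at h1
      refine ha (hperm.mem_iff.2 ?_)
      rw [List.mem_append]
      rcases h1 with h1 | h1
      · exact Or.inl (hE.mem_of_mem_edges h1 (by simp))
      · simp only [List.mem_cons, List.not_mem_nil, or_false] at h1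
        have h2 : a ∈ s(x, z) := h1 ▸ (by simp)
        rcases Sym2.mem_iff.1 h2 with rfl | rfl
        · exact Or.inl hE.mem_cons
        · exact Or.inr (by simp)
    rw [Finset.mem_symmDiff]
    tauto
  refine Run.of_pre ?_
  simp only [augmentCmd, Pre, Expr.Ok, Expr.eval, Expr.cost, Op.eval_simps, State.simps,
    Nat.reduceEqDiff, if_true, if_false, true_and, hz, Nat.add_sub_cancel, ← hxdef, h3]
  refine ⟨⟨by omega, by omega⟩, fun h => h.elim, fun _ => ⟨by omega, by omega,
    by omega, by omega, by omega, ?_⟩⟩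
  refine Run.loop_fuel rfl (fun n s' => AugInv D s.arr k ((x, z) :: U) n s' ∧
    n ≤ 300 * U.length + 100) (300 * U.length + 100) ?_ ?_ ?_ ?_
  · refine ⟨⟨[(x, z)], U, ?_, ?_, by simp, by simp⟩, le_rfl⟩
    · have h0 : Mates (s.arr aMate) (s.arr aMate) [] := ⟨by simp, fun _ _ => rfl⟩
      exact h0.cons hxz' (by simp) (by simp)
    · simp only [State.simps, Nat.reduceEqDiff, if_false, if_true]
      rw [← List.append_nil U]
      refine .succ (l := l) .zero ?_ ?_ ?_
      · simpa using hvD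
      · simpa using hl.nodup
      · simpa using hU
  · intro n s' _ _
    trivial
  · intro n s' hsame ⟨hI, hn⟩ h0
    refine (augmentStepCmd_spec hF hd hN hDB hWnd (n := n) (by omega) ?_ hI h0).mono ?_
    · intro a h1 h2
      have ha : (Cmd.loop (.reg rTop) augmentStepCmd).warr a = false := by
        interval_cases a <;> rfl
      rw [hsame.arr a ha rfl]
      simp [State.setArr_arr, show a ≠ 0 by omega, show a ≠ 13 by omega, show a ≠ 14 by omega]
    · rintro t tr s'' - - - ⟨n', h1, h2⟩
      exact ⟨n', ⟨h1, by omega⟩, by simp only [Expr.cost]; omega⟩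
  · intro t n' s' hsame ⟨⟨P, U', hM, hP, hpm, _⟩, _⟩ h0 ht
    simp only [Expr.eval] at h0
    rw [h0] at hP
    cases hP
    rw [List.append_nil] at hpm
    have he : ∀ a, a ∈ ends P ↔ a ∈ ends ((x, z) :: U) := fun a =>
      (List.Perm.flatMap_right _ hpm).mem_iff
    simp only [Expr.cost] at ht
    refine ⟨by omega, _, ⟨hvH, hN, hv, Or.inl ⟨z, p, hp, rfl⟩⟩, ?_⟩
    intro a c
    -- On the path, the entry written is an edge of the new matching, and partners are unique. Off
    -- the path, neither the array nor the matching has changed.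
    by_cases ha : a ∈ ends P
    · have key : ∀ d, s'.arr aMate a = d + 1 → s(a, d) ∈ symmDiff N p.edges.toFinset →
          (s'.arr aMate a = c + 1 ↔ s(a, c) ∈ symmDiff N p.edges.toFinset) := by
        intro d h1 h2
        constructor
        · intro h3
          obtain rfl : c = d := by omega
          exact h2
        · intro h3
          rw [hN'.eq_right h3 h2, h1]
      obtain ⟨q, hq, hqa⟩ := mem_ends.1 ha
      have h1 := hWE q (hpm.mem_iff.1 hq)
      obtain ⟨h2, h3⟩ := hM.pairs q hq
      rcases hqa with rfl | rfl
      · exact key _ h2 h1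
      · rw [Sym2.eq_swap] at h1
        exact key _ h3 h1
    · rw [hoff a (fun h => ha ((he a).2 h)), ← hh a c]
      rw [hM.other a ha]

end

end DynMatch

namespace DynMatch

section

variable {H G : DynGraph} {N : Finset (Sym2 ℕ)} {v : ℕ} {m ex B : ℕ}

/-! ### The search subroutine -/

/-- Search for an augmenting path from the vertex `rRoot` in the stored graph without the vertex
`rEx - 1`, and augment along such a path. -/
def searchCmd : Cmd := (.skip ;; setupCmd) ;; (.skip ;; mainCmd) ;; (.skip ;; augmentCmd)

/-- The 5000 units per edge of the setup include the budget with which the main loop starts. The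
augmentation adds `300 * k + 500`, where `k ≤ m + 1`. -/
theorem searchCmd_spec {s : State} (hB : (m + 200) * (m + 200) < B) (hd : H.Loopless)
    (hN : H.IsMatching N) (hvH : v ∈ H.verts) (hv : Free N v) (hvx : v + 1 ≠ ex)
    (hNm : N.card ≤ m) (hh : s.Holds N) (hT : HalfEdges H (s.arr aT) m ex)
    (hTB : ∀ h < 2 * m, s.arr aT h + 1 < B) (hvB : v + 1 < B) (h3 : s.reg rRoot = v)
    (h4 : s.reg rM = m) (h5 : s.reg rEx = ex) :
    Run B .skip searchCmd s fun t _ s' => t ≤ 7000 * (m + 1) ∧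
      ∃ N', AugmentingSearch H v N N' ∧ s'.Holds N' := by
  have hB1 : (m + 4) * (m + 4) < B :=
    lt_of_le_of_lt (Nat.mul_le_mul (by omega) (by omega)) hB
  have hB2 : 400 * m + 40000 < B := by nlinarith
  refine Run.of_pre ?_
  simp only [searchCmd, Pre]
  refine (setupCmd_spec (H := H) (N := N) (by omega) h3 h4 h5 hh hT).mono ?_
  rintro t1 tr1 s1 - - hs1 ⟨hS, hI, ht1⟩
  have e2 : s1.arr aT = s.arr aT := hs1.arr 2 rfl rfl
  refine (mainCmd_spec rfl hB1 hd hN hv hvx hNm hS hI (by rwa [e2])).mono ?_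
  rintro t2 tr2 s2 - - hs2 ⟨ht2, hres⟩
  have hh2 : s2.Holds N := by
    intro x y
    rw [hs2.arr 0 rfl rfl, hs1.arr 0 rfl rfl]
    exact hh x y
  have e3 : s2.reg rRoot = v := by rw [hs2.reg 3 rfl rfl, hs1.reg 3 rfl rfl, h3]
  rcases hres with ⟨hf, hno⟩ | ⟨hF, hf⟩
  · refine Run.of_pre ?_
    simp only [augmentCmd, Pre, Expr.Ok, Expr.eval, Expr.cost, Op.eval_simps, hf, ne_eq,
      not_true_eq_false, false_implies, true_implies, and_true, true_and]
    exact ⟨⟨by omega, by omega⟩, fun _ => ⟨by omega, N, ⟨hvH, hN, hv, Or.inr ⟨hno, rfl⟩⟩, hh2⟩⟩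
  · have hk := hF.card_le
    refine (augmentCmd_spec hF hd hN hv ?_ (by omega) hh2 e3 rfl hf hvH).mono ?_
    · rintro x (rfl | ⟨h, hh, rfl⟩)
      · exact hvB
      · exact hTB h hh
    · rintro t3 tr3 s3 - - - ⟨ht3, hN'⟩
      exact ⟨by omega, hN'⟩

theorem searchCmd_callFree : searchCmd.callFree = true := rfl

/-- The `j`-th edge of a list of half-edges. -/
def edgeAt (T : ℕ → ℕ) (j : ℕ) : Sym2 ℕ := s(T (2 * j), T (2 * j + 1))

/-- `T` lists the `m` edges in `E`, each of them once. -/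
structure Lists (T : ℕ → ℕ) (m : ℕ) (E : Finset (Sym2 ℕ)) : Prop where
  mem : ∀ j < m, edgeAt T j ∈ E
  exists_eq : ∀ e ∈ E, ∃ j < m, edgeAt T j = e
  inj : ∀ i < m, ∀ j < m, edgeAt T i = edgeAt T j → i = j

theorem Lists.card_eq {T : ℕ → ℕ} {E : Finset (Sym2 ℕ)} (h : Lists T m E) : E.card = m := by
  have h1 : E = (Finset.range m).image (edgeAt T) := by
    ext e
    simp only [Finset.mem_image, Finset.mem_range]
    exact ⟨fun he => h.exists_eq e he, fun ⟨j, hj, he⟩ => he ▸ h.mem j hj⟩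
  rw [h1, Finset.card_image_of_injOn, Finset.card_range]
  intro i hi j hj hij
  exact h.inj i (by simpa using hi) j (by simpa using hj) hij

theorem edgeAt_half (T : ℕ → ℕ) (h : ℕ) : edgeAt T (h / 2) = s(T h, T (h ^^^ 1)) := by
  have h1 := xor_one_div_two h
  have h2 : h ^^^ 1 ≠ h := by
    intro h1
    have h2 : h ^^^ h ^^^ 1 = h ^^^ h := by
      rw [Nat.xor_assoc, h1]
    simp at h2
  rw [edgeAt]
  rcases Nat.mod_two_eq_zero_or_one h with h3 | h3
  · rw [show 2 * (h / 2) + 1 = h ^^^ 1 by omega, show 2 * (h / 2) = h by omega]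
  · rw [show 2 * (h / 2) + 1 = h by omega, show 2 * (h / 2) = h ^^^ 1 by omega, Sym2.eq_swap]

/-- A vertex is removed for a search without touching the list: edges at the vertex `ex - 1` are
skipped. As names are shifted by one, `ex = 0` removes nothing. -/
theorem Lists.halfEdges {T : ℕ → ℕ} (h : Lists T m G.edges) {S : Finset ℕ}
    (hS : ∀ x, x ∈ S ↔ x + 1 = ex) : HalfEdges (G.removeVerts S) T m ex := by
  have hex : ∀ x y, (∀ z ∈ S, z ∉ s(x, y)) ↔ x + 1 ≠ ex ∧ y + 1 ≠ ex := by
    intro x y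
    constructor
    · intro h1
      exact ⟨fun h2 => h1 x ((hS x).2 h2) (by simp), fun h2 => h1 y ((hS y).2 h2) (by simp)⟩
    · rintro ⟨h1, h2⟩ z hz hzx
      rw [hS] at hz
      rcases Sym2.mem_iff.1 hzx with rfl | rfl
      · exact h1 hz
      · exact h2 hz
  intro x y
  rw [DynGraph.mem_removeVerts, hex]
  constructor
  · rintro ⟨h1, h2⟩
    obtain ⟨j, hj, he⟩ := h.exists_eq _ h1
    have h3 : (2 * j) / 2 = j := by omega
    have h4 : (2 * j + 1) / 2 = j := by omega
    rw [edgeAt] at he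
    have h5 := edgeAt_half T (2 * j)
    have h6 := edgeAt_half T (2 * j + 1)
    have h7 := xor_one_div_two (2 * j)
    have h8 := xor_one_div_two (2 * j + 1)
    have h9 : ∀ h, h ^^^ 1 ≠ h := by
      intro h h1
      have h2 : h ^^^ h ^^^ 1 = h ^^^ h := by
        rw [Nat.xor_assoc, h1]
      simp at h2
    have h10 := h9 (2 * j)
    have h11 := h9 (2 * j + 1)
    have e1 : 2 * j ^^^ 1 = 2 * j + 1 := by omega
    have e2 : (2 * j + 1) ^^^ 1 = 2 * j := by omega
    rcases Sym2.eq_iff.1 he with ⟨h5, h6⟩ | ⟨h5, h6⟩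
    · exact ⟨2 * j, by omega, h5, by rw [e1, h6], h2⟩
    · exact ⟨2 * j + 1, by omega, h6, by rw [e2, h5], h2⟩
  · rintro ⟨h', hh, h1, h2, h3⟩
    refine ⟨?_, h3⟩
    have := h.mem (h' / 2) (by omega)
    rwa [edgeAt_half, h1, h2] at this

/-- The graph `G` is stored in the memory `s`, with words smaller than `B`. -/
structure Stored (B : ℕ) (G : DynGraph) (s : State) : Prop where
  lists : Lists (s.arr aT) (s.reg rM) G.edges
  loopless : G.Loopless
  ends_mem : ∀ e ∈ G.edges, ∀ x ∈ e, x ∈ G.verts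
  small : ∀ x ∈ G.verts, x + 1 < B
  size : (G.edges.card + 200) * (G.edges.card + 200) < B

theorem Stored.congr {s s' : State} (h : Stored B G s) (h2 : s'.arr aT = s.arr aT)
    (h4 : s'.reg rM = s.reg rM) : Stored B G s' := by
  obtain ⟨g1, g2, g3, g4, g5⟩ := h
  exact ⟨by rwa [h2, h4], g2, g3, g4, g5⟩

/-- The program `c` runs the search subroutine and leaves the record `g` of calls. -/
def Searches (B K : ℕ) (sub c : Cmd) (g : State → State → List (State × State)) : Prop :=
  ∀ (G : DynGraph) (S : Finset ℕ) (N : Finset (Sym2 ℕ)) (v ex : ℕ) (s : State), Stored B G s →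
    (∀ x, x ∈ S ↔ x + 1 = ex) → s.reg rEx = ex → s.reg rRoot = v → v ∈ G.verts → v ∉ S →
    (G.removeVerts S).IsMatching N → Free N v → s.Holds N →
    Run B sub c s fun t tr s' => tr = g s s' ∧ t ≤ K * (G.edges.card + 1) ∧
      (∀ r, searchCmd.wreg r = false → s'.reg r = s.reg r) ∧
      (∀ a, searchCmd.warr a = false → s'.arr a = s.arr a) ∧
      ∃ N', AugmentingSearch (G.removeVerts S) v N N' ∧ s'.Holds N'

theorem Run.of_callFree {sub c : Cmd} {s : State}
    {Q : ℕ → List (State × State) → State → Prop} (hf : c.callFree = true)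
    (h : Run B .skip c s Q) : Run B sub c s fun t tr s' => tr = [] ∧ Q t [] s' := by
  intro hs
  obtain ⟨t, tr, s', he, hb, hq⟩ := h hs
  obtain ⟨rfl, he'⟩ := he.same_of_callFree hf
  exact ⟨t, [], s', he' sub, hb, rfl, hq⟩

/-- The inlined search leaves no record. It serves the preprocessing, where the loop rule wants a
body without calls. -/
theorem searches_searchCmd (B : ℕ) : Searches B 7000 searchCmd searchCmd fun _ _ => [] := by
  intro G S N v ex s hst hS h5 h3 hvG hvS hN hv hh
  have hm := hst.lists.card_eq
  have hT := hst.lists.halfEdges hS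
  have hTB : ∀ h < 2 * s.reg rM, s.arr aT h + 1 < B := by
    intro h hh
    have h1 := hst.lists.mem (h / 2) (by omega)
    rw [edgeAt_half] at h1
    exact hst.small _ (hst.ends_mem _ h1 _ (by simp))
  have hNm : N.card ≤ s.reg rM := by
    rw [← hm]
    exact Finset.card_le_card (DynGraph.IsMatching.of_removeVerts hN).1
  refine (Run.of_callFree searchCmd_callFree (searchCmd_spec (m := s.reg rM) (ex := ex)
    (by rw [← hm]; exact hst.size) (hst.loopless.removeVerts S) hN
    (Finset.mem_sdiff.2 ⟨hvG, hvS⟩) hv (fun h => hvS ((hS v).2 h)) hNm hh hT hTB (hst.small v hvG)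
    h3 rfl h5)).mono ?_
  rintro t tr s' - - hsame ⟨htr, ht, hN'⟩
  rw [hm]
  exact ⟨htr, by omega, fun r hr => hsame.reg r hr hr, fun a ha => hsame.arr a ha ha, hN'⟩

/-- The call costs one step more than its body and leaves exactly one record; this is the version
used for updates. -/
theorem searches_call (B : ℕ) : Searches B 7001 searchCmd .call fun s s' => [(s, s')] := by
  intro G S N v ex s hst hS h5 h3 hvG hvS hN hv hh
  refine Run.call searchCmd_callFree ?_
  refine (searches_searchCmd B G S N v ex s hst hS h5 h3 hvG hvS hN hv hh).mono ?_
  rintro t tr s' - - - ⟨-, ht, h1, h2, h3⟩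
  exact ⟨rfl, by omega, h1, h2, h3⟩

end

end DynMatch

namespace DynMatch

section

/-! ### Matchings under updates -/

variable {G H : DynGraph} {M N : Finset (Sym2 ℕ)} {B K : ℕ}

theorem DynGraph.removeVerts_empty (G : DynGraph) : G.removeVerts ∅ = G := by
  cases G
  simp [DynGraph.removeVerts]

theorem DynGraph.removeVerts_edges_congr (he : H.edges = G.edges) {S : Finset ℕ} :
    (H.removeVerts S).edges = (G.removeVerts S).edges := by
  rw [DynGraph.removeVerts, DynGraph.removeVerts, he]

theorem DynGraph.IsMaxMatching.congr (h : G.IsMaxMatching M) (he : H.edges = G.edges) :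
    H.IsMaxMatching M := by
  simpa only [DynGraph.IsMaxMatching, DynGraph.IsMatching, he] using h

theorem DynGraph.IsMaxMatching.anti (h : G.IsMaxMatching M) (he : H.edges ⊆ G.edges)
    (hM : M ⊆ H.edges) : H.IsMaxMatching M :=
  ⟨⟨hM, h.1.2⟩, fun N hN => h.2 N ⟨hN.1.trans he, hN.2⟩⟩

theorem DynGraph.IsMaxMatching.removeVerts_singleton (h : G.IsMaxMatching M) {x : ℕ}
    (hx : Free M x) : (G.removeVerts {x}).IsMaxMatching M :=
  ⟨h.1.removeVerts (by simpa using hx), fun N hN => h.2 N hN.of_removeVerts⟩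

theorem DynGraph.IsMatching.free_erase (hM : G.IsMatching M) {x y : ℕ} (h : s(x, y) ∈ M) :
    Free (M.erase s(x, y)) x ∧ Free (M.erase s(x, y)) y :=
  ⟨fun e he hx => (Finset.mem_erase.1 he).1
      (hM.2 _ (Finset.mem_erase.1 he).2 _ h x hx (by simp)),
    fun e he hx => (Finset.mem_erase.1 he).1
      (hM.2 _ (Finset.mem_erase.1 he).2 _ h y hx (by simp))⟩

/-- Deleting a matched edge from a maximum matching leaves a maximum matching of the graph
without the ends of the edge. -/
theorem DynGraph.IsMaxMatching.erase (h : G.IsMaxMatching M) {x y : ℕ} (hxy : s(x, y) ∈ M)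
    (he : H.edges = ((G.removeVerts {x}).removeVerts {y}).edges) :
    H.IsMaxMatching (M.erase s(x, y)) := by
  have hf := h.1.free_erase hxy
  refine DynGraph.IsMaxMatching.congr (G := (G.removeVerts {x}).removeVerts {y}) ⟨?_, ?_⟩ he
  · exact ((h.1.erase _).removeVerts (by simpa using hf.1)).removeVerts (by simpa using hf.2)
  · intro N hN
    have h1 := hN.free_of_removeVerts (Finset.mem_singleton_self y)
    have h2 := hN.of_removeVerts.free_of_removeVerts (Finset.mem_singleton_self x)
    -- A competitor avoids both ends of `xy`, so it can be enlarged by this edge and then compared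
    -- with `M`.
    have h3 := h.2 _ (hN.of_removeVerts.of_removeVerts.insert (h.1.1 hxy) h2 h1)
    have h4 : s(x, y) ∉ N := fun h => h2 _ h (by simp)
    rw [Finset.card_insert_of_notMem h4] at h3
    rw [Finset.card_erase_of_mem hxy]
    omega

/-- An inserted edge with free ends extends a maximum matching. -/
theorem DynGraph.IsMaxMatching.insert (h : G.IsMaxMatching M) {x y : ℕ}
    (he : H.edges = insert s(x, y) G.edges) (hx : Free M x) (hy : Free M y) :
    H.IsMaxMatching (insert s(x, y) M) := by
  have h1 : H.IsMatching M := ⟨fun e hm => by rw [he]; exact Finset.mem_insert_of_mem (h.1.1 hm),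
    h.1.2⟩
  refine ⟨h1.insert (by rw [he]; exact Finset.mem_insert_self _ _) hx hy, fun N hN => ?_⟩
  have h2 : s(x, y) ∉ M := fun h => hx _ h (by simp)
  rw [Finset.card_insert_of_notMem h2]
  have h3 : G.IsMatching (N.erase s(x, y)) := by
    refine ⟨fun e hm => ?_, (hN.erase _).2⟩
    have h4 := Finset.mem_erase.1 hm
    have h5 := hN.1 h4.2
    rw [he] at h5
    exact Finset.mem_of_mem_insert_of_ne h5 h4.1
  have := h.2 _ h3
  have := Finset.pred_card_le_card_erase (s := N) (a := s(x, y))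
  omega

theorem State.Holds.free_iff {s : State} (h : s.Holds M) {x : ℕ} :
    Free M x ↔ s.arr aMate x = 0 := by
  constructor
  · intro hf
    by_contra h0
    obtain ⟨y, hy⟩ := Nat.exists_eq_succ_of_ne_zero h0
    exact hf _ ((h x y).1 hy) (by simp)
  · intro h0
    by_contra hf
    obtain ⟨y, hy⟩ := not_free_iff.1 hf
    have := (h x y).2 hy
    omega

theorem State.Holds.erase {s s' : State} (h : s.Holds M) (hM : G.IsMatching M) {x y : ℕ}
    (hxy : s(x, y) ∈ M)
    (hs : ∀ z, s'.arr aMate z = if z = y then 0 else if z = x then 0 else s.arr aMate z) :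
    s'.Holds (M.erase s(x, y)) := by
  have hf := hM.free_erase hxy
  intro z u
  rw [hs]
  split_ifs with h1 h2
  · subst h1
    exact ⟨fun h => by simp at h, fun h => absurd (by simp) (hf.2 _ h)⟩
  · subst h2
    exact ⟨fun h => by simp at h, fun h => absurd (by simp) (hf.1 _ h)⟩
  · rw [h z u, Finset.mem_erase, and_iff_right]
    intro h3
    rcases Sym2.eq_iff.1 h3 with h4 | h4 <;> omega

theorem State.Holds.insert {s s' : State} (h : s.Holds M) {x y : ℕ} (hne : x ≠ y)
    (hx : Free M x) (hy : Free M y)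
    (hs : ∀ z, s'.arr aMate z = if z = y then x + 1 else if z = x then y + 1
      else s.arr aMate z) :
    s'.Holds (insert s(x, y) M) := by
  intro z u
  rw [hs, Finset.mem_insert]
  split_ifs with h1 h2
  · subst h1
    have h3 : s(z, u) ∉ M := fun h => hy _ h (by simp)
    rw [or_iff_left h3, Sym2.eq_iff]
    omega
  · subst h2
    have h3 : s(z, u) ∉ M := fun h => hx _ h (by simp)
    rw [or_iff_left h3, Sym2.eq_iff]
    omega
  · rw [h z u, or_iff_right]
    intro h3
    rcases Sym2.eq_iff.1 h3 with h4 | h4 <;> omega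

theorem AgreeOff.erase {T : Finset ℕ} {x y : ℕ} (hx : x ∈ T) :
    AgreeOff T M (M.erase s(x, y)) := by
  intro e he
  rw [Finset.mem_erase, iff_and_self]
  rintro - rfl
  exact he x hx (by simp)

theorem AgreeOff.insert {T : Finset ℕ} {x y : ℕ} (hx : x ∈ T) :
    AgreeOff T M (insert s(x, y) M) := by
  intro e he
  rw [Finset.mem_insert, or_iff_right]
  rintro rfl
  exact he x hx (by simp)

theorem AgreeOff.refl (T : Finset ℕ) (M : Finset (Sym2 ℕ)) : AgreeOff T M M := fun _ _ => Iff.rfl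

/-! ### Searches within updates -/

/-- The memory stores `G` and a maximum matching, into which the matching `M` has been turned by
at most two searches. -/
def Updated (B : ℕ) (G : DynGraph) (T : Finset ℕ) (R : Set ℕ) (M : Finset (Sym2 ℕ))
    (g : State → State → List (State × State)) (tr : List (State × State)) (s : State) : Prop :=
  Stored B G s ∧ ∃ M', s.Holds M' ∧ G.IsMaxMatching M' ∧
    ((∀ a b, g a b = [(a, b)]) → tr.length ≤ 2 ∧ SearchLog G T R M tr M')

variable {sub c : Cmd} {g : State → State → List (State × State)} {T : Finset ℕ} {R : Set ℕ}

theorem Updated.nil {s : State} (hst : Stored B G s) (hh : s.Holds N) (hN : G.IsMaxMatching N)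
    (hT : AgreeOff T M N) : Updated B G T R M g [] s :=
  ⟨hst, N, hh, hN, fun _ => ⟨by simp, hT⟩⟩

/-- Restores the one vertex whose absence makes `N` maximum. The excluded set is empty here, encoded
by `0` in the register `rEx`. -/
theorem Searches.one (hc : Searches B K sub c g) {s : State} {v : ℕ} (hst : Stored B G s)
    (h5 : s.reg rEx = 0) (h3 : s.reg rRoot = v) (hv : v ∈ G.verts)
    (hN : (G.removeVerts {v}).IsMaxMatching N) (hh : s.Holds N) (hT : AgreeOff T M N)
    (hR : v ∈ R) :
    Run B sub c s fun t tr s' => tr = g s s' ∧ t ≤ K * (G.edges.card + 1) ∧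
      Updated B G T R M g tr s' := by
  have h := hc G ∅ N v 0 s hst (by simp) h5 h3 hv (by simp)
    (by rw [DynGraph.removeVerts_empty]; exact hN.1.of_removeVerts)
    (hN.1.free_of_removeVerts (by simp)) hh
  refine h.mono ?_
  rintro t tr s' - - - ⟨rfl, ht, hr, ha, N', hN', hh'⟩
  refine ⟨rfl, ht, hst.congr (ha _ rfl) (hr _ rfl), N', hh', ?_, fun hg => ?_⟩
  · have h1 := hN'.isMaxMatching (hst.loopless.removeVerts _)
    rw [DynGraph.removeVerts_empty] at h1
    exact h1 hN
  · rw [hg]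
    refine ⟨by simp, ∅, by simp, N, N', hT, hh, hh', ?_, ?_, AgreeOff.refl _ _⟩
    · rwa [h3]
    · rwa [h3]

/-- The two missing vertices return one after the other. The search from `y` ignores `x` and gives a
maximum matching of the graph without `x`; this is what the search from `x` in the whole graph
needs. The register `r` keeps `x` while the first search runs. -/
theorem Searches.two (hc : Searches B K sub c g) {s : State} {x y r : ℕ} (hst : Stored B G s)
    (hr : searchCmd.wreg r = false) (hr5 : r ≠ rEx) (hB : 1 < B)
    (h5 : s.reg rEx = x + 1) (h3 : s.reg rRoot = y) (hrx : s.reg r = x) (hx : x ∈ G.verts)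
    (hy : y ∈ G.verts) (hxy : y ≠ x)
    (hN : ((G.removeVerts {x}).removeVerts {y}).IsMaxMatching N) (hh : s.Holds N)
    (hT : AgreeOff T M N) (hxT : x ∈ T) (hxR : x ∈ R) (hyR : y ∈ R) :
    Run B sub (c ;; .set rEx (.lit 0) ;; .set rRoot (.reg r) ;; .skip ;; c) s fun t tr s' =>
      t ≤ 2 * K * (G.edges.card + 1) + 10 ∧ Updated B G T R M g tr s' := by
  have hS : ∀ z, z ∈ ({x} : Finset ℕ) ↔ z + 1 = x + 1 := by simp
  have h := hc G {x} N y (x + 1) s hst hS h5 h3 hy (by simpa using hxy)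
    hN.1.of_removeVerts (hN.1.free_of_removeVerts (by simp)) hh
  refine Run.seq (h.mono ?_)
  rintro t tr s' - - - ⟨rfl, ht, hr', ha', N1, hN1, hh1⟩
  refine Run.of_pre ?_
  simp only [Pre, Expr.Ok, Expr.eval, Expr.cost]
  refine ⟨by omega, trivial, ?_⟩
  have hst' := hst.congr (ha' _ rfl) (hr' _ rfl)
  have hmax := hN1.isMaxMatching (hst.loopless.removeVerts _) hN
  have h2 := hc.one (g := g) (T := T) (R := R) (M := N1) (N := N1) (v := x)
    (s := (s'.setReg rEx 0).setReg rRoot ((s'.setReg rEx 0).reg r))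
    (hst'.congr rfl (by simp)) (by simp) (by simp [hr5, hr' r hr, hrx]) hx hmax
    (by simpa [State.Holds] using hh1) (AgreeOff.refl _ _) hxR
  refine h2.mono ?_
  rintro t2 tr2 s2 - - - ⟨htr2, ht2, hst2, M', hh2, hM', hlog⟩
  refine ⟨by nlinarith, hst2, M', hh2, hM', fun hg => ?_⟩
  obtain ⟨hl, h2⟩ := hlog hg
  rw [hg] at htr2
  subst htr2
  rw [hg]
  refine ⟨by simp, {x}, by simpa using hxT, N, N1, hT, hh, hh1, by rwa [h3], by rwa [h3], h2⟩

end

end DynMatch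

namespace DynMatch

section

/-! ### Editing the list of edges -/

variable {E E' : Finset (Sym2 ℕ)} {T T' : ℕ → ℕ} {B m : ℕ} {sub : Cmd}

theorem Lists.snoc (h : Lists T m E) {e : Sym2 ℕ} (he : e ∉ E)
    (hT : ∀ j < m, edgeAt T' j = edgeAt T j) (hm : edgeAt T' m = e) :
    Lists T' (m + 1) (insert e E) := by
  refine ⟨fun j hj => ?_, fun f hf => ?_, fun i hi j hj hij => ?_⟩
  · rcases Nat.lt_succ_iff_lt_or_eq.1 hj with h1 | rfl
    · rw [hT j h1]
      exact Finset.mem_insert_of_mem (h.mem j h1)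
    · rw [hm]
      exact Finset.mem_insert_self _ _
  · rcases Finset.mem_insert.1 hf with rfl | hf
    · exact ⟨m, by omega, hm⟩
    · obtain ⟨j, hj, rfl⟩ := h.exists_eq f hf
      exact ⟨j, by omega, hT j hj⟩
  · have hne : ∀ j < m, edgeAt T' j ≠ e := by
      intro j hj h1
      rw [hT j hj] at h1
      exact he (h1 ▸ h.mem j hj)
    rcases Nat.lt_succ_iff_lt_or_eq.1 hi with h1 | rfl <;>
      rcases Nat.lt_succ_iff_lt_or_eq.1 hj with h2 | rfl
    · rw [hT i h1, hT j h2] at hij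
      exact h.inj i h1 j h2 hij
    · exact absurd (hij.trans hm) (hne i h1)
    · exact absurd (hij.symm.trans hm) (hne j h2)
    · rfl

theorem Lists.empty (T : ℕ → ℕ) : Lists T 0 ∅ := by
  refine ⟨?_, ?_, ?_⟩ <;> simp

theorem edgeAt_congr {j : ℕ} (h0 : T' (2 * j) = T (2 * j)) (h1 : T' (2 * j + 1) = T (2 * j + 1)) :
    edgeAt T' j = edgeAt T j := by
  rw [edgeAt, edgeAt, h0, h1]

/-- Remove from the list the edges from register `43` to register `44` for which `e` is nonzero. -/
def filterCmd (e : Expr) : Cmd :=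
  .set 41 (.lit 0) ;;
  .set 42 (.lit 0) ;;
  .skip ;;
  .loop (.reg 41 <ₑ .reg rM)
    (.set 43 (.get aT (.reg 41 +ₑ .reg 41)) ;;
     .set 44 (.get aT (.reg 41 +ₑ .reg 41 +ₑ .lit 1)) ;;
     .ite e .skip
      (.put aT (.reg 42 +ₑ .reg 42) (.reg 43) ;;
       .put aT (.reg 42 +ₑ .reg 42 +ₑ .lit 1) (.reg 44) ;;
       .set 42 (.reg 42 +ₑ .lit 1)) ;;
     .set 41 (.reg 41 +ₑ .lit 1)) ;;
  .set rM (.reg 42)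

/-- The invariant of the loop in `filterCmd`. -/
structure FilterInv (T : ℕ → ℕ) (m : ℕ) (E' : Finset (Sym2 ℕ)) (T' : ℕ → ℕ) (i o : ℕ) : Prop where
  le : o ≤ i
  le' : i ≤ m
  rest : ∀ h, 2 * i ≤ h → T' h = T h
  lists : Lists T' o (((Finset.range i).image (edgeAt T)).filter (· ∈ E'))

theorem FilterInv.zero : FilterInv T m E' T 0 0 :=
  ⟨le_rfl, Nat.zero_le _, fun _ _ => rfl, by simpa using Lists.empty T⟩

theorem FilterInv.skip {i o : ℕ} (h : FilterInv T m E' T' i o) (hi : i < m)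
    (he : edgeAt T i ∉ E') : FilterInv T m E' T' (i + 1) o := by
  obtain ⟨h1, h2, h3, h4⟩ := h
  refine ⟨by omega, by omega, fun j hj => h3 j (by omega), ?_⟩
  rwa [Finset.range_add_one, Finset.image_insert, Finset.filter_insert, if_neg he]

theorem FilterInv.keep {T'' : ℕ → ℕ} {i o : ℕ} (h : FilterInv T m E' T' i o) (hi : i < m)
    (he : edgeAt T i ∈ E')
    (hinj : ∀ i < m, ∀ j < m, edgeAt T i = edgeAt T j → i = j)
    (hT : ∀ h, T'' h = if h = 2 * o + 1 then T (2 * i + 1) else if h = 2 * o then T (2 * i)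
      else T' h) : FilterInv T m E' T'' (i + 1) (o + 1) := by
  obtain ⟨h1, h2, h3, h4⟩ := h
  refine ⟨by omega, by omega, fun j hj => ?_, ?_⟩
  · rw [hT, if_neg (by omega), if_neg (by omega), h3 j (by omega)]
  · rw [Finset.range_add_one, Finset.image_insert, Finset.filter_insert, if_pos he]
    refine h4.snoc ?_ ?_ ?_
    · simp only [Finset.mem_filter, Finset.mem_image, Finset.mem_range, not_and]
      rintro ⟨j, hj, hij⟩
      have := hinj j (by omega) i hi hij
      omega
    · intro j hj
      apply edgeAt_congr <;> rw [hT, if_neg (by omega), if_neg (by omega)]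
    · rw [edgeAt, hT, hT, if_neg (by omega), if_pos rfl, if_pos rfl, edgeAt]

theorem FilterInv.done {i o : ℕ} (h : FilterInv T m E' T' i o) (hi : m ≤ i) (hE : Lists T m E)
    (hEE : E' ⊆ E) : Lists T' o E' := by
  obtain ⟨h1, h2, h3, h4⟩ := h
  obtain rfl : i = m := by omega
  convert h4
  ext e
  simp only [Finset.mem_filter, Finset.mem_image, Finset.mem_range]
  constructor
  · intro he
    obtain ⟨j, hj, hje⟩ := hE.exists_eq e (hEE he)
    exact ⟨⟨j, hj, hje⟩, he⟩
  · exact fun h => h.2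

/-- The list is compacted in place. The writing position never overtakes the reading position, so
entries not yet read are intact. -/
theorem filterCmd_spec {e : Expr} {s : State} {x y : ℕ} (hE : Lists (s.arr aT) (s.reg rM) E)
    (hB : 2 * s.reg rM + 2 < B) (h1 : s.reg 1 = x) (h2 : s.reg 2 = y) (hcost : e.cost ≤ 20)
    (hok : ∀ s', s'.reg 1 = x → s'.reg 2 = y → e.Ok B s') (hEE : E' ⊆ E)
    (he : ∀ s', s'.reg 1 = x → s'.reg 2 = y → s(s'.reg 43, s'.reg 44) ∈ E →
      (e.eval s' = 0 ↔ s(s'.reg 43, s'.reg 44) ∈ E')) :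
    Run B .skip (filterCmd e) s fun t tr s' => t ≤ 60 * (E.card + 1) ∧
      Lists (s'.arr aT) (s'.reg rM) E' := by
  have hm := hE.card_eq
  refine Run.of_pre ?_
  simp only [filterCmd, Pre, Expr.Ok, Expr.eval, Expr.cost]
  refine ⟨by omega, by omega, ?_⟩
  set m := s.reg rM with hm4
  refine Run.seq ?_
  refine Run.loop rfl (fun s' => FilterInv (s.arr aT) m E' (s'.arr aT) (s'.reg 41) (s'.reg 42))
    (fun s' => 60 * (m - s'.reg 41)) ?_ ?_ ?_ ?_
  · simpa using FilterInv.zero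
  · intro s' hsame hI
    simp only [Expr.Ok, Expr.eval, Op.eval_simps, true_and]
    omega
  · intro s' hsame hI h0
    have e4 : s'.reg rM = m := by rw [hsame.reg 4 rfl rfl]; simp [hm4]
    have e1 : s'.reg 1 = x := by rw [hsame.reg 1 rfl rfl]; simpa using h1
    have e2 : s'.reg 2 = y := by rw [hsame.reg 2 rfl rfl]; simpa using h2
    simp only [Expr.eval, Op.eval_simps, e4] at h0
    have hle := hI.le
    have hg : s(s'.arr aT (s'.reg 41 + s'.reg 41), s'.arr aT (s'.reg 41 + s'.reg 41 + 1)) =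
        edgeAt (s.arr aT) (s'.reg 41) := by
      rw [edgeAt, ← two_mul, hI.rest _ le_rfl, hI.rest _ (by omega)]
    have hmem := hE.mem _ h0
    refine Run.of_pre ?_
    simp only [Pre, Expr.Ok, Expr.eval, Expr.cost, Op.eval_simps, State.simps,
      Nat.reduceEqDiff, if_true, if_false, true_and]
    refine ⟨by omega, by omega, hok _ (by simpa using e1) (by simpa using e2), fun h => ?_,
      fun h => ?_⟩
    · rw [Ne, he _ (by simpa using e1) (by simpa using e2) (by simpa [hg] using hmem)] at h
      refine ⟨by omega, hI.skip h0 (by simpa [hg] using h), by omega⟩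
    · rw [he _ (by simpa using e1) (by simpa using e2) (by simpa [hg] using hmem)] at h
      refine ⟨by omega, by omega, by omega, by omega, ?_, by omega⟩
      refine hI.keep h0 (by simpa [hg] using h) hE.inj fun j => ?_
      simp only [Function.update_apply, ← two_mul]
      rw [hI.rest (2 * s'.reg 41 + 1) (by omega), hI.rest (2 * s'.reg 41) le_rfl]
  · intro t s' hsame hI h0 ht
    have e4 : s'.reg rM = m := by rw [hsame.reg 4 rfl rfl]; simp [hm4]
    simp only [Expr.eval, Op.eval_simps, e4] at h0
    simp only [Expr.cost, State.simps, if_true] at ht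
    refine Run.of_pre ?_
    simp only [Pre, Expr.Ok, Expr.eval, Expr.cost, State.simps, Nat.reduceEqDiff, if_true,
      if_false, true_and]
    simp at ht
    refine ⟨by omega, by simpa using hI.done h0 hE hEE⟩

end

end DynMatch

namespace DynMatch

section

/-! ### The updates -/

variable {E : Finset (Sym2 ℕ)} {B K m : ℕ} {sub c : Cmd} {G : DynGraph} {M : Finset (Sym2 ℕ)}
  {g : State → State → List (State × State)}

/-- Append to the list the edges from register `1` to the entries of the input. -/
def appendCmd : Cmd :=
  .set 41 (.lit 0) ;;
  .loop (.reg 41 <ₑ .reg 2)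
    (.put aT (.reg rM +ₑ .reg rM) (.reg 1) ;;
     .put aT (.reg rM +ₑ .reg rM +ₑ .lit 1) (.get aInput (.reg 41)) ;;
     .set rM (.reg rM +ₑ .lit 1) ;;
     .set 41 (.reg 41 +ₑ .lit 1))

theorem appendCmd_spec {s : State} {v : ℕ} {L : List ℕ}
    (hE : Lists (s.arr aT) (s.reg rM) E) (hB : 2 * (s.reg rM + L.length) + 2 < B)
    (h1 : s.reg 1 = v) (h2 : s.reg 2 = L.length)
    (hL : ∀ (i : ℕ) (h : i < L.length), s.arr aInput i = L[i]) (hnd : L.Nodup)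
    (hv : ∀ e ∈ E, v ∉ e) :
    Run B .skip appendCmd s fun t tr s' => t ≤ 60 * (L.length + 1) ∧
      Lists (s'.arr aT) (s'.reg rM) (E ∪ L.toFinset.image fun y => s(v, y)) := by
  refine Run.of_pre ?_
  simp only [appendCmd, Pre, Expr.Ok, Expr.eval, Expr.cost]
  refine ⟨by omega, ?_⟩
  refine Run.loop rfl (fun s' => s'.reg 41 ≤ L.length ∧ s'.reg rM = s.reg rM + s'.reg 41 ∧
      Lists (s'.arr aT) (s'.reg rM) (E ∪ (L.take (s'.reg 41)).toFinset.image fun y => s(v, y)))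
    (fun s' => 40 * (L.length - s'.reg 41)) ?_ ?_ ?_ ?_
  · simpa using hE
  · intro s' hsame hI
    simp only [Expr.Ok, Expr.eval, Op.eval_simps, true_and]
    omega
  · intro s' hsame ⟨hI1, hI2, hI3⟩ h0
    have e1 : s'.reg 1 = v := by rw [hsame.reg 1 rfl rfl]; simpa using h1
    have e2 : s'.reg 2 = L.length := by rw [hsame.reg 2 rfl rfl]; simpa using h2
    have ei : s'.arr aInput = s.arr aInput := by rw [hsame.arr 1 rfl rfl]; simp
    simp only [Expr.eval, Op.eval_simps, e2] at h0
    refine Run.of_pre ?_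
    simp only [Pre, Expr.Ok, Expr.eval, Expr.cost, Op.eval_simps, State.simps,
      Nat.reduceEqDiff, if_true, if_false, true_and]
    refine ⟨by omega, by omega, by omega, by omega, ⟨by omega, by omega, ?_⟩, by omega⟩
    rw [ei, hL _ h0, List.take_add_one, List.getElem?_eq_getElem h0, e1]
    simp only [Option.toList, List.toFinset_append, Finset.image_union, List.toFinset_cons,
      List.toFinset_nil, insert_empty_eq, Finset.image_singleton, ← Finset.union_assoc]
    rw [Finset.union_singleton]
    refine hI3.snoc ?_ ?_ ?_
    · simp only [Finset.mem_union, Finset.mem_image, List.mem_toFinset, not_or, not_exists,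
        not_and]
      refine ⟨fun h => hv _ h (by simp), fun y hy hyy => ?_⟩
      rw [List.mem_take_iff_getElem] at hy
      obtain ⟨j, hj, rfl⟩ := hy
      have h3 : L[j] = L[s'.reg 41] := by
        rcases Sym2.eq_iff.1 hyy with ⟨_, h⟩ | ⟨h, h'⟩
        · exact h
        · exact h'.trans h
      have := (hnd.getElem_inj_iff).1 h3
      omega
    · intro j hj
      apply edgeAt_congr <;>
      · simp only [Function.update_apply]
        rw [if_neg (by omega), if_neg (by omega)]
    · rw [edgeAt]
      simp only [Function.update_apply, ← two_mul]
      simp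
  · intro t s' hsame ⟨hI1, hI2, hI3⟩ h0 ht
    have e2 : s'.reg 2 = L.length := by rw [hsame.reg 2 rfl rfl]; simpa using h2
    simp only [Expr.eval, Op.eval_simps, e2] at h0
    simp only [Expr.cost, State.simps, if_true] at ht
    refine ⟨by omega, ?_⟩
    rwa [List.take_of_length_le h0] at hI3

/-- Insert the edge between registers `1` and `2`. -/
def insEdgeCmd (c : Cmd) : Cmd :=
  .put aT (.reg rM +ₑ .reg rM) (.reg 1) ;;
  .put aT (.reg rM +ₑ .reg rM +ₑ .lit 1) (.reg 2) ;;
  .set rM (.reg rM +ₑ .lit 1) ;;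
  .set rEx (.lit 0) ;;
  .ite (.get aMate (.reg 1))
    (.ite (.get aMate (.reg 2))
      (.set 40 (.get aMate (.reg 1) -ₑ .lit 1) ;;
       .put aMate (.reg 1) (.lit 0) ;;
       .put aMate (.reg 40) (.lit 0) ;;
       .set rEx (.reg 1 +ₑ .lit 1) ;;
       .set rRoot (.reg 40) ;;
       .skip ;;
       c ;; .set rEx (.lit 0) ;; .set rRoot (.reg 1) ;; .skip ;; c)
      (.set rRoot (.reg 2) ;; .skip ;; c))
    (.ite (.get aMate (.reg 2))
      (.set rRoot (.reg 1) ;; .skip ;; c)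
      (.put aMate (.reg 1) (.reg 2 +ₑ .lit 1) ;; .put aMate (.reg 2) (.reg 1 +ₑ .lit 1)))

/-- Delete the edge between registers `1` and `2`. -/
def delEdgeCmd (c : Cmd) : Cmd :=
  .skip ;; filterCmd (((.reg 43 =ₑ .reg 1) *ₑ (.reg 44 =ₑ .reg 2)) +ₑ
    ((.reg 43 =ₑ .reg 2) *ₑ (.reg 44 =ₑ .reg 1))) ;;
  .ite (.get aMate (.reg 1) =ₑ .reg 2 +ₑ .lit 1)
    (.put aMate (.reg 1) (.lit 0) ;;
     .put aMate (.reg 2) (.lit 0) ;;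
     .set rEx (.reg 1 +ₑ .lit 1) ;;
     .set rRoot (.reg 2) ;;
     .skip ;;
     c ;; .set rEx (.lit 0) ;; .set rRoot (.reg 1) ;; .skip ;; c)
    .skip

/-- Insert the vertex in register `1` with edges to the entries of the input. -/
def insVertexCmd (c : Cmd) : Cmd :=
  .skip ;; appendCmd ;; .set rEx (.lit 0) ;; .set rRoot (.reg 1) ;; .skip ;; c

/-- Delete the vertex in register `1`. -/
def delVertexCmd (c : Cmd) : Cmd :=
  .skip ;; filterCmd ((.reg 43 =ₑ .reg 1) +ₑ (.reg 44 =ₑ .reg 1)) ;;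
  .ite (.get aMate (.reg 1))
    (.set 40 (.get aMate (.reg 1) -ₑ .lit 1) ;;
     .put aMate (.reg 1) (.lit 0) ;;
     .put aMate (.reg 40) (.lit 0) ;;
     .set rEx (.lit 0) ;;
     .set rRoot (.reg 40) ;;
     .skip ;;
     c)
    .skip

/-- Process the update in registers `0`, `1`, `2` and array `1`. -/
def updCmd (c : Cmd) : Cmd :=
  .ite (.reg 0 =ₑ .lit 0) (.skip ;; insEdgeCmd c)
    (.ite (.reg 0 =ₑ .lit 1) (.skip ;; delEdgeCmd c)
      (.ite (.reg 0 =ₑ .lit 2) (.skip ;; insVertexCmd c) (.skip ;; delVertexCmd c)))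

/-- The new edge vanishes when one of its ends is removed, so maximality in the old graph carries
over to the new one without that end. If exactly one end is free, it is that end. If both are
matched, `x` is separated from its partner and both are restored, with no special treatment of `y`.
If both are free, the edge itself joins the matching, and no search is needed because one edge
raises the maximum by at most one. -/
theorem insEdgeCmd_spec (hc : Searches B K sub c g) {s : State} {x y : ℕ} (hst : Stored B G s)
    (hh : s.Holds M) (hM : G.IsMaxMatching M) (h1 : s.reg 1 = x) (h2 : s.reg 2 = y)
    (hx : x ∈ G.verts) (hy : y ∈ G.verts) (hxy : x ≠ y) (hxyG : s(x, y) ∉ G.edges)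
    (hB : (G.edges.card + 1 + 200) * (G.edges.card + 1 + 200) < B) :
    Run B sub (insEdgeCmd c) s fun t tr s' =>
      t ≤ (2 * K + 100) * (((Update.insertEdge x y).apply G).edges.card + 1) ∧
      Updated B ((Update.insertEdge x y).apply G) (Update.insertEdge x y).ends
        ((Update.insertEdge x y).roots M) M g tr s' := by
  have hcard := hst.lists.card_eq
  set H := (Update.insertEdge x y).apply G with hH
  have hHe : H.edges = insert s(x, y) G.edges := rfl
  have hHc : H.edges.card = G.edges.card + 1 := by rw [hHe, Finset.card_insert_of_notMem hxyG]
  have hHv : H.verts = G.verts := rfl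
  have hstore : ∀ s' : State, s'.reg rM = s.reg rM + 1 →
      (∀ h, s'.arr aT h = if h = 2 * s.reg rM + 1 then y else if h = 2 * s.reg rM then x
        else s.arr aT h) → Stored B H s' := by
    intro s' h4 hT
    refine ⟨?_, ?_, ?_, hst.small, by rw [hHc]; exact hB⟩
    · rw [h4, hHe]
      refine hst.lists.snoc hxyG ?_ ?_
      · intro j hj
        apply edgeAt_congr <;> rw [hT, if_neg (by omega), if_neg (by omega)]
      · rw [edgeAt, hT, hT, if_neg (by omega), if_pos rfl, if_pos rfl]
    · intro e he
      rcases Finset.mem_insert.1 he with rfl | he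
      · simpa using hxy
      · exact hst.loopless e he
    · intro e he z hz
      rcases Finset.mem_insert.1 he with rfl | he
      · rcases Sym2.mem_iff.1 hz with rfl | rfl
        · exact hx
        · exact hy
      · exact hst.ends_mem e he z hz
  have hrem : ∀ z, z = x ∨ z = y → (H.removeVerts {z}).edges = (G.removeVerts {z}).edges := by
    intro z hz
    ext e
    rw [DynGraph.mem_removeVerts, DynGraph.mem_removeVerts, hHe, Finset.mem_insert]
    constructor
    · rintro ⟨rfl | h3, h4⟩
      · exact absurd (by simpa using hz) (h4 z (by simp))
      · exact ⟨h3, h4⟩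
    · exact fun ⟨h3, h4⟩ => ⟨Or.inr h3, h4⟩
  have hxB := hst.small x hx
  have hyB := hst.small y hy
  have hmB : 2 * s.reg rM + 2 < B := by nlinarith
  refine Run.of_pre ?_
  simp only [insEdgeCmd, Pre, Expr.Ok, Expr.eval, Expr.cost, Op.eval_simps, State.simps,
    Nat.reduceEqDiff, if_true, if_false, true_and, h1, h2, OfNat.ofNat_ne_zero, one_ne_zero,
    OfNat.zero_ne_ofNat]
  refine ⟨by omega, by omega, by omega, by omega, fun hx0 => ⟨fun hy0 => ?_, fun hy0 => ?_⟩,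
    fun hx0 => ⟨fun hy0 => ?_, fun hy0 => ?_⟩⟩
  · obtain ⟨x', hx'⟩ := Nat.exists_eq_succ_of_ne_zero hx0
    have hmem := (hh x x').1 hx'
    have hne := hst.loopless.ne (hM.1.1 hmem)
    have hx'v := hst.ends_mem _ (hM.1.1 hmem) x' (by simp)
    have hsub : s.arr aMate x - 1 = x' := by omega
    rw [hsub]
    refine ⟨⟨by omega, by omega⟩, by omega, by omega, ⟨by omega, by omega⟩, ?_⟩
    refine Run.mono (Searches.two (G := H) (x := x) (y := x') (r := 1) (N := M.erase s(x, x'))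
      (M := M) (T := (Update.insertEdge x y).ends) (R := (Update.insertEdge x y).roots M)
      hc (hstore _ ?_ ?_) rfl (by decide) ?_ ?_ ?_ ?_ hx hx'v hne.symm ?_ ?_ ?_ ?_ ?_ ?_) ?_
    · simp
    · intro h
      simp [State.simps, Function.update_apply, ← two_mul]
    · omega
    · simp
    · simp
    · simpa using h1
    · exact hM.erase hmem (DynGraph.removeVerts_edges_congr (hrem x (Or.inl rfl)))
    · exact hh.erase hM.1 hmem fun z => by simp [State.simps, Function.update_apply]
    · exact AgreeOff.erase (by simp [Update.ends])
    · simp [Update.ends]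
    · exact Or.inr (Or.inr ⟨fun h => hx0 (hh.free_iff.1 h), fun h => hy0 (hh.free_iff.1 h),
        Or.inl rfl⟩)
    · exact Or.inr (Or.inr ⟨fun h => hx0 (hh.free_iff.1 h), fun h => hy0 (hh.free_iff.1 h),
        Or.inr (Or.inr (Or.inl hmem))⟩)
    · rintro t tr s' - - - ⟨ht, hu⟩
      exact ⟨by nlinarith, by simpa using hu⟩
  · have hyf := hh.free_iff.2 hy0
    refine Run.mono (Searches.one (G := H) (v := y) (N := M)
      (M := M) (T := (Update.insertEdge x y).ends) (R := (Update.insertEdge x y).roots M)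
      hc (hstore _ ?_ ?_) ?_ ?_ hy ?_ ?_ (AgreeOff.refl _ _) ?_) ?_
    · simp
    · intro h
      simp [State.simps, Function.update_apply, ← two_mul]
    · simp
    · simp
    · exact (hM.removeVerts_singleton hyf).congr (hrem y (Or.inr rfl))
    · simpa [State.Holds, State.simps] using hh
    · exact Or.inr (Or.inl ⟨rfl, hyf, fun h => hx0 (hh.free_iff.1 h)⟩)
    · rintro t tr s' - - - ⟨-, ht, hu⟩
      exact ⟨by nlinarith, by simpa using hu⟩
  · have hxf := hh.free_iff.2 hx0
    refine Run.mono (Searches.one (G := H) (v := x) (N := M)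
      (M := M) (T := (Update.insertEdge x y).ends) (R := (Update.insertEdge x y).roots M)
      hc (hstore _ ?_ ?_) ?_ ?_ hx ?_ ?_ (AgreeOff.refl _ _) ?_) ?_
    · simp
    · intro h
      simp [State.simps, Function.update_apply, ← two_mul]
    · simp
    · simp
    · exact (hM.removeVerts_singleton hxf).congr (hrem x (Or.inl rfl))
    · simpa [State.Holds, State.simps] using hh
    · exact Or.inl ⟨rfl, hxf, fun h => hy0 (hh.free_iff.1 h)⟩
    · rintro t tr s' - - - ⟨-, ht, hu⟩
      exact ⟨by nlinarith, by simpa using hu⟩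
  · have hxf := hh.free_iff.2 hx0
    have hyf := hh.free_iff.2 hy0
    refine ⟨⟨by omega, by omega⟩, ⟨by omega, by omega⟩, by nlinarith, ?_⟩
    refine Updated.nil (N := Insert.insert s(x, y) M) (hstore _ ?_ ?_) ?_ ?_ ?_
    · simp
    · intro h
      simp [State.simps, Function.update_apply, ← two_mul]
    · exact hh.insert hxy hxf hyf fun z => by simp [State.simps, Function.update_apply]
    · exact hM.insert hHe hxf hyf
    · exact AgreeOff.insert (by simp [Update.ends])

end

end DynMatch

/-! ### Correctness of deletions and of vertex insertion -/

namespace DynMatch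

section

variable {B K m : ℕ} {sub c : Cmd} {G : DynGraph} {M : Finset (Sym2 ℕ)}
  {g : State → State → List (State × State)}

theorem Run.of_skip {s : State} {Q : ℕ → List (State × State) → State → Prop}
    (hf : c.callFree = true) (h : Run B .skip c s Q) :
    Run B sub c s fun t tr s' => tr = [] ∧ Same c .skip s s' ∧ Q t [] s' := by
  refine (Run.of_callFree (sub := sub) hf (h.mono (Q' := fun t tr s' => Same c .skip s s' ∧
    Q t tr s') ?_)).mono ?_
  · rintro t tr s' - - hs hq
    exact ⟨hs, hq⟩
  · rintro t tr s' - - - ⟨h1, h2, h3⟩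
    exact ⟨h1, h2, h3⟩

theorem Op.eval_eq_le (a b : ℕ) : Op.eq.eval a b ≤ 1 := by
  rw [Op.eval]
  split_ifs <;> omega

theorem delEdgeCmd_spec (hc : Searches B K sub c g) {s : State} {x y : ℕ} (hst : Stored B G s)
    (hh : s.Holds M) (hM : G.IsMaxMatching M) (h1 : s.reg 1 = x) (h2 : s.reg 2 = y)
    (hxyG : s(x, y) ∈ G.edges) :
    Run B sub (delEdgeCmd c) s fun t tr s' =>
      t ≤ (2 * K + 100) * (G.edges.card + 1) ∧
      Updated B ((Update.deleteEdge x y).apply G) (Update.deleteEdge x y).ends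
        ((Update.deleteEdge x y).roots M) M g tr s' := by
  have hcard := hst.lists.card_eq
  set H := (Update.deleteEdge x y).apply G with hH
  have hHe : H.edges = G.edges.erase s(x, y) := rfl
  have hle : H.edges.card ≤ G.edges.card := Finset.card_erase_le
  have hx : x ∈ G.verts := hst.ends_mem _ hxyG x (by simp)
  have hy : y ∈ G.verts := hst.ends_mem _ hxyG y (by simp)
  have hxy := hst.loopless.ne hxyG
  have hxB := hst.small x hx
  have hyB := hst.small y hy
  have hsize := hst.size
  have hmB : 2 * s.reg rM + 10 < B := by nlinarith
  refine Run.of_pre ?_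
  simp only [delEdgeCmd, Pre]
  refine Run.seq (Run.mono (Run.of_skip rfl (filterCmd_spec (x := x) (y := y) (E' := H.edges)
    hst.lists (by omega) h1 h2 (by simp [Expr.cost]) ?_ (Finset.erase_subset _ _) ?_)) ?_)
  · intro s' e1 e2
    have hle2 : ∀ a b a' b', Op.eq.eval a b * Op.eq.eval a' b' ≤ 1 := fun a b a' b' =>
      Nat.mul_le_mul (Op.eval_eq_le a b) (Op.eval_eq_le a' b')
    have g1 := hle2 (s'.reg 43) (s'.reg 1) (s'.reg 44) (s'.reg 2)
    have g2 := hle2 (s'.reg 43) (s'.reg 2) (s'.reg 44) (s'.reg 1)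
    simp only [Expr.Ok, Expr.eval, Op.eval_simps]
    exact ⟨⟨⟨trivial, trivial, by omega⟩, ⟨trivial, trivial, by omega⟩, by omega⟩,
      ⟨⟨trivial, trivial, by omega⟩, ⟨trivial, trivial, by omega⟩, by omega⟩, by omega⟩
  -- Truth values are `0` and `1`: the sum of the two products vanishes unless the stored pair is
  -- the deleted edge in one of its two orientations.
  · intro s' e1 e2 he
    simp only [Expr.eval, Op.eval_simps, e1, e2, hHe, Finset.mem_erase, he, and_true, Ne,
      Sym2.eq_iff, Nat.add_eq_zero_iff, Nat.mul_eq_zero]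
    tauto
  rintro t tr s' - - - ⟨rfl, hsame, ht, hl⟩
  have e1 : s'.reg 1 = x := by rw [hsame.reg 1 rfl rfl, h1]
  have e2 : s'.reg 2 = y := by rw [hsame.reg 2 rfl rfl, h2]
  have e0 : s'.arr aMate = s.arr aMate := hsame.arr 0 rfl rfl
  have hh' : s'.Holds M := by simpa only [State.Holds, e0] using hh
  have hst' : Stored B H s' := ⟨hl, fun e he => hst.loopless e (Finset.mem_of_mem_erase he),
    fun e he => hst.ends_mem e (Finset.mem_of_mem_erase he), hst.small,
    lt_of_le_of_lt (Nat.mul_le_mul (by omega) (by omega)) hsize⟩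
  refine Run.of_pre ?_
  simp only [Pre, Expr.Ok, Expr.eval, Expr.cost, Op.eval_simps, State.simps,
    Nat.reduceEqDiff, if_true, if_false, true_and, e1, e2, OfNat.ofNat_ne_zero, one_ne_zero,
    OfNat.zero_ne_ofNat]
  refine ⟨by omega, fun h0 => ?_, fun h0 => ?_⟩
  · have hmem := (hh' x y).1 h0
    refine ⟨by omega, by omega, by omega, ?_⟩
    refine Run.mono (Searches.two (G := H) (x := x) (y := y) (r := 1) (N := M.erase s(x, y))
      (M := M) (T := (Update.deleteEdge x y).ends) (R := (Update.deleteEdge x y).roots M)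
      hc (hst'.congr ?_ ?_) rfl (by decide) ?_ ?_ ?_ ?_ hx hy hxy.symm ?_ ?_ ?_ ?_ ?_ ?_) ?_
    · simp [State.simps]
    · simp
    · omega
    · simp
    · simp
    · simpa using e1
    · refine hM.erase hmem ?_
      ext e
      simp only [DynGraph.mem_removeVerts, hHe, Finset.mem_erase, Finset.mem_singleton,
        forall_eq]
      constructor
      · tauto
      · rintro ⟨⟨h3, h4⟩, h5⟩
        exact ⟨⟨⟨fun h => h4 (by simp [h]), h3⟩, h4⟩, h5⟩
    · exact hh'.erase hM.1 hmem fun z => by simp [State.simps, Function.update_apply]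
    · exact AgreeOff.erase (by simp [Update.ends])
    · simp [Update.ends]
    · exact ⟨hmem, Or.inl rfl⟩
    · exact ⟨hmem, Or.inr rfl⟩
    · rintro t tr s' - - - ⟨ht, hu⟩
      refine ⟨?_, by simpa using hu⟩
      have := Nat.mul_le_mul_left (2 * K) (Nat.add_le_add_right hle 1)
      linarith
  · have hmem : s(x, y) ∉ M := fun h => h0 ((hh' x y).2 h)
    refine ⟨by linarith [Nat.zero_le (2 * K * (G.edges.card + 1))], ?_⟩
    refine Updated.nil hst' hh' (hM.anti (Finset.erase_subset _ _) ?_) (AgreeOff.refl _ _)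
    intro e he
    exact Finset.mem_erase.2 ⟨fun h => hmem (h ▸ he), hM.1.1 he⟩

/-- Without its edge at `x` the matching is maximum in the graph without `x` and its partner. As `x`
is gone for good, only the partner is restored. -/
theorem delVertexCmd_spec (hc : Searches B K sub c g) {s : State} {x : ℕ} (hst : Stored B G s)
    (hh : s.Holds M) (hM : G.IsMaxMatching M) (h1 : s.reg 1 = x) (hx : x ∈ G.verts) :
    Run B sub (delVertexCmd c) s fun t tr s' =>
      t ≤ (2 * K + 100) * (G.edges.card + 1) ∧
      Updated B ((Update.deleteVertex x).apply G) (Update.deleteVertex x).ends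
        ((Update.deleteVertex x).roots M) M g tr s' := by
  have hcard := hst.lists.card_eq
  set H := (Update.deleteVertex x).apply G with hH
  have hHG : H = G.removeVerts {x} := rfl
  have hHe : ∀ e, e ∈ H.edges ↔ e ∈ G.edges ∧ x ∉ e := by
    intro e
    rw [hHG, DynGraph.mem_removeVerts]
    simp
  have hsub : H.edges ⊆ G.edges := Finset.filter_subset _ _
  have hle : H.edges.card ≤ G.edges.card := Finset.card_le_card hsub
  have hxB := hst.small x hx
  have hsize := hst.size
  have hmB : 2 * s.reg rM + 10 < B := by nlinarith
  refine Run.of_pre ?_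
  simp only [delVertexCmd, Pre]
  refine Run.seq (Run.mono (Run.of_skip rfl (filterCmd_spec (x := x) (y := s.reg 2)
    (E' := H.edges) hst.lists (by omega) h1 rfl (by simp [Expr.cost]) ?_ hsub ?_)) ?_)
  · intro s' e1 e2
    have g1 := Op.eval_eq_le (s'.reg 43) (s'.reg 1)
    have g2 := Op.eval_eq_le (s'.reg 44) (s'.reg 1)
    simp only [Expr.Ok, Expr.eval]
    exact ⟨⟨trivial, trivial, by omega⟩, ⟨trivial, trivial, by omega⟩, by omega⟩
  · intro s' e1 e2 he
    simp only [Expr.eval, Op.eval_simps, e1, hHe, he, true_and, Sym2.mem_iff,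
      Nat.add_eq_zero_iff, not_or, Ne, eq_comm (a := x)]
  rintro t tr s' - - - ⟨rfl, hsame, ht, hl⟩
  have e1 : s'.reg 1 = x := by rw [hsame.reg 1 rfl rfl, h1]
  have e0 : s'.arr aMate = s.arr aMate := hsame.arr 0 rfl rfl
  have hh' : s'.Holds M := by simpa only [State.Holds, e0] using hh
  have hst' : Stored B H s' := ⟨hl, fun e he => hst.loopless e (hsub he),
    fun e he z hz => Finset.mem_sdiff.2 ⟨hst.ends_mem e (hsub he) z hz, fun h =>
      ((hHe e).1 he).2 (Finset.mem_singleton.1 h ▸ hz)⟩,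
    fun z hz => hst.small z (Finset.mem_sdiff.1 hz).1,
    lt_of_le_of_lt (Nat.mul_le_mul (by omega) (by omega)) hsize⟩
  refine Run.of_pre ?_
  simp only [Pre, Expr.Ok, Expr.eval, Expr.cost, Op.eval_simps, State.simps,
    Nat.reduceEqDiff, if_true, if_false, true_and, e1, OfNat.ofNat_ne_zero, one_ne_zero,
    OfNat.zero_ne_ofNat]
  refine ⟨fun h0 => ?_, fun h0 => ?_⟩
  · obtain ⟨x', hx'⟩ := Nat.exists_eq_succ_of_ne_zero h0
    have hmem := (hh' x x').1 hx'
    have hne := hst.loopless.ne (hM.1.1 hmem)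
    have hx'v := hst.ends_mem _ (hM.1.1 hmem) x' (by simp)
    have hx's : s'.arr aMate x - 1 = x' := by omega
    rw [hx's]
    refine ⟨⟨by omega, by omega⟩, by omega, by omega, by omega, ?_⟩
    refine Run.mono (Searches.one (G := H) (v := x') (N := M.erase s(x, x'))
      (M := M) (T := (Update.deleteVertex x).ends) (R := (Update.deleteVertex x).roots M)
      hc (hst'.congr ?_ ?_) ?_ ?_ ?_ ?_ ?_ ?_ ?_) ?_
    · simp [State.simps]
    · simp
    · simp
    · simp
    · exact Finset.mem_sdiff.2 ⟨hx'v, by simpa using hne.symm⟩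
    · exact hM.erase hmem rfl
    · exact hh'.erase hM.1 hmem fun z => by simp [State.simps, Function.update_apply]
    · exact AgreeOff.erase (by simp [Update.ends])
    · exact hmem
    · rintro t tr s' - - - ⟨-, ht, hu⟩
      refine ⟨?_, by simpa using hu⟩
      have := Nat.mul_le_mul_left K (Nat.add_le_add_right hle 1)
      nlinarith
  · have hxf := hh'.free_iff.2 h0
    refine ⟨by linarith [Nat.zero_le (2 * K * (G.edges.card + 1))], ?_⟩
    refine Updated.nil hst' hh' (hM.anti hsub fun e he => ?_) (AgreeOff.refl _ _)
    exact (hHe e).2 ⟨hM.1.1 he, hxf e he⟩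

theorem card_insertVertex {v : ℕ} {L : List ℕ} (hv : ∀ e ∈ G.edges, v ∉ e) (hnd : L.Nodup) :
    ((Update.insertVertex v L).apply G).edges.card = G.edges.card + L.length := by
  have hinj : (L.toFinset.image fun y => s(v, y)).card = L.length := by
    rw [Finset.card_image_of_injective, List.toFinset_card_of_nodup hnd]
    intro y z hyz
    rcases Sym2.eq_iff.1 hyz with ⟨_, h⟩ | ⟨h, h'⟩
    · exact h
    · exact h'.trans h
  rw [Update.apply, Finset.card_union_of_disjoint, hinj]
  rw [Finset.disjoint_left]
  intro e he he'
  obtain ⟨y, hy, rfl⟩ := Finset.mem_image.1 he'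
  exact hv _ he (by simp)

/-- The old matching is maximum in the new graph without `v`, so one search from `v` suffices. -/
theorem insVertexCmd_spec (hc : Searches B K sub c g) {s : State} {v : ℕ} {L : List ℕ}
    (hst : Stored B G s) (hh : s.Holds M) (hM : G.IsMaxMatching M) (h1 : s.reg 1 = v)
    (h2 : s.reg 2 = L.length) (hL : ∀ (i : ℕ) (h : i < L.length), s.arr aInput i = L[i])
    (hnd : L.Nodup) (hv : v ∉ G.verts) (hLv : ∀ y ∈ L, y ∈ G.verts) (hvB : v + 1 < B)
    (hB : (G.edges.card + L.length + 200) * (G.edges.card + L.length + 200) < B) :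
    Run B sub (insVertexCmd c) s fun t tr s' =>
      t ≤ (2 * K + 100) * (((Update.insertVertex v L).apply G).edges.card + 1) ∧
      Updated B ((Update.insertVertex v L).apply G) (Update.insertVertex v L).ends
        ((Update.insertVertex v L).roots M) M g tr s' := by
  have hcard := hst.lists.card_eq
  set H := (Update.insertVertex v L).apply G with hH
  have hHe : H.edges = G.edges ∪ L.toFinset.image fun y => s(v, y) := rfl
  have hvE : ∀ e ∈ G.edges, v ∉ e := fun e he h => hv (hst.ends_mem e he v h)
  have hcH : H.edges.card = G.edges.card + L.length := card_insertVertex hvE hnd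
  have hmB : 2 * (s.reg rM + L.length) + 10 < B := by nlinarith
  refine Run.of_pre ?_
  simp only [insVertexCmd, Pre]
  refine Run.seq (Run.mono (Run.of_skip rfl (appendCmd_spec
    hst.lists (by omega) h1 h2 hL hnd hvE)) ?_)
  rintro t tr s' - - - ⟨rfl, hsame, ht, hl⟩
  have e1 : s'.reg 1 = v := by rw [hsame.reg 1 rfl rfl, h1]
  have e0 : s'.arr aMate = s.arr aMate := hsame.arr 0 rfl rfl
  have hh' : s'.Holds M := by simpa only [State.Holds, e0] using hh
  have hst' : Stored B H s' := by
    refine ⟨hl, fun e he => ?_, fun e he z hz => ?_, fun z hz => ?_, by rwa [hcH]⟩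
    · rcases Finset.mem_union.1 he with he | he
      · exact hst.loopless e he
      · obtain ⟨y, hy, rfl⟩ := Finset.mem_image.1 he
        have := hLv y (List.mem_toFinset.1 hy)
        simp only [Sym2.mk_isDiag_iff]
        rintro rfl
        exact hv this
    · rcases Finset.mem_union.1 he with he | he
      · exact Finset.mem_insert_of_mem (hst.ends_mem e he z hz)
      · obtain ⟨y, hy, rfl⟩ := Finset.mem_image.1 he
        rcases Sym2.mem_iff.1 hz with rfl | rfl
        · exact Finset.mem_insert_self _ _
        · exact Finset.mem_insert_of_mem (hLv _ (List.mem_toFinset.1 hy))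
    · rcases Finset.mem_insert.1 hz with rfl | hz
      · exact hvB
      · exact hst.small z hz
  have hvM : Free M v := fun e he => hvE e (hM.1.1 he)
  refine Run.of_pre ?_
  simp only [Pre, Expr.Ok, Expr.eval, Expr.cost, Op.eval_simps, State.simps,
    Nat.reduceEqDiff, if_true, if_false, true_and, e1, OfNat.ofNat_ne_zero, one_ne_zero,
    OfNat.zero_ne_ofNat]
  refine ⟨by omega, ?_⟩
  refine Run.mono (Searches.one (G := H) (v := v) (N := M)
      (M := M) (T := (Update.insertVertex v L).ends) (R := (Update.insertVertex v L).roots M)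
      hc (hst'.congr ?_ ?_) ?_ ?_ ?_ ?_ ?_ (AgreeOff.refl _ _) ?_) ?_
  · simp
  · simp
  · simp
  · simp
  · exact Finset.mem_insert_self _ _
  · refine (hM.removeVerts_singleton hvM).congr ?_
    ext e
    rw [DynGraph.mem_removeVerts, DynGraph.mem_removeVerts, hHe, Finset.mem_union]
    constructor
    · rintro ⟨h3 | h3, h4⟩
      · exact ⟨h3, h4⟩
      · obtain ⟨y, hy, rfl⟩ := Finset.mem_image.1 h3
        exact absurd (by simp) (h4 v (by simp))
    · exact fun ⟨h3, h4⟩ => ⟨Or.inl h3, h4⟩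
  · simpa [State.Holds, State.simps] using hh'
  · exact rfl
  · rintro t tr s' - - - ⟨-, ht, hu⟩
    refine ⟨?_, by simpa using hu⟩
    rw [hcH] at ht ⊢
    nlinarith

end

end DynMatch

namespace DynMatch

section

/-! ### Correctness of the update program and of the preprocessing -/

variable {B K n : ℕ} {sub c : Cmd} {G : DynGraph} {M : Finset (Sym2 ℕ)}
  {g : State → State → List (State × State)}

theorem DynGraph.WF.apply {u : Update} (h : G.WF n) (hu : u.Valid n G) : (u.apply G).WF n := by
  obtain ⟨h1, h2⟩ := h
  cases u with
  | insertEdge x y =>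
    obtain ⟨hx, hy, hxy, -⟩ := hu
    refine ⟨h1, fun e he => ?_⟩
    rcases Finset.mem_insert.1 he with rfl | he
    · exact ⟨by simpa using hxy, by simpa [Update.apply] using ⟨hx, hy⟩⟩
    · exact h2 e he
  | deleteEdge x y => exact ⟨h1, fun e he => h2 e (Finset.mem_of_mem_erase he)⟩
  | insertVertex v L =>
    obtain ⟨hv, hvG, -, hL⟩ := hu
    refine ⟨fun x hx => ?_, fun e he => ?_⟩
    · rcases Finset.mem_insert.1 hx with rfl | hx
      · exact hv
      · exact h1 x hx
    · rcases Finset.mem_union.1 he with he | he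
      · exact ⟨(h2 e he).1, fun x hx => Finset.mem_insert_of_mem ((h2 e he).2 x hx)⟩
      · obtain ⟨y, hy, rfl⟩ := Finset.mem_image.1 he
        have hyG := hL y (List.mem_toFinset.1 hy)
        refine ⟨?_, ?_⟩
        · rw [Sym2.mk_isDiag_iff]
          rintro rfl
          exact hvG hyG
        · intro x hx
          rcases Sym2.mem_iff.1 hx with rfl | rfl
          · exact Finset.mem_insert_self _ _
          · exact Finset.mem_insert_of_mem hyG
  | deleteVertex x =>
    refine ⟨fun y hy => h1 y (Finset.mem_sdiff.1 hy).1, fun e he => ?_⟩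
    obtain ⟨h3, h4⟩ := DynGraph.mem_removeVerts.1 he
    refine ⟨(h2 e h3).1, fun y hy => Finset.mem_sdiff.2 ⟨(h2 e h3).2 y hy, fun h => ?_⟩⟩
    exact h4 y h hy

theorem DynGraph.WF.card_edges (h : G.WF n) : G.edges.card ≤ n * n := by
  have h1 : G.edges ⊆ (Finset.range n ×ˢ Finset.range n).image fun p => s(p.1, p.2) := by
    intro e
    induction e with
    | _ x y =>
      intro he
      have h2 := (h.2 _ he).2
      refine Finset.mem_image.2 ⟨(x, y), ?_, rfl⟩
      simp only [Finset.mem_product, Finset.mem_range]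
      exact ⟨h.1 x (h2 x (by simp)), h.1 y (h2 y (by simp))⟩
  refine (Finset.card_le_card h1).trans (Finset.card_image_le.trans ?_)
  simp

theorem length_le_of_lt {L : List ℕ} (hnd : L.Nodup) (hL : ∀ x ∈ L, x < n) : L.length ≤ n := by
  rw [← List.toFinset_card_of_nodup hnd, ← Finset.card_range n]
  exact Finset.card_le_card fun x hx => by simpa using hL x (by simpa using hx)

theorem State.Bdd.input {s : State} (h : s.Bdd B) {k a b : ℕ} {L : List ℕ} (hk : k < B)
    (ha : a < B) (hb : b < B) (hL : ∀ x ∈ L, x < B) : (s.input k a b L).Bdd B := by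
  refine ⟨fun r => ?_, fun r i => ?_⟩
  · simp only [State.input, Function.update_apply]
    split_ifs
    · exact hb
    · exact ha
    · exact hk
    · exact h.1 r
  · simp only [State.input, Function.update_apply]
    split_ifs
    · beta_reduce
      split_ifs
      · exact hL _ (List.getElem_mem _)
      · exact h.2 _ _
    · exact h.2 _ _

theorem State.Bdd.load {s : State} {u : Update} (h : s.Bdd B) (hG : G.WF n) (hu : u.Valid n G)
    (hB : n < B) (hB' : 3 < B) : (s.load u).Bdd B := by
  have hlt : ∀ x ∈ G.verts, x < B := fun x hx => (hG.1 x hx).trans hB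
  cases u with
  | insertEdge x y => exact h.input (by omega) (hlt _ hu.1) (hlt _ hu.2.1) (by simp)
  | deleteEdge x y =>
    have := (hG.2 _ hu).2
    exact h.input (by omega) (hlt _ (this x (by simp))) (hlt _ (this y (by simp))) (by simp)
  | insertVertex v L =>
    obtain ⟨h1, -, h2, h3⟩ := hu
    refine h.input (by omega) (by omega) ?_ fun x hx => hlt x (h3 x hx)
    exact (length_le_of_lt h2 fun x hx => hG.1 x (h3 x hx)).trans_lt hB
  | deleteVertex x => exact h.input (by omega) (hlt _ hu) (by omega) (by simp)

theorem State.load_frame (s : State) (u : Update) :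
    (∀ r, 3 ≤ r → (s.load u).reg r = s.reg r) ∧ ∀ a, a ≠ 1 → (s.load u).arr a = s.arr a := by
  cases u <;> refine ⟨fun r hr => ?_, fun a ha => ?_⟩ <;>
    simp only [State.load, State.input, Function.update_apply] <;>
    (repeat rw [if_neg (by omega)])

theorem updCmd_spec (hc : Searches B K sub c g) {s : State} {u : Update} (hst : Stored B G s)
    (hh : s.Holds M) (hM : G.IsMaxMatching M) (hu : u.Valid n G) (hnB : n + 3 < B)
    (hB : ((u.apply G).edges.card + 200) * ((u.apply G).edges.card + 200) < B) :
    Run B sub (updCmd c) (s.load u) fun t tr s' =>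
      t ≤ (2 * K + 120) * (max G.edges.card (u.apply G).edges.card + 1) ∧
      Updated B (u.apply G) u.ends (u.roots M) M g tr s' := by
  obtain ⟨hr, ha⟩ := s.load_frame u
  have hst' : Stored B G (s.load u) := hst.congr (ha _ (by decide)) (hr _ (by decide))
  have hh' : (s.load u).Holds M := by simpa only [State.Holds, ha 0 (by decide)] using hh
  have hl := le_max_left G.edges.card (u.apply G).edges.card
  have hr := le_max_right G.edges.card (u.apply G).edges.card
  have hl' := Nat.mul_le_mul_left (2 * K + 100) (Nat.add_le_add_right hl 1)
  have hr' := Nat.mul_le_mul_left (2 * K + 100) (Nat.add_le_add_right hr 1)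
  set mx := max G.edges.card (u.apply G).edges.card
  have hsplit : (2 * K + 120) * (mx + 1) = (2 * K + 100) * (mx + 1) + 20 * mx + 20 := by ring
  rw [hsplit]
  refine Run.of_pre ?_
  simp only [updCmd, Pre, Expr.Ok, Expr.eval, Expr.cost, Op.eval_simps, true_and]
  cases u with
  | insertEdge x y =>
    obtain ⟨h1, h2, h3, h4⟩ := hu
    have h0 : (s.load (.insertEdge x y)).reg 0 = 0 := by
      simp [State.load, State.input, Function.update_apply]
    simp only [h0, ne_eq, not_true_eq_false, not_false_eq_true, IsEmpty.forall_iff, true_and,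
      and_true, forall_const]
    refine ⟨by omega, (insEdgeCmd_spec hc hst' hh' hM ?_ ?_ h1 h2 h3 h4 ?_).mono ?_⟩
    · simp [State.load, State.input, Function.update_apply]
    · simp [State.load, State.input, Function.update_apply]
    · rw [Update.apply, Finset.card_insert_of_notMem h4] at hB
      exact hB
    · rintro t tr s' - - - ⟨ht, hu⟩
      exact ⟨by omega, hu⟩
  | deleteEdge x y =>
    have h0 : (s.load (.deleteEdge x y)).reg 0 = 1 := by
      simp [State.load, State.input, Function.update_apply]
    simp only [h0, ne_eq, not_true_eq_false, not_false_eq_true, IsEmpty.forall_iff, true_and,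
      and_true, forall_const, one_ne_zero]
    refine ⟨by omega, by omega, (delEdgeCmd_spec hc hst' hh' hM ?_ ?_ hu).mono ?_⟩
    · simp [State.load, State.input, Function.update_apply]
    · simp [State.load, State.input, Function.update_apply]
    · rintro t tr s' - - - ⟨ht, hu⟩
      exact ⟨by omega, hu⟩
  | insertVertex v L =>
    obtain ⟨h1, h2, h3, h4⟩ := hu
    have h0 : (s.load (.insertVertex v L)).reg 0 = 2 := by
      simp [State.load, State.input, Function.update_apply]
    simp only [h0, ne_eq, not_true_eq_false, not_false_eq_true, IsEmpty.forall_iff, true_and,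
      and_true, forall_const, OfNat.ofNat_ne_zero, OfNat.ofNat_ne_one]
    refine ⟨by omega, by omega, by omega,
      (insVertexCmd_spec hc hst' hh' hM ?_ ?_ ?_ h3 h2 h4 ?_ ?_).mono ?_⟩
    · simp [State.load, State.input, Function.update_apply]
    · simp [State.load, State.input, Function.update_apply]
    · intro i hi
      simp [State.load, State.input, hi]
    · omega
    · rwa [card_insertVertex (fun e he h => h2 (hst.ends_mem e he v h)) h3] at hB
    · rintro t tr s' - - - ⟨ht, hu⟩
      exact ⟨by omega, hu⟩
  | deleteVertex x =>
    have h0 : (s.load (.deleteVertex x)).reg 0 = 3 := by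
      simp [State.load, State.input, Function.update_apply]
    simp only [h0, ne_eq, not_true_eq_false, not_false_eq_true, IsEmpty.forall_iff, true_and,
      and_true, forall_const, OfNat.ofNat_ne_zero, OfNat.ofNat_ne_one, Nat.reduceEqDiff]
    refine ⟨by omega, by omega, by omega, (delVertexCmd_spec hc hst' hh' hM ?_ hu).mono ?_⟩
    · simp [State.load, State.input, Function.update_apply]
    · rintro t tr s' - - - ⟨ht, hu⟩
      exact ⟨by omega, hu⟩

end

end DynMatch

/-! ### Preprocessing, word length and sequences of updates -/

namespace DynMatch

section

variable {B n : ℕ}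

/-- Insert the edges of the initial graph one by one. -/
def initCmd : Cmd :=
  .set 50 (.reg 1) ;;
  .set 51 (.reg 2) ;;
  .loop (.reg 51)
    (.set 1 (.get aInput (.reg 50)) ;;
     .set 2 (.get aInput (.reg 50 +ₑ .lit 1)) ;;
     .set 50 (.reg 50 +ₑ .lit 2) ;;
     .set 51 (.reg 51 -ₑ .lit 1) ;;
     .skip ;;
     insEdgeCmd searchCmd)

theorem getElem?_flatMap_pair (es : List (ℕ × ℕ)) : ∀ j (h : j < es.length),
    (es.flatMap fun e => [e.1, e.2])[2 * j]? = some es[j].1 ∧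
      (es.flatMap fun e => [e.1, e.2])[2 * j + 1]? = some es[j].2 := by
  induction es with
  | nil => simp
  | cons e es ih =>
    intro j hj
    cases j with
    | zero => simp
    | succ j =>
      have := ih j (by simpa using hj)
      simpa [mul_add] using this

theorem initialState_arr (vs : List ℕ) (es : List (ℕ × ℕ)) {j : ℕ} (h : j < es.length) :
    (initialState vs es).arr aInput (vs.length + 2 * j) = es[j].1 ∧
      (initialState vs es).arr aInput (vs.length + 2 * j + 1) = es[j].2 := by
  obtain ⟨h1, h2⟩ := getElem?_flatMap_pair es j h
  have h3 : ∀ i, (vs ++ es.flatMap fun e => [e.1, e.2])[vs.length + i]? =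
      (es.flatMap fun e => [e.1, e.2])[i]? := by
    intro i
    rw [List.getElem?_append_right (by omega), Nat.add_sub_cancel_left]
  rw [← h3] at h1 h2
  obtain ⟨g1, g2⟩ := List.getElem?_eq_some_iff.1 h1
  obtain ⟨g3, g4⟩ := List.getElem?_eq_some_iff.1 h2
  simp only [initialState, State.input, Function.update_self, dif_pos g1, g2]
  exact ⟨trivial, by rw [dif_pos (by simpa [add_assoc] using g3)]; exact g4⟩

theorem initialState_bdd {G : DynGraph} {vs : List ℕ} {es : List (ℕ × ℕ)} (hG : G.WF n)
    (hl : G.ListedBy vs es) (hB : n < B) (hB' : n * n < B) : (initialState vs es).Bdd B := by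
  obtain ⟨h1, h2, h3, h4⟩ := hl
  have hvs : ∀ x ∈ vs, x < n := fun x hx => hG.1 x (by rw [← h2]; simpa using hx)
  have hes : es.length ≤ n * n := by
    have := hG.card_edges
    rwa [← h4, List.toFinset_card_of_nodup h3, List.length_map] at this
  refine State.Bdd.input ⟨fun _ => by simp; omega, fun _ _ => by simp; omega⟩ (by omega)
    ((length_le_of_lt h1 hvs).trans_lt hB) (by omega) ?_
  intro x hx
  rcases List.mem_append.1 hx with hx | hx
  · exact (hvs x hx).trans hB
  · obtain ⟨e, he, hxe⟩ := List.mem_flatMap.1 hx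
    have h5 : s(e.1, e.2) ∈ G.edges := by
      rw [← h4, List.mem_toFinset]
      exact List.mem_map_of_mem (f := fun e : ℕ × ℕ => s(e.1, e.2)) he
    exact (hG.1 x ((hG.2 _ h5).2 x (by simpa using hxe))).trans hB

/-- The empty matching is maximum in the graph without edges; the initial edges are then inserted
one at a time by the update program, whose correctness keeps the matching maximum. -/
theorem initCmd_spec {G : DynGraph} {vs : List ℕ} {es : List (ℕ × ℕ)} (hG : G.WF n)
    (hl : G.ListedBy vs es) (hn : n + 1 < B)
    (hB : (n * n + 200) * (n * n + 200) < B) :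
    Run B searchCmd initCmd (initialState vs es) fun t tr s' =>
      Stored B G s' ∧ ∃ M, s'.Holds M ∧ G.IsMaxMatching M := by
  obtain ⟨h1, h2, h3, h4⟩ := hl
  have hvs : ∀ x ∈ vs, x < n := fun x hx => hG.1 x (by rw [← h2]; simpa using hx)
  have hvl := length_le_of_lt h1 hvs
  have hes : es.length ≤ n * n := by
    have := hG.card_edges
    rwa [← h4, List.toFinset_card_of_nodup h3, List.length_map] at this
  have hnn : n * n * 2 + n + 4 < B := by
    have := Nat.le_mul_self n
    have := Nat.mul_le_mul_left (n * n + 200) (show 200 ≤ n * n + 200 by omega)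
    omega
  set D : ℕ → DynGraph := fun j => ⟨G.verts, ((es.take j).map fun e => s(e.1, e.2)).toFinset⟩
    with hD
  set s₀ := initialState vs es with hs₀
  have i1 : s₀.reg 1 = vs.length := by
    simp [hs₀, initialState, State.input, Function.update_apply]
  have i2 : s₀.reg 2 = es.length := by
    simp [hs₀, initialState, State.input, Function.update_apply]
  have i4 : s₀.reg rM = 0 := by
    simp [hs₀, initialState, State.input, Function.update_apply]
  have i0 : ∀ x, s₀.arr aMate x = 0 := by
    intro x
    simp [hs₀, initialState, State.input, Function.update_apply]
  have hbase : Stored B (D 0) s₀ := by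
    refine ⟨by simpa [hD, i4] using Lists.empty _, fun e he => ?_, fun e he => ?_, fun x hx => ?_,
      ?_⟩
    · simp [hD] at he
    · simp [hD] at he
    · have := hG.1 x hx
      omega
    · simp only [hD, List.take_zero, List.map_nil, List.toFinset_nil, Finset.card_empty]
      nlinarith
  refine Run.of_pre ?_
  simp only [initCmd, Pre, Expr.Ok, Expr.eval, Expr.cost]
  refine ⟨trivial, trivial, ?_⟩
  refine Run.loop rfl (fun s' => s'.reg 51 ≤ es.length ∧
      s'.reg 50 = vs.length + 2 * (es.length - s'.reg 51) ∧
      Stored B (D (es.length - s'.reg 51)) s' ∧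
      ∃ M, s'.Holds M ∧ (D (es.length - s'.reg 51)).IsMaxMatching M)
    -- No bound on the preprocessing is claimed, but the loop rule needs some measure of the
    -- remaining time. A quadratic one in the number of edges suffices, since an insertion takes
    -- linear time.
    (fun s' => (100000 + 20000 * (es.length + 1)) * s'.reg 51) ?_ ?_ ?_ ?_
  · simp only [State.simps, Nat.reduceEqDiff, if_true, if_false, i1, i2, Nat.sub_self]
    refine ⟨le_rfl, by omega, hbase.congr (by simp) (by simp), ∅, ?_, ?_⟩
    · intro x y
      simp [i0]
    · refine ⟨⟨by simp, by simp⟩, fun N hN => ?_⟩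
      have := hN.1
      simp only [hD, List.take_zero, List.map_nil, List.toFinset_nil] at this
      simp [Finset.subset_empty.1 this]
  · intro s' hsame hI
    trivial
  · intro s' hsame ⟨hI1, hI2, hI3, M, hI4, hI5⟩ h0
    simp only [Expr.eval] at h0
    have ei : s'.arr aInput = s₀.arr aInput := by rw [hsame.arr 1 rfl rfl]; simp
    set j := es.length - s'.reg 51 with hj
    have hjl : j < es.length := by omega
    obtain ⟨a1, a2⟩ := initialState_arr vs es hjl
    rw [← hs₀] at a1 a2
    have hmap : ((es.take (j + 1)).map fun e => s(e.1, e.2)) =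
        ((es.take j).map fun e => s(e.1, e.2)) ++ [s(es[j].1, es[j].2)] := by
      rw [List.take_add_one, List.getElem?_eq_getElem hjl, List.map_append]
      rfl
    have hnd : ((es.take (j + 1)).map fun e => s(e.1, e.2)).Nodup := by
      rw [List.map_take]
      exact h3.sublist (List.take_sublist _ _)
    have hnot : s(es[j].1, es[j].2) ∉ (D j).edges := by
      rw [hmap, List.nodup_append] at hnd
      intro h
      exact hnd.2.2 _ (List.mem_toFinset.1 h) _ (by simp) rfl
    have hstep : (Update.insertEdge es[j].1 es[j].2).apply (D j) = D (j + 1) := by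
      simp only [Update.apply, hD, hmap, List.toFinset_append, List.toFinset_cons,
        List.toFinset_nil, insert_empty_eq]
      rw [Finset.union_singleton]
    have hmem : s(es[j].1, es[j].2) ∈ G.edges := by
      rw [← h4, List.mem_toFinset]
      exact List.mem_map_of_mem (f := fun e : ℕ × ℕ => s(e.1, e.2)) (List.getElem_mem hjl)
    have hcard : (D j).edges.card ≤ j := by
      refine (List.toFinset_card_le _).trans ?_
      simp
    have hcard' : (D (j + 1)).edges.card ≤ j + 1 := by
      refine (List.toFinset_card_le _).trans ?_
      simp
    refine Run.of_pre ?_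
    simp only [Pre, Expr.Ok, Expr.eval, Expr.cost, Op.eval_simps, State.simps,
      Nat.reduceEqDiff, if_true, if_false, true_and, ei, hI2, a1, a2, and_true]
    refine ⟨by omega, by omega, by omega, ?_⟩
    refine Run.mono (insEdgeCmd_spec (G := D j) (M := M) (x := es[j].1) (y := es[j].2)
      (searches_searchCmd B) (hI3.congr ?_ ?_) ?_ hI5 ?_ ?_ ?_ ?_ ?_ hnot ?_) ?_
    · simp
    · simp
    · simpa [State.Holds] using hI4
    · simp [a1]
    · simp [a2]
    · exact (hG.2 _ hmem).2 _ (by simp)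
    · exact (hG.2 _ hmem).2 _ (by simp)
    · simpa using (hG.2 _ hmem).1
    · exact lt_of_le_of_lt (Nat.mul_le_mul (by omega) (by omega)) hB
    · rintro t tr s'' - - hs ⟨ht, hst, M', hM', hmax, -⟩
      have e51 : s''.reg 51 = s'.reg 51 - 1 := by rw [hs.reg 51 rfl rfl]; simp
      have e50 : s''.reg 50 = vs.length + 2 * j + 2 := by rw [hs.reg 50 rfl rfl]; simp
      have hj' : es.length - s''.reg 51 = j + 1 := by omega
      rw [hstep] at ht hst hmax
      rw [hj', e51]
      refine ⟨⟨by omega, by omega, hst, M', hM', hmax⟩, ?_⟩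
      obtain ⟨q, hq⟩ := Nat.exists_eq_succ_of_ne_zero h0
      rw [hq, Nat.succ_sub_one]
      have : 1 ≤ q + 1 := by omega
      nlinarith
  · intro t s' hsame ⟨hI1, hI2, hI3, hI4⟩ h0 ht
    simp only [Expr.eval] at h0
    have hDG : D (es.length - s'.reg 51) = G := by
      rw [h0, Nat.sub_zero]
      simp only [hD, List.take_length, h4]
    rw [hDG] at hI3 hI4
    exact ⟨hI3, hI4⟩

/-- Finite dependent choice: memory and matching after an update are chosen from those before it. -/
theorem exists_sequence {α : Type*} (P : ℕ → α → Prop) (R : ℕ → α → α → Prop) {a : α} (k : ℕ)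
    (h0 : P 0 a) (h : ∀ i < k, ∀ a, P i a → ∃ b, P (i + 1) b ∧ R i a b) :
    ∃ f : ℕ → α, f 0 = a ∧ (∀ i ≤ k, P i (f i)) ∧ ∀ i < k, R i (f i) (f (i + 1)) := by
  induction k with
  | zero =>
    refine ⟨fun _ => a, rfl, fun i hi => ?_, fun i hi => by omega⟩
    obtain rfl : i = 0 := by omega
    exact h0
  | succ k ih =>
    obtain ⟨f, hf0, hf1, hf2⟩ := ih fun i hi => h i (by omega)
    obtain ⟨b, hb1, hb2⟩ := h k (by omega) _ (hf1 k le_rfl)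
    refine ⟨fun i => if i ≤ k then f i else b, by simp [hf0], fun i hi => ?_, fun i hi => ?_⟩
    · rcases Nat.lt_succ_iff_lt_or_eq.1 (Nat.lt_succ_of_le hi) with h1 | rfl
      · simpa [Nat.le_of_lt_succ h1] using hf1 i (by omega)
      · simpa using hb1
    · rcases Nat.lt_succ_iff_lt_or_eq.1 hi with h1 | rfl
      · simpa [h1.le, Nat.succ_le_of_lt h1] using hf2 i h1
      · simpa using hb2

/-- With `p = 2 ^ (log₂ n + 1)` one has `n < p` and `2 ≤ p`, so `n ^ 2 + 200 < 256 * p ^ 2 ≤ p ^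
10`. Squaring gives the exponent 20, which is the factor required of the word length. -/
theorem word_bound {w : ℕ} (h : 20 * (Nat.log 2 n + 1) ≤ w) :
    n + 3 < 2 ^ w ∧ (n * n + 200) * (n * n + 200) < 2 ^ w := by
  set p := 2 ^ (Nat.log 2 n + 1) with hp
  have hnp : n < p := Nat.lt_pow_succ_log_self (by norm_num) n
  have hp2 : 2 ≤ p := by
    rw [hp, pow_succ]
    have := Nat.one_le_two_pow (n := Nat.log 2 n)
    omega
  have hw : p ^ 20 ≤ 2 ^ w := by
    rw [hp, ← pow_mul]
    exact Nat.pow_le_pow_right (by norm_num) (by linarith)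
  have h8 : 2 ^ 8 ≤ p ^ 8 := Nat.pow_le_pow_left hp2 8
  have h1 : n * n + 200 < p ^ 10 := by
    have h2 : p ^ 10 = p * p * p ^ 8 := by ring
    have h3 : n * n ≤ p * p := Nat.mul_le_mul hnp.le hnp.le
    have h4 : 4 ≤ p * p := Nat.mul_le_mul hp2 hp2
    nlinarith
  have h2 : (n * n + 200) * (n * n + 200) < p ^ 20 := by
    rw [show p ^ 20 = p ^ 10 * p ^ 10 by ring]
    exact Nat.mul_lt_mul'' h1 h1
  refine ⟨?_, h2.trans_le hw⟩
  have := Nat.le_mul_self n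
  have := Nat.mul_le_mul_left (n * n + 200) (show 200 ≤ n * n + 200 by omega)
  omega

end

end DynMatch

/-! ### Assembling the algorithm -/

theorem theorem11 :
    ∃ (init upd search : Cmd) (C c : ℕ),
      ∀ (n w : ℕ), c * (Nat.log 2 n + 1) ≤ w →
      ∀ (k : ℕ) (u : ℕ → Update) (G : ℕ → DynGraph) (vs : List ℕ) (es : List (ℕ × ℕ)),
        (G 0).WF n → (G 0).ListedBy vs es →
        (∀ i < k, (u i).Valid n (G i) ∧ G (i + 1) = (u i).apply (G i)) →
        ∃ (s : ℕ → State) (M : ℕ → Finset (Sym2 ℕ)),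
          (∃ t tr, Exec (2 ^ w) search init (initialState vs es) t tr (s 0)) ∧
          (∀ i ≤ k, (s i).Holds (M i) ∧ (G i).IsMaxMatching (M i)) ∧
          ∀ i < k, ∃ t tr,
            Exec (2 ^ w) search upd ((s i).load (u i)) t tr (s (i + 1)) ∧
            t ≤ C * (max (G i).edges.card (G (i + 1)).edges.card + 1) ∧
            tr.length ≤ 2 ∧
            SearchLog (G (i + 1)) (u i).ends ((u i).roots (M i)) (M i) tr (M (i + 1)) := by
  -- An update makes at most two calls at `7001` steps per unit of `m + 1`, and `120` covers editing
  -- the edge list and the branching; `20` comes from `word_bound`.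
  refine ⟨initCmd, updCmd .call, searchCmd, 2 * 7001 + 120, 20, ?_⟩
  intro n w hw k u G vs es hG hl hu
  obtain ⟨hB1, hB2⟩ := word_bound hw
  set B := 2 ^ w
  have hWF : ∀ i ≤ k, (G i).WF n := by
    intro i hi
    induction i with
    | zero => exact hG
    | succ i ih =>
      rw [(hu i hi).2]
      exact (ih (by omega)).apply (hu i hi).1
  obtain ⟨t, tr, s₀, he, hb, hst, M₀, hh, hM⟩ := initCmd_spec hG hl (by omega) hB2
    (initialState_bdd hG hl (by omega) (by nlinarith))
  have hstep : ∀ i < k, ∀ a : State × Finset (Sym2 ℕ),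
      (a.1.Bdd B ∧ Stored B (G i) a.1 ∧ a.1.Holds a.2 ∧ (G i).IsMaxMatching a.2) →
      ∃ b : State × Finset (Sym2 ℕ), (b.1.Bdd B ∧ Stored B (G (i + 1)) b.1 ∧ b.1.Holds b.2 ∧
          (G (i + 1)).IsMaxMatching b.2) ∧
        ∃ t tr, Exec B searchCmd (updCmd .call) (a.1.load (u i)) t tr b.1 ∧
          t ≤ (2 * 7001 + 120) * (max (G i).edges.card (G (i + 1)).edges.card + 1) ∧
          tr.length ≤ 2 ∧ SearchLog (G (i + 1)) (u i).ends ((u i).roots a.2) a.2 tr b.2 := by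
    rintro i hi ⟨s, M⟩ ⟨hb, hst, hh, hM⟩
    obtain ⟨hv, hG'⟩ := hu i hi
    have hcard := (hWF (i + 1) hi).card_edges
    rw [hG'] at hcard ⊢
    obtain ⟨t, tr, s', he, hb', ht, hst', M', hh', hM', hlog⟩ :=
      updCmd_spec (searches_call B) hst hh hM hv hB1
        (lt_of_le_of_lt (Nat.mul_le_mul (by omega) (by omega)) hB2)
        (hb.load (hWF i hi.le) hv (by omega) (by omega))
    obtain ⟨h1, h2⟩ := hlog fun _ _ => rfl
    exact ⟨(s', M'), ⟨hb', hst', hh', hM'⟩, t, tr, he, ht, h1, h2⟩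
  obtain ⟨f, hf0, hf1, hf2⟩ := exists_sequence (a := (s₀, M₀)) _ _ k ⟨hb, hst, hh, hM⟩ hstep
  exact ⟨fun i => (f i).1, fun i => (f i).2, ⟨t, tr, by simpa only [hf0] using he⟩,
    fun i hi => (hf1 i hi).2.2, hf2⟩
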